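/- **Setting.** Let $R>0$ and let $f:[0,R]\to[0,\infty)$ be Lipschitz with $f(0)=f(R)=0$, and suppose that for some $\bar\rho\in\,]0,R[$ one has $f'(\rho)(\bar\rho-\rho)>0$ for a.e. $\rho\in[0,R]$. Let $w:\,]-\infty,0[\,\to[0,\infty)$ be bounded and non-decreasing, with $\int_{-\infty}^0 w=1$ and $w(x)=0$ for all $x\le -i_w$, for some $i_w>0$. Let $p$ be a multivalued piecewise constant non-increasing map: there are $n\ge0$, points $0<\xi_1<\dots<\xi_n<R$ and levels $f(\bar\rho)\ge p_0>p_1>\dots>p_n>0$ such that, with $\xi_0=0$ and $\xi_{n+1}=R$, $p=p_i$ on $]\xi_i,\xi_{i+1}[$ for $0\le i\le n$, $p(0)=p_0$, $p(R)=p_n$, and $p(\xi_i)=[p_i,p_{i-1}]$ for $1\le i\le n$. Denote by $p(r\pm)$ the one-sided limits of $p$, with $p(0-)=p_0$ and $p(R+)=p_n$. For $\rho_L,\rho_R\in[0,R]$ let $\rho_0=\rho_L$ on $\{x<0\}$ and $\rho_0=\rho_R$ on $\{x\ge0\}$. Consider the constrained Riemann problem $$\partial_t\rho+\partial_xf(\rho)=0,\qquad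 f(\rho(t,0\pm))\le q(t)\in p\Big(\int_{-\infty}^0w(x)\rho(t,x)\,dx\Big),\qquad \rho(0,\cdot)=\rho_0 .$$ **Solutions.** For $0<T\le\infty$, an *entropy weak solution on $[0,T[$* is a map $\rho\in L^\infty(]0,T[\times\mathbb R;[0,R])\cap C^0([0,T[;L^1_{loc}(\mathbb R;[0,R]))$ for which there is $q\in L^\infty(]0,T[;[0,f(\bar\rho)])$ such that: * for every $k\in[0,R]$ and every $0\le\phi\in C_c^\infty(\mathbb R^2)$ supported in $\{t<T\}$, $$\int_0^T\!\!\int_{\mathbb R}\big[|\rho-k|\partial_t\phi+\mathrm{sign}(\rho-k)(f(\rho)-f(k))\partial_x\phi\big]dx\,dt+2\int_0^T\Big[1-\frac{q(t)}{f(\bar\rho)}\Big]f(k)\phi(t,0)\,dt+\int_{\mathbb R}|\rho_0(x)-k|\phi(0,x)\,dx\ge0;$$ * $\rho$ has measure-theoretic traces $\rho(\cdot,0\pm)$ at $x=0$, that is, $\lim_{\varepsilon\downarrow0}\frac1\varepsilon\int_0^T\!\int_{-\varepsilon}^0|\rho(t,x)-\rho(t,0-)|\phi(t,x)\,dx\,dt=0$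 for all $\phi\in C_c^\infty(\mathbb R^2)$ supported in $\{t<T\}$, and similarly at $0+$ with the inner integral over $]0,\varepsilon[$; and $f(\rho(t,0\pm))\le q(t)$ for a.e. $t$; * $q(t)\in p\big(\int_{-\infty}^0w(x)\rho(t,x)\,dx\big)$ for a.e. $t$. A map $\sigma$ is *the unique entropy weak solution for small times* if there is $\tau>0$ such that $\sigma$ is an entropy weak solution on $[0,\tau[$ and every entropy weak solution $\rho$ on any $[0,T[$ satisfies $\rho(t,\cdot)=\sigma(t,\cdot)$ a.e. for all $0\le t<\min(\tau,T)$. **Riemann solvers.** Let $\mathcal R$ be the classical Riemann solver: $\mathcal R[a,b](x/t)$ is the Kružkov solution of the unconstrained Riemann problem with states $a,b$; explicitly, $\mathcal R[a,b](v)$ minimizes $s\mapsto f(s)-vs$ on $[a,b]$ if $a\le b$, and maximizes it on $[b,a]$ if $b<a$. For $q\in[0,f(\bar\rho)]$ let $\check\rho(q)\le\bar\rho\le\hat\rho(q)$ be the points of $[0,R]$ with $f(\check\rho(q))=q=f(\hat\rho(q))$. **Regions.** $\mathcal C$ is the set of $(\rho_L,\rho_R)\in[0,R]^2$ satisfying one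 of * (C1) $\rho_L<\rho_R$, $f(\rho_R)<f(\rho_L)$, $f(\rho_R)\le p(\rho_L+)$; * (C2) $\rho_L<\rho_R$, $f(\rho_L)\le f(\rho_R)$, $f(\rho_L)\le p(\rho_L+)$; * (C3) $\rho_R\le\rho_L\le\bar\rho$, $f(\rho_L)\le p(\rho_L+)$; * (C4) $\rho_R\le\bar\rho<\rho_L$, $f(\bar\rho)=p(\rho_L+)$; * (C5) $\bar\rho<\rho_R\le\rho_L$, $f(\rho_R)\le p(\rho_L-)$, $f(\rho_L)<p(\rho_L+)$. $\mathcal N$ is the set of $(\rho_L,\rho_R)\in[0,R]^2$ satisfying one of * (N1) $\rho_L<\rho_R$, $f(\rho_L)>f(\rho_R)>p(\rho_L+)$; * (N2) $\rho_L<\rho_R$, $f(\rho_L)\le f(\rho_R)$, $f(\rho_L)>p(\rho_L-)$; * (N3) $\rho_R\le\rho_L\le\bar\rho$, $f(\rho_L)>p(\rho_L-)$; * (N4a) $\rho_R\le\bar\rho<\rho_L$, $f(\bar\rho)\ne p(\rho_L-)$, $f(\rho_L)<p(\rho_L+)$; * (N4b) $\rho_R\le\bar\rho<\rho_L$, $f(\bar\rho)\ne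 p(\rho_L-)$, $f(\rho_L)>p(\rho_L-)$; * (N5a) $\bar\rho<\rho_R\le\rho_L$, $f(\rho_R)>p(\rho_L-)$, $f(\rho_L)<p(\rho_L+)$; * (N5b) $\bar\rho<\rho_R\le\rho_L$, $f(\rho_L)>p(\rho_L-)$. **Proposition.** Let $\rho_L,\rho_R\in[0,R]$. 1. If $(\rho_L,\rho_R)\in\mathcal C$, then $(t,x)\mapsto\mathcal R[\rho_L,\rho_R](x/t)$ is the unique entropy weak solution for small times. 2. If $(\rho_L,\rho_R)\in\mathcal N$, then there is a unique $\bar p\in[p(\rho_L+),p(\rho_L-)]$ such that the map equal to $\mathcal R[\rho_L,\hat\rho(\bar p)](x/t)$ for $x<0$ and to $\mathcal R[\check\rho(\bar p),\rho_R](x/t)$ for $x\ge0$ is the unique entropy weak solution for small times. 3. Suppose that $(\rho_L,\rho_R)\in[0,R]^2\setminus(\mathcal C\cup\mathcal N)$, that $p(\rho_L-)\ne p(\rho_L+)$ and $p(\rho_L+)\le f(\rho_L)\le p(\rho_L-)$, and that it is not the case that $\rho_R=\rho_L>\bar\rho$ and $f(\rho_L)=p(\rho_L+)$. Then for some $\tau>0$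 the problem admits two entropy weak solutions on $[0,\tau[$ which differ, on a set of positive measure in $x$, at every time $t\in\,]0,\tau[$. -/

import Mathlib

open MeasureTheory Set Filter Topology
open scoped ContDiff

noncomputable section

namespace PointConstraint

/-- Assumption on the flux: `f` is Lipschitz and nonnegative on `[0,R]`, vanishes at `0` and `R`,
and `f'(s) (ρbar - s) > 0` for a.e. `s ∈ [0,R]`, where `ρbar ∈ ]0,R[`. Only the values of `f` on
`[0,R]` matter. -/
structure FluxCondition (R ρbar : ℝ) (f : ℝ → ℝ) : Prop where
  lipschitz : ∃ K, LipschitzOnWith K f (Icc 0 R)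
  nonneg : ∀ s ∈ Icc 0 R, 0 ≤ f s
  map_zero : f 0 = 0
  map_R : f R = 0
  ρbar_mem : ρbar ∈ Ioo 0 R
  deriv_sign : ∀ᵐ s ∂(volume.restrict (Icc 0 R)), 0 < deriv f s * (ρbar - s)

/-- Assumption on the weight, a function on the negative half-line: nonnegative, bounded,
non-decreasing, of unit mass, and zero far from the origin. -/
structure WeightCondition (w : ℝ → ℝ) : Prop where
  nonneg : ∀ x < 0, 0 ≤ w x
  bounded : ∃ M, ∀ x < 0, w x ≤ M
  monotone : MonotoneOn w (Iio 0)
  integral_eq_one : ∫ x in Iio (0 : ℝ), w x = 1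
  support : ∃ i : ℝ, 0 < i ∧ ∀ x ≤ -i, w x = 0

/-- Data of a multivalued piecewise constant non-increasing constraint on `[0,R]` with values in
`]0,fmax]`: jump points `0 < ξ 0 < ⋯ < ξ (n-1) < R` and levels
`level 0 > ⋯ > level n`, where `level i.castSucc` and `level i.succ` are the values immediately
to the left and to the right of `ξ i`. -/
structure Constraint (R fmax : ℝ) where
  n : ℕ
  ξ : Fin n → ℝ
  level : Fin (n + 1) → ℝ
  ξ_strictMono : StrictMono ξ
  ξ_mem : ∀ i, ξ i ∈ Ioo 0 R
  level_strictAnti : StrictAnti level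
  level_mem : ∀ i, level i ∈ Ioc 0 fmax

namespace Constraint

variable {R fmax : ℝ}

/-- The one-sided limit `p(r-)`: the level indexed by the number of jump points `< r`. -/
def leftValue (p : Constraint R fmax) (r : ℝ) : ℝ :=
  p.level ⟨(Finset.univ.filter fun i => p.ξ i < r).card,
    Nat.lt_succ_of_le ((Finset.card_le_univ _).trans (Fintype.card_fin _).le)⟩

/-- The one-sided limit `p(r+)`: the level indexed by the number of jump points `≤ r`. -/
def rightValue (p : Constraint R fmax) (r : ℝ) : ℝ :=
  p.level ⟨(Finset.univ.filter fun i => p.ξ i ≤ r).card,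
    Nat.lt_succ_of_le ((Finset.card_le_univ _).trans (Fintype.card_fin _).le)⟩

/-- The set `p(r)`: a single level away from the jump points, and the whole interval between the
two adjacent levels at a jump point. -/
def values (p : Constraint R fmax) (r : ℝ) : Set ℝ :=
  Icc (p.rightValue r) (p.leftValue r)

end Constraint

/-- The times `t` with `0 < t < T`; `T = ⊤` gives the whole half-line. -/
def timeInterval (T : EReal) : Set ℝ := {t | 0 < t ∧ (t : EReal) < T}

/-- Smooth compactly supported functions of `(t,x) ∈ ℝ²` whose support lies in `{t < T}`. -/
structure IsTestFunction (T : EReal) (φ : ℝ × ℝ → ℝ) : Prop where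
  smooth : ContDiff ℝ ∞ φ
  compact : HasCompactSupport φ
  support : ∀ z ∈ tsupport φ, (z.1 : EReal) < T

/-- `γ` is the measure theoretic trace at `x = 0-` of `ρ` on the time interval `]0,T[`. -/
structure IsLeftTrace (R : ℝ) (T : EReal) (ρ : ℝ → ℝ → ℝ) (γ : ℝ → ℝ) : Prop where
  measurable : AEStronglyMeasurable γ (volume.restrict (timeInterval T))
  mem : ∀ᵐ t ∂(volume.restrict (timeInterval T)), γ t ∈ Icc 0 R
  tendsto : ∀ φ, IsTestFunction T φ →
    Tendsto (fun ε : ℝ => ε⁻¹ *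
        ∫ z in timeInterval T ×ˢ Ioo (-ε) 0, |ρ z.1 z.2 - γ z.1| * φ z)
      (𝓝[>] 0) (𝓝 0)

/-- `γ` is the measure theoretic trace at `x = 0+` of `ρ` on the time interval `]0,T[`. -/
structure IsRightTrace (R : ℝ) (T : EReal) (ρ : ℝ → ℝ → ℝ) (γ : ℝ → ℝ) : Prop where
  measurable : AEStronglyMeasurable γ (volume.restrict (timeInterval T))
  mem : ∀ᵐ t ∂(volume.restrict (timeInterval T)), γ t ∈ Icc 0 R
  tendsto : ∀ φ, IsTestFunction T φ →
    Tendsto (fun ε : ℝ => ε⁻¹ *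
        ∫ z in timeInterval T ×ˢ Ioo 0 ε, |ρ z.1 z.2 - γ z.1| * φ z)
      (𝓝[>] 0) (𝓝 0)

/-- The entropy inequality on `[0,T[` with constraint `q`, for initial datum `ρ0`, Kružkov constant
`k` and test function `φ`. -/
def EntropyInequality (ρbar : ℝ) (f : ℝ → ℝ) (ρ0 : ℝ → ℝ) (T : EReal) (ρ : ℝ → ℝ → ℝ)
    (q : ℝ → ℝ) (k : ℝ) (φ : ℝ × ℝ → ℝ) : Prop :=
  0 ≤ (∫ z in timeInterval T ×ˢ (univ : Set ℝ),
          (|ρ z.1 z.2 - k| * fderiv ℝ φ z (1, 0) +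
            Real.sign (ρ z.1 z.2 - k) * (f (ρ z.1 z.2) - f k) * fderiv ℝ φ z (0, 1)))
      + 2 * (∫ t in timeInterval T, (1 - q t / f ρbar) * f k * φ (t, 0))
      + ∫ x, |ρ0 x - k| * φ (0, x)

/-- `ρ` (as a function of `t`, then `x`) is an entropy weak solution on the time interval `[0,T[`
of the conservation law with flux `f`, initial datum `ρ0` and point constraint at `x = 0` given by
`q(t) ∈ p(∫_{x<0} w(x) ρ(t,x) dx)`. The case `T = ⊤` is that of global solutions. -/
structure IsEntropyWeakSolution (R ρbar : ℝ) (f w : ℝ → ℝ) (p : Constraint R (f ρbar))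
    (ρ0 : ℝ → ℝ) (T : EReal) (ρ : ℝ → ℝ → ℝ) : Prop where
  measurable : AEStronglyMeasurable (fun z : ℝ × ℝ => ρ z.1 z.2)
    (volume.restrict (timeInterval T ×ˢ (univ : Set ℝ)))
  slice_measurable : ∀ t : ℝ, 0 ≤ t → (t : EReal) < T → AEStronglyMeasurable (ρ t) volume
  slice_mem : ∀ t : ℝ, 0 ≤ t → (t : EReal) < T → ∀ᵐ x, ρ t x ∈ Icc 0 R
  continuous : ∀ t₀ : ℝ, 0 ≤ t₀ → (t₀ : EReal) < T → ∀ M : ℝ,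
    Tendsto (fun t => ∫ x in Icc (-M) M, |ρ t x - ρ t₀ x|)
      (𝓝[{t | 0 ≤ t ∧ (t : EReal) < T}] t₀) (𝓝 0)
  constrained : ∃ q γl γr : ℝ → ℝ,
    AEStronglyMeasurable q (volume.restrict (timeInterval T)) ∧
    (∀ᵐ t ∂(volume.restrict (timeInterval T)), q t ∈ Icc 0 (f ρbar)) ∧
    (∀ φ, IsTestFunction T φ → (∀ z, 0 ≤ φ z) → ∀ k ∈ Icc 0 R,
      EntropyInequality ρbar f ρ0 T ρ q k φ) ∧
    IsLeftTrace R T ρ γl ∧ IsRightTrace R T ρ γr ∧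
    (∀ᵐ t ∂(volume.restrict (timeInterval T)), f (γl t) ≤ q t ∧ f (γr t) ≤ q t) ∧
    (∀ᵐ t ∂(volume.restrict (timeInterval T)),
      q t ∈ p.values (∫ x in Iio (0 : ℝ), w x * ρ t x))

/-- The Riemann datum. -/
def riemannDatum (ρL ρR : ℝ) (x : ℝ) : ℝ := if x < 0 then ρL else ρR

/-- The profile `𝓡[a,b]` of the classical (Kružkov) solution `𝓡[a,b](x/t)` of the unconstrained
Riemann problem for an arbitrary continuous flux: at speed `v` it is the point that minimizes
`f s - v s` on `[a,b]` if `a ≤ b`, and that maximizes it on `[b,a]` if `b < a`; equivalently, the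
inverse of the derivative of the lower convex, respectively upper concave, envelope of `f`.
That point is unique except at countably many speeds, where shocks sit. -/
def riemannSolver (f : ℝ → ℝ) (a b v : ℝ) : ℝ :=
  if a ≤ b then sSup {s | s ∈ Icc a b ∧ ∀ r ∈ Icc a b, f s - v * s ≤ f r - v * r}
  else sInf {s | s ∈ Icc b a ∧ ∀ r ∈ Icc b a, f r - v * r ≤ f s - v * s}

/-- `ρ̌(q)`: the point of `[0,ρbar]` at which `f` equals `q`. -/
def checkρ (ρbar : ℝ) (f : ℝ → ℝ) (q : ℝ) : ℝ := Function.invFunOn f (Icc 0 ρbar) q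

/-- `ρ̂(q)`: the point of `[ρbar,R]` at which `f` equals `q`. -/
def hatρ (R ρbar : ℝ) (f : ℝ → ℝ) (q : ℝ) : ℝ := Function.invFunOn f (Icc ρbar R) q

/-- The map `(t,x) ↦ 𝓡[ρL,ρR](x/t)`, completed by the datum at the initial time. -/
def classicalMap (f : ℝ → ℝ) (ρL ρR : ℝ) (t x : ℝ) : ℝ :=
  if 0 < t then riemannSolver f ρL ρR (x / t) else riemannDatum ρL ρR x

/-- The nonclassical map with level `q`: `𝓡[ρL,ρ̂(q)](x/t)` for `x < 0` and `𝓡[ρ̌(q),ρR](x/t)` for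
`x ≥ 0`, completed by the datum at the initial time. -/
def nonclassicalMap (R ρbar : ℝ) (f : ℝ → ℝ) (ρL ρR q : ℝ) (t x : ℝ) : ℝ :=
  if 0 < t then
    if x < 0 then riemannSolver f ρL (hatρ R ρbar f q) (x / t)
    else riemannSolver f (checkρ ρbar f q) ρR (x / t)
  else riemannDatum ρL ρR x

/-- `σ` is the unique entropy weak solution of the constrained Riemann problem for small times:
it is one on some `[0,τ[`, and every entropy weak solution, on whatever time interval `[0,T[`,
agrees with `σ` as long as `t < τ`. -/
def IsUniqueForSmallTimes (R ρbar : ℝ) (f w : ℝ → ℝ) (p : Constraint R (f ρbar)) (ρL ρR : ℝ)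
    (σ : ℝ → ℝ → ℝ) : Prop :=
  ∃ τ : ℝ, 0 < τ ∧
    IsEntropyWeakSolution R ρbar f w p (riemannDatum ρL ρR) τ σ ∧
    ∀ (T : EReal) (ρ : ℝ → ℝ → ℝ), 0 < T →
      IsEntropyWeakSolution R ρbar f w p (riemannDatum ρL ρR) T ρ →
      ∀ t : ℝ, 0 ≤ t → t < τ → (t : EReal) < T → ρ t =ᵐ[volume] σ t

/-- The set `𝒞`; the disjuncts are conditions (C1) to (C5). -/
def classicalRegion (R ρbar : ℝ) (f : ℝ → ℝ) (p : Constraint R (f ρbar)) : Set (ℝ × ℝ) :=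
  {z | ∃ ρL ρR : ℝ, z = (ρL, ρR) ∧ ρL ∈ Icc 0 R ∧ ρR ∈ Icc 0 R ∧
    ((ρL < ρR ∧ f ρR < f ρL ∧ f ρR ≤ p.rightValue ρL) ∨
     (ρL < ρR ∧ f ρL ≤ f ρR ∧ f ρL ≤ p.rightValue ρL) ∨
     (ρR ≤ ρL ∧ ρL ≤ ρbar ∧ f ρL ≤ p.rightValue ρL) ∨
     (ρR ≤ ρbar ∧ ρbar < ρL ∧ f ρbar = p.rightValue ρL) ∨
     (ρbar < ρR ∧ ρR ≤ ρL ∧ f ρR ≤ p.leftValue ρL ∧ f ρL < p.rightValue ρL))}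

/-- The set `𝒩`; the disjuncts are conditions (N1), (N2), (N3), (N4a), (N4b), (N5a), (N5b). -/
def nonclassicalRegion (R ρbar : ℝ) (f : ℝ → ℝ) (p : Constraint R (f ρbar)) : Set (ℝ × ℝ) :=
  {z | ∃ ρL ρR : ℝ, z = (ρL, ρR) ∧ ρL ∈ Icc 0 R ∧ ρR ∈ Icc 0 R ∧
    ((ρL < ρR ∧ f ρR < f ρL ∧ p.rightValue ρL < f ρR) ∨
     (ρL < ρR ∧ f ρL ≤ f ρR ∧ p.leftValue ρL < f ρL) ∨
     (ρR ≤ ρL ∧ ρL ≤ ρbar ∧ p.leftValue ρL < f ρL) ∨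
     (ρR ≤ ρbar ∧ ρbar < ρL ∧ f ρbar ≠ p.leftValue ρL ∧ f ρL < p.rightValue ρL) ∨
     (ρR ≤ ρbar ∧ ρbar < ρL ∧ f ρbar ≠ p.leftValue ρL ∧ p.leftValue ρL < f ρL) ∨
     (ρbar < ρR ∧ ρR ≤ ρL ∧ p.leftValue ρL < f ρR ∧ f ρL < p.rightValue ρL) ∨
     (ρbar < ρR ∧ ρR ≤ ρL ∧ p.leftValue ρL < f ρL))}

end PointConstraint

end

open MeasureTheory Set Filter Topology
open scoped ContDiff
open Real (smoothTransition)

noncomputable section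

namespace PointConstraint

section

/-! ### The Kružkov flux -/

/-! The constraint sees the solution only through the mean ξ(t) of ρ(t,·) against w. By finite speed
of propagation the left half of the solution differs from ρL only in ]-Kt,0[ for some K, and there w
is within o(1) of its left limit w(0-) > 0. So ξ(t) - ρL equals w(0-) times the mass gained by the
left half, up to o(t) (`WeightCondition.mean_sub_le`), and by mass balance the gain is ∫₀ᵗ (f(ρL) -
f(γ)), where γ is the left trace (`HalfSol.mass`). At small times, therefore, a mean flux through
the interface that stays below f(ρL) by a fixed amount forces the level p(ρL+), a mean flux that
stays above it forces p(ρL-), and a left half that remains equal to ρL is compatible with every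
level in [p(ρL+), p(ρL-)] (`exists_small_time`, `exists_level_time`).

Uniqueness splits accordingly. For a given level q, two pairs of traces admissible for q dissipate
(`Germ.dissipation`). Added to the L¹ contraction on each half-line, which comes from doubling of
variables and a cone cut-off that keeps track of the boundary flux (`kato`, `cone_integrated`), this
shows that a solution coincides with any explicit map whose traces are admissible for its level
(`LineSol.ae_eq`). What remains is an a priori determination of the level of an arbitrary solution.
Three bounds on the interface flux serve: the constraint itself (`forcesLevel_right_of_lt`), the
boundary entropy inequality on the right half-line, which caps the mean flux by f(ρR)
(`forcesLevel_right_of_right_flux`), and one-sided bounds on both traces when ρL is congested and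
larger than ρR, which keep the flux above f(ρL) (`forcesLevel_left`). In (C1) to (C4) no
determination is needed, because the traces of the classical solution are admissible for every level
that can occur.

Existence is explicit. The profile of the Riemann solver optimises f(s) - v s at each speed v. It is
monotone in v, and the optimal value is an envelope of affine functions of v whose derivative is
minus the profile. Hence the entropy integral is exact on each side of the speed at which the
profile crosses a constant k, and the leftover at the crossing has a sign (`IsProfile.entropy`); f
need be neither convex nor concave, and waves are never listed. Two profiles glued at x = 0 with
admissible traces form a solution as soon as the level agrees with the sign of f(ρL) minus the
interface flux (`ProfilePair.exists_solution`).

Non-uniqueness uses the same consistency test at a jump of p: a solution that starts with interface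
flux f(ρL) and keeps its left half undisturbed, and another one whose flux moves ξ off the jump, can
both be consistent. Different interface fluxes give different limits at x = 0-, so the two maps
differ at every positive time.

The right half-line is never treated separately: the reflection of x turns it into a left half-line
with flux -f. -/

/-- The Kružkov entropy flux `sign (a - b) (F a - F b)`. -/
def kflux (F : ℝ → ℝ) (a b : ℝ) : ℝ := Real.sign (a - b) * (F a - F b)

/-- This form shows the symmetry and the joint Lipschitz continuity, which the discontinuous sign
hides. -/
theorem kflux_eq (F : ℝ → ℝ) (a b : ℝ) : kflux F a b = F (max a b) - F (min a b) := by
  unfold kflux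
  rcases lt_trichotomy a b with h | h | h
  · rw [Real.sign_of_neg (by linarith), max_eq_right h.le, min_eq_left h.le]; ring
  · simp [h]
  · rw [Real.sign_of_pos (by linarith), max_eq_left h.le, min_eq_right h.le]; ring

theorem kflux_comm (F : ℝ → ℝ) (a b : ℝ) : kflux F a b = kflux F b a := by
  rw [kflux_eq, kflux_eq, max_comm, min_comm]

theorem kflux_of_le (F : ℝ → ℝ) {a b : ℝ} (h : a ≤ b) : kflux F a b = F b - F a := by
  rw [kflux_eq, max_eq_right h, min_eq_left h]

theorem kflux_of_ge (F : ℝ → ℝ) {a b : ℝ} (h : b ≤ a) : kflux F a b = F a - F b := by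
  rw [kflux_eq, max_eq_left h, min_eq_right h]

theorem kflux_neg (F : ℝ → ℝ) (a b : ℝ) : kflux (fun s => -F s) a b = -kflux F a b := by
  unfold kflux; ring

/-- `F` is Lipschitz with constant `K`. -/
def Lip (K : ℝ) (F : ℝ → ℝ) : Prop := 0 ≤ K ∧ ∀ a b, |F a - F b| ≤ K * |a - b|

theorem Lip.neg {K : ℝ} {F : ℝ → ℝ} (h : Lip K F) : Lip K (fun s => -F s) :=
  ⟨h.1, fun a b => by rw [← abs_neg]; convert h.2 a b using 2; ring⟩

theorem Lip.continuous {K : ℝ} {F : ℝ → ℝ} (h : Lip K F) : Continuous F := by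
  have : LipschitzWith ⟨K, h.1⟩ F := LipschitzWith.of_dist_le_mul fun a b => by
    rw [Real.dist_eq, Real.dist_eq]; exact h.2 a b
  exact this.continuous

theorem Lip.kflux_le {K : ℝ} {F : ℝ → ℝ} (h : Lip K F) (a b : ℝ) :
    |kflux F a b| ≤ K * |a - b| := by
  rcases le_total a b with hab | hab
  · rw [kflux_of_le F hab, abs_sub_comm]; exact h.2 a b
  · rw [kflux_of_ge F hab]; exact h.2 a b

theorem Lip.kflux_sub_le {K : ℝ} {F : ℝ → ℝ} (h : Lip K F) (a b c d : ℝ) :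
    |kflux F a b - kflux F c d| ≤ 2 * K * (|a - c| + |b - d|) := by
  rw [kflux_eq, kflux_eq]
  have h1 := h.2 (max a b) (max c d)
  have h2 := h.2 (min a b) (min c d)
  have h3 : |max a b - max c d| ≤ |a - c| + |b - d| :=
    (abs_max_sub_max_le_max a b c d).trans
      (max_le (by linarith [abs_nonneg (b - d)]) (by linarith [abs_nonneg (a - c)]))
  have h4 : |min a b - min c d| ≤ |a - c| + |b - d| :=
    (abs_min_sub_min_le_max a b c d).trans
      (max_le (by linarith [abs_nonneg (b - d)]) (by linarith [abs_nonneg (a - c)]))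
  have h5 := mul_le_mul_of_nonneg_left h3 h.1
  have h6 := mul_le_mul_of_nonneg_left h4 h.1
  calc _ = |(F (max a b) - F (max c d)) - (F (min a b) - F (min c d))| := by ring_nf
    _ ≤ |F (max a b) - F (max c d)| + |F (min a b) - F (min c d)| := abs_sub _ _
    _ ≤ _ := by linarith

theorem Lip.continuous_kflux {K : ℝ} {F : ℝ → ℝ} (h : Lip K F) :
    Continuous fun z : ℝ × ℝ => kflux F z.1 z.2 := by
  simp only [kflux_eq]
  have := h.continuous
  fun_prop

/-! ### Derivatives of test functions -/

theorem fderiv_fst_eq_deriv {φ : ℝ × ℝ → ℝ} (h : Differentiable ℝ φ) (z : ℝ × ℝ) :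
    HasDerivAt (fun t => φ (t, z.2)) (fderiv ℝ φ z (1, 0)) z.1 := by
  have h1 : HasDerivAt (fun t : ℝ => (t, z.2)) ((1 : ℝ), (0 : ℝ)) z.1 :=
    (hasDerivAt_id z.1).prodMk (hasDerivAt_const z.1 z.2)
  exact (h z).hasFDerivAt.comp_hasDerivAt_of_eq z.1 h1 rfl

theorem fderiv_snd_eq_deriv {φ : ℝ × ℝ → ℝ} (h : Differentiable ℝ φ) (z : ℝ × ℝ) :
    HasDerivAt (fun x => φ (z.1, x)) (fderiv ℝ φ z (0, 1)) z.2 := by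
  have h1 : HasDerivAt (fun x : ℝ => (z.1, x)) ((0 : ℝ), (1 : ℝ)) z.2 :=
    (hasDerivAt_const z.2 z.1).prodMk (hasDerivAt_id z.2)
  exact (h z).hasFDerivAt.comp_hasDerivAt_of_eq z.2 h1 rfl

/-- The partial derivative of a smooth compactly supported function in a fixed direction. -/
theorem fderiv_apply_props {φ : ℝ × ℝ → ℝ} (h : ContDiff ℝ ∞ φ) (hc : HasCompactSupport φ)
    (e : ℝ × ℝ) :
    Continuous (fun z => fderiv ℝ φ z e) ∧ HasCompactSupport (fun z => fderiv ℝ φ z e) :=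
  ⟨(h.continuous_fderiv (by simp)).clm_apply continuous_const,
    hc.fderiv_apply (𝕜 := ℝ) e⟩

theorem Continuous.exists_abs_le_of_compact {α : Type*} [TopologicalSpace α] {φ : α → ℝ}
    (h : Continuous φ) (hc : HasCompactSupport φ) : ∃ C, 0 ≤ C ∧ ∀ z, |φ z| ≤ C := by
  obtain ⟨C, hC⟩ := h.bounded_above_of_compact_support hc
  refine ⟨max C 0, le_max_right _ _, fun z => (hC z).trans (le_max_left _ _)⟩

/-- Integration by parts against the constant 1. It allows constants to be added freely to an
entropy and to its flux. -/
theorem integral_fderiv_eq_zero {φ : ℝ × ℝ → ℝ} (h : ContDiff ℝ ∞ φ) (hc : HasCompactSupport φ)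
    (e : ℝ × ℝ) : ∫ z, fderiv ℝ φ z e = 0 := by
  have h0 := fderiv_apply_props h hc e
  have := integral_mul_fderiv_eq_neg_fderiv_mul_of_integrable (𝕜 := ℝ) (μ := (volume : Measure (ℝ × ℝ)))
    (f := fun _ => (1 : ℝ)) (g := φ) (v := e) (by simp)
    (by simpa using h0.1.integrable_of_hasCompactSupport h0.2)
    (by simpa using h.continuous.integrable_of_hasCompactSupport hc)
    (by fun_prop) (fun x _ => h.differentiable (by simp) x)
  simpa using this

/-! ### Nonnegativity from testing -/

/-- A sequence of bump functions shrinking to the origin. -/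
def bumpSeq (E : Type*) [NormedAddCommGroup E] (n : ℕ) : ContDiffBump (0 : E) where
  rIn := 1 / (2 * (n + 1))
  rOut := 1 / (n + 1)
  rIn_pos := by positivity
  rIn_lt_rOut := by
    apply one_div_lt_one_div_of_lt <;> linarith [(Nat.cast_nonneg n : (0 : ℝ) ≤ n)]

theorem bumpSeq_rOut_tendsto (E : Type*) [NormedAddCommGroup E] :
    Tendsto (fun n => (bumpSeq E n).rOut) atTop (𝓝 0) :=
  tendsto_one_div_add_atTop_nhds_zero_nat

/-- A bounded ratio of outer to inner radius is what almost everywhere convergence of the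
mollifications requires. -/
theorem bumpSeq_rOut_le (E : Type*) [NormedAddCommGroup E] (n : ℕ) :
    (bumpSeq E n).rOut ≤ 2 * (bumpSeq E n).rIn := by
  simp only [bumpSeq]
  apply le_of_eq
  field_simp

/-- Normalised bumps centred at `t` compute mollifications of `h`, which converge to `h t` at almost
every `t`. Once the radius is below the distance from `t` to the ends of the interval, these bumps
are admissible tests. -/
theorem ae_nonneg_of_forall_test {T : ℝ} {h : ℝ → ℝ} (hh : LocallyIntegrable h)
    (H : ∀ a : ℝ → ℝ, ContDiff ℝ ∞ a → HasCompactSupport a → tsupport a ⊆ Ioo 0 T →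
      (∀ t, 0 ≤ a t) → 0 ≤ ∫ t, a t * h t) :
    ∀ᵐ t, t ∈ Ioo 0 T → 0 ≤ h t := by
  have key := ContDiffBump.ae_convolution_tendsto_right_of_locallyIntegrable
    (φ := bumpSeq ℝ) (K := 2) (bumpSeq_rOut_tendsto ℝ)
    (Eventually.of_forall fun n => bumpSeq_rOut_le ℝ n) hh
  filter_upwards [key] with t ht htT
  refine ge_of_tendsto ht ?_
  obtain ⟨δ, hδ, hδT⟩ := Metric.isOpen_iff.1 isOpen_Ioo t htT
  filter_upwards [(bumpSeq_rOut_tendsto ℝ).eventually (gt_mem_nhds hδ)] with n hn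
  have hr := (bumpSeq ℝ n).rOut_pos
  rw [convolution_eq_swap]
  have hc : ContDiff ℝ ∞ fun s => (bumpSeq ℝ n).normed volume (t - s) :=
    (ContDiffBump.contDiff_normed _).comp (contDiff_const.sub contDiff_id)
  have hs : tsupport (fun s => (bumpSeq ℝ n).normed volume (t - s)) ⊆
      Metric.closedBall t (bumpSeq ℝ n).rOut := by
    refine closure_minimal ?_ Metric.isClosed_closedBall
    intro s hs
    have : t - s ∈ Function.support ((bumpSeq ℝ n).normed volume) := hs
    rw [ContDiffBump.support_normed_eq] at this
    rw [Metric.mem_closedBall, dist_comm, Real.dist_eq]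
    rw [Metric.mem_ball, dist_zero_right, Real.norm_eq_abs] at this
    exact this.le
  have := H (fun s => (bumpSeq ℝ n).normed volume (t - s)) hc
    ((isCompact_closedBall t _).of_isClosed_subset (isClosed_tsupport _) hs)
    (fun s hs' => hδT ((Metric.closedBall_subset_ball hn) (hs hs')))
    (fun s => ContDiffBump.nonneg_normed _ _)
  simpa using this

end

section

/-! ### Bounded functions with bounded support -/

theorem integrable_of_bounded_box {f : ℝ × ℝ → ℝ} (hm : Measurable f) {C : ℝ}
    (hb : ∀ z, |f z| ≤ C) {a b c d : ℝ} (hs : ∀ z, f z ≠ 0 → z ∈ Icc a b ×ˢ Icc c d) :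
    Integrable f := by
  have h : IntegrableOn f (Icc a b ×ˢ Icc c d) :=
    Measure.integrableOn_of_bounded (M := C)
      (isCompact_Icc.prod isCompact_Icc).measure_lt_top.ne hm.aestronglyMeasurable
      (Eventually.of_forall hb)
  rw [integrableOn_iff_integrable_of_support_subset (fun z hz => hs z hz)] at h
  exact h

theorem integrable_of_bounded_Icc {f : ℝ → ℝ} (hm : Measurable f) {C : ℝ}
    (hb : ∀ z, |f z| ≤ C) {a b : ℝ} (hs : ∀ z, f z ≠ 0 → z ∈ Icc a b) :
    Integrable f := by
  have h : IntegrableOn f (Icc a b) :=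
    Measure.integrableOn_of_bounded (M := C)
      isCompact_Icc.measure_lt_top.ne hm.aestronglyMeasurable (Eventually.of_forall hb)
  rw [integrableOn_iff_integrable_of_support_subset (fun z hz => hs z hz)] at h
  exact h

theorem integrableOn_of_bounded' {α : Type*} [MeasurableSpace α] {μ : Measure α} {f : α → ℝ}
    (hm : Measurable f) {C : ℝ} (hb : ∀ z, |f z| ≤ C) {s : Set α} (hs : μ s ≠ ⊤) :
    IntegrableOn f s μ :=
  Measure.integrableOn_of_bounded (M := C) hs hm.aestronglyMeasurable (Eventually.of_forall hb)

theorem volume_Ioo_prod_Ioo_ne_top (a b c d : ℝ) :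
    (volume : Measure (ℝ × ℝ)) (Ioo a b ×ˢ Ioo c d) ≠ ⊤ := by
  rw [Measure.volume_eq_prod, Measure.prod_prod]
  exact ENNReal.mul_ne_top (by simp) (by simp)

/-- A function that is dominated on a set by `c * |G|` and vanishes outside. -/
theorem abs_integral_le_of_dominated {α : Type*} [MeasurableSpace α] {μ : Measure α}
    {f G : α → ℝ} {c : ℝ} {s : Set α} (hs : MeasurableSet s) (hG : IntegrableOn G s μ)
    (hf : ∀ z ∈ s, |f z| ≤ c * |G z|) (hf0 : ∀ z, z ∉ s → f z = 0) :
    |∫ z, f z ∂μ| ≤ c * ∫ z in s, |G z| ∂μ := by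
  rw [← setIntegral_eq_integral_of_forall_compl_eq_zero hf0, ← integral_const_mul]
  exact norm_integral_le_of_norm_le (f := f) (hG.abs.const_mul c)
    ((ae_restrict_iff' hs).2 (Eventually.of_forall hf))

/-! ### The smooth step -/


theorem hasDerivAt_step (x : ℝ) : HasDerivAt smoothTransition (deriv smoothTransition x) x :=
  ((Real.smoothTransition.contDiff (n := 1)).differentiable (by simp) x).hasDerivAt

theorem deriv_step_nonneg (x : ℝ) : 0 ≤ deriv smoothTransition x := Real.smoothTransition.monotone.deriv_nonneg

/-- The step attains its minimum at such points, which settles the endpoint `0` as well. -/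
theorem deriv_step_of_nonpos {x : ℝ} (h : x ≤ 0) : deriv smoothTransition x = 0 := by
  apply IsLocalMin.deriv_eq_zero
  filter_upwards with y
  rw [Real.smoothTransition.zero_of_nonpos h]; exact Real.smoothTransition.nonneg y

theorem deriv_step_of_one_le {x : ℝ} (h : 1 ≤ x) : deriv smoothTransition x = 0 := by
  apply IsLocalMax.deriv_eq_zero
  filter_upwards with y
  rw [Real.smoothTransition.one_of_one_le h]; exact Real.smoothTransition.le_one y

theorem continuous_deriv_step : Continuous (deriv smoothTransition) :=
  (Real.smoothTransition.contDiff (n := 1)).continuous_deriv (by simp)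

theorem exists_deriv_step_le : ∃ C, 0 ≤ C ∧ ∀ x, |deriv smoothTransition x| ≤ C := by
  refine Continuous.exists_abs_le_of_compact continuous_deriv_step ?_
  refine HasCompactSupport.intro (isCompact_Icc (a := (0 : ℝ)) (b := 1)) fun x hx => ?_
  rcases le_total x 0 with h | h
  · exact deriv_step_of_nonpos h
  · exact deriv_step_of_one_le (by by_contra h'; exact hx ⟨h, by linarith⟩)

theorem abs_step_le (x : ℝ) : |smoothTransition x| ≤ 1 := by
  rw [abs_of_nonneg (Real.smoothTransition.nonneg x)]; exact Real.smoothTransition.le_one x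

/-! ### Integrated inequalities on the half-line -/

/-- Nonnegative smooth functions compactly supported in `]0,T[ × ]-∞,0[`. -/
structure InteriorTest (T : ℝ) (φ : ℝ × ℝ → ℝ) : Prop where
  smooth : ContDiff ℝ ∞ φ
  compact : HasCompactSupport φ
  support : ∀ z ∈ tsupport φ, 0 < z.1 ∧ z.1 < T ∧ z.2 < 0
  nonneg : ∀ z, 0 ≤ φ z

/-- `∂ₜ G + ∂ₓ H ≤ 0` in the sense of distributions on `]0,T[ × ]-∞,0[`. -/
def InteriorIneq (T : ℝ) (G H : ℝ × ℝ → ℝ) : Prop :=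
  ∀ φ, InteriorTest T φ →
    0 ≤ ∫ z, (G z * fderiv ℝ φ z (1, 0) + H z * fderiv ℝ φ z (0, 1))

/-- `G` vanishes at the initial time, in the mean. -/
def InitialZero (G : ℝ × ℝ → ℝ) : Prop :=
  ∀ M, Tendsto (fun ε : ℝ => ε⁻¹ * ∫ z in Ioo 0 ε ×ˢ Ioo (-M) 0, |G z|) (𝓝[>] 0) (𝓝 0)

/-- `β` is the strong trace of `H` at `x = 0-`. -/
def HasTrace (T : ℝ) (H : ℝ × ℝ → ℝ) (β : ℝ → ℝ) : Prop :=
  ∀ s < T, Tendsto (fun ε : ℝ => ε⁻¹ * ∫ z in Ioo 0 s ×ˢ Ioo (-ε) 0, |H z - β z.1|)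
    (𝓝[>] 0) (𝓝 0)

/-- The test function of the cone argument. -/
def coneTest (A : ℝ → ℝ) (L M ε : ℝ) (z : ℝ × ℝ) : ℝ :=
  smoothTransition (z.1 / ε - 1) * A z.1 * smoothTransition (-z.2 / ε - 1) * smoothTransition (z.2 + M - L * z.1)

theorem coneTest_support {A : ℝ → ℝ} {L M ε s : ℝ} (hε : 0 < ε) (hL : 0 ≤ L)
    (hA : ∀ t, s ≤ t → A t = 0) {z : ℝ × ℝ} (hz : coneTest A L M ε z ≠ 0) :
    z ∈ Icc ε s ×ˢ Icc (-M) (-ε) := by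
  unfold coneTest at hz
  simp only [ne_eq, mul_eq_zero, not_or, Real.smoothTransition.zero_iff_nonpos, not_le] at hz
  obtain ⟨⟨⟨h1, h2⟩, h3⟩, h4⟩ := hz
  have h1' : ε < z.1 := by rw [sub_pos, lt_div_iff₀ hε] at h1; linarith
  have h3' : ε < -z.2 := by rw [sub_pos, lt_div_iff₀ hε] at h3; linarith
  have h5 : 0 ≤ L * z.1 := mul_nonneg hL (by linarith)
  refine ⟨⟨h1'.le, ?_⟩, by linarith, by linarith⟩
  by_contra h
  exact h2 (hA _ (by linarith))

theorem coneTest_interior {A : ℝ → ℝ} {L M ε s T : ℝ} (hε : 0 < ε) (hL : 0 ≤ L) (hs : s < T)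
    (hA : ∀ t, s ≤ t → A t = 0) (hAs : ContDiff ℝ ∞ A) (hA0 : ∀ t, 0 ≤ A t) :
    InteriorTest T (coneTest A L M ε) := by
  have hsub : tsupport (coneTest A L M ε) ⊆ Icc ε s ×ˢ Icc (-M) (-ε) :=
    closure_minimal (fun z hz => coneTest_support hε hL hA hz)
      (isClosed_Icc.prod isClosed_Icc)
  refine ⟨?_, ?_, ?_, ?_⟩
  · unfold coneTest
    have hS : ContDiff ℝ ∞ smoothTransition := Real.smoothTransition.contDiff
    refine ((ContDiff.mul ?_ ?_).mul ?_).mul ?_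
    · exact hS.comp ((contDiff_fst.div_const _).sub contDiff_const)
    · exact hAs.comp contDiff_fst
    · exact hS.comp ((contDiff_snd.neg.div_const _).sub contDiff_const)
    · exact hS.comp ((contDiff_snd.add contDiff_const).sub (contDiff_const.mul contDiff_fst))
  · exact (isCompact_Icc.prod isCompact_Icc).of_isClosed_subset (isClosed_tsupport _) hsub
  · intro z hz
    obtain ⟨⟨h1, h2⟩, h3, h4⟩ := hsub hz
    exact ⟨by linarith, by linarith, by linarith⟩
  · intro z
    exact mul_nonneg (mul_nonneg (mul_nonneg (Real.smoothTransition.nonneg _) (hA0 _))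
      (Real.smoothTransition.nonneg _)) (Real.smoothTransition.nonneg _)

/-- The three terms are the initial layer, the time weight, whose derivative is `-a`, and the moving
cone cut-off. The last one has a counterpart in the space derivative, and the two are combined
through `H ≤ L G`. -/
theorem coneTest_fderiv_fst {A a : ℝ → ℝ} {L M ε : ℝ} (z : ℝ × ℝ)
    (hd : Differentiable ℝ (coneTest A L M ε))
    (hA' : ∀ t, HasDerivAt A (-a t) t) :
    fderiv ℝ (coneTest A L M ε) z (1, 0) =
      ε⁻¹ * deriv smoothTransition (z.1 / ε - 1) * A z.1 * smoothTransition (-z.2 / ε - 1) * smoothTransition (z.2 + M - L * z.1)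
      - smoothTransition (z.1 / ε - 1) * a z.1 * smoothTransition (-z.2 / ε - 1) * smoothTransition (z.2 + M - L * z.1)
      - smoothTransition (z.1 / ε - 1) * A z.1 * smoothTransition (-z.2 / ε - 1) * (L * deriv smoothTransition (z.2 + M - L * z.1)) := by
  have h := fderiv_fst_eq_deriv hd z
  have e1 : HasDerivAt (fun t : ℝ => t / ε - 1) (ε⁻¹) z.1 := by
    simpa using ((hasDerivAt_id z.1).div_const ε).sub_const 1
  have e2 : HasDerivAt (fun t : ℝ => z.2 + M - L * t) (-L) z.1 := by
    simpa using ((hasDerivAt_id z.1).const_mul L).const_sub (z.2 + M)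
  have h2 := ((((hasDerivAt_step _).comp z.1 e1).mul (hA' z.1)).mul_const
    (smoothTransition (-z.2 / ε - 1))).mul ((hasDerivAt_step _).comp z.1 e2)
  have h3 := h.unique h2
  rw [h3]
  simp only [Function.comp_apply, Pi.mul_apply]
  ring

theorem coneTest_fderiv_snd {A : ℝ → ℝ} {L M ε : ℝ} (z : ℝ × ℝ)
    (hd : Differentiable ℝ (coneTest A L M ε)) :
    fderiv ℝ (coneTest A L M ε) z (0, 1) =
      -(smoothTransition (z.1 / ε - 1) * A z.1 * (ε⁻¹ * deriv smoothTransition (-z.2 / ε - 1)) * smoothTransition (z.2 + M - L * z.1))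
      + smoothTransition (z.1 / ε - 1) * A z.1 * smoothTransition (-z.2 / ε - 1) * deriv smoothTransition (z.2 + M - L * z.1) := by
  have h := fderiv_snd_eq_deriv hd z
  have e1 : HasDerivAt (fun t : ℝ => -t / ε - 1) (-ε⁻¹) z.2 := by
    have := ((hasDerivAt_id z.2).neg.div_const ε).sub_const 1
    convert! this using 1
    rw [neg_div, one_div]
  have e2 : HasDerivAt (fun t : ℝ => t + M - L * z.1) 1 z.2 := by
    simpa using ((hasDerivAt_id z.2).add_const M).sub_const (L * z.1)
  have h2 := (((hasDerivAt_step _).comp z.2 e1).const_mul (smoothTransition (z.1 / ε - 1) * A z.1)).mul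
    ((hasDerivAt_step _).comp z.2 e2)
  have h3 := h.unique h2
  rw [h3]
  simp only [Function.comp_apply]
  ring

/-- The kernel is an approximate identity supported in `[-2ε,-ε]`; it extracts traces at `0-`. -/
theorem integral_scaled_deriv_step {ε : ℝ} (hε : 0 < ε) :
    ∫ x : ℝ, ε⁻¹ * deriv smoothTransition (-x / ε - 1) = 1 := by
  have h0 : (∫ y : ℝ, deriv smoothTransition y) = 1 := by
    have : (∫ y : ℝ, deriv smoothTransition y) = ∫ y in (0:ℝ)..1, deriv smoothTransition y := by
      rw [intervalIntegral.integral_of_le zero_le_one]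
      refine (setIntegral_eq_integral_of_forall_compl_eq_zero fun x hx => ?_).symm
      rcases le_or_gt x 0 with h | h
      · exact deriv_step_of_nonpos h
      · exact deriv_step_of_one_le (by by_contra h'; exact hx ⟨h, by linarith⟩)
    rw [this, intervalIntegral.integral_deriv_eq_sub (fun x _ => (hasDerivAt_step x).differentiableAt)
      (continuous_deriv_step.intervalIntegrable _ _)]
    simp
  rw [integral_const_mul]
  have h1 := Measure.integral_comp_mul_left (fun y => deriv smoothTransition (y - 1)) (-ε⁻¹)
  have h2 : (∫ y : ℝ, deriv smoothTransition (y - 1)) = 1 := by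
    rw [integral_sub_right_eq_self (fun y => deriv smoothTransition y) 1, h0]
  rw [h2] at h1
  have h3 : (fun x : ℝ => deriv smoothTransition (-x / ε - 1)) = fun x => deriv smoothTransition (-ε⁻¹ * x - 1) := by
    funext x; congr 1; field_simp
  rw [h3, h1]
  simp [abs_of_pos hε, hε.ne']

end

/-! ### The cone inequality with boundary flux. -/

section

theorem tendsto_mul_nhdsGT {c : ℝ} (hc : 0 < c) :
    Tendsto (fun ε : ℝ => c * ε) (𝓝[>] 0) (𝓝[>] 0) := by
  refine tendsto_nhdsWithin_iff.2 ⟨?_, ?_⟩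
  · have : Tendsto (fun ε : ℝ => c * ε) (𝓝 0) (𝓝 (c * 0)) := tendsto_id.const_mul c
    rw [mul_zero] at this
    exact this.mono_left nhdsWithin_le_nhds
  · filter_upwards [self_mem_nhdsWithin] with ε hε
    exact mul_pos hc (mem_Ioi.1 hε)

theorem tendsto_step_div {r : ℝ} (hr : 0 < r) :
    Tendsto (fun ε : ℝ => smoothTransition (r / ε - 1)) (𝓝[>] 0) (𝓝 1) := by
  refine tendsto_const_nhds.congr' ?_
  filter_upwards [Ioo_mem_nhdsGT (show (0 : ℝ) < r / 2 by linarith)] with ε hε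
  rw [Real.smoothTransition.one_of_one_le]
  rw [le_sub_iff_add_le, le_div_iff₀ hε.1]
  linarith [hε.2]

theorem step_div_of_nonpos {r ε : ℝ} (hr : r ≤ 0) (hε : 0 < ε) :
    smoothTransition (r / ε - 1) = 0 :=
  Real.smoothTransition.zero_of_nonpos (by linarith [div_nonpos_of_nonpos_of_nonneg hr hε.le])

/-- The cut-off inequality, tested against the time weight `A`, in the limit of vanishing layers. -/
theorem cone_inequality {T L M M₀ C : ℝ} {G H : ℝ × ℝ → ℝ} {β A a : ℝ → ℝ} {s : ℝ}
    (hG : Measurable G) (hGC : ∀ z, |G z| ≤ C) (hH : Measurable H) (hHC : ∀ z, |H z| ≤ C)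
    (hβ : Measurable β) (hβC : ∀ t, |β t| ≤ C) (hL : 0 ≤ L)
    (hineq : InteriorIneq T G H) (hini : InitialZero G) (htr : HasTrace T H β)
    (hfar : ∀ᵐ z : ℝ × ℝ, 0 < z.1 → z.1 < T → z.2 < -M₀ → H z ≤ L * G z)
    (hM : M₀ + L * T + 1 ≤ M) (hM' : L * T + 2 ≤ M) (hs : s < T)
    (hA : ∀ t, s ≤ t → A t = 0) (hAs : ContDiff ℝ ∞ A) (hA0 : ∀ t, 0 ≤ A t)
    (hA' : ∀ t, HasDerivAt A (-a t) t) (hAC : ∀ t, A t ≤ C) (haC : ∀ t, |a t| ≤ C)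
    (ham : Measurable a) (ha : ∀ t, a t ≠ 0 → t ∈ Icc 0 s) :
    0 ≤ -(∫ z : ℝ × ℝ, (Ioi 0 ×ˢ Iio 0).indicator
        (fun z => a z.1 * (smoothTransition (z.2 + M - L * z.1) * G z)) z)
      - ∫ t, (Ioi 0).indicator (fun t => β t * A t) t := by
  obtain ⟨c, hc0, hc⟩ := exists_deriv_step_le
  have hC0 : 0 ≤ C := (abs_nonneg _).trans (hGC 0)
  have hAm : Measurable A := hAs.continuous.measurable
  have hSm : Measurable smoothTransition := Real.smoothTransition.continuous.measurable
  have hdSm : Measurable (deriv smoothTransition) := continuous_deriv_step.measurable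
  have hAabs : ∀ t, |A t| ≤ C := fun t => by rw [abs_of_nonneg (hA0 t)]; exact hAC t
  set D : ℝ × ℝ → ℝ := fun z => smoothTransition (z.2 + M - L * z.1) with hD
  have hDm : Measurable D := by fun_prop
  have hD1 : ∀ z, |D z| ≤ 1 := fun z => abs_step_le _
  -- the three surviving terms
  set I₁ : ℝ → ℝ × ℝ → ℝ := fun ε z =>
    G z * (ε⁻¹ * deriv smoothTransition (z.1 / ε - 1) * A z.1 *
      smoothTransition (-z.2 / ε - 1) * D z) with hI₁
  set I₂ : ℝ → ℝ × ℝ → ℝ := fun ε z =>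
    smoothTransition (z.1 / ε - 1) * a z.1 * smoothTransition (-z.2 / ε - 1) * D z * G z with hI₂
  set I₃ : ℝ → ℝ × ℝ → ℝ := fun ε z =>
    (H z - β z.1) * (smoothTransition (z.1 / ε - 1) * A z.1 *
      (ε⁻¹ * deriv smoothTransition (-z.2 / ε - 1)) * D z) with hI₃
  set I₄ : ℝ → ℝ × ℝ → ℝ := fun ε z =>
    (β z.1 * (smoothTransition (z.1 / ε - 1) * A z.1)) *
      (ε⁻¹ * deriv smoothTransition (-z.2 / ε - 1)) with hI₄
  have hI₁m : ∀ ε, Measurable (I₁ ε) := fun ε => by simp only [hI₁]; fun_prop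
  have hI₂m : ∀ ε, Measurable (I₂ ε) := fun ε => by simp only [hI₂]; fun_prop
  have hI₃m : ∀ ε, Measurable (I₃ ε) := fun ε => by simp only [hI₃]; fun_prop
  have hI₄m : ∀ ε, Measurable (I₄ ε) := fun ε => by simp only [hI₄]; fun_prop
  have supp_t : ∀ {ε t : ℝ}, 0 < ε → smoothTransition (t / ε - 1) ≠ 0 → 0 < t := by
    intro ε t hε h
    by_contra h'
    exact h (step_div_of_nonpos (not_lt.1 h') hε)
  have supp_dt : ∀ {ε t : ℝ}, 0 < ε → deriv smoothTransition (t / ε - 1) ≠ 0 →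
      t ∈ Ioo 0 (2 * ε) := by
    intro ε t hε h
    constructor
    · by_contra h'
      exact h (deriv_step_of_nonpos
        (by linarith [div_nonpos_of_nonpos_of_nonneg (not_lt.1 h') hε.le]))
    · by_contra h'
      apply h (deriv_step_of_one_le _)
      rw [le_sub_iff_add_le, le_div_iff₀ hε]; linarith
  have supp_D : ∀ {z : ℝ × ℝ}, 0 < z.1 → D z ≠ 0 → -M < z.2 := by
    intro z hz h
    by_contra h'
    apply h (Real.smoothTransition.zero_of_nonpos _)
    have := mul_nonneg hL hz.le
    linarith
  have habs5 : ∀ {x y z w v b₁ b₂ b₃ b₄ b₅ : ℝ}, |x| ≤ b₁ → |y| ≤ b₂ → |z| ≤ b₃ → |w| ≤ b₄ →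
      |v| ≤ b₅ → |x * y * z * w * v| ≤ b₁ * b₂ * b₃ * b₄ * b₅ := by
    intro x y z w v b₁ b₂ b₃ b₄ b₅ h1 h2 h3 h4 h5
    have p1 := (abs_nonneg _).trans h1
    have p2 := (abs_nonneg _).trans h2
    have p3 := (abs_nonneg _).trans h3
    have p4 := (abs_nonneg _).trans h4
    rw [abs_mul, abs_mul, abs_mul, abs_mul]
    gcongr
  have inv_abs : ∀ {ε : ℝ}, 0 < ε → |ε⁻¹| ≤ ε⁻¹ := fun hε => by
    rw [abs_of_pos (inv_pos.2 hε)]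
  have int₁ : ∀ {ε}, 0 < ε → Integrable (I₁ ε) := by
    intro ε hε
    refine integrable_of_bounded_box (hI₁m ε) (C := C * (ε⁻¹ * c * C * 1 * 1))
      (a := 0) (b := 2 * ε) (c := -M) (d := 0) ?_ ?_
    · intro z
      rw [hI₁]; dsimp only
      rw [abs_mul]
      exact mul_le_mul (hGC z) (habs5 (inv_abs hε) (hc _) (hAabs _) (abs_step_le _) (hD1 z))
        (abs_nonneg _) hC0
    · intro z hz
      simp only [hI₁, ne_eq, mul_eq_zero, not_or] at hz
      have h1 := supp_dt hε hz.2.1.1.1.2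
      have h2 := supp_t hε (by simpa using hz.2.1.2)
      have h3 := supp_D h1.1 hz.2.2
      exact ⟨⟨h1.1.le, h1.2.le⟩, h3.le, by linarith⟩
  have int₂ : ∀ {ε}, 0 < ε → Integrable (I₂ ε) := by
    intro ε hε
    refine integrable_of_bounded_box (hI₂m ε) (C := 1 * C * 1 * 1 * C)
      (a := 0) (b := s) (c := -M) (d := 0) ?_ ?_
    · intro z
      exact habs5 (abs_step_le _) (haC _) (abs_step_le _) (hD1 z) (hGC z)
    · intro z hz
      simp only [hI₂, ne_eq, mul_eq_zero, not_or] at hz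
      have h1 := supp_t hε hz.1.1.1.1
      have h2 := supp_t hε (by simpa using hz.1.1.2)
      have h3 := supp_D h1 hz.1.2
      exact ⟨ha _ hz.1.1.1.2, h3.le, by linarith⟩
  have supp_A : ∀ {t}, A t ≠ 0 → t < s := fun {t} h => by
    by_contra h'; exact h (hA t (not_lt.1 h'))
  have int₃ : ∀ {ε}, 0 < ε → Integrable (I₃ ε) := by
    intro ε hε
    refine integrable_of_bounded_box (hI₃m ε) (C := (C + C) * (1 * C * ε⁻¹ * c * 1))
      (a := 0) (b := s) (c := -M) (d := 0) ?_ ?_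
    · intro z
      rw [hI₃]; dsimp only
      rw [abs_mul]
      refine mul_le_mul ((abs_sub _ _).trans (add_le_add (hHC z) (hβC _))) ?_
        (abs_nonneg _) (by linarith)
      rw [← mul_assoc (smoothTransition (z.1 / ε - 1) * A z.1)]
      exact habs5 (abs_step_le _) (hAabs _) (inv_abs hε) (hc _) (hD1 z)
    · intro z hz
      simp only [hI₃, ne_eq, mul_eq_zero, not_or] at hz
      have h1 := supp_t hε hz.2.1.1.1
      have h2 := supp_dt hε hz.2.1.2.2
      have h3 := supp_D h1 hz.2.2
      exact ⟨⟨h1.le, (supp_A hz.2.1.1.2).le⟩, h3.le, by linarith [h2.1]⟩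
  have int₄ : ∀ {ε}, 0 < ε → Integrable (I₄ ε) := by
    intro ε hε
    refine integrable_of_bounded_box (hI₄m ε) (C := C * 1 * C * ε⁻¹ * c)
      (a := 0) (b := s) (c := -(2 * ε)) (d := 0) ?_ ?_
    · intro z
      rw [hI₄]; dsimp only
      rw [← mul_assoc, ← mul_assoc]
      exact habs5 (hβC _) (abs_step_le _) (hAabs _) (inv_abs hε) (hc _)
    · intro z hz
      simp only [hI₄, ne_eq, mul_eq_zero, not_or] at hz
      have h1 := supp_t hε hz.1.2.1
      have h2 := supp_dt hε hz.2.2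
      exact ⟨⟨h1.le, (supp_A hz.1.2.2).le⟩, by linarith [h2.2], by linarith [h2.1]⟩
  have main : ∀ᶠ ε : ℝ in 𝓝[>] 0, 0 ≤ (∫ z, I₁ ε z) - (∫ z, I₂ ε z) - (∫ z, I₃ ε z)
      - ∫ z, I₄ ε z := by
    filter_upwards [Ioo_mem_nhdsGT (show (0 : ℝ) < 1 / 2 by norm_num)] with ε hε
    have ht := coneTest_interior (M := M) hε.1 hL hs hA hAs hA0
    have hd := ht.smooth.differentiable (by simp)
    refine (hineq _ ht).trans ?_
    have i2 : Integrable fun z => I₁ ε z - I₂ ε z := (int₁ hε.1).sub (int₂ hε.1)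
    have i3 : Integrable fun z => I₁ ε z - I₂ ε z - I₃ ε z := i2.sub (int₃ hε.1)
    rw [← integral_sub (int₁ hε.1) (int₂ hε.1), ← integral_sub i2 (int₃ hε.1),
      ← integral_sub i3 (int₄ hε.1)]
    have p1 := fderiv_apply_props ht.smooth ht.compact (1, 0)
    have p2 := fderiv_apply_props ht.smooth ht.compact (0, 1)
    refine integral_mono_ae ?_ (i3.sub (int₄ hε.1)) ?_
    · exact ((p1.1.integrable_of_hasCompactSupport p1.2).bdd_mul hG.aestronglyMeasurable
        (Eventually.of_forall hGC)).add ((p2.1.integrable_of_hasCompactSupport p2.2).bdd_mul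
          hH.aestronglyMeasurable (Eventually.of_forall hHC))
    · filter_upwards [hfar] with z hz
      rw [coneTest_fderiv_fst z hd hA', coneTest_fderiv_snd z hd]
      -- In the boundary layer `x > -2ε > -1`, so `M ≥ L T + 2` makes the cone cut-off equal to one
      -- there. The trace term becomes a product of a function of `t` and a function of `x`.
      have e4 : I₄ ε z = β z.1 * (smoothTransition (z.1 / ε - 1) * A z.1 *
          (ε⁻¹ * deriv smoothTransition (-z.2 / ε - 1)) * D z) := by
        by_cases h0 : smoothTransition (z.1 / ε - 1) * A z.1 *
          (ε⁻¹ * deriv smoothTransition (-z.2 / ε - 1)) = 0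
        · rw [h0, hI₄]
          dsimp only
          rw [mul_assoc, h0]; ring
        · have h1 : D z = 1 := by
            simp only [mul_eq_zero, not_or] at h0
            apply Real.smoothTransition.one_of_one_le
            have h2 := (supp_dt hε.1 h0.2.2).2
            have h3 := supp_A h0.1.2
            have h4 := mul_le_mul_of_nonneg_left (h3.trans hs).le hL
            linarith [hε.2]
          rw [h1, hI₄]
          dsimp only
          ring
      -- Where the cone cut-off varies, `x < 1 - M + L t ≤ -M₀`, and there `H ≤ L G`: the cut-off
      -- moves inwards fast enough for its contribution to have a sign.
      have hlast : smoothTransition (z.1 / ε - 1) * A z.1 * smoothTransition (-z.2 / ε - 1) *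
          deriv smoothTransition (z.2 + M - L * z.1) * (H z - L * G z) ≤ 0 := by
        by_cases h0 : smoothTransition (z.1 / ε - 1) * A z.1 * smoothTransition (-z.2 / ε - 1) *
          deriv smoothTransition (z.2 + M - L * z.1) = 0
        · rw [h0, zero_mul]
        · simp only [mul_eq_zero, not_or] at h0
          have h1 := supp_t hε.1 h0.1.1.1
          have h2 := (supp_A h0.1.1.2).trans hs
          have h3 : z.2 + M - L * z.1 < 1 := by
            by_contra h'
            exact h0.2 (deriv_step_of_one_le (not_lt.1 h'))
          have h4 := mul_le_mul_of_nonneg_left h2.le hL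
          have h5 := hz h1 h2 (by linarith)
          exact mul_nonpos_of_nonneg_of_nonpos (mul_nonneg (mul_nonneg (mul_nonneg
            (Real.smoothTransition.nonneg _) (hA0 _)) (Real.smoothTransition.nonneg _))
            (deriv_step_nonneg _)) (by linarith)
      rw [e4]
      simp only [hI₁, hI₂, hI₃, hD]
      linarith
  -- limits
  have lim₁ : Tendsto (fun ε => ∫ z, I₁ ε z) (𝓝[>] 0) (𝓝 0) := by
    -- The derivative of the time step lives on `]0,2ε[`, hence the rescaling by two; the same
    -- occurs in the boundary layer.
    have h3 := ((hini M).comp (tendsto_mul_nhdsGT two_pos)).const_mul (2 * c * C)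
    rw [mul_zero] at h3
    refine squeeze_zero_norm' ?_ h3
    filter_upwards [self_mem_nhdsWithin] with ε hε
    have hε' : 0 < ε := hε
    refine (abs_integral_le_of_dominated (G := G) (c := ε⁻¹ * c * C)
      (s := Ioo 0 (2 * ε) ×ˢ Ioo (-M) 0) (measurableSet_Ioo.prod measurableSet_Ioo)
      (integrableOn_of_bounded' hG hGC (volume_Ioo_prod_Ioo_ne_top _ _ _ _)) ?_ ?_).trans ?_
    · intro z _
      simp only [hI₁]
      rw [abs_mul, mul_comm]
      refine mul_le_mul_of_nonneg_right ?_ (abs_nonneg _)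
      simpa using habs5 (inv_abs hε') (hc (z.1 / ε - 1)) (hAabs z.1)
        (abs_step_le (-z.2 / ε - 1)) (hD1 z)
    · intro z hz
      by_contra h
      apply hz
      simp only [hI₁, mul_eq_zero, not_or] at h
      have h1 := supp_dt hε' h.2.1.1.1.2
      have h2 := supp_t hε' (by simpa using h.2.1.2)
      have h3 := supp_D h1.1 h.2.2
      exact ⟨h1, h3, by linarith⟩
    · simp only [Function.comp_apply]
      apply le_of_eq
      field_simp
  have lim₂ : Tendsto (fun ε => ∫ z, I₂ ε z) (𝓝[>] 0)
      (𝓝 (∫ z : ℝ × ℝ, (Ioi 0 ×ˢ Iio 0).indicator (fun z => a z.1 * (D z * G z)) z)) := by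
    refine tendsto_integral_filter_of_dominated_convergence
      ((Icc 0 s ×ˢ Icc (-M) 0).indicator fun _ => C * C) ?_ ?_ ?_ ?_
    · exact Eventually.of_forall fun ε => (hI₂m ε).aestronglyMeasurable
    · filter_upwards [self_mem_nhdsWithin] with ε hε
      refine Eventually.of_forall fun z => ?_
      by_cases h : I₂ ε z = 0
      · rw [h, norm_zero]
        exact indicator_nonneg (fun _ _ => mul_nonneg hC0 hC0) z
      · have h' := h
        simp only [hI₂, mul_eq_zero, not_or] at h
        have h1 := supp_t hε h.1.1.1.1
        have h2 := supp_t hε (by simpa using h.1.1.2)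
        have h3 := supp_D h1 h.1.2
        rw [indicator_of_mem (show z ∈ Icc 0 s ×ˢ Icc (-M) 0 from
          ⟨ha _ h.1.1.1.2, h3.le, by linarith⟩)]
        refine (habs5 (abs_step_le (z.1 / ε - 1)) (haC z.1) (abs_step_le (-z.2 / ε - 1))
          (hD1 z) (hGC z)).trans (le_of_eq (by ring))
    · exact (integrable_indicator_iff (measurableSet_Icc.prod measurableSet_Icc)).2
        (integrableOn_const (isCompact_Icc.prod isCompact_Icc).measure_lt_top.ne)
    · refine Eventually.of_forall fun z => ?_
      by_cases hz : z ∈ Ioi (0 : ℝ) ×ˢ Iio (0 : ℝ)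
      · rw [indicator_of_mem hz]
        have h1 := tendsto_step_div hz.1
        have h2 := tendsto_step_div (r := -z.2) (by have := hz.2; simp at this; linarith)
        have := (((h1.mul_const (a z.1)).mul h2).mul_const (D z)).mul_const (G z)
        convert this using 2
        ring
      · rw [indicator_of_notMem hz]
        refine tendsto_const_nhds.congr' ?_
        filter_upwards [self_mem_nhdsWithin] with ε hε
        by_contra h
        have h := Ne.symm h
        simp only [hI₂, ne_eq, mul_eq_zero, not_or] at h
        have h1 := supp_t hε h.1.1.1.1
        have h2 := supp_t hε (by simpa using h.1.1.2)
        exact hz ⟨h1, by simp; linarith⟩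
  have lim₃ : Tendsto (fun ε => ∫ z, I₃ ε z) (𝓝[>] 0) (𝓝 0) := by
    have h3 := ((htr s hs).comp (tendsto_mul_nhdsGT two_pos)).const_mul (2 * c * C)
    rw [mul_zero] at h3
    refine squeeze_zero_norm' ?_ h3
    filter_upwards [self_mem_nhdsWithin] with ε hε
    have hε' : 0 < ε := hε
    refine (abs_integral_le_of_dominated (G := fun z => H z - β z.1) (c := ε⁻¹ * c * C)
      (s := Ioo 0 s ×ˢ Ioo (-(2 * ε)) 0) (measurableSet_Ioo.prod measurableSet_Ioo)
      (integrableOn_of_bounded' (C := C + C) (by fun_prop)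
        (fun z => (abs_sub _ _).trans (add_le_add (hHC z) (hβC _)))
        (volume_Ioo_prod_Ioo_ne_top _ _ _ _)) ?_ ?_).trans ?_
    · intro z _
      simp only [hI₃]
      rw [abs_mul, mul_comm]
      refine mul_le_mul_of_nonneg_right ?_ (abs_nonneg _)
      rw [← mul_assoc (smoothTransition (z.1 / ε - 1) * A z.1)]
      refine (habs5 (abs_step_le (z.1 / ε - 1)) (hAabs z.1) (inv_abs hε')
        (hc (-z.2 / ε - 1)) (hD1 z)).trans (le_of_eq ?_)
      ring
    · intro z hz
      by_contra h
      apply hz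
      simp only [hI₃, mul_eq_zero, not_or] at h
      have h1 := supp_t hε' h.2.1.1.1
      have h2 := supp_dt hε' h.2.1.2.2
      exact ⟨⟨h1, supp_A h.2.1.1.2⟩, by linarith [h2.2], by linarith [h2.1]⟩
    · simp only [Function.comp_apply]
      apply le_of_eq
      field_simp
  have lim₄ : Tendsto (fun ε => ∫ z, I₄ ε z) (𝓝[>] 0)
      (𝓝 (∫ t, (Ioi 0).indicator (fun t => β t * A t) t)) := by
    have e : ∀ᶠ ε : ℝ in 𝓝[>] 0, (∫ t, β t * (smoothTransition (t / ε - 1) * A t)) =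
        ∫ z, I₄ ε z := by
      filter_upwards [self_mem_nhdsWithin] with ε hε
      simp only [hI₄]
      rw [Measure.volume_eq_prod, integral_prod_mul (fun t => β t * (smoothTransition (t / ε - 1) * A t))
        (fun x => ε⁻¹ * deriv smoothTransition (-x / ε - 1)), integral_scaled_deriv_step hε, mul_one]
    refine Tendsto.congr' e ?_
    refine tendsto_integral_filter_of_dominated_convergence
      ((Icc 0 s).indicator fun _ => C * C) ?_ ?_ ?_ ?_
    · exact Eventually.of_forall fun ε => Measurable.aestronglyMeasurable (by fun_prop)
    · filter_upwards [self_mem_nhdsWithin] with ε hε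
      refine Eventually.of_forall fun t => ?_
      by_cases h : β t * (smoothTransition (t / ε - 1) * A t) = 0
      · rw [h, norm_zero]
        exact indicator_nonneg (fun _ _ => mul_nonneg hC0 hC0) t
      · have h' := h
        simp only [mul_eq_zero, not_or] at h
        have h1 := supp_t hε h.2.1
        rw [indicator_of_mem (show t ∈ Icc 0 s from ⟨h1.le, (supp_A h.2.2).le⟩),
          norm_mul, norm_mul]
        have q1 := mul_le_mul (abs_step_le (t / ε - 1)) (hAabs t) (abs_nonneg _) zero_le_one
        rw [one_mul] at q1
        exact mul_le_mul (hβC t) q1 (mul_nonneg (abs_nonneg _) (abs_nonneg _)) hC0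
    · exact (integrable_indicator_iff measurableSet_Icc).2
        (integrableOn_const isCompact_Icc.measure_lt_top.ne)
    · refine Eventually.of_forall fun t => ?_
      by_cases ht : t ∈ Ioi (0 : ℝ)
      · rw [indicator_of_mem ht]
        have := ((tendsto_step_div ht).mul_const (A t)).const_mul (β t)
        simpa using this
      · rw [indicator_of_notMem ht]
        refine tendsto_const_nhds.congr' ?_
        filter_upwards [self_mem_nhdsWithin] with ε hε
        rw [step_div_of_nonpos (not_lt.1 ht) hε]; ring
  have := ge_of_tendsto (((lim₁.sub lim₂).sub lim₃).sub lim₄) main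
  simpa using this

/-- The cone argument needs a nonnegative decreasing time weight `A` that vanishes before `T`; with
`A t = ∫ a` over `[t,s]`, every nonnegative test function `a` occurs as `-A'`. The time `s` is the
last point of the support of `a`, or `T / 2` by default if `a` vanishes. -/
theorem exists_antideriv_of_test {T : ℝ} {a : ℝ → ℝ} (ha : ContDiff ℝ ∞ a)
    (hc : HasCompactSupport a) (hT : tsupport a ⊆ Ioo 0 T) (h0 : ∀ t, 0 ≤ a t) (hTpos : 0 < T) :
    ∃ (A : ℝ → ℝ) (s C : ℝ), 0 < s ∧ s < T ∧ ContDiff ℝ ∞ A ∧ (∀ t, HasDerivAt A (-a t) t) ∧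
      (∀ t, s ≤ t → A t = 0) ∧ (∀ t, 0 ≤ A t) ∧ (∀ t, A t ≤ C) ∧ (∀ t, |a t| ≤ C) ∧
      (∀ t, a t ≠ 0 → t ∈ Icc 0 s) := by
  obtain ⟨s, hs0, hsT, hs⟩ : ∃ s, 0 < s ∧ s < T ∧ ∀ t, a t ≠ 0 → t ∈ Icc 0 s := by
    rcases (tsupport a).eq_empty_or_nonempty with he | hne
    · refine ⟨T / 2, by linarith, by linarith, fun t ht => ?_⟩
      have := subset_tsupport a ht
      rw [he] at this; exact this.elim
    · have hm := hc.isCompact.sSup_mem hne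
      refine ⟨sSup (tsupport a), (hT hm).1, (hT hm).2, fun t ht => ⟨(hT (subset_tsupport a ht)).1.le, ?_⟩⟩
      exact le_csSup hc.isCompact.bddAbove (subset_tsupport a ht)
  obtain ⟨C, hC0, hC⟩ := Continuous.exists_abs_le_of_compact ha.continuous hc
  have hd : ∀ t, HasDerivAt (fun t => ∫ r in t..s, a r) (-a t) t := fun t =>
    intervalIntegral.integral_hasDerivAt_left (ha.continuous.intervalIntegrable _ _)
      (ha.continuous.stronglyMeasurableAtFilter _ _) ha.continuous.continuousAt
  have hz : ∀ t, s ≤ t → (∫ r in t..s, a r) = 0 := by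
    intro t ht
    rw [intervalIntegral.integral_symm, neg_eq_zero, intervalIntegral.integral_of_le ht]
    refine setIntegral_eq_zero_of_forall_eq_zero fun r hr => ?_
    by_contra h
    exact absurd (hs r h).2 (not_le.2 hr.1)
  have hi : Integrable a := ha.continuous.integrable_of_hasCompactSupport hc
  refine ⟨fun t => ∫ r in t..s, a r, s, max C (∫ r, a r), hs0, hsT, ?_, hd, hz, ?_, ?_,
    fun t => (hC t).trans (le_max_left _ _), hs⟩
  · rw [contDiff_infty_iff_deriv]
    refine ⟨fun t => (hd t).differentiableAt, ?_⟩
    rw [show deriv (fun t => ∫ r in t..s, a r) = fun t => -a t from funext fun t => (hd t).deriv]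
    exact ha.neg
  · intro t
    rcases le_total t s with h | h
    · exact intervalIntegral.integral_nonneg h fun r _ => h0 r
    · exact (hz t h).ge
  · intro t
    refine le_trans ?_ (le_max_right _ _)
    rcases le_total t s with h | h
    · dsimp only
      rw [intervalIntegral.integral_of_le h]
      exact setIntegral_le_integral hi (Eventually.of_forall h0)
    · dsimp only
      rw [hz t h]; exact integral_nonneg h0

/-- Integrated form of a distributional inequality on the half-line, with boundary flux `β`. -/
theorem cone_integrated {T L M M₀ C : ℝ} {G H : ℝ × ℝ → ℝ} {β : ℝ → ℝ} (hT : 0 < T)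
    (hG : Measurable G) (hGC : ∀ z, |G z| ≤ C) (hH : Measurable H) (hHC : ∀ z, |H z| ≤ C)
    (hβ : Measurable β) (hβC : ∀ t, |β t| ≤ C) (hL : 0 ≤ L)
    (hineq : InteriorIneq T G H) (hini : InitialZero G) (htr : HasTrace T H β)
    (hfar : ∀ᵐ z : ℝ × ℝ, 0 < z.1 → z.1 < T → z.2 < -M₀ → H z ≤ L * G z)
    (hM : M₀ + L * T + 1 ≤ M) (hM' : L * T + 2 ≤ M) :
    ∀ᵐ t, t ∈ Ioo 0 T →
      ∫ x in Iio 0, smoothTransition (x + M - L * t) * G (t, x) ≤ -∫ r in (0:ℝ)..t, β r := by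
  have hC0 : 0 ≤ C := (abs_nonneg _).trans (hGC 0)
  have hSm : Measurable smoothTransition := Real.smoothTransition.continuous.measurable
  have hβi : LocallyIntegrable β := by
    refine (locallyIntegrable_const C).mono hβ.aestronglyMeasurable
      (Eventually.of_forall fun t => ?_)
    simpa [abs_of_nonneg hC0] using hβC t
  have hβii : ∀ x y, IntervalIntegrable β volume x y := fun x y =>
    (hβi.integrableOn_isCompact isCompact_uIcc).intervalIntegrable
  set W : ℝ × ℝ → ℝ := (Ioo 0 T ×ˢ Iio 0).indicator
    (fun z : ℝ × ℝ => smoothTransition (z.2 + M - L * z.1) * G z) with hW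
  have hWm : Measurable W :=
    Measurable.indicator (by fun_prop) (measurableSet_Ioo.prod measurableSet_Iio)
  have hWi : Integrable W := by
    refine integrable_of_bounded_box hWm (C := C) (a := 0) (b := T) (c := -M) (d := 0) ?_ ?_
    · intro z
      by_cases hz : z ∈ Ioo 0 T ×ˢ Iio (0 : ℝ)
      · rw [hW, indicator_of_mem hz, abs_mul]
        simpa using mul_le_mul (abs_step_le (z.2 + M - L * z.1)) (hGC z) (abs_nonneg _)
          zero_le_one
      · rw [hW, indicator_of_notMem hz, abs_zero]; exact hC0
    · intro z hz
      have hz' := mem_of_indicator_ne_zero hz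
      rw [hW, indicator_of_mem hz'] at hz
      have h1 : 0 < z.2 + M - L * z.1 := by
        by_contra h'
        exact hz (by rw [Real.smoothTransition.zero_of_nonpos (not_lt.1 h'), zero_mul])
      have h2 := mul_nonneg hL hz'.1.1.le
      exact ⟨⟨hz'.1.1.le, hz'.1.2.le⟩, by linarith, (mem_Iio.1 hz'.2).le⟩
  set g : ℝ → ℝ := fun t => ∫ x, W (t, x) with hg
  have hgi : Integrable g := hWi.integral_prod_left
  set b : ℝ → ℝ := fun t => ∫ r in (0:ℝ)..t, β r with hb
  have hbc : Continuous b := intervalIntegral.continuous_primitive hβii 0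
  -- The pointwise claim is the nonnegativity of `-g - b`. Tested against `a = -A'`, it is the cone
  -- inequality with time weight `A`, by Fubini for `g` and by parts for `b`.
  have key := ae_nonneg_of_forall_test (T := T) (h := fun t => -g t - b t)
    (hgi.locallyIntegrable.neg.sub hbc.locallyIntegrable) ?_
  · filter_upwards [key] with t ht htT
    have h1 := ht htT
    have h2 : g t = ∫ x in Iio 0, smoothTransition (x + M - L * t) * G (t, x) := by
      rw [← integral_indicator measurableSet_Iio]
      simp only [hg, hW]
      congr 1
      funext x
      by_cases hx : x ∈ Iio (0 : ℝ)
      · rw [indicator_of_mem hx, indicator_of_mem (show (t, x) ∈ Ioo 0 T ×ˢ Iio 0 from ⟨htT, hx⟩)]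
      · rw [indicator_of_notMem hx, indicator_of_notMem (fun h => hx h.2)]
    rw [← h2]
    linarith
  · intro a has hac haT ha0
    obtain ⟨A, s, C', hs0, hsT, hAs, hA', hA, hA0, hAC, haC, hasupp⟩ :=
      exists_antideriv_of_test has hac haT ha0 hT
    have hm := le_max_left C C'
    have hm' := le_max_right C C'
    have h := cone_inequality (C := max C C') (M := M) hG (fun z => (hGC z).trans hm) hH
      (fun z => (hHC z).trans hm) hβ (fun z => (hβC z).trans hm) hL hineq hini htr hfar hM hM' hsT hA
      hAs hA0 hA' (fun t => (hAC t).trans hm') (fun t => (haC t).trans hm')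
      has.continuous.measurable hasupp
    have e1 : (∫ z : ℝ × ℝ, (Ioi 0 ×ˢ Iio 0).indicator
        (fun z => a z.1 * (smoothTransition (z.2 + M - L * z.1) * G z)) z) = ∫ t, a t * g t := by
      have : ∀ z : ℝ × ℝ, (Ioi 0 ×ˢ Iio 0).indicator
        (fun z => a z.1 * (smoothTransition (z.2 + M - L * z.1) * G z)) z = a z.1 * W z := by
        intro z
        by_cases haz : a z.1 = 0
        · rw [haz, zero_mul, indicator_apply_eq_zero]
          intro _; rw [haz, zero_mul]
        · have ht := haT (subset_tsupport a haz)
          by_cases hx : z.2 ∈ Iio (0 : ℝ)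
          · rw [hW, indicator_of_mem (show z ∈ Ioi 0 ×ˢ Iio 0 from ⟨ht.1, hx⟩),
              indicator_of_mem (show z ∈ Ioo 0 T ×ˢ Iio 0 from ⟨ht, hx⟩)]
          · rw [hW, indicator_of_notMem (fun h => hx h.2), indicator_of_notMem (fun h => hx h.2),
              mul_zero]
      simp_rw [this]
      rw [Measure.volume_eq_prod, integral_prod]
      · simp only [hg, integral_const_mul]
      · exact hWi.bdd_mul (has.continuous.measurable.comp measurable_fst).aestronglyMeasurable
          (Eventually.of_forall fun z => haC z.1)
    have e2 : (∫ t, (Ioi 0).indicator (fun t => β t * A t) t) = ∫ t, a t * b t := by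
      -- As `β` is merely bounded, its primitive `b` is only absolutely continuous. The boundary
      -- terms vanish because `A s = 0` and `b 0 = 0`.
      have hbac : AbsolutelyContinuousOnInterval b 0 s :=
        (hβii 0 s).absolutelyContinuousOnInterval_intervalIntegral (c := 0) (by simp)
      have hAac : AbsolutelyContinuousOnInterval A 0 s :=
        (hAs.of_le (by simp)).contDiffOn.absolutelyContinuousOnInterval
      have hp := AbsolutelyContinuousOnInterval.integral_mul_deriv_eq_deriv_mul hAac hbac
      have hb0 : b 0 = 0 := by simp [hb]
      rw [hA s le_rfl, hb0] at hp
      have q1 : (∫ x in (0:ℝ)..s, A x * deriv b x) = ∫ t, (Ioi 0).indicator (fun t => β t * A t) t := by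
        rw [integral_indicator measurableSet_Ioi]
        rw [setIntegral_eq_of_subset_of_forall_sdiff_eq_zero measurableSet_Ioi
          (show Ioc 0 s ⊆ Ioi 0 from fun x hx => hx.1)]
        · rw [intervalIntegral.integral_of_le hs0.le]
          refine setIntegral_congr_ae measurableSet_Ioc ?_
          filter_upwards [_root_.LocallyIntegrable.ae_hasDerivAt_integral hβi] with x hx _
          rw [(hx 0).deriv, mul_comm]
        · intro x hx
          rw [hA x (by by_contra h'; exact hx.2 ⟨hx.1, (not_le.1 h').le⟩), mul_zero]
      have q2 : (∫ x in (0:ℝ)..s, deriv A x * b x) = -∫ t, a t * b t := by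
        rw [intervalIntegral.integral_of_le hs0.le,
          ← setIntegral_eq_integral_of_forall_compl_eq_zero (s := Ioc 0 s)
            (f := fun t => a t * b t), ← integral_neg]
        · congr 1
          funext x
          rw [(hA' x).deriv]; ring
        · intro x hx
          by_contra h
          have hax : a x ≠ 0 := fun h' => h (by rw [h', zero_mul])
          exact hx ⟨(haT (subset_tsupport a hax)).1, (hasupp x hax).2⟩
      rw [← q1, hp, q2]; ring
    rw [e1, e2] at h
    have e3 : (∫ t, a t * (-g t - b t)) = -(∫ t, a t * g t) - ∫ t, a t * b t := by
      rw [← integral_neg, ← integral_sub]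
      · congr 1; funext t; ring
      · exact (hgi.bdd_mul has.continuous.aestronglyMeasurable
          (Eventually.of_forall fun t => haC t)).neg
      · exact (has.continuous.mul hbc).integrable_of_hasCompactSupport hac.mul_right
    rw [e3]; exact h

end

section

/-! ### Doubling of variables -/

/-- The mollifiers used in the doubling argument. -/
def mollifier (n : ℕ) : ℝ × ℝ → ℝ := (bumpSeq (ℝ × ℝ) n).normed volume

theorem mollifier_smooth (n : ℕ) : ContDiff ℝ ∞ (mollifier n) := ContDiffBump.contDiff_normed _

theorem mollifier_nonneg (n : ℕ) (z : ℝ × ℝ) : 0 ≤ mollifier n z := ContDiffBump.nonneg_normed _ _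

theorem mollifier_compact (n : ℕ) : HasCompactSupport (mollifier n) :=
  ContDiffBump.hasCompactSupport_normed _

theorem integral_mollifier_sub (n : ℕ) (z : ℝ × ℝ) : ∫ w, mollifier n (z - w) = 1 := by
  rw [integral_sub_left_eq_self (fun w => mollifier n w) volume z]
  exact ContDiffBump.integral_normed _

theorem mollifier_support {n : ℕ} {z : ℝ × ℝ} (h : mollifier n z ≠ 0) :
    ‖z‖ < (bumpSeq (ℝ × ℝ) n).rOut := by
  have : z ∈ Function.support ((bumpSeq (ℝ × ℝ) n).normed volume) := h
  rw [ContDiffBump.support_normed_eq] at this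
  simpa using this

theorem integrable_mollifier_sub (n : ℕ) (z : ℝ × ℝ) : Integrable fun w => mollifier n (z - w) :=
  ((mollifier_smooth n).continuous.integrable_of_hasCompactSupport
    (mollifier_compact n)).comp_sub_left z

/-- Almost every point is a Lebesgue point of `v`. The mollifications of `|v - c|` converge almost
everywhere simultaneously for all rational `c`, and a rational close to `v z` replaces the constant
`v z`, which varies with `z`. -/
theorem ae_tendsto_mollified_abs_sub {v : ℝ × ℝ → ℝ} (hv : Measurable v) {R : ℝ}
    (hvR : ∀ z, |v z| ≤ R) :
    ∀ᵐ z, Tendsto (fun n => ∫ w, mollifier n (z - w) * |v w - v z|) atTop (𝓝 0) := by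
  have key : ∀ c : ℚ, ∀ᵐ z, Tendsto (fun n => ∫ w, mollifier n (z - w) * |v w - c|) atTop
      (𝓝 |v z - c|) := by
    intro c
    have hl : LocallyIntegrable (fun w => |v w - c|) := by
      refine (locallyIntegrable_const (R + |(c : ℝ)|)).mono
        (by fun_prop) (Eventually.of_forall fun w => ?_)
      rw [Real.norm_eq_abs, abs_abs]
      refine ((abs_sub _ _).trans (add_le_add (hvR w) le_rfl)).trans (le_abs_self _)
    have := ContDiffBump.ae_convolution_tendsto_right_of_locallyIntegrable
      (φ := bumpSeq (ℝ × ℝ)) (K := 2) (bumpSeq_rOut_tendsto _)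
      (Eventually.of_forall fun n => bumpSeq_rOut_le _ n) hl
    filter_upwards [this] with z hz
    simp only [convolution_eq_swap] at hz
    simpa only [mollifier, ContinuousLinearMap.lsmul_apply, smul_eq_mul] using hz
  rw [← ae_all_iff] at key
  filter_upwards [key] with z hz
  rw [Metric.tendsto_atTop']
  intro ε hε
  obtain ⟨c, hc1, hc2⟩ := exists_rat_btwn (show v z < v z + ε / 3 by linarith)
  have hc : |v z - c| < ε / 3 := by rw [abs_lt]; constructor <;> linarith
  have h1 := (hz c).eventually (gt_mem_nhds hc)
  obtain ⟨N, hN⟩ := eventually_atTop.1 h1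
  refine ⟨N, fun n hn => ?_⟩
  have h0 : 0 ≤ ∫ w, mollifier n (z - w) * |v w - v z| :=
    integral_nonneg fun w => mul_nonneg (mollifier_nonneg n _) (abs_nonneg _)
  rw [Real.dist_eq, sub_zero, abs_of_nonneg h0]
  have hi := integrable_mollifier_sub n z
  have hib : ∀ c : ℝ, Integrable fun w => mollifier n (z - w) * |v w - c| := fun c => by
    refine hi.mul_bdd (c := R + |c|) (by fun_prop) (Eventually.of_forall fun w => ?_)
    rw [Real.norm_eq_abs, abs_abs]
    exact (abs_sub _ _).trans (add_le_add (hvR w) le_rfl)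
  have h2 : (∫ w, mollifier n (z - w) * |v w - v z|) ≤
      ∫ w, (mollifier n (z - w) * |v w - c| + mollifier n (z - w) * (ε / 3)) := by
    refine integral_mono (hib _) ((hib _).add (hi.mul_const _)) fun w => ?_
    dsimp only
    rw [← mul_add]
    refine mul_le_mul_of_nonneg_left ?_ (mollifier_nonneg n _)
    have := abs_sub_le (v w) c (v z)
    rw [abs_sub_comm (c : ℝ) (v z)] at this
    linarith
  rw [integral_add (hib _) (hi.mul_const _), integral_mul_const, integral_mollifier_sub] at h2
  have := hN n hn.le
  linarith

/-- This is a convolution integrand with `g` reflected; it justifies Fubini in the doubled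
variables. -/
theorem integrable_shear {p g : ℝ × ℝ → ℝ} (hp : Integrable p) (hg : Integrable g) :
    Integrable (fun y : (ℝ × ℝ) × (ℝ × ℝ) => p y.1 * g (y.1 - y.2)) (volume.prod volume) := by
  have h1 : Integrable (fun w => g (-w)) := hg.comp_neg
  have h2 := (hp.convolution_integrand (ContinuousLinearMap.lsmul ℝ ℝ) h1).swap
  refine h2.congr (Eventually.of_forall fun y => ?_)
  simp

/-- **Kato inequality**: two Kružkov solutions on the half-plane satisfy
`∂ₜ|u - v| + ∂ₓ Φ(u,v) ≤ 0` there. -/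
theorem kato {K R T : ℝ} {F : ℝ → ℝ} (hF : Lip K F) {u v : ℝ × ℝ → ℝ}
    (hu : Measurable u) (huR : ∀ z, u z ∈ Icc 0 R) (hv : Measurable v) (hvR : ∀ z, v z ∈ Icc 0 R)
    (hEu : ∀ k ∈ Icc 0 R, InteriorIneq T (fun z => |u z - k|) (fun z => kflux F (u z) k))
    (hEv : ∀ k ∈ Icc 0 R, InteriorIneq T (fun z => |v z - k|) (fun z => kflux F (v z) k)) :
    InteriorIneq T (fun z => |u z - v z|) (fun z => kflux F (u z) (v z)) := by
  intro φ hφ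
  have hd : Differentiable ℝ φ := hφ.smooth.differentiable (by simp)
  -- Room around the support of `φ`: mollifiers of radius below `δ` centred in it remain admissible
  -- tests in the second variable.
  obtain ⟨δ, hδ, hδQ⟩ := hφ.compact.isCompact.exists_thickening_subset_open
    (t := {z : ℝ × ℝ | 0 < z.1 ∧ z.1 < T ∧ z.2 < 0})
    ((isOpen_lt continuous_const continuous_fst).inter
      ((isOpen_lt continuous_fst continuous_const).inter (isOpen_lt continuous_snd continuous_const)))
    hφ.support
  have hφc := hφ.smooth.continuous
  have hφi := hφc.integrable_of_hasCompactSupport hφ.compact (μ := volume)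
  have p1 := fderiv_apply_props hφ.smooth hφ.compact (1, 0)
  have p2 := fderiv_apply_props hφ.smooth hφ.compact (0, 1)
  have i1 := p1.1.integrable_of_hasCompactSupport p1.2 (μ := volume)
  have i2 := p2.1.integrable_of_hasCompactSupport p2.2 (μ := volume)
  have hk := hF.continuous_kflux.measurable
  have habs : ∀ a ∈ Icc 0 R, ∀ b ∈ Icc 0 R, |a - b| ≤ R := by
    intro a ha b hb; rw [abs_le]; constructor <;> linarith [ha.1, ha.2, hb.1, hb.2]
  have hkf : ∀ a ∈ Icc 0 R, ∀ b ∈ Icc 0 R, |kflux F a b| ≤ K * R := fun a ha b hb =>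
    (hF.kflux_le a b).trans (mul_le_mul_of_nonneg_left (habs a ha b hb) hF.1)
  have hnonneg : ∀ᶠ n in atTop, 0 ≤ ∫ z, ∫ w,
      (|u z - v w| * fderiv ℝ φ z (1, 0) + kflux F (u z) (v w) * fderiv ℝ φ z (0, 1)) *
        mollifier n (z - w) := by
    filter_upwards [(bumpSeq_rOut_tendsto (ℝ × ℝ)).eventually (gt_mem_nhds hδ)] with n hn
    set η := mollifier n with hη
    have hηs : ContDiff ℝ ∞ η := mollifier_smooth n
    have hηd : Differentiable ℝ η := hηs.differentiable (by simp)
    have hηi : Integrable η := hηs.continuous.integrable_of_hasCompactSupport (mollifier_compact n)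
    have r1 := fderiv_apply_props hηs (mollifier_compact n) (1, 0)
    have r2 := fderiv_apply_props hηs (mollifier_compact n) (0, 1)
    have j1 := r1.1.integrable_of_hasCompactSupport r1.2 (μ := volume)
    have j2 := r2.1.integrable_of_hasCompactSupport r2.2 (μ := volume)
    -- `A₁` is the entropy integrand of `u` in the variable `z` with constant `v w`, and `A₂` that
    -- of `v` in the variable `w` with constant `u z`, both for the test function `φ z η (z - w)`.
    -- The derivatives of `η` cancel in the sum, by symmetry of the entropy and of its flux, so
    -- nothing blows up when `η` shrinks.
    set A₁ : (ℝ × ℝ) × (ℝ × ℝ) → ℝ := fun y =>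
      |u y.1 - v y.2| * (fderiv ℝ φ y.1 (1, 0) * η (y.1 - y.2) +
        φ y.1 * fderiv ℝ η (y.1 - y.2) (1, 0)) +
      kflux F (u y.1) (v y.2) * (fderiv ℝ φ y.1 (0, 1) * η (y.1 - y.2) +
        φ y.1 * fderiv ℝ η (y.1 - y.2) (0, 1)) with hA₁
    set A₂ : (ℝ × ℝ) × (ℝ × ℝ) → ℝ := fun y =>
      |v y.2 - u y.1| * (-(φ y.1 * fderiv ℝ η (y.1 - y.2) (1, 0))) +
      kflux F (v y.2) (u y.1) * (-(φ y.1 * fderiv ℝ η (y.1 - y.2) (0, 1))) with hA₂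
    have m1 : Measurable fun y : (ℝ × ℝ) × (ℝ × ℝ) => |u y.1 - v y.2| := by fun_prop
    have m1' : Measurable fun y : (ℝ × ℝ) × (ℝ × ℝ) => |v y.2 - u y.1| := by fun_prop
    have m2 : Measurable fun y : (ℝ × ℝ) × (ℝ × ℝ) => kflux F (u y.1) (v y.2) :=
      hk.comp ((hu.comp measurable_fst).prodMk (hv.comp measurable_snd))
    have m2' : Measurable fun y : (ℝ × ℝ) × (ℝ × ℝ) => kflux F (v y.2) (u y.1) :=
      hk.comp ((hv.comp measurable_snd).prodMk (hu.comp measurable_fst))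
    have iA₁ : Integrable A₁ (volume.prod volume) := by
      refine Integrable.add ?_ ?_
      · refine ((integrable_shear i1 hηi).add (integrable_shear hφi j1)).bdd_mul (c := R)
          m1.aestronglyMeasurable (Eventually.of_forall fun y => ?_)
        rw [Real.norm_eq_abs, abs_abs]; exact habs _ (huR _) _ (hvR _)
      · exact ((integrable_shear i2 hηi).add (integrable_shear hφi j2)).bdd_mul (c := K * R)
          m2.aestronglyMeasurable (Eventually.of_forall fun y => hkf _ (huR _) _ (hvR _))
    have iA₂ : Integrable A₂ (volume.prod volume) := by
      refine Integrable.add ?_ ?_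
      · refine (integrable_shear hφi j1).neg.bdd_mul (c := R)
          m1'.aestronglyMeasurable (Eventually.of_forall fun y => ?_)
        rw [Real.norm_eq_abs, abs_abs]; exact habs _ (hvR _) _ (huR _)
      · exact (integrable_shear hφi j2).neg.bdd_mul (c := K * R)
          m2'.aestronglyMeasurable (Eventually.of_forall fun y => hkf _ (hvR _) _ (huR _))
    have n1 : 0 ≤ ∫ y, A₁ y ∂(volume.prod volume) := by
      rw [integral_prod_symm _ iA₁]
      refine integral_nonneg fun w => ?_
      have htest : InteriorTest T fun z => φ z * η (z - w) := by
        refine ⟨hφ.smooth.mul (hηs.comp (contDiff_id.sub contDiff_const)),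
          hφ.compact.mul_right, fun z hz => hφ.support z (tsupport_mul_subset_left hz),
          fun z => mul_nonneg (hφ.nonneg z) (mollifier_nonneg n _)⟩
      have hdz : ∀ z e, fderiv ℝ (fun z => φ z * η (z - w)) z e =
          fderiv ℝ φ z e * η (z - w) + φ z * fderiv ℝ η (z - w) e := by
        intro z e
        have e1 : HasFDerivAt (fun z => η (z - w)) (fderiv ℝ η (z - w)) z :=
          (hηd (z - w)).hasFDerivAt.comp z ((hasFDerivAt_id z).sub_const w)
        rw [((hd z).hasFDerivAt.fun_mul e1).fderiv]
        simp; ring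
      have := hEu (v w) (hvR w) _ htest
      simp only [hdz] at this; exact this
    have n2 : 0 ≤ ∫ y, A₂ y ∂(volume.prod volume) := by
      rw [integral_prod _ iA₂]
      refine integral_nonneg fun z => ?_
      by_cases hz : z ∈ tsupport φ
      · have hsub : tsupport (fun w => φ z * η (z - w)) ⊆
            Metric.closedBall z (bumpSeq (ℝ × ℝ) n).rOut := by
          refine closure_minimal (fun w hw => ?_) Metric.isClosed_closedBall
          have h1 : η (z - w) ≠ 0 := fun h => hw (by simp [h])
          have h2 := mollifier_support h1
          rw [Metric.mem_closedBall, dist_comm, dist_eq_norm]; exact h2.le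
        have htest : InteriorTest T fun w => φ z * η (z - w) := by
          refine ⟨contDiff_const.mul (hηs.comp (contDiff_const.sub contDiff_id)),
            (isCompact_closedBall z _).of_isClosed_subset (isClosed_tsupport _) hsub,
            fun w hw => ?_, fun w => mul_nonneg (hφ.nonneg z) (mollifier_nonneg n _)⟩
          apply hδQ
          rw [Metric.mem_thickening_iff]
          exact ⟨z, hz, (Metric.mem_closedBall.1 (hsub hw)).trans_lt hn⟩
        have hdw : ∀ w e, fderiv ℝ (fun w => φ z * η (z - w)) w e =
            -(φ z * fderiv ℝ η (z - w) e) := by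
          intro w e
          have e1 : HasFDerivAt (fun w => η (z - w)) (-fderiv ℝ η (z - w)) w := by
            have := (hηd (z - w)).hasFDerivAt.comp w ((hasFDerivAt_id w).const_sub z)
            convert! this using 1
            ext <;> simp
          rw [(e1.const_mul (φ z)).fderiv]
          simp
        have := hEv (u z) (huR z) _ htest
        simp only [hdw] at this; exact this
      · have : φ z = 0 := image_eq_zero_of_notMem_tsupport hz
        simp [hA₂, this]
    have hsum : 0 ≤ ∫ y, (A₁ y + A₂ y) ∂(volume.prod volume) := by
      rw [integral_add iA₁ iA₂]; exact add_nonneg n1 n2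
    have hB := integral_prod _ (iA₁.add iA₂)
    simp only [Pi.add_apply] at hB
    rw [hB] at hsum
    convert hsum using 5 with z w
    simp only [hA₁, hA₂]
    rw [abs_sub_comm (v w), kflux_comm F (v w)]
    ring
  have hlim : Tendsto (fun n => ∫ z, ∫ w,
      (|u z - v w| * fderiv ℝ φ z (1, 0) + kflux F (u z) (v w) * fderiv ℝ φ z (0, 1)) *
        mollifier n (z - w)) atTop
      (𝓝 (∫ z, (|u z - v z| * fderiv ℝ φ z (1, 0) +
        kflux F (u z) (v z) * fderiv ℝ φ z (0, 1)))) := by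
    set Θ : ℝ × ℝ → ℝ × ℝ → ℝ := fun z w =>
      |u z - v w| * fderiv ℝ φ z (1, 0) + kflux F (u z) (v w) * fderiv ℝ φ z (0, 1) with hΘ
    set B : ℝ × ℝ → ℝ := fun z =>
      R * |fderiv ℝ φ z (1, 0)| + K * R * |fderiv ℝ φ z (0, 1)| with hBd
    have hΘB : ∀ z w, |Θ z w| ≤ B z := by
      intro z w
      refine (abs_add_le _ _).trans (add_le_add ?_ ?_)
      · rw [abs_mul, abs_abs]
        exact mul_le_mul_of_nonneg_right (habs _ (huR _) _ (hvR _)) (abs_nonneg _)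
      · rw [abs_mul]
        exact mul_le_mul_of_nonneg_right (hkf _ (huR _) _ (hvR _)) (abs_nonneg _)
    have hΘm : ∀ z, Measurable (Θ z) := fun z => by
      have : Measurable fun w => kflux F (u z) (v w) := hk.comp (measurable_const.prodMk hv)
      simp only [hΘ]; fun_prop
    have hΘi : ∀ n z, Integrable fun w => Θ z w * mollifier n (z - w) := fun n z =>
      (integrable_mollifier_sub n z).bdd_mul (c := B z) (hΘm z).aestronglyMeasurable
        (Eventually.of_forall fun w => hΘB z w)
    have hΘm2 : Measurable fun y : (ℝ × ℝ) × (ℝ × ℝ) => Θ y.1 y.2 := by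
      have m2 : Measurable fun y : (ℝ × ℝ) × (ℝ × ℝ) => kflux F (u y.1) (v y.2) :=
        hk.comp ((hu.comp measurable_fst).prodMk (hv.comp measurable_snd))
      have q1 : Measurable fun y : (ℝ × ℝ) × (ℝ × ℝ) => fderiv ℝ φ y.1 (1, 0) :=
        p1.1.measurable.comp measurable_fst
      have q2 : Measurable fun y : (ℝ × ℝ) × (ℝ × ℝ) => fderiv ℝ φ y.1 (0, 1) :=
        p2.1.measurable.comp measurable_fst
      simp only [hΘ]
      exact (Measurable.mul (by fun_prop) q1).add (m2.mul q2)
    refine tendsto_integral_of_dominated_convergence B ?_ ?_ ?_ ?_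
    · intro n
      have : Measurable fun y : (ℝ × ℝ) × (ℝ × ℝ) => Θ y.1 y.2 * mollifier n (y.1 - y.2) := by
        have := (mollifier_smooth n).continuous.measurable
        exact hΘm2.mul (this.comp (measurable_fst.sub measurable_snd))
      exact this.stronglyMeasurable.integral_prod_right'.aestronglyMeasurable
    · exact (i1.abs.const_mul R).add (i2.abs.const_mul (K * R))
    · intro n
      refine Eventually.of_forall fun z => ?_
      refine (norm_integral_le_of_norm_le ((integrable_mollifier_sub n z).const_mul (B z))
        (Eventually.of_forall fun w => ?_)).trans ?_
      · rw [norm_mul, Real.norm_eq_abs, Real.norm_eq_abs, abs_of_nonneg (mollifier_nonneg n _)]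
        exact mul_le_mul_of_nonneg_right (hΘB z w) (mollifier_nonneg n _)
      · rw [integral_const_mul, integral_mollifier_sub, mul_one]
    -- The integrand depends on `v w` in a Lipschitz way, so its mollification converges at every
    -- Lebesgue point of `v`.
    · filter_upwards [ae_tendsto_mollified_abs_sub hv (R := R)
        (fun z => by rw [abs_of_nonneg (hvR z).1]; exact (hvR z).2)] with z hz
      set c := |fderiv ℝ φ z (1, 0)| + 2 * K * |fderiv ℝ φ z (0, 1)| with hc
      have hz' := hz.const_mul c
      rw [mul_zero] at hz'
      rw [tendsto_iff_norm_sub_tendsto_zero]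
      refine squeeze_zero (fun _ => norm_nonneg _) (fun n => ?_) hz'
      have e1 : Θ z z = ∫ w, Θ z z * mollifier n (z - w) := by
        rw [integral_const_mul, integral_mollifier_sub, mul_one]
      rw [show |u z - v z| * fderiv ℝ φ z (1, 0) + kflux F (u z) (v z) * fderiv ℝ φ z (0, 1)
        = Θ z z from rfl, e1, ← integral_sub (hΘi n z) ((integrable_mollifier_sub n z).const_mul _),
        ← integral_const_mul]
      refine norm_integral_le_of_norm_le ?_ (Eventually.of_forall fun w => ?_)
      · refine Integrable.const_mul ?_ c
        refine (integrable_mollifier_sub n z).mul_bdd (c := R) (by fun_prop)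
          (Eventually.of_forall fun w => ?_)
        rw [Real.norm_eq_abs, abs_abs]; exact habs _ (hvR _) _ (hvR _)
      · rw [← sub_mul, norm_mul, Real.norm_eq_abs, Real.norm_eq_abs,
          abs_of_nonneg (mollifier_nonneg n _), mul_comm (mollifier n _), ← mul_assoc]
        refine mul_le_mul_of_nonneg_right ?_ (mollifier_nonneg n _)
        have h1 : |(|u z - v w| - |u z - v z|)| ≤ |v w - v z| := by
          refine (abs_abs_sub_abs_le _ _).trans (le_of_eq ?_)
          rw [abs_sub_comm (v w)]; congr 1; ring
        have h2 := hF.kflux_sub_le (u z) (v w) (u z) (v z)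
        rw [sub_self, abs_zero, zero_add] at h2
        calc |Θ z w - Θ z z| = |(|u z - v w| - |u z - v z|) * fderiv ℝ φ z (1, 0) +
              (kflux F (u z) (v w) - kflux F (u z) (v z)) * fderiv ℝ φ z (0, 1)| := by
                simp only [hΘ]; congr 1; ring
          _ ≤ |v w - v z| * |fderiv ℝ φ z (1, 0)| +
              2 * K * |v w - v z| * |fderiv ℝ φ z (0, 1)| := by
                refine (abs_add_le _ _).trans (add_le_add ?_ ?_)
                · rw [abs_mul]; exact mul_le_mul_of_nonneg_right h1 (abs_nonneg _)
                · rw [abs_mul]; exact mul_le_mul_of_nonneg_right h2 (abs_nonneg _)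
          _ = c * |v w - v z| := by rw [hc]; ring
  exact ge_of_tendsto hlim hnonneg

end

section

/-! ### Algebra of distributional inequalities, traces and initial conditions -/

theorem InteriorTest.integrable_mul {T : ℝ} {φ : ℝ × ℝ → ℝ} (hφ : InteriorTest T φ)
    {G : ℝ × ℝ → ℝ} (hG : Measurable G) {C : ℝ} (hGC : ∀ z, |G z| ≤ C) (e : ℝ × ℝ) :
    Integrable fun z => G z * fderiv ℝ φ z e := by
  have p := fderiv_apply_props hφ.smooth hφ.compact e
  exact (p.1.integrable_of_hasCompactSupport p.2).bdd_mul hG.aestronglyMeasurable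
    (Eventually.of_forall hGC)

theorem InteriorTest.integrable {T : ℝ} {φ : ℝ × ℝ → ℝ} (hφ : InteriorTest T φ)
    {G H : ℝ × ℝ → ℝ} (hG : Measurable G) (hH : Measurable H) {C : ℝ} (hGC : ∀ z, |G z| ≤ C)
    (hHC : ∀ z, |H z| ≤ C) :
    Integrable fun z => G z * fderiv ℝ φ z (1, 0) + H z * fderiv ℝ φ z (0, 1) :=
  (hφ.integrable_mul hG hGC _).add (hφ.integrable_mul hH hHC _)

theorem InteriorIneq.add {T : ℝ} {G₁ H₁ G₂ H₂ : ℝ × ℝ → ℝ} {C : ℝ}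
    (h₁ : InteriorIneq T G₁ H₁) (h₂ : InteriorIneq T G₂ H₂)
    (mG₁ : Measurable G₁) (mH₁ : Measurable H₁) (mG₂ : Measurable G₂) (mH₂ : Measurable H₂)
    (bG₁ : ∀ z, |G₁ z| ≤ C) (bH₁ : ∀ z, |H₁ z| ≤ C) (bG₂ : ∀ z, |G₂ z| ≤ C)
    (bH₂ : ∀ z, |H₂ z| ≤ C) :
    InteriorIneq T (fun z => G₁ z + G₂ z) (fun z => H₁ z + H₂ z) := by
  intro φ hφ
  have h := add_nonneg (h₁ φ hφ) (h₂ φ hφ)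
  rw [← integral_add (hφ.integrable mG₁ mH₁ bG₁ bH₁) (hφ.integrable mG₂ mH₂ bG₂ bH₂)] at h
  refine h.trans_eq (integral_congr_ae (Eventually.of_forall fun z => ?_))
  ring

theorem InteriorIneq.add_const {T : ℝ} {G H : ℝ × ℝ → ℝ} {C : ℝ} (h : InteriorIneq T G H)
    (mG : Measurable G) (mH : Measurable H) (bG : ∀ z, |G z| ≤ C) (bH : ∀ z, |H z| ≤ C)
    (c d : ℝ) : InteriorIneq T (fun z => G z + c) (fun z => H z + d) := by
  refine h.add (C := max C (max |c| |d|)) ?_ mG mH measurable_const measurable_const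
    (fun z => (bG z).trans (le_max_left _ _)) (fun z => (bH z).trans (le_max_left _ _))
    (fun z => (le_max_left _ _).trans (le_max_right _ _))
    (fun z => (le_max_right _ _).trans (le_max_right _ _))
  intro φ hφ
  rw [integral_add (hφ.integrable_mul measurable_const (fun _ => le_rfl) _)
    (hφ.integrable_mul measurable_const (fun _ => le_rfl) _), integral_const_mul,
    integral_const_mul, integral_fderiv_eq_zero hφ.smooth hφ.compact,
    integral_fderiv_eq_zero hφ.smooth hφ.compact]
  simp

theorem InitialZero.of_le {G g₁ g₂ : ℝ × ℝ → ℝ} {C : ℝ} (h₁ : InitialZero g₁) (h₂ : InitialZero g₂)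
    (m₁ : Measurable g₁) (m₂ : Measurable g₂)
    (b₁ : ∀ z, |g₁ z| ≤ C) (b₂ : ∀ z, |g₂ z| ≤ C) (hle : ∀ z, |G z| ≤ |g₁ z| + |g₂ z|) :
    InitialZero G := by
  intro M
  have h := (h₁ M).add (h₂ M)
  rw [add_zero] at h
  refine squeeze_zero' ?_ ?_ h
  · filter_upwards [self_mem_nhdsWithin] with ε hε
    exact mul_nonneg (inv_nonneg.2 (le_of_lt hε)) (integral_nonneg fun z => abs_nonneg _)
  · filter_upwards [self_mem_nhdsWithin] with ε hε
    rw [← mul_add]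
    refine mul_le_mul_of_nonneg_left ?_ (inv_nonneg.2 (le_of_lt hε))
    have i₁ : IntegrableOn g₁ (Ioo 0 ε ×ˢ Ioo (-M) 0) :=
      integrableOn_of_bounded' m₁ b₁ (volume_Ioo_prod_Ioo_ne_top _ _ _ _)
    have i₂ : IntegrableOn g₂ (Ioo 0 ε ×ˢ Ioo (-M) 0) :=
      integrableOn_of_bounded' m₂ b₂ (volume_Ioo_prod_Ioo_ne_top _ _ _ _)
    rw [← integral_add i₁.abs i₂.abs]
    exact integral_mono_of_nonneg (Eventually.of_forall fun z => abs_nonneg _) (i₁.abs.add i₂.abs)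
      (Eventually.of_forall hle)

/-- Traces pass to Lipschitz functions of one or two functions that have traces; the entropy fluxes
below are of this kind. -/
theorem HasTrace.of_le {T : ℝ} {H u v : ℝ × ℝ → ℝ} {β γ δ : ℝ → ℝ} {c C : ℝ}
    (h₁ : HasTrace T u γ) (h₂ : HasTrace T v δ)
    (mu : Measurable u) (mγ : Measurable γ) (mv : Measurable v) (mδ : Measurable δ)
    (bu : ∀ z, |u z| ≤ C) (bγ : ∀ t, |γ t| ≤ C) (bv : ∀ z, |v z| ≤ C) (bδ : ∀ t, |δ t| ≤ C)
    (hle : ∀ z, |H z - β z.1| ≤ c * (|u z - γ z.1| + |v z - δ z.1|)) :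
    HasTrace T H β := by
  intro s hs
  have h := ((h₁ s hs).add (h₂ s hs)).const_mul c
  rw [add_zero, mul_zero] at h
  refine squeeze_zero' ?_ ?_ h
  · filter_upwards [self_mem_nhdsWithin] with ε hε
    exact mul_nonneg (inv_nonneg.2 (le_of_lt hε)) (integral_nonneg fun z => abs_nonneg _)
  · filter_upwards [self_mem_nhdsWithin] with ε hε
    rw [← mul_add, mul_left_comm]
    refine mul_le_mul_of_nonneg_left ?_ (inv_nonneg.2 (le_of_lt hε))
    have i₁ : IntegrableOn (fun z => u z - γ z.1) (Ioo 0 s ×ˢ Ioo (-ε) 0) :=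
      integrableOn_of_bounded' (C := C + C) (by fun_prop)
        (fun z => (abs_sub _ _).trans (add_le_add (bu z) (bγ _)))
        (volume_Ioo_prod_Ioo_ne_top _ _ _ _)
    have i₂ : IntegrableOn (fun z => v z - δ z.1) (Ioo 0 s ×ˢ Ioo (-ε) 0) :=
      integrableOn_of_bounded' (C := C + C) (by fun_prop)
        (fun z => (abs_sub _ _).trans (add_le_add (bv z) (bδ _)))
        (volume_Ioo_prod_Ioo_ne_top _ _ _ _)
    rw [← integral_add i₁.abs i₂.abs, ← integral_const_mul]
    exact integral_mono_of_nonneg (Eventually.of_forall fun z => abs_nonneg _)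
      ((i₁.abs.add i₂.abs).const_mul c) (Eventually.of_forall hle)

/-! ### Solutions on the left half-line -/

/-- `u` is a Kružkov solution on `]0,T[ × ]-∞,0[` with flux `F`, values in `[0,R]`, constant initial
datum `a` and strong trace `γ` at `x = 0-`. -/
structure HalfSol (F : ℝ → ℝ) (R T a : ℝ) (u : ℝ × ℝ → ℝ) (γ : ℝ → ℝ) : Prop where
  measurable : Measurable u
  mem : ∀ z, u z ∈ Icc 0 R
  trace_measurable : Measurable γ
  trace_mem : ∀ t, γ t ∈ Icc 0 R
  datum_mem : a ∈ Icc 0 R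
  entropy : ∀ k ∈ Icc 0 R, ∀ φ : ℝ × ℝ → ℝ, ContDiff ℝ ∞ φ → HasCompactSupport φ →
    (∀ z ∈ tsupport φ, z.1 < T) → (∀ z, 0 ≤ φ z) → (∀ z, 0 ≤ z.2 → φ z = 0) →
    0 ≤ (∫ z in Ioi 0 ×ˢ univ, (|u z - k| * fderiv ℝ φ z (1, 0) +
      kflux F (u z) k * fderiv ℝ φ z (0, 1))) + ∫ x, |a - k| * φ (0, x)
  trace : HasTrace T u γ

variable {F : ℝ → ℝ} {K R T a : ℝ} {u v : ℝ × ℝ → ℝ} {γ δ : ℝ → ℝ}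

theorem abs_sub_le_of_mem {x y : ℝ} (hx : x ∈ Icc 0 R) (hy : y ∈ Icc 0 R) : |x - y| ≤ R := by
  rw [abs_le]; constructor <;> linarith [hx.1, hx.2, hy.1, hy.2]

theorem abs_le_of_mem {x : ℝ} (hx : x ∈ Icc 0 R) : |x| ≤ R := by
  rw [abs_of_nonneg hx.1]; exact hx.2

theorem HalfSol.nonneg (h : HalfSol F R T a u γ) : 0 ≤ R := h.datum_mem.1.trans h.datum_mem.2

theorem HalfSol.interior (h : HalfSol F R T a u γ) {k : ℝ} (hk : k ∈ Icc 0 R) :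
    InteriorIneq T (fun z => |u z - k|) (fun z => kflux F (u z) k) := by
  intro φ hφ
  have hz0 : ∀ z : ℝ × ℝ, z.1 ≤ 0 ∨ 0 ≤ z.2 → z ∉ tsupport φ := by
    intro z hz hz'
    obtain ⟨h1, h2, h3⟩ := hφ.support z hz'
    rcases hz with hz | hz <;> linarith
  have := h.entropy k hk φ hφ.smooth hφ.compact (fun z hz => (hφ.support z hz).2.1) hφ.nonneg
    (fun z hz => image_eq_zero_of_notMem_tsupport (hz0 z (Or.inr hz)))
  have e1 : (∫ x, |a - k| * φ (0, x)) = 0 := by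
    have : ∀ x, |a - k| * φ (0, x) = 0 := fun x => by
      rw [image_eq_zero_of_notMem_tsupport (hz0 (0, x) (Or.inl le_rfl)), mul_zero]
    simp [this]
  rw [e1, add_zero, setIntegral_eq_integral_of_forall_compl_eq_zero] at this
  · exact this
  · intro z hz
    have : z.1 ≤ 0 := by
      by_contra h'
      exact hz ⟨not_le.1 h', mem_univ _⟩
    rw [fderiv_of_notMem_tsupport (𝕜 := ℝ) (hz0 z (Or.inl this))]
    simp

theorem HalfSol.measurable_kflux (hF : Lip K F) (h : HalfSol F R T a u γ) (k : ℝ) :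
    Measurable fun z => kflux F (u z) k :=
  hF.continuous_kflux.measurable.comp (h.measurable.prodMk measurable_const)

/-- The weak form of the equation, as a pair of inequalities (`e = 1` and `e = -1`). -/
theorem HalfSol.conservation (hF : Lip K F) (h : HalfSol F R T a u γ) {e : ℝ}
    (he : e = 1 ∨ e = -1) (c : ℝ) :
    InteriorIneq T (fun z => e * (u z - c)) (fun z => e * (F (u z) - F c)) := by
  have hR := h.nonneg
  have hm := h.measurable
  have hFm := hF.continuous.measurable
  have hb : ∀ k ∈ Icc 0 R, ∀ z, |kflux F (u z) k| ≤ K * R := fun k hk z =>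
    (hF.kflux_le _ _).trans (mul_le_mul_of_nonneg_left (abs_sub_le_of_mem (h.mem z) hk) hF.1)
  rcases he with rfl | rfl
  -- The constants `0` and `R` lie below and above all values of `u`; for them the absolute value
  -- disappears and the entropy inequality becomes one half of the weak equation.
  · have h0 : (0 : ℝ) ∈ Icc 0 R := ⟨le_rfl, hR⟩
    have := (h.interior h0).add_const (C := max R (K * R)) (by fun_prop) (h.measurable_kflux hF 0)
      (fun z => by rw [abs_abs]; exact (abs_sub_le_of_mem (h.mem z) h0).trans (le_max_left _ _))
      (fun z => (hb 0 h0 z).trans (le_max_right _ _)) (-c) (F 0 - F c)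
    convert this using 2 with z z
    · rw [sub_zero, abs_of_nonneg (h.mem z).1]; ring
    · rw [kflux_of_ge F (h.mem z).1]; ring
  · have h0 : R ∈ Icc 0 R := ⟨hR, le_rfl⟩
    have := (h.interior h0).add_const (C := max R (K * R)) (by fun_prop) (h.measurable_kflux hF R)
      (fun z => by rw [abs_abs]; exact (abs_sub_le_of_mem (h.mem z) h0).trans (le_max_left _ _))
      (fun z => (hb R h0 z).trans (le_max_right _ _)) (c - R) (F c - F R)
    convert this using 2 with z z
    · rw [abs_of_nonpos (by linarith [(h.mem z).2])]; ring
    · rw [kflux_of_le F (h.mem z).2]; ring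

/-- The time profile used near the initial time. -/
def initialProfile (s : ℝ) : ℝ :=
  (2 - s) * (1 - smoothTransition (s - 1)) * smoothTransition (s + 2)

theorem initialProfile_smooth : ContDiff ℝ ∞ initialProfile := by
  have hS : ContDiff ℝ ∞ smoothTransition := Real.smoothTransition.contDiff
  exact ((contDiff_const.sub contDiff_id).mul (contDiff_const.sub
    (hS.comp (contDiff_id.sub contDiff_const)))).mul (hS.comp (contDiff_id.add contDiff_const))

theorem initialProfile_of_two_le {s : ℝ} (h : 2 ≤ s) : initialProfile s = 0 := by
  unfold initialProfile
  rw [Real.smoothTransition.one_of_one_le (show (1 : ℝ) ≤ s - 1 by linarith)]; ring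

theorem initialProfile_of_le {s : ℝ} (h : s ≤ -2) : initialProfile s = 0 := by
  unfold initialProfile
  rw [Real.smoothTransition.zero_of_nonpos (show s + 2 ≤ 0 by linarith)]; ring

theorem initialProfile_nonneg (s : ℝ) : 0 ≤ initialProfile s := by
  rcases le_total 2 s with h | h
  · exact (initialProfile_of_two_le h).ge
  · exact mul_nonneg (mul_nonneg (by linarith)
      (by linarith [Real.smoothTransition.le_one (s - 1)])) (Real.smoothTransition.nonneg _)

theorem initialProfile_le {s : ℝ} (h : 0 ≤ s) : initialProfile s ≤ 2 := by
  rcases le_total 2 s with h2 | h2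
  · rw [initialProfile_of_two_le h2]; norm_num
  · unfold initialProfile
    have h1 := Real.smoothTransition.nonneg (s - 1)
    have h3 := Real.smoothTransition.le_one (s - 1)
    rw [Real.smoothTransition.one_of_one_le (show (1 : ℝ) ≤ s + 2 by linarith), mul_one]
    nlinarith

theorem hasDerivAt_initialProfile {s : ℝ} (h : 0 < s) :
    HasDerivAt initialProfile
      (-(1 - smoothTransition (s - 1)) - (2 - s) * deriv smoothTransition (s - 1)) s := by
  have e1 : HasDerivAt (fun s : ℝ => s - 1) 1 s := (hasDerivAt_id s).sub_const 1
  have e2 : HasDerivAt (fun s : ℝ => s + 2) 1 s := (hasDerivAt_id s).add_const 2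
  have e3 := ((((hasDerivAt_id s).const_sub 2).mul
    (((hasDerivAt_step _).comp s e1).const_sub 1))).mul ((hasDerivAt_step _).comp s e2)
  convert! e3 using 1
  simp only [Function.comp_apply, id_eq]
  rw [Real.smoothTransition.one_of_one_le (show (1 : ℝ) ≤ s + 2 by linarith),
    deriv_step_of_one_le (show (1 : ℝ) ≤ s + 2 by linarith)]
  ring

theorem deriv_initialProfile_nonpos {s : ℝ} (h : 0 < s) : deriv initialProfile s ≤ 0 := by
  rw [(hasDerivAt_initialProfile h).deriv]
  have h1 := Real.smoothTransition.le_one (s - 1)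
  have h2 : 0 ≤ (2 - s) * deriv smoothTransition (s - 1) := by
    rcases le_total 2 s with h2 | h2
    · rw [deriv_step_of_one_le (by linarith), mul_zero]
    · exact mul_nonneg (by linarith) (deriv_step_nonneg _)
  linarith

theorem deriv_initialProfile_of_lt_one {s : ℝ} (h : 0 < s) (h1 : s < 1) :
    deriv initialProfile s = -1 := by
  rw [(hasDerivAt_initialProfile h).deriv, deriv_step_of_nonpos (by linarith),
    Real.smoothTransition.zero_of_nonpos (by linarith)]
  ring

/-- A smooth cut-off equal to `1` on `[-M,-d]`, supported in `[-M-1,0]`. -/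
def spaceCutoff (M d x : ℝ) : ℝ := smoothTransition (-x / d) * smoothTransition (x + M + 1)

theorem spaceCutoff_smooth (M d : ℝ) : ContDiff ℝ ∞ (spaceCutoff M d) := by
  have hS : ContDiff ℝ ∞ smoothTransition := Real.smoothTransition.contDiff
  exact (hS.comp (contDiff_id.neg.div_const _)).mul
    (hS.comp ((contDiff_id.add contDiff_const).add contDiff_const))

theorem spaceCutoff_nonneg (M d x : ℝ) : 0 ≤ spaceCutoff M d x :=
  mul_nonneg (Real.smoothTransition.nonneg _) (Real.smoothTransition.nonneg _)

theorem spaceCutoff_support {M d x : ℝ} (hd : 0 < d) (h : spaceCutoff M d x ≠ 0) :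
    x ∈ Icc (-M - 1) 0 := by
  simp only [spaceCutoff, ne_eq, mul_eq_zero, not_or, Real.smoothTransition.zero_iff_nonpos,
    not_le] at h
  have := (div_pos_iff_of_pos_right hd).1 h.1
  exact ⟨by linarith [h.2], by linarith⟩

theorem spaceCutoff_of_nonneg {M d x : ℝ} (hd : 0 < d) (h : 0 ≤ x) : spaceCutoff M d x = 0 := by
  unfold spaceCutoff
  rw [Real.smoothTransition.zero_of_nonpos, zero_mul]
  exact div_nonpos_of_nonpos_of_nonneg (by linarith) hd.le

theorem spaceCutoff_eq_one {M d x : ℝ} (hd : 0 < d) (h : -M ≤ x) (h' : x ≤ -d) :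
    spaceCutoff M d x = 1 := by
  unfold spaceCutoff
  rw [Real.smoothTransition.one_of_one_le, Real.smoothTransition.one_of_one_le, one_mul]
  · linarith
  · rw [le_div_iff₀ hd]; linarith

theorem spaceCutoff_compact {M d : ℝ} (hd : 0 < d) : HasCompactSupport (spaceCutoff M d) :=
  HasCompactSupport.intro isCompact_Icc fun x hx => by
    by_contra h; exact hx (spaceCutoff_support (M := M) hd h)

end

/-! ### Attainment of the initial datum. -/

section

variable {F : ℝ → ℝ} {K R T a : ℝ} {u v : ℝ × ℝ → ℝ} {γ δ : ℝ → ℝ}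

theorem volume_prod_lt_top {s t : Set ℝ} (hs : volume s < ⊤) (ht : volume t < ⊤) :
    (volume : Measure (ℝ × ℝ)) (s ×ˢ t) < ⊤ := by
  rw [Measure.volume_eq_prod, Measure.prod_prod]
  exact ENNReal.mul_lt_top hs ht

theorem fderiv_mul_fst {p r : ℝ → ℝ} {p' : ℝ} {z : ℝ × ℝ} (hp : HasDerivAt p p' z.1)
    (hd : Differentiable ℝ fun z : ℝ × ℝ => p z.1 * r z.2) :
    fderiv ℝ (fun z : ℝ × ℝ => p z.1 * r z.2) z (1, 0) = p' * r z.2 :=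
  (fderiv_fst_eq_deriv hd z).unique (hp.mul_const (r z.2))

theorem fderiv_mul_snd {p r : ℝ → ℝ} {r' : ℝ} {z : ℝ × ℝ} (hr : HasDerivAt r r' z.2)
    (hd : Differentiable ℝ fun z : ℝ × ℝ => p z.1 * r z.2) :
    fderiv ℝ (fun z : ℝ × ℝ => p z.1 * r z.2) z (0, 1) = p z.1 * r' :=
  (fderiv_snd_eq_deriv hd z).unique (hr.const_mul (p z.1))

/-- With Kružkov constant `a` the initial term vanishes. The time profile has slope `-1/ε` on
`]0,ε[` and never increases for positive times, so its derivative bounds the mean over the layer,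
while the flux term is at most a constant times the area of a box of height `2ε`. The constant
depends on `d` through the space cut-off. -/
theorem HalfSol.initial_layer (hF : Lip K F) (h : HalfSol F R T a u γ) {M d : ℝ} (hd : 0 < d)
    (hM : 0 ≤ M) :
    ∃ C, ∀ ε, 0 < ε → 2 * ε < T →
      ε⁻¹ * ∫ z in Ioo 0 ε ×ˢ Ioo (-M) (-d), |u z - a| ≤ C * ε := by
  have hR := h.nonneg
  obtain ⟨c, hc0, hc⟩ := Continuous.exists_abs_le_of_compact
    ((spaceCutoff_smooth M d).continuous_deriv (by simp)) (spaceCutoff_compact (M := M) hd).deriv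
  refine ⟨K * R * (2 * c) * (2 * (M + 1)), fun ε hε hεT => ?_⟩
  set ψ := spaceCutoff M d with hψ
  have hψd : ∀ x, HasDerivAt ψ (deriv ψ x) x := fun x =>
    ((spaceCutoff_smooth M d).differentiable (by simp) x).hasDerivAt
  set p : ℝ → ℝ := fun t => initialProfile (t / ε) with hp
  have hps : ContDiff ℝ ∞ p := initialProfile_smooth.comp (contDiff_id.div_const _)
  have hpd : ∀ t, HasDerivAt p (deriv initialProfile (t / ε) * ε⁻¹) t := fun t => by
    have e1 : HasDerivAt (fun t : ℝ => t / ε) ε⁻¹ t := by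
      simpa using (hasDerivAt_id t).div_const ε
    exact (initialProfile_smooth.differentiable (by simp) (t / ε)).hasDerivAt.comp t e1
  set φ : ℝ × ℝ → ℝ := fun z => p z.1 * ψ z.2 with hφ
  have hφs : ContDiff ℝ ∞ φ :=
    (hps.comp contDiff_fst).mul ((spaceCutoff_smooth M d).comp contDiff_snd)
  have hφdiff : Differentiable ℝ φ := hφs.differentiable (by simp)
  have hsupp : tsupport φ ⊆ Icc (-(2 * ε)) (2 * ε) ×ˢ Icc (-M - 1) 0 := by
    refine closure_minimal (fun z hz => ?_) (isClosed_Icc.prod isClosed_Icc)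
    have hz' : p z.1 ≠ 0 ∧ ψ z.2 ≠ 0 := by simpa [hφ, not_or] using hz
    refine ⟨⟨?_, ?_⟩, spaceCutoff_support hd hz'.2⟩
    · by_contra h'
      refine hz'.1 (initialProfile_of_le ?_)
      rw [div_le_iff₀ hε]; linarith
    · by_contra h'
      refine hz'.1 (initialProfile_of_two_le ?_)
      rw [le_div_iff₀ hε]; linarith
  have hφc : HasCompactSupport φ :=
    (isCompact_Icc.prod isCompact_Icc).of_isClosed_subset (isClosed_tsupport _) hsupp
  have hE := h.entropy a h.datum_mem φ hφs hφc
    (fun z hz => (hsupp hz).1.2.trans_lt hεT)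
    (fun z => mul_nonneg (initialProfile_nonneg _) (spaceCutoff_nonneg _ _ _))
    (fun z hz => by simp only [hφ, hψ]; rw [spaceCutoff_of_nonneg hd hz, mul_zero])
  simp only [sub_self, abs_zero, zero_mul, integral_zero, add_zero] at hE
  simp only [hφ, fderiv_mul_fst (hpd _) hφdiff, fderiv_mul_snd (hψd _) hφdiff] at hE
  set f₁ : ℝ × ℝ → ℝ := fun z => |u z - a| * (deriv initialProfile (z.1 / ε) * ε⁻¹ * ψ z.2) with hf₁
  set f₂ : ℝ × ℝ → ℝ := fun z => kflux F (u z) a * (p z.1 * deriv ψ z.2) with hf₂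
  have mP : MeasurableSet (Ioi (0 : ℝ) ×ˢ (univ : Set ℝ)) := measurableSet_Ioi.prod MeasurableSet.univ
  have q1 := fderiv_apply_props hφs hφc (1, 0)
  have q2 := fderiv_apply_props hφs hφc (0, 1)
  have hm := h.measurable
  have i₁ : Integrable f₁ := by
    have := (q1.1.integrable_of_hasCompactSupport q1.2 (μ := volume)).bdd_mul
      (f := fun z => |u z - a|) (c := R)
      (Measurable.aestronglyMeasurable (by fun_prop)) (Eventually.of_forall fun z => by
        rw [Real.norm_eq_abs, abs_abs]; exact abs_sub_le_of_mem (h.mem z) h.datum_mem)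
    simpa only [hφ, fderiv_mul_fst (hpd _) hφdiff] using this
  have hkb : ∀ z, |kflux F (u z) a| ≤ K * R := fun z => (hF.kflux_le _ _).trans
    (mul_le_mul_of_nonneg_left (abs_sub_le_of_mem (h.mem z) h.datum_mem) hF.1)
  have i₂ : Integrable f₂ := by
    have := (q2.1.integrable_of_hasCompactSupport q2.2 (μ := volume)).bdd_mul
      (h.measurable_kflux hF a).aestronglyMeasurable (Eventually.of_forall hkb)
    simpa only [hφ, fderiv_mul_snd (hψd _) hφdiff] using this
  have hE' : 0 ≤ (∫ z in Ioi 0 ×ˢ univ, f₁ z) + ∫ z in Ioi 0 ×ˢ univ, f₂ z := by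
    rw [← integral_add i₁.integrableOn i₂.integrableOn]; exact hE
  have b₁ : ε⁻¹ * ∫ z in Ioo 0 ε ×ˢ Ioo (-M) (-d), |u z - a| ≤ ∫ z in Ioi 0 ×ˢ univ, -f₁ z := by
    rw [← integral_const_mul]
    have hsub : Ioo 0 ε ×ˢ Ioo (-M) (-d) ⊆ Ioi (0 : ℝ) ×ˢ (univ : Set ℝ) :=
      fun z hz => ⟨hz.1.1, mem_univ _⟩
    calc ∫ z in Ioo 0 ε ×ˢ Ioo (-M) (-d), ε⁻¹ * |u z - a|
        = ∫ z in Ioo 0 ε ×ˢ Ioo (-M) (-d), -f₁ z := by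
          refine setIntegral_congr_fun (measurableSet_Ioo.prod measurableSet_Ioo) fun z hz => ?_
          simp only [hf₁, hψ]
          rw [spaceCutoff_eq_one hd hz.2.1.le hz.2.2.le,
            deriv_initialProfile_of_lt_one (div_pos hz.1.1 hε)
              (by rw [div_lt_one hε]; exact hz.1.2)]
          ring
      _ ≤ _ := by
          refine setIntegral_mono_set i₁.neg.integrableOn ?_ (LE.le.eventuallyLE hsub)
          refine (ae_restrict_iff' mP).2 (Eventually.of_forall fun z hz => ?_)
          have hz1 : 0 < z.1 := hz.1
          simp only [Pi.zero_apply, hf₁]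
          have n1 := deriv_initialProfile_nonpos (div_pos hz1 hε)
          have n2 := mul_nonneg (abs_nonneg (u z - a)) (mul_nonneg (mul_nonneg (neg_nonneg.2 n1)
            (inv_nonneg.2 hε.le)) (spaceCutoff_nonneg M d z.2))
          linarith
  have b₂ : ∫ z in Ioi 0 ×ˢ univ, f₂ z ≤ K * R * (2 * c) * (2 * (M + 1)) * ε := by
    have e1 : ∫ z in Ioi 0 ×ˢ univ, f₂ z = ∫ z in Ioc 0 (2 * ε) ×ˢ Icc (-M - 1) 0, f₂ z := by
      refine setIntegral_eq_of_subset_of_forall_sdiff_eq_zero mP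
        (fun z hz => ⟨hz.1.1, mem_univ _⟩) fun z hz => ?_
      by_contra hne
      have hz' : z ∈ tsupport φ := by
        by_contra hz'
        apply hne
        have := fderiv_mul_snd (hψd _) hφdiff (z := z)
        rw [fderiv_of_notMem_tsupport (𝕜 := ℝ) hz'] at this
        simp only [hf₂]
        rw [← this]; simp
      exact hz.2 ⟨⟨hz.1.1, (hsupp hz').1.2⟩, (hsupp hz').2⟩
    rw [e1]
    have hv : volume.real (Ioc 0 (2 * ε) ×ˢ Icc (-M - 1) 0) = 2 * ε * (M + 1) := by
      rw [Measure.volume_eq_prod, measureReal_prod_prod]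
      rw [Real.volume_real_Ioc_of_le (by linarith), Real.volume_real_Icc_of_le (by linarith)]
      ring
    have := norm_setIntegral_le_of_norm_le_const (f := f₂) (C := K * R * (2 * c))
      (s := Ioc 0 (2 * ε) ×ˢ Icc (-M - 1) 0) (μ := volume) (volume_prod_lt_top measure_Ioc_lt_top measure_Icc_lt_top) (fun z hz => by
        simp only [hf₂]
        rw [norm_mul, norm_mul]
        have hp0 := initialProfile_nonneg (z.1 / ε)
        have hp2 := initialProfile_le (div_pos hz.1.1 hε).le
        refine mul_le_mul (hkb z) (mul_le_mul ?_ (hc _) (abs_nonneg _) two_pos.le)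
          (mul_nonneg (abs_nonneg _) (abs_nonneg _)) (mul_nonneg hF.1 hR)
        rw [Real.norm_eq_abs, abs_of_nonneg hp0]; exact hp2)
    rw [hv] at this
    refine (le_abs_self _).trans (this.trans (le_of_eq (by ring)))
  rw [integral_neg] at b₁
  linarith

/-- The initial datum is attained in the mean. -/
theorem HalfSol.initial (hT : 0 < T) (hF : Lip K F) (h : HalfSol F R T a u γ) :
    InitialZero fun z => u z - a := by
  have hR := h.nonneg
  have hm := h.measurable
  intro M
  rw [Metric.tendsto_nhds]
  intro η hη
  -- The strip `[-d,0]`, which the layer estimate does not reach, contributes at most `R d < η / 2`.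
  set d := η / (2 * (R + 1)) with hd
  have hd0 : 0 < d := by positivity
  obtain ⟨C, hC⟩ := h.initial_layer hF (M := max M 0) hd0 (le_max_right _ _)
  have h1 : ∀ᶠ ε : ℝ in 𝓝[>] 0, C * ε < η / 2 := by
    have : Tendsto (fun ε : ℝ => C * ε) (𝓝 0) (𝓝 (C * 0)) := tendsto_id.const_mul C
    rw [mul_zero] at this
    exact (this.eventually (gt_mem_nhds (by positivity))).filter_mono nhdsWithin_le_nhds
  filter_upwards [h1, Ioo_mem_nhdsGT (show (0 : ℝ) < T / 2 by linarith)] with ε hε1 hε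
  have hb : ∀ z, |u z - a| ≤ R := fun z => abs_sub_le_of_mem (h.mem z) h.datum_mem
  have n0 : 0 ≤ ε⁻¹ * ∫ z in Ioo 0 ε ×ˢ Ioo (-M) 0, |u z - a| :=
    mul_nonneg (inv_nonneg.2 hε.1.le) (integral_nonneg fun z => abs_nonneg _)
  rw [Real.dist_eq, sub_zero, abs_of_nonneg n0]
  have mabs : Measurable fun z => |u z - a| := by fun_prop
  have iall : ∀ x y, IntegrableOn (fun z => |u z - a|) (Ioo 0 ε ×ˢ Icc x y) := fun x y =>
    integrableOn_of_bounded' mabs (C := R) (fun z => by rw [abs_abs]; exact hb z) (volume_prod_lt_top measure_Ioo_lt_top measure_Icc_lt_top).ne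
  have step : ∫ z in Ioo 0 ε ×ˢ Ioo (-M) 0, |u z - a| ≤
      (∫ z in Ioo 0 ε ×ˢ Ioo (-max M 0) (-d), |u z - a|) +
        ∫ z in Ioo 0 ε ×ˢ Icc (-d) 0, |u z - a| := by
    rw [← setIntegral_union]
    · refine setIntegral_mono_set ?_ (Eventually.of_forall fun z => abs_nonneg _)
        (LE.le.eventuallyLE ?_)
      · exact IntegrableOn.union ((iall (-max M 0) (-d)).mono_set
          (prod_mono subset_rfl Ioo_subset_Icc_self)) (iall _ _)
      · rintro z ⟨hz1, hz2⟩
        rcases lt_or_ge z.2 (-d) with h' | h'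
        · exact Or.inl ⟨hz1, by linarith [hz2.1, le_max_left M 0], h'⟩
        · exact Or.inr ⟨hz1, h', hz2.2.le⟩
    · rw [Set.disjoint_left]
      rintro z ⟨_, hz⟩ ⟨_, hz'⟩
      exact absurd hz.2 (not_lt.2 hz'.1)
    · exact measurableSet_Ioo.prod measurableSet_Icc
    · exact (iall (-max M 0) (-d)).mono_set (prod_mono subset_rfl Ioo_subset_Icc_self)
    · exact iall _ _
  have s2 : ∫ z in Ioo 0 ε ×ˢ Icc (-d) 0, |u z - a| ≤ R * (ε * d) := by
    have hv : volume.real (Ioo 0 ε ×ˢ Icc (-d) 0) = ε * d := by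
      rw [Measure.volume_eq_prod, measureReal_prod_prod, Real.volume_real_Ioo_of_le hε.1.le,
        Real.volume_real_Icc_of_le (by linarith)]
      ring
    rw [← hv]
    refine (le_abs_self _).trans (norm_setIntegral_le_of_norm_le_const (f := fun z => |u z - a|) (volume_prod_lt_top measure_Ioo_lt_top measure_Icc_lt_top) fun z _ => ?_)
    rw [Real.norm_eq_abs, abs_abs]; exact hb z
  have s3 := hC ε hε.1 (by linarith [hε.2])
  have s4 : R * d < η / 2 := by
    rw [hd, mul_div_assoc', div_lt_div_iff₀ (by positivity) (by positivity)]
    nlinarith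
  calc ε⁻¹ * ∫ z in Ioo 0 ε ×ˢ Ioo (-M) 0, |u z - a|
      ≤ ε⁻¹ * ((∫ z in Ioo 0 ε ×ˢ Ioo (-max M 0) (-d), |u z - a|) + R * (ε * d)) :=
        mul_le_mul_of_nonneg_left (by linarith) (inv_nonneg.2 hε.1.le)
    _ = ε⁻¹ * (∫ z in Ioo 0 ε ×ˢ Ioo (-max M 0) (-d), |u z - a|) + R * d := by
        have := hε.1.ne'
        field_simp
    _ < η := by linarith

end

/-! ### Contraction and boundary flux estimates on the half-line. -/

section

variable {F : ℝ → ℝ} {K R T a : ℝ} {u v : ℝ × ℝ → ℝ} {γ δ : ℝ → ℝ}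

theorem Lip.abs_sub_le (hF : Lip K F) {x y : ℝ} (hx : x ∈ Icc 0 R) (hy : y ∈ Icc 0 R) :
    |F x - F y| ≤ K * R :=
  (hF.2 x y).trans (mul_le_mul_of_nonneg_left (abs_sub_le_of_mem hx hy) hF.1)

theorem Lip.abs_kflux_le (hF : Lip K F) {x y : ℝ} (hx : x ∈ Icc 0 R) (hy : y ∈ Icc 0 R) :
    |kflux F x y| ≤ K * R :=
  (hF.kflux_le x y).trans (mul_le_mul_of_nonneg_left (abs_sub_le_of_mem hx hy) hF.1)

theorem integrableOn_step_mul {f : ℝ → ℝ} (hf : Measurable f) {C : ℝ} (hC : ∀ x, |f x| ≤ C)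
    (c : ℝ) : IntegrableOn (fun x => smoothTransition (x + c) * f x) (Iio 0) := by
  have hSm : Measurable smoothTransition := Real.smoothTransition.continuous.measurable
  have : Integrable ((Iio (0 : ℝ)).indicator fun x => smoothTransition (x + c) * f x) := by
    refine integrable_of_bounded_Icc (C := C) (a := -c) (b := 0)
      (Measurable.indicator (by fun_prop) measurableSet_Iio) (fun x => ?_) fun x hx => ?_
    · have hC0 := (abs_nonneg _).trans (hC 0)
      by_cases hx : x ∈ Iio (0 : ℝ)
      · rw [indicator_of_mem hx, abs_mul]
        simpa using mul_le_mul (abs_step_le (x + c)) (hC x) (abs_nonneg _) zero_le_one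
      · rw [indicator_of_notMem hx, abs_zero]; exact hC0
    · have hx' := mem_of_indicator_ne_zero hx
      rw [indicator_of_mem hx'] at hx
      refine ⟨?_, (mem_Iio.1 hx').le⟩
      by_contra h
      exact hx (by rw [Real.smoothTransition.zero_of_nonpos (by linarith), zero_mul])
  exact (integrable_indicator_iff measurableSet_Iio).1 this

/-- From the weighted to the plain integral, for nonnegative integrands. -/
theorem setIntegral_Ioo_le_step {f : ℝ → ℝ} (hf : Measurable f) {C : ℝ} (hC : ∀ x, |f x| ≤ C)
    (h0 : ∀ x, 0 ≤ f x) {c M : ℝ} (hM : M + 1 ≤ c) :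
    ∫ x in Ioo (-M) 0, f x ≤ ∫ x in Iio 0, smoothTransition (x + c) * f x := by
  calc ∫ x in Ioo (-M) 0, f x = ∫ x in Ioo (-M) 0, smoothTransition (x + c) * f x := by
        refine setIntegral_congr_fun measurableSet_Ioo fun x hx => ?_
        rw [Real.smoothTransition.one_of_one_le (by linarith [hx.1]), one_mul]
    _ ≤ _ := setIntegral_mono_set (integrableOn_step_mul hf hC c)
        (Eventually.of_forall fun x => mul_nonneg (Real.smoothTransition.nonneg _) (h0 x))
        (LE.le.eventuallyLE fun x hx => hx.2)

/-- The cone inequality for nonnegative densities. -/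
theorem cone_nonneg {C : ℝ} {G H : ℝ × ℝ → ℝ} {β : ℝ → ℝ} (hT : 0 < T)
    (hG : Measurable G) (hGC : ∀ z, |G z| ≤ C) (hH : Measurable H) (hHC : ∀ z, |H z| ≤ C)
    (hβ : Measurable β) (hβC : ∀ t, |β t| ≤ C) (hK : 0 ≤ K)
    (hineq : InteriorIneq T G H) (hini : InitialZero G) (htr : HasTrace T H β)
    (hG0 : ∀ z, 0 ≤ G z) (hle : ∀ z, H z ≤ K * G z) (M : ℝ) :
    ∀ᵐ t, t ∈ Ioo 0 T → ∫ x in Ioo (-M) 0, G (t, x) ≤ -∫ r in (0:ℝ)..t, β r := by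
  -- The cone cut-off has to stay equal to one on `]-M,0[` up to time `T`. No far-field condition is
  -- needed, since `H ≤ K G` holds everywhere; hence `M₀ = 0`.
  set N := max (max 0 M + K * T + 1) (K * T + 2) with hN
  filter_upwards [cone_integrated (M := N) (M₀ := 0) hT hG hGC hH hHC hβ hβC hK hineq hini htr
    (Eventually.of_forall fun z _ _ _ => hle z)
    (by linarith [le_max_left (max 0 M + K * T + 1) (K * T + 2), le_max_left 0 M])
    (le_max_right _ _)] with t ht htT
  refine le_trans ?_ (ht htT)
  have hKt := mul_le_mul_of_nonneg_left htT.2.le hK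
  have := setIntegral_Ioo_le_step (f := fun x => G (t, x)) (by fun_prop) (fun x => hGC _)
    (fun x => hG0 _) (c := N - K * t) (M := M)
    (by linarith [le_max_left (max 0 M + K * T + 1) (K * T + 2), le_max_right 0 M])
  simpa only [add_sub_assoc] using this

/-- `L¹` contraction up to the boundary flux. -/
theorem HalfSol.contraction (hT : 0 < T) (hF : Lip K F) (hu : HalfSol F R T a u γ)
    (hv : HalfSol F R T a v δ) (M : ℝ) :
    ∀ᵐ t, t ∈ Ioo 0 T → ∫ x in Ioo (-M) 0, |u (t, x) - v (t, x)| ≤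
      -∫ r in (0:ℝ)..t, kflux F (γ r) (δ r) := by
  have mu := hu.measurable
  have mv := hv.measurable
  have hk := hF.continuous_kflux.measurable
  have hR := hu.nonneg
  have b1 := le_max_left R (K * R)
  have b2 := le_max_right R (K * R)
  refine cone_nonneg (G := fun z => |u z - v z|) (H := fun z => kflux F (u z) (v z))
    (C := max R (K * R)) hT (by fun_prop)
    (fun z => by rw [abs_abs]; exact (abs_sub_le_of_mem (hu.mem z) (hv.mem z)).trans b1)
    (hk.comp (mu.prodMk mv)) (fun z => (hF.abs_kflux_le (hu.mem z) (hv.mem z)).trans b2)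
    (hk.comp (hu.trace_measurable.prodMk hv.trace_measurable))
    (fun t => (hF.abs_kflux_le (hu.trace_mem t) (hv.trace_mem t)).trans b2) hF.1
    (kato hF mu hu.mem mv hv.mem (fun k hk => hu.interior hk) (fun k hk => hv.interior hk))
    ?_ ?_ (fun z => abs_nonneg _) (fun z => (le_abs_self _).trans (hF.kflux_le _ _)) M
  · refine (hu.initial hT hF).of_le (hv.initial hT hF) (C := R) (by fun_prop) (by fun_prop)
      (fun z => abs_sub_le_of_mem (hu.mem z) hu.datum_mem)
      (fun z => abs_sub_le_of_mem (hv.mem z) hv.datum_mem) fun z => ?_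
    rw [abs_abs]
    have := abs_sub_le (u z) a (v z)
    rwa [abs_sub_comm a] at this
  · exact hu.trace.of_le hv.trace (C := R) mu hu.trace_measurable mv hv.trace_measurable
      (fun z => abs_le_of_mem (hu.mem z)) (fun t => abs_le_of_mem (hu.trace_mem t))
      (fun z => abs_le_of_mem (hv.mem z)) (fun t => abs_le_of_mem (hv.trace_mem t))
      (fun z => hF.kflux_sub_le _ _ _ _)

/-- The averaged boundary flux is controlled by the initial datum. -/
theorem HalfSol.boundary_flux (hT : 0 < T) (hF : Lip K F) (h : HalfSol F R T a u γ) :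
    ∀ᵐ t, t ∈ Ioo 0 T → ∫ r in (0:ℝ)..t, kflux F (γ r) a ≤ 0 := by
  have mu := h.measurable
  have hk := hF.continuous_kflux.measurable
  have b1 := le_max_left R (K * R)
  have b2 := le_max_right R (K * R)
  have := cone_nonneg (G := fun z => |u z - a|) (H := fun z => kflux F (u z) a)
    (β := fun t => kflux F (γ t) a)
    (C := max R (K * R)) hT (by fun_prop)
    (fun z => by rw [abs_abs]; exact (abs_sub_le_of_mem (h.mem z) h.datum_mem).trans b1)
    (h.measurable_kflux hF a) (fun z => (hF.abs_kflux_le (h.mem z) h.datum_mem).trans b2)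
    (hk.comp (h.trace_measurable.prodMk measurable_const))
    (fun t => (hF.abs_kflux_le (h.trace_mem t) h.datum_mem).trans b2) hF.1
    (h.interior h.datum_mem)
    ((h.initial hT hF).of_le (h.initial hT hF) (C := R) (by fun_prop) (by fun_prop)
      (fun z => abs_sub_le_of_mem (h.mem z) h.datum_mem)
      (fun z => abs_sub_le_of_mem (h.mem z) h.datum_mem)
      (fun z => by rw [abs_abs]; linarith [abs_nonneg (u z - a)]))
    (h.trace.of_le h.trace (C := R) (c := 2 * K) mu h.trace_measurable mu h.trace_measurable
      (fun z => abs_le_of_mem (h.mem z)) (fun t => abs_le_of_mem (h.trace_mem t))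
      (fun z => abs_le_of_mem (h.mem z)) (fun t => abs_le_of_mem (h.trace_mem t))
      (fun z => by
        have h1 := hF.kflux_sub_le (u z) a (γ z.1) a
        have h2 := mul_nonneg (mul_nonneg zero_le_two hF.1) (abs_nonneg (u z - γ z.1))
        rw [sub_self, abs_zero] at h1
        linarith))
    (fun z => abs_nonneg _) (fun z => (le_abs_self _).trans (hF.kflux_le _ _)) 1
  filter_upwards [this] with t ht htT
  have h1 := ht htT
  have h2 : 0 ≤ ∫ x in Ioo (-1 : ℝ) 0, |u (t, x) - a| := integral_nonneg fun x => abs_nonneg _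
  linarith

/-- One-sided version of the boundary estimate: `e = 1` concerns `(u - k)⁺`, `e = -1` concerns
`(k - u)⁺`. -/
theorem HalfSol.boundary_flux_oneSided (hT : 0 < T) (hF : Lip K F) (h : HalfSol F R T a u γ)
    {e k : ℝ} (he : e = 1 ∨ e = -1) (hk : k ∈ Icc 0 R) (hak : |a - k| + e * (a - k) = 0) :
    ∀ᵐ t, t ∈ Ioo 0 T →
      ∫ r in (0:ℝ)..t, (kflux F (γ r) k + e * (F (γ r) - F k)) ≤ 0 := by
  have mu := h.measurable
  have hFm := hF.continuous.measurable
  have hkm := hF.continuous_kflux.measurable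
  have hR := h.nonneg
  have he1 : |e| = 1 := by rcases he with rfl | rfl <;> simp
  have heabs : ∀ x, |e * x| = |x| := fun x => by rw [abs_mul, he1, one_mul]
  have b1 := le_max_left R (K * R)
  have b2 := le_max_right R (K * R)
  have hKR : 0 ≤ max R (K * R) := hR.trans b1
  have mk : Measurable fun t => kflux F (γ t) k :=
    hkm.comp (h.trace_measurable.prodMk measurable_const)
  have mγ := h.trace_measurable
  have mku := h.measurable_kflux hF k
  -- `|x| + e x` is twice the positive part of `e x`. The entropy inequality is added to one half of
  -- the weak equation, and `hak` says that this one-sided entropy vanishes initially.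
  have hineq := (h.interior hk).add (h.conservation hF he k) (C := max R (K * R))
    (by fun_prop) mku (by fun_prop) (by fun_prop)
    (fun z => by rw [abs_abs]; exact (abs_sub_le_of_mem (h.mem z) hk).trans b1)
    (fun z => (hF.abs_kflux_le (h.mem z) hk).trans b2)
    (fun z => by rw [heabs]; exact (abs_sub_le_of_mem (h.mem z) hk).trans b1)
    (fun z => by rw [heabs]; exact (hF.abs_sub_le (h.mem z) hk).trans b2)
  have hadd : ∀ {x y : ℝ}, |x| ≤ max R (K * R) → |y| ≤ max R (K * R) →
      |x + y| ≤ 2 * max R (K * R) := fun hx hy => by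
    linarith [(abs_add_le _ _).trans (add_le_add hx hy)]
  have hGnn : ∀ x : ℝ, 0 ≤ |x - k| + e * (x - k) := fun x => by
    have := neg_abs_le (e * (x - k)); rw [heabs] at this; linarith
  have := cone_nonneg (G := fun z => |u z - k| + e * (u z - k))
    (H := fun z => kflux F (u z) k + e * (F (u z) - F k))
    (β := fun t => kflux F (γ t) k + e * (F (γ t) - F k))
    (C := 2 * max R (K * R)) hT (by fun_prop)
    (fun z => hadd (by rw [abs_abs]; exact (abs_sub_le_of_mem (h.mem z) hk).trans b1)
      (by rw [heabs]; exact (abs_sub_le_of_mem (h.mem z) hk).trans b1))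
    (by fun_prop)
    (fun z => hadd ((hF.abs_kflux_le (h.mem z) hk).trans b2)
      (by rw [heabs]; exact (hF.abs_sub_le (h.mem z) hk).trans b2))
    (by fun_prop)
    (fun t => hadd ((hF.abs_kflux_le (h.trace_mem t) hk).trans b2)
      (by rw [heabs]; exact (hF.abs_sub_le (h.trace_mem t) hk).trans b2))
    hF.1 hineq
    ((h.initial hT hF).of_le (h.initial hT hF) (C := R) (by fun_prop) (by fun_prop)
      (fun z => abs_sub_le_of_mem (h.mem z) h.datum_mem)
      (fun z => abs_sub_le_of_mem (h.mem z) h.datum_mem)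
      (fun z => by
        rw [abs_of_nonneg (hGnn _)]
        have h1 := abs_sub_le (u z) a k
        have h2 := le_abs_self (e * (u z - a))
        rw [heabs] at h2
        have : e * (u z - k) = e * (u z - a) + e * (a - k) := by ring
        linarith))
    (h.trace.of_le h.trace (C := R) (c := 2 * K) mu h.trace_measurable mu h.trace_measurable
      (fun z => abs_le_of_mem (h.mem z)) (fun t => abs_le_of_mem (h.trace_mem t))
      (fun z => abs_le_of_mem (h.mem z)) (fun t => abs_le_of_mem (h.trace_mem t))
      (fun z => by
        have h1 := hF.kflux_sub_le (u z) k (γ z.1) k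
        have h2 := hF.2 (u z) (γ z.1)
        rw [sub_self, abs_zero, add_zero] at h1
        have h3 := abs_add_le (kflux F (u z) k - kflux F (γ z.1) k) (e * (F (u z) - F (γ z.1)))
        rw [heabs] at h3
        have h4 := mul_nonneg hF.1 (abs_nonneg (u z - γ z.1))
        calc _ = |kflux F (u z) k - kflux F (γ z.1) k + e * (F (u z) - F (γ z.1))| := by
              congr 1; ring
          _ ≤ _ := by linarith))
    (fun z => hGnn _) (fun z => ?_) 1
  · filter_upwards [this] with t ht htT
    have h1 := ht htT
    have h2 : 0 ≤ ∫ x in Ioo (-1 : ℝ) 0, (|u (t, x) - k| + e * (u (t, x) - k)) :=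
      integral_nonneg fun x => hGnn _
    linarith
  · have h1 := le_abs_self (F (u z) - F k)
    have h2 := hF.2 (u z) k
    have h3 := neg_abs_le (F (u z) - F k)
    rcases le_total (u z) k with huk | huk
    · rw [kflux_of_le F huk]
      rw [abs_of_nonpos (show u z - k ≤ 0 by linarith)] at h2 ⊢
      rcases he with rfl | rfl <;> nlinarith
    · rw [kflux_of_ge F huk]
      rw [abs_of_nonneg (show 0 ≤ u z - k by linarith)] at h2 ⊢
      rcases he with rfl | rfl <;> nlinarith

end

/-! ### Finite speed of propagation and mass balance. -/

section

variable {F : ℝ → ℝ} {K R T a : ℝ} {u v : ℝ × ℝ → ℝ} {γ δ : ℝ → ℝ}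

/-- Multiplying by a cut-off that moves to the left at speed `K` preserves the inequality. -/
theorem InteriorIneq.mul_movingStep {G H : ℝ × ℝ → ℝ} {C : ℝ} (h : InteriorIneq T G H)
    (mG : Measurable G) (mH : Measurable H) (bG : ∀ z, |G z| ≤ C) (bH : ∀ z, |H z| ≤ C)
    (hle : ∀ z, |H z| ≤ K * G z) (d : ℝ) :
    InteriorIneq T (fun z => G z * smoothTransition (-(z.2 + K * z.1) - d))
      (fun z => H z * smoothTransition (-(z.2 + K * z.1) - d)) := by
  intro φ hφ
  have hS : ContDiff ℝ ∞ smoothTransition := Real.smoothTransition.contDiff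
  set E : ℝ × ℝ → ℝ := fun z => smoothTransition (-(z.2 + K * z.1) - d) with hE
  have hEs : ContDiff ℝ ∞ E := hS.comp
    ((contDiff_snd.add (contDiff_const.mul contDiff_fst)).neg.sub contDiff_const)
  have hEd : Differentiable ℝ E := hEs.differentiable (by simp)
  have hd := hφ.smooth.differentiable (by simp)
  have htest : InteriorTest T fun z => φ z * E z :=
    ⟨hφ.smooth.mul hEs, hφ.compact.mul_right,
      fun z hz => hφ.support z (tsupport_mul_subset_left hz),
      fun z => mul_nonneg (hφ.nonneg z) (Real.smoothTransition.nonneg _)⟩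
  have hprod : ∀ z e, fderiv ℝ (fun z => φ z * E z) z e =
      fderiv ℝ φ z e * E z + φ z * fderiv ℝ E z e := by
    intro z e
    rw [((hd z).hasFDerivAt.fun_mul (hEd z).hasFDerivAt).fderiv]
    simp; ring
  have hE1 : ∀ z, fderiv ℝ E z (1, 0) = -(K * deriv smoothTransition (-(z.2 + K * z.1) - d)) := by
    intro z
    have e1 : HasDerivAt (fun t : ℝ => -(z.2 + K * t) - d) (-K) z.1 := by
      simpa using (((hasDerivAt_id z.1).const_mul K).const_add z.2).neg.sub_const d
    rw [(fderiv_fst_eq_deriv hEd z).unique ((hasDerivAt_step _).comp z.1 e1)]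
    ring
  have hE2 : ∀ z, fderiv ℝ E z (0, 1) = -deriv smoothTransition (-(z.2 + K * z.1) - d) := by
    intro z
    have e1 : HasDerivAt (fun x : ℝ => -(x + K * z.1) - d) (-1) z.2 := by
      simpa using ((hasDerivAt_id z.2).add_const (K * z.1)).neg.sub_const d
    rw [(fderiv_snd_eq_deriv hEd z).unique ((hasDerivAt_step _).comp z.2 e1)]
    ring
  have mE : Measurable E := hEs.continuous.measurable
  have bE : ∀ z, |E z| ≤ 1 := fun z => abs_step_le _
  refine (h _ htest).trans (integral_mono (htest.integrable mG mH bG bH)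
    (hφ.integrable (C := C) (mG.mul mE) (mH.mul mE)
      (fun z => ?_) (fun z => ?_)) fun z => ?_)
  · exact (abs_mul _ _).le.trans ((mul_le_mul (bG z) (bE z) (abs_nonneg _)
      ((abs_nonneg _).trans (bG z))).trans (mul_one _).le)
  · exact (abs_mul _ _).le.trans ((mul_le_mul (bH z) (bE z) (abs_nonneg _)
      ((abs_nonneg _).trans (bH z))).trans (mul_one _).le)
  · simp only [hprod, hE1, hE2]
    have h1 := neg_abs_le (H z)
    have h2 := hle z
    -- The two derivatives of the cut-off contribute `-(K G + H)` times a nonnegative factor, and `K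
    -- G + H ≥ 0` since `|H| ≤ K G`.
    have h3 : 0 ≤ φ z * deriv smoothTransition (-(z.2 + K * z.1) - d) * (K * G z + H z) :=
      mul_nonneg (mul_nonneg (hφ.nonneg z) (deriv_step_nonneg _)) (by linarith)
    nlinarith

/-- Finite speed of propagation. -/
theorem HalfSol.finite_speed (hT : 0 < T) (hF : Lip K F) (h : HalfSol F R T a u γ) :
    ∀ᵐ z : ℝ × ℝ, 0 < z.1 → z.1 < T → z.2 < -(K * z.1) → u z = a := by
  have mu := h.measurable
  have hSm : Measurable smoothTransition := Real.smoothTransition.continuous.measurable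
  have hSt := Real.smoothTransition.continuous
  have mset : MeasurableSet {z : ℝ × ℝ | 0 < z.1 → z.1 < T → z.2 < -(K * z.1) → u z = a} := by
    have e : {z : ℝ × ℝ | 0 < z.1 → z.1 < T → z.2 < -(K * z.1) → u z = a} =
        {z | ¬ 0 < z.1} ∪ ({z | ¬ z.1 < T} ∪ ({z | ¬ z.2 < -(K * z.1)} ∪ {z | u z = a})) := by
      ext z; simp only [mem_ofPred_eq, mem_union]; tauto
    rw [e]
    refine MeasurableSet.union ?_ (MeasurableSet.union ?_ (MeasurableSet.union ?_ ?_))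
    · exact (measurableSet_lt measurable_const measurable_fst).compl
    · exact (measurableSet_lt measurable_fst measurable_const).compl
    · exact (measurableSet_lt measurable_snd (by fun_prop)).compl
    · exact measurableSet_eq_fun mu measurable_const
  rw [Measure.volume_eq_prod, Measure.ae_prod_iff_ae_ae mset]
  have hR := h.nonneg
  have b1 := le_max_left R (K * R)
  have b2 := le_max_right R (K * R)
  have mk := h.measurable_kflux hF a
  have hbk : ∀ z, |kflux F (u z) a| ≤ max R (K * R) := fun z =>
    (hF.abs_kflux_le (h.mem z) h.datum_mem).trans b2
  have hbu : ∀ z, |(|u z - a|)| ≤ max R (K * R) := fun z => by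
    rw [abs_abs]; exact (abs_sub_le_of_mem (h.mem z) h.datum_mem).trans b1
  -- The cut-off vanishes for `x ≥ -K t - 1/(n+1)`, in particular near the boundary: the boundary
  -- flux is zero and the solution is compared with its datum on the undisturbed region only.
  have key : ∀ n m : ℕ, ∀ᵐ t, t ∈ Ioo 0 T → ∫ x in Ioo (-(m : ℝ)) 0,
      |u (t, x) - a| * smoothTransition (-(x + K * t) - 1 / (n + 1)) ≤ 0 := by
    intro n m
    have hd : (0 : ℝ) < 1 / (n + 1) := by positivity
    have mul1 : ∀ {x y : ℝ}, |x| ≤ max R (K * R) → |x * smoothTransition y| ≤ max R (K * R) := by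
      intro x y hx
      rw [abs_mul]
      simpa using mul_le_mul hx (abs_step_le y) (abs_nonneg _) ((abs_nonneg _).trans hx)
    have := cone_nonneg
      (G := fun z => |u z - a| * smoothTransition (-(z.2 + K * z.1) - 1 / (n + 1)))
      (H := fun z => kflux F (u z) a * smoothTransition (-(z.2 + K * z.1) - 1 / (n + 1)))
      (β := fun _ => 0) (C := max R (K * R)) hT (by fun_prop) (fun z => mul1 (hbu z)) (by fun_prop)
      (fun z => mul1 (hbk z)) measurable_const (fun t => by simpa using Or.inl hR) hF.1
      ((h.interior h.datum_mem).mul_movingStep (by fun_prop) mk hbu hbk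
        (fun z => hF.kflux_le _ _) _)
      ((h.initial hT hF).of_le (h.initial hT hF) (C := R) (by fun_prop) (by fun_prop)
        (fun z => abs_sub_le_of_mem (h.mem z) h.datum_mem)
        (fun z => abs_sub_le_of_mem (h.mem z) h.datum_mem)
        (fun z => by
          rw [abs_mul, abs_abs]
          have := mul_le_mul_of_nonneg_left (abs_step_le (-(z.2 + K * z.1) - 1 / (n + 1)))
            (abs_nonneg (u z - a))
          linarith [abs_nonneg (u z - a)]))
      (fun s hs => by
        refine tendsto_const_nhds.congr' ?_
        filter_upwards [Ioo_mem_nhdsGT hd] with ε hε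
        rw [setIntegral_eq_zero_of_forall_eq_zero, mul_zero]
        intro z hz
        have h1 := mul_nonneg hF.1 hz.1.1.le
        rw [Real.smoothTransition.zero_of_nonpos (by linarith [hz.2.1, hε.2]), mul_zero, sub_zero,
          abs_zero])
      (fun z => mul_nonneg (abs_nonneg _) (Real.smoothTransition.nonneg _))
      (fun z => by
        rw [← mul_assoc]
        exact mul_le_mul_of_nonneg_right ((le_abs_self _).trans (hF.kflux_le _ _))
          (Real.smoothTransition.nonneg _)) m
    simpa using this
  have key' := ae_all_iff.2 fun n => ae_all_iff.2 (key n)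
  filter_upwards [key'] with t ht
  by_cases htT : t ∈ Ioo 0 T
  swap
  · exact Eventually.of_forall fun x h1 h2 => absurd ⟨h1, h2⟩ htT
  have hz : ∀ n m : ℕ, ∀ᵐ x : ℝ, x ∈ Ioo (-(m : ℝ)) 0 →
      |u (t, x) - a| * smoothTransition (-(x + K * t) - 1 / (n + 1)) = 0 := by
    intro n m
    have hnn : ∀ x, 0 ≤ |u (t, x) - a| * smoothTransition (-(x + K * t) - 1 / (n + 1)) :=
      fun x => mul_nonneg (abs_nonneg _) (Real.smoothTransition.nonneg _)
    have h0 := le_antisymm (ht n m htT) (integral_nonneg hnn)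
    rw [integral_eq_zero_iff_of_nonneg hnn] at h0
    · exact (ae_restrict_iff' measurableSet_Ioo).1 h0
    · refine integrableOn_of_bounded' (C := R) (by fun_prop) (fun x => ?_) (by simp)
      rw [abs_of_nonneg (hnn x)]
      simpa using mul_le_mul (abs_sub_le_of_mem (h.mem (t, x)) h.datum_mem)
        (Real.smoothTransition.le_one _) (Real.smoothTransition.nonneg _) hR
  filter_upwards [ae_all_iff.2 fun n => ae_all_iff.2 (hz n)] with x hx _ _ hxt
  obtain ⟨n, hn⟩ := exists_nat_one_div_lt (show 0 < -(x + K * t) by linarith)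
  obtain ⟨m, hm⟩ := exists_nat_gt (-x)
  have h1 := mul_nonneg hF.1 htT.1.le
  have h2 := hx n m ⟨by linarith, by linarith⟩
  have h3 := Real.smoothTransition.pos_of_pos (show 0 < -(x + K * t) - 1 / ((n : ℝ) + 1) by linarith)
  have h4 := (mul_eq_zero.1 h2).resolve_right h3.ne'
  linarith [abs_eq_zero.1 h4]

/-- Mass balance on the half-line. -/
theorem HalfSol.mass (hT : 0 < T) (hF : Lip K F) (h : HalfSol F R T a u γ) :
    ∀ᵐ t, t ∈ Ioo 0 T → (∀ᵐ x, x < -(K * t) → u (t, x) = a) ∧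
      ∫ x in Ioo (-(K * t)) 0, (u (t, x) - a) = ∫ r in (0:ℝ)..t, (F a - F (γ r)) := by
  have hfs := h.finite_speed hT hF
  have mu := h.measurable
  have mγ := h.trace_measurable
  have hFm := hF.continuous.measurable
  have hR := h.nonneg
  have b1 := le_max_left R (K * R)
  have b2 := le_max_right R (K * R)
  have hKT := mul_nonneg hF.1 hT.le
  -- By finite speed `u = a` beyond distance `K T`, so `M₀ = K T` is allowed in the cone inequality
  -- even though the integrands have no sign. This `M` also keeps the weight equal to one on `]-K
  -- t,0[`. The signs `e = 1` and `e = -1` together give equality.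
  set M := 2 * (K * T) + 2 with hM
  have key : ∀ e : ℝ, e = 1 ∨ e = -1 → ∀ᵐ t, t ∈ Ioo 0 T →
      ∫ x in Iio 0, smoothTransition (x + M - K * t) * (e * (u (t, x) - a)) ≤
        -∫ r in (0:ℝ)..t, e * (F (γ r) - F a) := by
    intro e he
    have he1 : |e| = 1 := by rcases he with rfl | rfl <;> simp
    have heabs : ∀ x, |e * x| = |x| := fun x => by rw [abs_mul, he1, one_mul]
    refine cone_integrated (G := fun z => e * (u z - a)) (H := fun z => e * (F (u z) - F a))
      (β := fun t => e * (F (γ t) - F a)) (M₀ := K * T) (C := max R (K * R)) hT (by fun_prop)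
      (fun z => by rw [heabs]; exact (abs_sub_le_of_mem (h.mem z) h.datum_mem).trans b1)
      (by fun_prop)
      (fun z => by rw [heabs]; exact (hF.abs_sub_le (h.mem z) h.datum_mem).trans b2)
      (by fun_prop)
      (fun t => by rw [heabs]; exact (hF.abs_sub_le (h.trace_mem t) h.datum_mem).trans b2)
      hF.1 (h.conservation hF he a)
      ((h.initial hT hF).of_le (h.initial hT hF) (C := R) (by fun_prop) (by fun_prop)
        (fun z => abs_sub_le_of_mem (h.mem z) h.datum_mem)
        (fun z => abs_sub_le_of_mem (h.mem z) h.datum_mem)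
        (fun z => by rw [heabs]; linarith [abs_nonneg (u z - a)]))
      (h.trace.of_le h.trace (C := R) (c := K) mu h.trace_measurable mu h.trace_measurable
        (fun z => abs_le_of_mem (h.mem z)) (fun t => abs_le_of_mem (h.trace_mem t))
        (fun z => abs_le_of_mem (h.mem z)) (fun t => abs_le_of_mem (h.trace_mem t))
        (fun z => by
          rw [← mul_sub, heabs, sub_sub_sub_cancel_right]
          have h2 := mul_nonneg hF.1 (abs_nonneg (u z - γ z.1))
          linarith [hF.2 (u z) (γ z.1)]))
      ?_ (by linarith) (by linarith)
    filter_upwards [hfs] with z hz h1 h2 h3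
    have h4 := mul_le_mul_of_nonneg_left h2.le hF.1
    rw [hz h1 h2 (by linarith)]; simp
  rw [Measure.volume_eq_prod] at hfs
  filter_upwards [key 1 (Or.inl rfl), key (-1) (Or.inr rfl), Measure.ae_ae_of_ae_prod hfs]
    with t h1 h2 h3 htT
  have h3' : ∀ᵐ x, x < -(K * t) → u (t, x) = a := by
    filter_upwards [h3] with x hx hxt using hx htT.1 htT.2 hxt
  refine ⟨h3', ?_⟩
  have hKt := mul_le_mul_of_nonneg_left htT.2.le hF.1
  have hKt0 := mul_nonneg hF.1 htT.1.le
  have e1 : ∀ e : ℝ, ∫ x in Iio 0, smoothTransition (x + M - K * t) * (e * (u (t, x) - a)) =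
      e * ∫ x in Ioo (-(K * t)) 0, (u (t, x) - a) := by
    intro e
    rw [← integral_const_mul, ← integral_indicator measurableSet_Iio,
      ← integral_indicator measurableSet_Ioo]
    refine integral_congr_ae ?_
    have hne : ∀ᵐ x : ℝ, x ≠ -(K * t) := by simp [ae_iff, measure_singleton]
    filter_upwards [h3', hne] with x hx hxne
    rcases lt_or_ge x 0 with hx0 | hx0
    · rw [indicator_of_mem (show x ∈ Iio (0 : ℝ) from hx0)]
      rcases lt_or_ge x (-(K * t)) with hxt | hxt
      · rw [hx hxt, indicator_of_notMem (fun h' => absurd h'.1 (not_lt.2 hxt.le))]; ring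
      · rw [indicator_of_mem (show x ∈ Ioo (-(K * t)) 0 from ⟨lt_of_le_of_ne hxt hxne.symm, hx0⟩),
          Real.smoothTransition.one_of_one_le (by linarith), one_mul]
    · rw [indicator_of_notMem (notMem_Iio.2 hx0),
        indicator_of_notMem (fun h' => absurd h'.2 (not_lt.2 hx0))]
  have h1 := h1 htT
  have h2 := h2 htT
  rw [e1, intervalIntegral.integral_const_mul] at h1 h2
  have e2 : ∫ r in (0:ℝ)..t, (F a - F (γ r)) = -∫ r in (0:ℝ)..t, (F (γ r) - F a) := by
    rw [← intervalIntegral.integral_neg]; congr 1; funext r; ring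
  rw [e2]
  linarith

end

section

/-! ### The flux -/

/-- The extension of `f` from `[0,R]` by constants. -/
def extFlux (R : ℝ) (f : ℝ → ℝ) (s : ℝ) : ℝ := f (max 0 (min R s))

theorem extFlux_eq {R : ℝ} {f : ℝ → ℝ} {s : ℝ} (hs : s ∈ Icc 0 R) : extFlux R f s = f s := by
  unfold extFlux; rw [min_eq_right hs.2, max_eq_right hs.1]

theorem clamp_mem {R : ℝ} (hR : 0 ≤ R) (s : ℝ) : max 0 (min R s) ∈ Icc 0 R :=
  ⟨le_max_left _ _, max_le hR (min_le_left _ _)⟩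

variable {R ρbar : ℝ} {f : ℝ → ℝ}

theorem FluxCondition.pos (hf : FluxCondition R ρbar f) : 0 < R :=
  hf.ρbar_mem.1.trans hf.ρbar_mem.2

theorem FluxCondition.exists_lip (hf : FluxCondition R ρbar f) : ∃ K, Lip K (extFlux R f) := by
  obtain ⟨K, hK⟩ := hf.lipschitz
  refine ⟨K, K.2, fun a b => ?_⟩
  have h := hK.dist_le_mul _ (clamp_mem hf.pos.le a) _ (clamp_mem hf.pos.le b)
  rw [Real.dist_eq, Real.dist_eq] at h
  refine h.trans (mul_le_mul_of_nonneg_left ?_ K.2)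
  have h1 := abs_max_sub_max_le_abs (min R a) (min R b) 0
  rw [max_comm, max_comm (min R b)] at h1
  have h2 := abs_min_sub_min_le_max R a R b
  rw [sub_self, abs_zero, max_eq_right (abs_nonneg _)] at h2
  exact h1.trans h2

theorem FluxCondition.continuousOn (hf : FluxCondition R ρbar f) : ContinuousOn f (Icc 0 R) := by
  obtain ⟨K, hK⟩ := hf.lipschitz
  exact hK.continuousOn

/-- A Lipschitz function is absolutely continuous, so an almost everywhere sign of the derivative is
enough for strict monotonicity on either side of `ρbar`. -/
theorem FluxCondition.sub_eq_integral (hf : FluxCondition R ρbar f) {a b : ℝ} (ha : 0 ≤ a)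
    (hab : a ≤ b) (hb : b ≤ R) :
    IntervalIntegrable (deriv f) volume a b ∧ ∫ x in a..b, deriv f x = f b - f a := by
  obtain ⟨K, hK⟩ := hf.lipschitz
  have hac : AbsolutelyContinuousOnInterval f a b := by
    refine LipschitzOnWith.absolutelyContinuousOnInterval (K := K) (hK.mono ?_)
    rw [uIcc_of_le hab]; exact Icc_subset_Icc ha hb
  exact ⟨hac.intervalIntegrable_deriv, hac.integral_deriv_eq_sub⟩

theorem FluxCondition.deriv_sign_on (hf : FluxCondition R ρbar f) {a b : ℝ} (ha : 0 ≤ a)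
    (hb : b ≤ R) : ∀ᵐ s, s ∈ Ioc a b → 0 < deriv f s * (ρbar - s) := by
  filter_upwards [(ae_restrict_iff' measurableSet_Icc).1 hf.deriv_sign] with s hs h
  exact hs ⟨ha.trans h.1.le, h.2.trans hb⟩

theorem integral_pos_of_ae_pos {g : ℝ → ℝ} {a b : ℝ} (hab : a < b)
    (hi : IntervalIntegrable g volume a b) (hp : ∀ᵐ s, s ∈ Ioc a b → 0 < g s) :
    0 < ∫ x in a..b, g x := by
  rw [intervalIntegral.integral_of_le hab.le, setIntegral_pos_iff_support_of_nonneg_ae]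
  · refine lt_of_lt_of_le (b := volume (Ioc a b)) (by simpa using hab) (measure_mono_ae ?_)
    filter_upwards [hp] with s hs h using ⟨(hs h).ne', h⟩
  · filter_upwards [(ae_restrict_iff' measurableSet_Ioc).2 hp] with s hs using hs.le
  · exact (intervalIntegrable_iff_integrableOn_Ioc_of_le hab.le).1 hi

theorem FluxCondition.strictMonoOn (hf : FluxCondition R ρbar f) :
    StrictMonoOn f (Icc 0 ρbar) := by
  intro a ha b hb hab
  obtain ⟨hi, he⟩ := hf.sub_eq_integral ha.1 hab.le (hb.2.trans hf.ρbar_mem.2.le)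
  have : 0 < ∫ x in a..b, deriv f x := by
    refine integral_pos_of_ae_pos hab hi ?_
    filter_upwards [hf.deriv_sign_on ha.1 (hb.2.trans hf.ρbar_mem.2.le)] with s hs h
    exact pos_of_mul_pos_left (hs h) (by linarith [h.2, hb.2])
  linarith

theorem FluxCondition.strictAntiOn (hf : FluxCondition R ρbar f) :
    StrictAntiOn f (Icc ρbar R) := by
  intro a ha b hb hab
  have h0 := hf.ρbar_mem.1.le.trans ha.1
  obtain ⟨hi, he⟩ := hf.sub_eq_integral h0 hab.le hb.2
  have : 0 < ∫ x in a..b, -deriv f x := by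
    refine integral_pos_of_ae_pos hab hi.neg ?_
    filter_upwards [hf.deriv_sign_on h0 hb.2] with s hs h
    have := hs h
    nlinarith [h.1, ha.1]
  rw [intervalIntegral.integral_neg] at this
  linarith

theorem FluxCondition.le_max (hf : FluxCondition R ρbar f) {s : ℝ} (hs : s ∈ Icc 0 R) :
    f s ≤ f ρbar := by
  obtain ⟨h0, h1⟩ := hf.ρbar_mem
  rcases le_total s ρbar with h | h
  · exact hf.strictMonoOn.monotoneOn ⟨hs.1, h⟩ ⟨h0.le, le_rfl⟩ h
  · exact hf.strictAntiOn.antitoneOn ⟨le_rfl, h1.le⟩ ⟨h, hs.2⟩ h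

theorem FluxCondition.lt_max (hf : FluxCondition R ρbar f) {s : ℝ} (hs : s ∈ Icc 0 R)
    (hne : s ≠ ρbar) : f s < f ρbar := by
  obtain ⟨h0, h1⟩ := hf.ρbar_mem
  rcases lt_or_gt_of_ne hne with h | h
  · exact hf.strictMonoOn ⟨hs.1, h.le⟩ ⟨h0.le, le_rfl⟩ h
  · exact hf.strictAntiOn ⟨le_rfl, h1.le⟩ ⟨h.le, hs.2⟩ h

theorem FluxCondition.max_pos (hf : FluxCondition R ρbar f) : 0 < f ρbar := by
  have := hf.lt_max ⟨le_rfl, hf.pos.le⟩ hf.ρbar_mem.1.ne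
  rwa [hf.map_zero] at this

/-- `f` is quasiconcave. -/
theorem FluxCondition.min_le (hf : FluxCondition R ρbar f) {a b s : ℝ} (ha : 0 ≤ a) (hb : b ≤ R)
    (hs : s ∈ Icc a b) : min (f a) (f b) ≤ f s := by
  rcases le_total s ρbar with h | h
  · exact (min_le_left _ _).trans
      (hf.strictMonoOn.monotoneOn ⟨ha, hs.1.trans h⟩ ⟨ha.trans hs.1, h⟩ hs.1)
  · exact (min_le_right _ _).trans
      (hf.strictAntiOn.antitoneOn ⟨h, hs.2.trans hb⟩ ⟨h.trans hs.2, hb⟩ hs.2)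

theorem FluxCondition.check_spec (hf : FluxCondition R ρbar f) {q : ℝ} (hq : q ∈ Icc 0 (f ρbar)) :
    checkρ ρbar f q ∈ Icc 0 ρbar ∧ f (checkρ ρbar f q) = q := by
  obtain ⟨h0, h1⟩ := hf.ρbar_mem
  have hc := hf.continuousOn.mono (Icc_subset_Icc le_rfl h1.le)
  have : q ∈ f '' Icc 0 ρbar := by
    have := intermediate_value_Icc h0.le hc
    rw [hf.map_zero] at this
    exact this hq
  exact ⟨Function.invFunOn_mem this, Function.invFunOn_eq this⟩

theorem FluxCondition.hat_spec (hf : FluxCondition R ρbar f) {q : ℝ} (hq : q ∈ Icc 0 (f ρbar)) :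
    hatρ R ρbar f q ∈ Icc ρbar R ∧ f (hatρ R ρbar f q) = q := by
  obtain ⟨h0, h1⟩ := hf.ρbar_mem
  have hc := hf.continuousOn.mono (Icc_subset_Icc h0.le le_rfl)
  have : q ∈ f '' Icc ρbar R := by
    have := intermediate_value_Icc' h1.le hc
    rw [hf.map_R] at this
    exact this hq
  exact ⟨Function.invFunOn_mem this, Function.invFunOn_eq this⟩

/-! ### Admissible pairs of traces -/

/-- The pairs of traces that satisfy the constraint `q` and the entropy condition at `x = 0`. -/
structure Germ (R : ℝ) (f : ℝ → ℝ) (q a b : ℝ) : Prop where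
  left_mem : a ∈ Icc 0 R
  right_mem : b ∈ Icc 0 R
  eq : f a = f b
  le : f a ≤ q
  entropy : a ≤ b ∨ f a = q

/-- Two admissible pairs for the same constraint dissipate. -/
theorem Germ.dissipation {q a b c d : ℝ} (hf : FluxCondition R ρbar f) (h : Germ R f q a b)
    (h' : Germ R f q c d) : 0 ≤ kflux f a c - kflux f b d := by
  have h1 := h.eq
  have h2 := h'.eq
  rcases le_total a c with hac | hac <;> rcases le_total b d with hbd | hbd
  · rw [kflux_of_le _ hac, kflux_of_le _ hbd]; linarith
  -- When the two components are ordered alike the terms cancel. Here the difference is `2 (f c - f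
  -- a)`: either `c ≤ d`, so that `c` lies between `a` and `b` and quasiconcavity applies, or `f c =
  -- q ≥ f a`. The next case is its mirror image.
  · rw [kflux_of_le _ hac, kflux_of_ge _ hbd]
    rcases h'.entropy with e | e
    · have := hf.min_le h.left_mem.1 h.right_mem.2 (s := c) ⟨hac, e.trans hbd⟩
      rw [← h1, min_self] at this
      linarith
    · linarith [h.le]
  · rw [kflux_of_ge _ hac, kflux_of_le _ hbd]
    rcases h.entropy with e | e
    · have := hf.min_le h'.left_mem.1 h'.right_mem.2 (s := a) ⟨hac, e.trans hbd⟩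
      rw [← h2, min_self] at this
      linarith
    · linarith [h'.le]
  · rw [kflux_of_ge _ hac, kflux_of_ge _ hbd]; linarith

/-- An admissible pair satisfies the entropy inequality at the interface. -/
theorem Germ.interface {q a b k : ℝ} (hf : FluxCondition R ρbar f) (h : Germ R f q a b)
    (hq : q ≤ f ρbar) (hk : k ∈ Icc 0 R) :
    0 ≤ kflux f a k - kflux f b k + 2 * ((1 - q / f ρbar) * f k) := by
  have h1 := h.eq
  have hm := hf.max_pos
  have hk0 := hf.nonneg k hk
  have h0 : 0 ≤ (1 - q / f ρbar) * f k :=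
    mul_nonneg (sub_nonneg.2 ((div_le_one hm).2 hq)) hk0
  rcases le_total a k with hak | hak <;> rcases le_total b k with hbk | hbk
  · rw [kflux_of_le _ hak, kflux_of_le _ hbk]; linarith
  · rw [kflux_of_le _ hak, kflux_of_ge _ hbk]
    have := hf.min_le h.left_mem.1 h.right_mem.2 (s := k) ⟨hak, hbk⟩
    rw [← h1, min_self] at this
    linarith
  · rw [kflux_of_ge _ hak, kflux_of_le _ hbk]
    rcases h.entropy with e | e
    · have : a = k := le_antisymm (e.trans hbk) hak
      rw [this] at h1 ⊢
      linarith
    -- Here `f a = f b = q`, and the sum reduces to `2 q (1 - f k / f ρbar)`.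
    · have h2 := hf.nonneg a h.left_mem
      have h3 : q * (f k / f ρbar) ≤ q * 1 :=
        mul_le_mul_of_nonneg_left ((div_le_one hm).2 (hf.le_max hk)) (e ▸ h2)
      have h4 : (1 - q / f ρbar) * f k = f k - q * (f k / f ρbar) := by ring
      linarith
  · rw [kflux_of_ge _ hak, kflux_of_ge _ hbk]; linarith

/-- The interface inequalities for `k = 0`, `k = R` and `k = ρbar` characterise admissibility. -/
theorem Germ.of_interface {q a b : ℝ} (hf : FluxCondition R ρbar f) (ha : a ∈ Icc 0 R)
    (hb : b ∈ Icc 0 R) (haq : f a ≤ q)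
    (h : ∀ k, k = 0 ∨ k = R ∨ k = ρbar →
      0 ≤ kflux f a k - kflux f b k + 2 * ((1 - q / f ρbar) * f k)) : Germ R f q a b := by
  have h0 := h 0 (Or.inl rfl)
  have hR := h R (Or.inr (Or.inl rfl))
  have hm := h ρbar (Or.inr (Or.inr rfl))
  rw [kflux_of_ge _ ha.1, kflux_of_ge _ hb.1, hf.map_zero] at h0
  rw [kflux_of_le _ ha.2, kflux_of_le _ hb.2, hf.map_R] at hR
  -- The interface term vanishes for `k = 0` and `k = R`, where `f k = 0`; the two inequalities
  -- compare the fluxes in opposite directions.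
  have he : f a = f b := by linarith
  refine ⟨ha, hb, he, haq, ?_⟩
  rcases le_or_gt a b with hab | hab
  · exact Or.inl hab
  right
  -- Equal fluxes at `b < a` force `b ≤ ρbar ≤ a`; then `k = ρbar` separates the two traces and the
  -- interface inequality reads `q ≤ f a`.
  have h1 : b ≤ ρbar := by
    by_contra! hc
    exact (hf.strictAntiOn ⟨hc.le, hb.2⟩ ⟨hc.le.trans hab.le, ha.2⟩ hab).ne he
  have h2 : ρbar ≤ a := by
    by_contra! hc
    exact (hf.strictMonoOn ⟨hb.1, hab.le.trans hc.le⟩ ⟨ha.1, hc.le⟩ hab).ne he.symm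
  rw [kflux_of_ge _ h2, kflux_of_le _ h1] at hm
  have : (1 - q / f ρbar) * f ρbar = f ρbar - q := by
    have := hf.max_pos.ne'
    field_simp
  linarith

end

section

/-! ### Solutions on the line with an interface term -/

/-- The reflection `(t,x) ↦ (t,-x)`. -/
def reflect (z : ℝ × ℝ) : ℝ × ℝ := (z.1, -z.2)

theorem reflect_smooth : ContDiff ℝ ∞ reflect := contDiff_fst.prodMk contDiff_snd.neg

theorem reflect_reflect (z : ℝ × ℝ) : reflect (reflect z) = z := by simp [reflect]

theorem measurable_reflect : Measurable reflect := measurable_fst.prodMk measurable_snd.neg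

/-- The reflection as a measurable equivalence. -/
def reflectEquiv : ℝ × ℝ ≃ᵐ ℝ × ℝ where
  toFun := reflect
  invFun := reflect
  left_inv := reflect_reflect
  right_inv := reflect_reflect
  measurable_toFun := measurable_reflect
  measurable_invFun := measurable_reflect

theorem reflect_measurePreserving : MeasurePreserving reflect := by
  have := (MeasurePreserving.id (volume : Measure ℝ)).prod
    (Measure.measurePreserving_neg (volume : Measure ℝ))
  exact this

theorem integral_reflect (g : ℝ × ℝ → ℝ) : ∫ z, g (reflect z) = ∫ z, g z :=
  reflect_measurePreserving.integral_comp reflectEquiv.measurableEmbedding g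

theorem setIntegral_reflect (g : ℝ × ℝ → ℝ) (s t : Set ℝ) :
    ∫ z in s ×ˢ t, g (reflect z) = ∫ z in s ×ˢ (-t), g z := by
  have e : reflect ⁻¹' (s ×ˢ (-t)) = s ×ˢ t := by
    ext z; simp [reflect]
  rw [← e]
  exact reflect_measurePreserving.setIntegral_preimage_emb reflectEquiv.measurableEmbedding g _

theorem hasCompactSupport_reflect {φ : ℝ × ℝ → ℝ} (hc : HasCompactSupport φ) :
    HasCompactSupport fun z => φ (reflect z) :=
  hc.comp_homeomorph ((Homeomorph.refl ℝ).prodCongr (Homeomorph.neg ℝ))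

theorem fderiv_reflect_fst {φ : ℝ × ℝ → ℝ} (hs : ContDiff ℝ ∞ φ) (z : ℝ × ℝ) :
    fderiv ℝ (fun z => φ (reflect z)) z (1, 0) = fderiv ℝ φ (reflect z) (1, 0) :=
  (fderiv_fst_eq_deriv ((hs.comp reflect_smooth).differentiable (by simp)) z).unique
    (fderiv_fst_eq_deriv (hs.differentiable (by simp)) (reflect z))

theorem fderiv_reflect_snd {φ : ℝ × ℝ → ℝ} (hs : ContDiff ℝ ∞ φ) (z : ℝ × ℝ) :
    fderiv ℝ (fun z => φ (reflect z)) z (0, 1) = -fderiv ℝ φ (reflect z) (0, 1) := by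
  refine (fderiv_snd_eq_deriv ((hs.comp reflect_smooth).differentiable (by simp)) z).unique ?_
  have e : HasDerivAt (fun x : ℝ => -x) (-1) z.2 := hasDerivAt_neg z.2
  have := (fderiv_snd_eq_deriv (hs.differentiable (by simp)) (reflect z)).comp z.2 e
  convert! this using 1
  ring

/-- `u` is a solution on `]0,T[ × ℝ` with flux `F`, values in `[0,R]`, Riemann datum `(a,b)`, traces
`γ` and `δ` at `x = 0-` and `x = 0+`, and constraint `q`; the maximal flux is `m`. -/
structure LineSol (F : ℝ → ℝ) (m R T a b : ℝ) (u : ℝ × ℝ → ℝ) (γ δ q : ℝ → ℝ) : Prop where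
  measurable : Measurable u
  mem : ∀ z, u z ∈ Icc 0 R
  left_measurable : Measurable γ
  left_mem : ∀ t, γ t ∈ Icc 0 R
  right_measurable : Measurable δ
  right_mem : ∀ t, δ t ∈ Icc 0 R
  q_measurable : Measurable q
  q_mem : ∀ t, q t ∈ Icc 0 m
  leftDatum_mem : a ∈ Icc 0 R
  rightDatum_mem : b ∈ Icc 0 R
  entropy : ∀ k ∈ Icc 0 R, ∀ φ : ℝ × ℝ → ℝ, ContDiff ℝ ∞ φ → HasCompactSupport φ →
    (∀ z ∈ tsupport φ, z.1 < T) → (∀ z, 0 ≤ φ z) →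
    0 ≤ (∫ z in Ioi 0 ×ˢ univ, (|u z - k| * fderiv ℝ φ z (1, 0) +
      kflux F (u z) k * fderiv ℝ φ z (0, 1))) + 2 * (∫ t in Ioi 0, (1 - q t / m) * F k * φ (t, 0))
      + ∫ x, |riemannDatum a b x - k| * φ (0, x)
  left_trace : HasTrace T u γ
  right_trace : HasTrace T (fun z => u (reflect z)) δ

variable {F : ℝ → ℝ} {K m R T a b : ℝ} {u v : ℝ × ℝ → ℝ} {γ δ q : ℝ → ℝ}

/-- Tests that vanish for `x ≥ 0` see neither the interface term nor the right datum. -/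
theorem LineSol.left (h : LineSol F m R T a b u γ δ q) : HalfSol F R T a u γ where
  measurable := h.measurable
  mem := h.mem
  trace_measurable := h.left_measurable
  trace_mem := h.left_mem
  datum_mem := h.leftDatum_mem
  trace := h.left_trace
  entropy k hk φ hs hc ht hn h0 := by
    have := h.entropy k hk φ hs hc ht hn
    have e1 : ∀ t : ℝ, φ (t, 0) = 0 := fun t => h0 _ le_rfl
    have e2 : ∀ x, |riemannDatum a b x - k| * φ (0, x) = |a - k| * φ (0, x) := by
      intro x
      rcases lt_or_ge x 0 with hx | hx
      · simp [riemannDatum, hx]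
      · simp [h0 (0, x) hx]
    simp only [e1, e2, mul_zero, integral_zero, add_zero] at this
    exact this

/-- Reflecting `x` turns the right half-line into the left one and changes the sign of the flux; all
half-line estimates then apply. -/
theorem LineSol.right (h : LineSol F m R T a b u γ δ q) :
    HalfSol (fun s => -F s) R T b (fun z => u (reflect z)) δ where
  measurable := h.measurable.comp measurable_reflect
  mem z := h.mem _
  trace_measurable := h.right_measurable
  trace_mem := h.right_mem
  datum_mem := h.rightDatum_mem
  trace := h.right_trace
  entropy k hk φ hs hc ht hn h0 := by
    have hc' := hasCompactSupport_reflect hc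
    have ht' : ∀ z ∈ tsupport fun z => φ (reflect z), z.1 < T := by
      intro z hz
      have := tsupport_comp_subset_preimage φ reflect_smooth.continuous hz
      exact ht (reflect z) this
    have := h.entropy k hk (fun z => φ (reflect z)) (hs.comp reflect_smooth) hc' ht' (fun z => hn _)
    have e1 : ∀ t : ℝ, φ (reflect (t, 0)) = 0 := fun t => h0 _ (by simp [reflect])
    have e2 : ∀ x, |riemannDatum a b x - k| * φ (reflect (0, x)) = |b - k| * φ (0, -x) := by
      intro x
      rcases lt_or_ge x 0 with hx | hx
      · simp [reflect, h0 (0, -x) (by simpa using hx.le)]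
      · simp [riemannDatum, not_lt.2 hx, reflect]
    have e3 : ∫ x, |b - k| * φ (0, -x) = ∫ x, |b - k| * φ (0, x) :=
      integral_neg_eq_self (fun x => |b - k| * φ (0, x)) volume
    simp only [e1, e2, mul_zero, integral_zero, add_zero, e3] at this
    simp only [fderiv_reflect_fst hs, fderiv_reflect_snd hs] at this
    have p3 := setIntegral_reflect (fun z => |u (reflect z) - k| * fderiv ℝ φ z (1, 0) +
      kflux F (u (reflect z)) k * -fderiv ℝ φ z (0, 1)) (Ioi 0) univ
    simp only [reflect_reflect, neg_univ] at p3
    rw [p3] at this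
    simp only [kflux_neg]
    simpa only [neg_mul, mul_neg] using this

/-- The mean over a thin layer converges to the trace. -/
theorem HasTrace.tendsto_layer {H : ℝ × ℝ → ℝ} {β p : ℝ → ℝ} {C P s : ℝ} (h : HasTrace T H β)
    (mH : Measurable H) (bH : ∀ z, |H z| ≤ C) (mβ : Measurable β) (bβ : ∀ t, |β t| ≤ C)
    (mp : Measurable p) (bp : ∀ t, |p t| ≤ P) (hs : s < T) (sp : ∀ t, p t ≠ 0 → t ∈ Ioo 0 s) :
    Tendsto (fun ε : ℝ => ∫ z : ℝ × ℝ,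
      H z * (p z.1 * (ε⁻¹ * deriv smoothTransition (-z.2 / ε - 1))))
      (𝓝[>] 0) (𝓝 (∫ t, p t * β t)) := by
  obtain ⟨D, hD0, hD⟩ := exists_deriv_step_le
  have mS := continuous_deriv_step.measurable
  have hP : 0 ≤ P := (abs_nonneg _).trans (bp 0)
  have hC : 0 ≤ C := (abs_nonneg _).trans (bH 0)
  have lim : Tendsto (fun ε : ℝ => 2 * P * D *
      ((2 * ε)⁻¹ * ∫ z in Ioo 0 s ×ˢ Ioo (-(2 * ε)) 0, |H z - β z.1|)) (𝓝[>] 0) (𝓝 0) := by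
    have := ((h s hs).comp (tendsto_mul_nhdsGT two_pos)).const_mul (2 * P * D)
    rwa [mul_zero] at this
  rw [tendsto_iff_norm_sub_tendsto_zero]
  refine squeeze_zero' (Eventually.of_forall fun ε => norm_nonneg _) ?_ lim
  filter_upwards [self_mem_nhdsWithin] with ε hε
  have hε : 0 < ε := hε
  set L : ℝ → ℝ := fun x => ε⁻¹ * deriv smoothTransition (-x / ε - 1) with hL
  have hLs : ∀ x, L x ≠ 0 → x ∈ Ioo (-(2 * ε)) 0 := by
    intro x hx
    have hx' : deriv smoothTransition (-x / ε - 1) ≠ 0 := right_ne_zero_of_mul hx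
    constructor
    · by_contra hc
      refine hx' (deriv_step_of_one_le ?_)
      have : 2 ≤ -x / ε := by rw [le_div_iff₀ hε]; linarith
      linarith
    · by_contra hc
      refine hx' (deriv_step_of_nonpos ?_)
      have : -x / ε ≤ 0 := div_nonpos_of_nonpos_of_nonneg (by linarith) hε.le
      linarith
  have bL : ∀ x, |L x| ≤ ε⁻¹ * D := fun x => by
    rw [hL, abs_mul, abs_of_pos (inv_pos.2 hε)]
    exact mul_le_mul_of_nonneg_left (hD _) (inv_pos.2 hε).le
  have mL : Measurable L := by rw [hL]; fun_prop
  have sup : ∀ {g : ℝ × ℝ → ℝ} (z : ℝ × ℝ), g z * (p z.1 * L z.2) ≠ 0 →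
      z ∈ Icc 0 s ×ˢ Icc (-(2 * ε)) 0 := fun z hz => by
    have h1 := right_ne_zero_of_mul hz
    exact ⟨Ioo_subset_Icc_self (sp _ (left_ne_zero_of_mul h1)),
      Ioo_subset_Icc_self (hLs _ (right_ne_zero_of_mul h1))⟩
  have bpL : ∀ z : ℝ × ℝ, |p z.1 * L z.2| ≤ P * (ε⁻¹ * D) := fun z => by
    rw [abs_mul]; exact mul_le_mul (bp _) (bL _) (abs_nonneg _) hP
  have int : ∀ {g : ℝ × ℝ → ℝ}, Measurable g → (∀ z, |g z| ≤ C) →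
      Integrable fun z : ℝ × ℝ => g z * (p z.1 * L z.2) := by
    intro g mg bg
    refine integrable_of_bounded_box (C := C * (P * (ε⁻¹ * D))) (by fun_prop) (fun z => ?_) sup
    rw [abs_mul]; exact mul_le_mul (bg _) (bpL z) (abs_nonneg _) hC
  have e1 : ∫ t, p t * β t = ∫ z : ℝ × ℝ, β z.1 * (p z.1 * L z.2) := by
    have : ∫ z : ℝ × ℝ, (p z.1 * β z.1) * L z.2 = (∫ t, p t * β t) * ∫ x, L x := by
      rw [Measure.volume_eq_prod]
      exact integral_prod_mul (fun t => p t * β t) L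
    rw [integral_scaled_deriv_step hε, mul_one] at this
    rw [← this]; congr 1; funext z; ring
  rw [e1, ← integral_sub (int mH bH) (int (g := fun z => β z.1) (by fun_prop) fun z => bβ _)]
  have hI : IntegrableOn (fun z : ℝ × ℝ => H z - β z.1) (Ioo 0 s ×ˢ Ioo (-(2 * ε)) 0) :=
    integrableOn_of_bounded' (C := C + C) (by fun_prop)
      (fun z => (abs_sub _ _).trans (add_le_add (bH _) (bβ _)))
      (volume_Ioo_prod_Ioo_ne_top _ _ _ _)
  have := abs_integral_le_of_dominated (μ := volume)
    (f := fun z : ℝ × ℝ => H z * (p z.1 * L z.2) - β z.1 * (p z.1 * L z.2)) (c := P * (ε⁻¹ * D))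
    (measurableSet_Ioo.prod measurableSet_Ioo) hI (fun z _ => by
      rw [← sub_mul, abs_mul, mul_comm]
      exact mul_le_mul_of_nonneg_right (bpL z) (abs_nonneg _)) (fun z hz => by
      rw [← sub_mul]
      by_contra hne
      have h1 := right_ne_zero_of_mul hne
      exact hz ⟨sp _ (left_ne_zero_of_mul h1), hLs _ (right_ne_zero_of_mul h1)⟩)
  rw [Real.norm_eq_abs]
  refine this.trans (le_of_eq ?_)
  field_simp

/-- The plateau `1 - S(-x/ε-1) - S(x/ε-1)`. -/
def plateau (ε x : ℝ) : ℝ := 1 - smoothTransition (-x / ε - 1) - smoothTransition (x / ε - 1)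

theorem plateau_smooth (ε : ℝ) : ContDiff ℝ ∞ (plateau ε) := by
  have hS : ContDiff ℝ ∞ smoothTransition := Real.smoothTransition.contDiff
  exact (contDiff_const.sub (hS.comp ((contDiff_id.neg.div_const ε).sub contDiff_const))).sub
    (hS.comp ((contDiff_id.div_const ε).sub contDiff_const))

theorem plateau_hasDerivAt (ε x : ℝ) : HasDerivAt (plateau ε)
    (ε⁻¹ * deriv smoothTransition (-x / ε - 1) - ε⁻¹ * deriv smoothTransition (x / ε - 1)) x := by
  have h1 : HasDerivAt (fun x : ℝ => -x / ε - 1) (-ε⁻¹) x := by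
    have := ((hasDerivAt_neg x).div_const ε).sub_const 1
    convert! this using 1; rw [neg_div, one_div]
  have h2 : HasDerivAt (fun x : ℝ => x / ε - 1) ε⁻¹ x := by
    have := ((hasDerivAt_id x).div_const ε).sub_const 1
    convert! this using 1; rw [one_div]
  have := (((hasDerivAt_step _).comp x h1).const_sub 1).sub ((hasDerivAt_step _).comp x h2)
  convert! this using 1; ring

theorem plateau_zero (ε : ℝ) : plateau ε 0 = 1 := by
  unfold plateau
  rw [Real.smoothTransition.zero_of_nonpos (by simp), Real.smoothTransition.zero_of_nonpos (by simp)]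
  ring

theorem plateau_mem {ε : ℝ} (hε : 0 < ε) (x : ℝ) : plateau ε x ∈ Icc 0 1 := by
  have h1 := Real.smoothTransition.nonneg (-x / ε - 1)
  have h2 := Real.smoothTransition.nonneg (x / ε - 1)
  refine ⟨?_, by unfold plateau; linarith⟩
  unfold plateau
  rcases le_total x 0 with hx | hx
  · have : x / ε ≤ 0 := div_nonpos_of_nonpos_of_nonneg hx hε.le
    rw [Real.smoothTransition.zero_of_nonpos (x := x / ε - 1) (by linarith)]
    linarith [Real.smoothTransition.le_one (-x / ε - 1)]
  · have : -x / ε ≤ 0 := div_nonpos_of_nonpos_of_nonneg (by linarith) hε.le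
    rw [Real.smoothTransition.zero_of_nonpos (x := -x / ε - 1) (by linarith)]
    linarith [Real.smoothTransition.le_one (x / ε - 1)]

theorem plateau_support {ε x : ℝ} (hε : 0 < ε) (hx : plateau ε x ≠ 0) :
    x ∈ Icc (-(2 * ε)) (2 * ε) := by
  constructor
  · by_contra h
    apply hx
    unfold plateau
    have h1 : 2 ≤ -x / ε := by rw [le_div_iff₀ hε]; linarith
    have h2 : x / ε ≤ 0 := div_nonpos_of_nonpos_of_nonneg (by linarith) hε.le
    rw [Real.smoothTransition.one_of_one_le (x := -x / ε - 1) (by linarith),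
      Real.smoothTransition.zero_of_nonpos (x := x / ε - 1) (by linarith)]; ring
  · by_contra h
    apply hx
    unfold plateau
    have h1 : 2 ≤ x / ε := by rw [le_div_iff₀ hε]; linarith
    have h2 : -x / ε ≤ 0 := div_nonpos_of_nonpos_of_nonneg (by linarith) hε.le
    rw [Real.smoothTransition.one_of_one_le (x := x / ε - 1) (by linarith),
      Real.smoothTransition.zero_of_nonpos (x := -x / ε - 1) (by linarith)]; ring

/-- The entropy inequality at the interface. -/
theorem LineSol.interface (hF : Lip K F) (h : LineSol F m R T a b u γ δ q) {k : ℝ}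
    (hk : k ∈ Icc 0 R) : ∀ᵐ t, t ∈ Ioo 0 T →
      0 ≤ kflux F (γ t) k - kflux F (δ t) k + 2 * ((1 - q t / m) * F k) := by
  have mγ := h.left_measurable
  have mδ := h.right_measurable
  have mq := h.q_measurable
  have mu := h.measurable
  have mk : Measurable fun s => kflux F s k :=
    hF.continuous_kflux.measurable.comp (measurable_id.prodMk measurable_const)
  have mr := measurable_reflect
  have hR : 0 ≤ R := hk.1.trans hk.2
  have bq : ∀ t, |(1 - q t / m) * F k| ≤ |F k| := by
    intro t
    rw [abs_mul]
    refine mul_le_of_le_one_left (abs_nonneg _) ?_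
    obtain ⟨h0, h1⟩ := h.q_mem t
    have h2 : 0 ≤ q t / m := div_nonneg h0 (h0.trans h1)
    have h3 : q t / m ≤ 1 := div_le_one_of_le₀ h1 (h0.trans h1)
    rw [abs_le]; constructor <;> linarith
  have bγ : ∀ t, |kflux F (γ t) k| ≤ K * R := fun t => hF.abs_kflux_le (h.left_mem t) hk
  have bδ : ∀ t, |kflux F (δ t) k| ≤ K * R := fun t => hF.abs_kflux_le (h.right_mem t) hk
  have bu : ∀ z, |kflux F (u z) k| ≤ K * R := fun z => hF.abs_kflux_le (h.mem z) hk
  refine ae_nonneg_of_forall_test ?_ ?_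
  · have hm : Measurable fun t =>
        kflux F (γ t) k - kflux F (δ t) k + 2 * ((1 - q t / m) * F k) := by fun_prop
    rw [locallyIntegrable_iff]
    intro s hs
    refine integrableOn_of_bounded' (C := K * R + K * R + 2 * |F k|) hm (fun t => ?_)
      hs.measure_lt_top.ne
    refine (abs_add_le _ _).trans (add_le_add ((abs_sub _ _).trans (add_le_add (bγ t) (bδ t))) ?_)
    rw [abs_mul, abs_two]
    exact mul_le_mul_of_nonneg_left (bq t) two_pos.le
  intro p hps hpc hpT hp0
  obtain ⟨P, hP0, hP⟩ := Continuous.exists_abs_le_of_compact hps.continuous hpc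
  obtain ⟨P', hP'0, hP'⟩ := Continuous.exists_abs_le_of_compact
    (hps.continuous_deriv (by simp)) hpc.deriv
  have hpd : ∀ t, HasDerivAt p (deriv p t) t := fun t =>
    (hps.differentiable (by simp) t).hasDerivAt
  -- a time before `T` after which `p` vanishes
  obtain ⟨s, hsT, hs⟩ : ∃ s < T, tsupport p ⊆ Ioo 0 s := by
    rcases (tsupport p).eq_empty_or_nonempty with he | hne
    · exact ⟨T - 1, by linarith, by rw [he]; exact empty_subset _⟩
    · obtain ⟨c, hc, hmax⟩ := hpc.isCompact.exists_isMaxOn hne continuous_id.continuousOn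
      refine ⟨(c + T) / 2, by linarith [(hpT hc).2], fun t ht => ⟨(hpT ht).1, ?_⟩⟩
      have : t ≤ c := hmax ht
      linarith [(hpT hc).2]
  have sp : ∀ t, p t ≠ 0 → t ∈ Ioo 0 s := fun t ht => hs (subset_tsupport _ ht)
  have sp' : ∀ t, deriv p t ≠ 0 → t ∈ Ioo 0 s := fun t ht => by
    refine hs (by_contra fun hc => ht ?_)
    exact image_eq_zero_of_notMem_tsupport (fun h' => hc (tsupport_deriv_subset h'))
  have hL := HasTrace.tendsto_layer (T := T) (H := fun z => kflux F (u z) k)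
    (β := fun t => kflux F (γ t) k) (C := K * R)
    (h.left_trace.of_le h.left_trace (C := R) (c := 2 * K) mu mγ mu mγ
      (fun z => abs_le_of_mem (h.mem z)) (fun t => abs_le_of_mem (h.left_mem t))
      (fun z => abs_le_of_mem (h.mem z)) (fun t => abs_le_of_mem (h.left_mem t))
      (fun z => (hF.kflux_sub_le _ _ _ _).trans (mul_le_mul_of_nonneg_left
        (by rw [sub_self, abs_zero]; exact add_le_add_right (abs_nonneg _) _)
        (by linarith [hF.1]))))
    (by fun_prop) bu (by fun_prop) bγ hps.continuous.measurable hP hsT sp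
  have hRt := HasTrace.tendsto_layer (T := T) (H := fun z => kflux F (u (reflect z)) k)
    (β := fun t => kflux F (δ t) k) (C := K * R)
    (h.right_trace.of_le h.right_trace (C := R) (c := 2 * K) (by fun_prop) mδ (by fun_prop) mδ
      (fun z => abs_le_of_mem (h.mem _)) (fun t => abs_le_of_mem (h.right_mem t))
      (fun z => abs_le_of_mem (h.mem _)) (fun t => abs_le_of_mem (h.right_mem t))
      (fun z => (hF.kflux_sub_le _ _ _ _).trans (mul_le_mul_of_nonneg_left
        (by rw [sub_self, abs_zero]; exact add_le_add_right (abs_nonneg _) _)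
        (by linarith [hF.1]))))
    (by fun_prop) (fun z => bu _) (by fun_prop) bδ hps.continuous.measurable hP hsT sp
  have hA : Tendsto (fun ε : ℝ => R * P' * (volume.real (Ioo 0 s) * (4 * ε))) (𝓝[>] 0) (𝓝 0) := by
    have : Tendsto (fun ε : ℝ => R * P' * (volume.real (Ioo 0 s) * (4 * ε))) (𝓝 0)
        (𝓝 (R * P' * (volume.real (Ioo 0 s) * (4 * 0)))) := by
      apply Continuous.tendsto; fun_prop
    simp only [mul_zero] at this
    exact this.mono_left nhdsWithin_le_nhds
  set Q := ∫ t, p t * ((1 - q t / m) * F k) with hQ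
  have lim := ((hA.add (hL.sub hRt)).add_const (2 * Q))
  rw [zero_add] at lim
  have ip : ∀ {g : ℝ → ℝ} {C : ℝ}, Measurable g → (∀ t, |g t| ≤ C) →
      Integrable fun t => p t * g t := by
    intro g C mg bg
    refine integrable_of_bounded_Icc (a := 0) (b := s) (C := P * C)
      (hps.continuous.measurable.mul mg) (fun t => ?_)
      (fun t ht => Ioo_subset_Icc_self (sp t (left_ne_zero_of_mul ht)))
    rw [abs_mul]; exact mul_le_mul (hP t) (bg t) (abs_nonneg _) hP0
  have i1 := ip (by fun_prop) bγ
  have i2 := ip (by fun_prop) bδ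
  have i3 := ip (by fun_prop) bq
  have final : ∫ t, p t * (kflux F (γ t) k - kflux F (δ t) k + 2 * ((1 - q t / m) * F k)) =
      (∫ t, p t * kflux F (γ t) k) - (∫ t, p t * kflux F (δ t) k) + 2 * Q := by
    have e : (fun t => p t * (kflux F (γ t) k - kflux F (δ t) k + 2 * ((1 - q t / m) * F k))) =
        fun t => (p t * kflux F (γ t) k - p t * kflux F (δ t) k) +
          2 * (p t * ((1 - q t / m) * F k)) := by
      funext t; ring
    have i12 : Integrable fun t => p t * kflux F (γ t) k - p t * kflux F (δ t) k := i1.sub i2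
    rw [e, integral_add i12 (i3.const_mul 2), integral_sub i1 i2, integral_const_mul]
  rw [final]
  refine ge_of_tendsto lim ?_
  filter_upwards [self_mem_nhdsWithin] with ε hε
  have hε : 0 < ε := hε
  -- The plateau is one at `x = 0`, and its space derivative is an approximate identity at `0-`
  -- minus one at `0+`, which produces the two traces with opposite signs. The term with the time
  -- derivative is of order `ε`.
  set φ : ℝ × ℝ → ℝ := fun z => p z.1 * plateau ε z.2 with hφ
  have hφs : ContDiff ℝ ∞ φ := (hps.comp contDiff_fst).mul ((plateau_smooth ε).comp contDiff_snd)
  have hφd : Differentiable ℝ φ := hφs.differentiable (by simp)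
  have hsupp : tsupport φ ⊆ tsupport p ×ˢ Icc (-(2 * ε)) (2 * ε) := by
    refine closure_minimal (fun z hz => ?_) ((isClosed_tsupport p).prod isClosed_Icc)
    exact ⟨subset_tsupport _ (left_ne_zero_of_mul hz), plateau_support hε (right_ne_zero_of_mul hz)⟩
  have hφc : HasCompactSupport φ :=
    (hpc.isCompact.prod isCompact_Icc).of_isClosed_subset (isClosed_tsupport _) hsupp
  have hE := h.entropy k hk φ hφs hφc (fun z hz => (hpT (hsupp hz).1).2)
    (fun z => mul_nonneg (hp0 _) (plateau_mem hε _).1)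
  have p0 : p 0 = 0 := by
    by_contra hc; exact lt_irrefl _ (sp 0 hc).1
  have mpl : Measurable (plateau ε) := (plateau_smooth ε).continuous.measurable
  have mp' : Measurable (deriv p) := (hps.continuous_deriv (by simp)).measurable
  simp only [hφ, fderiv_mul_fst (hpd _) hφd, fderiv_mul_snd (plateau_hasDerivAt ε _) hφd,
    plateau_zero, p0, zero_mul, mul_zero, integral_zero, add_zero, mul_one] at hE
  have eQ : ∫ t in Ioi 0, (1 - q t / m) * F k * p t = Q := by
    rw [hQ, setIntegral_eq_integral_of_forall_compl_eq_zero]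
    · congr 1; funext t; ring
    · intro t ht
      have : p t = 0 := by by_contra hc; exact ht (sp t hc).1
      rw [this, mul_zero]
  rw [eQ] at hE
  set f₁ : ℝ × ℝ → ℝ := fun z => |u z - k| * (deriv p z.1 * plateau ε z.2) with hf₁
  set f₂ : ℝ × ℝ → ℝ := fun z =>
    kflux F (u z) k * (p z.1 * (ε⁻¹ * deriv smoothTransition (-z.2 / ε - 1))) with hf₂
  set f₃ : ℝ × ℝ → ℝ := fun z => kflux F (u (reflect z)) k *
    (p z.1 * (ε⁻¹ * deriv smoothTransition (-z.2 / ε - 1))) with hf₃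
  obtain ⟨D, hD0, hD⟩ := exists_deriv_step_le
  have mS := continuous_deriv_step.measurable
  have mp := hps.continuous.measurable
  have supS : ∀ x, deriv smoothTransition (-x / ε - 1) ≠ 0 → x ∈ Icc (-(2 * ε)) 0 := by
    intro x hx'
    constructor
    · by_contra hc
      refine hx' (deriv_step_of_one_le ?_)
      have : 2 ≤ -x / ε := by rw [le_div_iff₀ hε]; linarith
      linarith
    · by_contra hc
      refine hx' (deriv_step_of_nonpos ?_)
      have : -x / ε ≤ 0 := div_nonpos_of_nonpos_of_nonneg (by linarith) hε.le
      linarith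
  have iL : ∀ {g : ℝ × ℝ → ℝ}, Measurable g → (∀ z, |g z| ≤ K * R) → Integrable fun z : ℝ × ℝ =>
      g z * (p z.1 * (ε⁻¹ * deriv smoothTransition (-z.2 / ε - 1))) := by
    intro g mg bg
    refine integrable_of_bounded_box (a := 0) (b := s) (c := -(2 * ε)) (d := 0)
      (C := K * R * (P * (ε⁻¹ * D))) (by fun_prop) (fun z => ?_) (fun z hz => ?_)
    · rw [abs_mul, abs_mul, abs_mul, abs_of_pos (inv_pos.2 hε)]
      have h1 := mul_le_mul_of_nonneg_left (hD (-z.2 / ε - 1)) (inv_pos.2 hε).le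
      have h2 : 0 ≤ ε⁻¹ * |deriv smoothTransition (-z.2 / ε - 1)| :=
        mul_nonneg (inv_pos.2 hε).le (abs_nonneg _)
      exact mul_le_mul (bg z) (mul_le_mul (hP _) h1 h2 hP0) (mul_nonneg (abs_nonneg _) h2)
        ((abs_nonneg _).trans (bg z))
    · have h1 := right_ne_zero_of_mul hz
      exact ⟨Ioo_subset_Icc_self (sp _ (left_ne_zero_of_mul h1)),
        supS _ (right_ne_zero_of_mul (right_ne_zero_of_mul h1))⟩
  have j2 : Integrable f₂ := iL (by fun_prop) bu
  have j3 : Integrable f₃ := iL (by fun_prop) (fun z => bu _)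
  have j3' : Integrable fun z => f₃ (reflect z) :=
    (reflect_measurePreserving.integrable_comp_emb reflectEquiv.measurableEmbedding).2 j3
  have b1 : ∀ z, |f₁ z| ≤ R * P' := by
    intro z
    rw [hf₁, abs_mul, abs_mul, abs_abs]
    have h1 := plateau_mem hε z.2
    have h2 : |plateau ε z.2| ≤ 1 := by rw [abs_of_nonneg h1.1]; exact h1.2
    have h3 := mul_le_mul (hP' z.1) h2 (abs_nonneg _) hP'0
    rw [mul_one] at h3
    exact mul_le_mul (abs_sub_le_of_mem (h.mem z) hk) h3
      (mul_nonneg (abs_nonneg _) (abs_nonneg _)) hR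
  have s1 : ∀ z, f₁ z ≠ 0 → z ∈ Ioo 0 s ×ˢ Icc (-(2 * ε)) (2 * ε) := fun z hz => by
    have h1 := right_ne_zero_of_mul hz
    exact ⟨sp' _ (left_ne_zero_of_mul h1), plateau_support hε (right_ne_zero_of_mul h1)⟩
  have j1 : Integrable f₁ := integrable_of_bounded_box (C := R * P') (by fun_prop) b1
    (fun z hz => ⟨Ioo_subset_Icc_self (s1 z hz).1, (s1 z hz).2⟩)
  have n1 : ∫ z, f₁ z ≤ R * P' * (volume.real (Ioo 0 s) * (4 * ε)) := by
    rw [← setIntegral_eq_integral_of_forall_compl_eq_zero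
      (s := Ioo 0 s ×ˢ Icc (-(2 * ε)) (2 * ε)) (fun z hz => by_contra fun hc => hz (s1 z hc))]
    have := norm_setIntegral_le_of_norm_le_const (f := f₁) (μ := volume) (C := R * P')
      (volume_prod_lt_top (s := Ioo 0 s) (t := Icc (-(2 * ε)) (2 * ε)) measure_Ioo_lt_top
        measure_Icc_lt_top) (fun z _ => b1 z)
    rw [Measure.volume_eq_prod, measureReal_prod_prod,
      Real.volume_real_Icc_of_le (by linarith)] at this
    refine (le_abs_self _).trans (this.trans (le_of_eq ?_))
    ring
  have hsplit : ∫ z in Ioi 0 ×ˢ univ, (|u z - k| * (deriv p z.1 * plateau ε z.2) +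
      kflux F (u z) k * (p z.1 * (ε⁻¹ * deriv smoothTransition (-z.2 / ε - 1) -
        ε⁻¹ * deriv smoothTransition (z.2 / ε - 1)))) =
      (∫ z, f₁ z) + ((∫ z, f₂ z) - ∫ z, f₃ z) := by
    rw [← integral_reflect f₃, ← integral_sub j2 j3']
    have j23 : Integrable fun z => f₂ z - f₃ (reflect z) := j2.sub j3'
    rw [← integral_add j1 j23, setIntegral_eq_integral_of_forall_compl_eq_zero]
    · congr 1; funext z
      simp only [hf₁, hf₂, hf₃, reflect_reflect]
      simp only [reflect, neg_neg]
      ring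
    · intro z hz
      have e1 : p z.1 = 0 := by
        by_contra hc; exact hz ⟨(sp _ hc).1, mem_univ _⟩
      have e2 : deriv p z.1 = 0 := by
        by_contra hc; exact hz ⟨(sp' _ hc).1, mem_univ _⟩
      rw [e1, e2]; ring
  rw [hsplit] at hE
  linarith

/-- Admissibility is detected by three Kružkov constants, so the exceptional sets of times combine
into one null set. -/
theorem LineSol.germ {ρbar : ℝ} {f : ℝ → ℝ} (hf : FluxCondition R ρbar f)
    (h : LineSol (extFlux R f) (f ρbar) R T a b u γ δ q)
    (hq : ∀ᵐ t, t ∈ Ioo 0 T → f (γ t) ≤ q t) :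
    ∀ᵐ t, t ∈ Ioo 0 T → Germ R f (q t) (γ t) (δ t) := by
  obtain ⟨K, hK⟩ := hf.exists_lip
  have h0 : (0 : ℝ) ∈ Icc 0 R := ⟨le_rfl, hf.pos.le⟩
  have hR : R ∈ Icc 0 R := ⟨hf.pos.le, le_rfl⟩
  have hm : ρbar ∈ Icc 0 R := Ioo_subset_Icc_self hf.ρbar_mem
  filter_upwards [h.interface hK h0, h.interface hK hR, h.interface hK hm, hq]
    with t e1 e2 e3 e4 ht
  have e : ∀ k ∈ Icc 0 R, kflux (extFlux R f) (γ t) k - kflux (extFlux R f) (δ t) k +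
      2 * ((1 - q t / f ρbar) * extFlux R f k) = kflux f (γ t) k - kflux f (δ t) k +
      2 * ((1 - q t / f ρbar) * f k) := by
    intro k hk
    simp only [kflux, extFlux_eq hk, extFlux_eq (h.left_mem t), extFlux_eq (h.right_mem t)]
  refine Germ.of_interface hf (h.left_mem t) (h.right_mem t) (e4 ht) ?_
  rintro k (rfl | rfl | rfl)
  · rw [← e _ h0]; exact e1 ht
  · rw [← e _ hR]; exact e2 ht
  · rw [← e _ hm]; exact e3 ht

end

section

/-! ### Measurable representatives -/

theorem exists_measurable_rep {α : Type*} [MeasurableSpace α] {μ : Measure α} {g : α → ℝ} {c d : ℝ}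
    (hcd : c ≤ d) (hm : AEStronglyMeasurable g μ) (hmem : ∀ᵐ x ∂μ, g x ∈ Icc c d) :
    ∃ g' : α → ℝ, Measurable g' ∧ (∀ x, g' x ∈ Icc c d) ∧ g =ᵐ[μ] g' := by
  have h := hm.stronglyMeasurable_mk.measurable
  refine ⟨fun x => max c (min d (hm.mk g x)), by fun_prop,
    fun x => ⟨le_max_left _ _, max_le hcd (min_le_left _ _)⟩, ?_⟩
  filter_upwards [hm.ae_eq_mk, hmem] with x h1 h2
  rw [h1] at h2
  rw [h1, min_eq_right h2.2, max_eq_right h2.1]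

theorem measurableSet_timeInterval (T : EReal) : MeasurableSet (timeInterval T) :=
  (measurableSet_lt measurable_const measurable_id).inter
    (measurableSet_lt measurable_coe_real_ereal measurable_const)

/-- A jointly measurable representative is needed for the set in question to be measurable, so that
Fubini assembles the slice-wise bounds. -/
theorem ae_mem_of_slice {T : EReal} {R : ℝ} {ρ : ℝ → ℝ → ℝ}
    (hm : AEStronglyMeasurable (fun z : ℝ × ℝ => ρ z.1 z.2)
      (volume.restrict (timeInterval T ×ˢ (univ : Set ℝ))))
    (hs : ∀ t ∈ timeInterval T, ∀ᵐ x, ρ t x ∈ Icc 0 R) :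
    ∀ᵐ z : ℝ × ℝ ∂(volume.restrict (timeInterval T ×ˢ (univ : Set ℝ))), ρ z.1 z.2 ∈ Icc 0 R := by
  have e : (volume : Measure (ℝ × ℝ)).restrict (timeInterval T ×ˢ (univ : Set ℝ)) =
      (volume.restrict (timeInterval T)).prod volume := by
    rw [Measure.volume_eq_prod, ← Measure.prod_restrict, Measure.restrict_univ]
  have h1 := hm.ae_eq_mk
  have mg := hm.stronglyMeasurable_mk.measurable
  set g := hm.mk _ with hg
  have h2 : ∀ᵐ z : ℝ × ℝ ∂(volume.restrict (timeInterval T ×ˢ (univ : Set ℝ))), g z ∈ Icc 0 R := by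
    rw [e] at h1 ⊢
    refine (Measure.ae_prod_iff_ae_ae (mg measurableSet_Icc)).2 ?_
    filter_upwards [Measure.ae_ae_of_ae_prod h1,
      ae_restrict_mem (measurableSet_timeInterval T)] with t ht htT
    filter_upwards [ht, hs t htT] with x hx hx'
    rw [← hx]; exact hx'
  filter_upwards [h1, h2] with z hz hz'
  rw [hz]; exact hz'

/-- A test function that dominates the indicator of a box, which removes the weight from the trace
conditions. -/
theorem exists_test_eq_one {T : EReal} {s T₀ : ℝ} (hs : s < T₀) (hT : (T₀ : EReal) ≤ T) :
    ∃ φ, IsTestFunction T φ ∧ (∀ z, 0 ≤ φ z) ∧ ∀ z ∈ Ioo 0 s ×ˢ Icc (-1 : ℝ) 1, φ z = 1 := by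
  obtain ⟨r, hsr, hrT⟩ := exists_between hs
  have hS : ContDiff ℝ ∞ smoothTransition := Real.smoothTransition.contDiff
  have hrs : 0 < r - s := by linarith
  set η : ℝ → ℝ := fun t => smoothTransition (t + 1) * smoothTransition ((r - t) / (r - s)) with hη
  have hηs : ContDiff ℝ ∞ η := (hS.comp (contDiff_id.add contDiff_const)).mul
    (hS.comp ((contDiff_const.sub contDiff_id).div_const _))
  have hηsupp : ∀ t, η t ≠ 0 → t ∈ Icc (-1) r := by
    intro t ht
    constructor
    · by_contra hc
      exact left_ne_zero_of_mul ht (Real.smoothTransition.zero_of_nonpos (by linarith))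
    · by_contra hc
      exact right_ne_zero_of_mul ht (Real.smoothTransition.zero_of_nonpos
        (div_nonpos_of_nonpos_of_nonneg (by linarith) hrs.le))
  set φ : ℝ × ℝ → ℝ := fun z => η z.1 * plateau 1 z.2 with hφ
  have hsupp : tsupport φ ⊆ Icc (-1) r ×ˢ Icc (-(2 * 1)) (2 * 1) :=
    closure_minimal (fun z hz => ⟨hηsupp _ (left_ne_zero_of_mul hz),
      plateau_support one_pos (right_ne_zero_of_mul hz)⟩) (isClosed_Icc.prod isClosed_Icc)
  refine ⟨φ, ⟨(hηs.comp contDiff_fst).mul ((plateau_smooth 1).comp contDiff_snd),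
    (isCompact_Icc.prod isCompact_Icc).of_isClosed_subset (isClosed_tsupport _) hsupp,
    fun z hz => lt_of_lt_of_le (EReal.coe_lt_coe_iff.2 ((hsupp hz).1.2.trans_lt hrT)) hT⟩,
    fun z => mul_nonneg (mul_nonneg (Real.smoothTransition.nonneg _)
      (Real.smoothTransition.nonneg _)) (plateau_mem one_pos _).1, fun z hz => ?_⟩
  have h1 : η z.1 = 1 := by
    simp only [hη]
    rw [Real.smoothTransition.one_of_one_le (x := z.1 + 1) (by linarith [hz.1.1]),
      Real.smoothTransition.one_of_one_le (x := (r - z.1) / (r - s))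
        (by rw [le_div_iff₀ hrs]; linarith [hz.1.2]), one_mul]
  have h2 : plateau 1 z.2 = 1 := by
    unfold plateau
    rw [Real.smoothTransition.zero_of_nonpos (by linarith [hz.2.1]),
      Real.smoothTransition.zero_of_nonpos (by linarith [hz.2.2])]; ring
  simp only [hφ, h1, h2, mul_one]

/-- Passage from the weak to the strong form of a trace. -/
theorem tendsto_trace_of_test {T : EReal} {R T₀ s : ℝ} {ρ : ℝ → ℝ → ℝ} {γ γ' : ℝ → ℝ}
    {u : ℝ × ℝ → ℝ} {J : ℝ → Set ℝ} (hJm : ∀ ε, MeasurableSet (J ε))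
    (hJ : ∀ ε, 0 < ε → ε < 1 → J ε ⊆ Icc (-1) 1)
    (mu : Measurable u) (bu : ∀ z, u z ∈ Icc 0 R) (mγ : Measurable γ') (bγ : ∀ t, γ' t ∈ Icc 0 R)
    (hu : (fun z : ℝ × ℝ => ρ z.1 z.2) =ᵐ[volume.restrict (timeInterval T ×ˢ (univ : Set ℝ))] u)
    (hγ : γ =ᵐ[volume.restrict (timeInterval T)] γ')
    (hT : (T₀ : EReal) ≤ T) (hs : s < T₀)
    (h : ∀ φ, IsTestFunction T φ → Tendsto (fun ε : ℝ => ε⁻¹ *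
        ∫ z in timeInterval T ×ˢ J ε, |ρ z.1 z.2 - γ z.1| * φ z) (𝓝[>] 0) (𝓝 0)) :
    Tendsto (fun ε : ℝ => ε⁻¹ * ∫ z in Ioo 0 s ×ˢ J ε, |u z - γ' z.1|) (𝓝[>] 0) (𝓝 0) := by
  obtain ⟨φ, hφ, hφ0, hφ1⟩ := exists_test_eq_one hs hT
  obtain ⟨C, hC0, hC⟩ := Continuous.exists_abs_le_of_compact hφ.smooth.continuous hφ.compact
  refine squeeze_zero' ?_ ?_ (h φ hφ)
  · filter_upwards [self_mem_nhdsWithin] with ε hε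
    exact mul_nonneg (inv_nonneg.2 (le_of_lt hε)) (integral_nonneg fun z => abs_nonneg _)
  filter_upwards [Ioo_mem_nhdsGT one_pos] with ε hε
  refine mul_le_mul_of_nonneg_left ?_ (inv_pos.2 hε.1).le
  have hI := measurableSet_timeInterval T
  have hγ2 : ∀ᵐ z : ℝ × ℝ ∂(volume.restrict (timeInterval T ×ˢ (univ : Set ℝ))),
      γ z.1 = γ' z.1 := by
    have e : (volume : Measure (ℝ × ℝ)).restrict (timeInterval T ×ˢ (univ : Set ℝ)) =
        (volume.restrict (timeInterval T)).prod volume := by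
      rw [Measure.volume_eq_prod, ← Measure.prod_restrict, Measure.restrict_univ]
    rw [e]
    exact Measure.quasiMeasurePreserving_fst.ae hγ
  have e1 : ∫ z in timeInterval T ×ˢ J ε, |ρ z.1 z.2 - γ z.1| * φ z =
      ∫ z in timeInterval T ×ˢ J ε, |u z - γ' z.1| * φ z := by
    refine integral_congr_ae ?_
    have hle : (volume : Measure (ℝ × ℝ)).restrict (timeInterval T ×ˢ J ε) ≤
        volume.restrict (timeInterval T ×ˢ (univ : Set ℝ)) :=
      Measure.restrict_mono (prod_mono_right (subset_univ _)) le_rfl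
    filter_upwards [ae_mono hle hu, ae_mono hle hγ2] with z h1 h2
    rw [h1, h2]
  have int : Integrable fun z => |u z - γ' z.1| * φ z :=
    (hφ.smooth.continuous.integrable_of_hasCompactSupport hφ.compact).bdd_mul
      (f := fun z => |u z - γ' z.1|) (c := R) (Measurable.aestronglyMeasurable (by fun_prop))
      (Eventually.of_forall fun z => by
        rw [Real.norm_eq_abs, abs_abs]; exact abs_sub_le_of_mem (bu z) (bγ _))
  rw [e1]
  calc ∫ z in Ioo 0 s ×ˢ J ε, |u z - γ' z.1| = ∫ z in Ioo 0 s ×ˢ J ε, |u z - γ' z.1| * φ z := by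
        refine setIntegral_congr_fun (measurableSet_Ioo.prod (hJm ε)) fun z hz => ?_
        simp only [hφ1 z ⟨hz.1, hJ ε hε.1 hε.2 hz.2⟩, mul_one]
    _ ≤ _ := by
        refine setIntegral_mono_set int.integrableOn (Eventually.of_forall fun z =>
          mul_nonneg (abs_nonneg _) (hφ0 z)) (LE.le.eventuallyLE ?_)
        exact prod_mono (fun t ht => ⟨ht.1, lt_of_lt_of_le
          (EReal.coe_lt_coe_iff.2 (ht.2.trans hs)) hT⟩) le_rfl

variable {R ρbar : ℝ} {f w : ℝ → ℝ} {p : Constraint R (f ρbar)} {a b : ℝ} {T : EReal}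
  {ρ : ℝ → ℝ → ℝ}

/-- An entropy weak solution has everywhere defined measurable representatives. -/
theorem IsEntropyWeakSolution.exists_lineSol (hf : FluxCondition R ρbar f)
    (h : IsEntropyWeakSolution R ρbar f w p (riemannDatum a b) T ρ) (ha : a ∈ Icc 0 R)
    (hb : b ∈ Icc 0 R) {T₀ : ℝ} (hT : (T₀ : EReal) ≤ T) :
    ∃ u γ δ q, LineSol (extFlux R f) (f ρbar) R T₀ a b u γ δ q ∧
      (∀ᵐ t, t ∈ Ioo 0 T₀ → ∀ᵐ x, ρ t x = u (t, x)) ∧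
      (∀ᵐ t, t ∈ Ioo 0 T₀ → Germ R f (q t) (γ t) (δ t)) ∧
      (∀ᵐ t, t ∈ Ioo 0 T₀ → q t ∈ p.values (∫ x in Iio (0 : ℝ), w x * u (t, x))) := by
  obtain ⟨q, γ, δ, mq, bq, hE, hγ, hδ, hle, hval⟩ := h.constrained
  have hI := measurableSet_timeInterval T
  obtain ⟨u, mu, bu, eu⟩ := exists_measurable_rep hf.pos.le h.measurable
    (ae_mem_of_slice h.measurable fun t ht => h.slice_mem t ht.1.le ht.2)
  obtain ⟨q', mq', bq', eq'⟩ := exists_measurable_rep hf.max_pos.le mq bq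
  obtain ⟨γ', mγ, bγ, eγ⟩ := exists_measurable_rep hf.pos.le hγ.measurable hγ.mem
  obtain ⟨δ', mδ, bδ, eδ⟩ := exists_measurable_rep hf.pos.le hδ.measurable hδ.mem
  have hsub : Ioo 0 T₀ ⊆ timeInterval T := fun t ht =>
    ⟨ht.1, lt_of_lt_of_le (EReal.coe_lt_coe_iff.2 ht.2) hT⟩
  have hout : ∀ t : ℝ, 0 < t → t ∉ timeInterval T → T₀ ≤ t := fun t h0 ht => by
    by_contra hc; exact ht (hsub ⟨h0, not_le.1 hc⟩)
  have hline : LineSol (extFlux R f) (f ρbar) R T₀ a b u γ' δ' q' := by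
    refine ⟨mu, bu, mγ, bγ, mδ, bδ, mq', bq', ha, hb, ?_, ?_, ?_⟩
    · intro k hk φ hs hc ht hn
      have hφ : IsTestFunction T φ := ⟨hs, hc, fun z hz =>
        lt_of_lt_of_le (EReal.coe_lt_coe_iff.2 (ht z hz)) hT⟩
      have := hE φ hφ hn k hk
      unfold EntropyInequality at this
      have e1 : (∫ z in timeInterval T ×ˢ (univ : Set ℝ),
          (|ρ z.1 z.2 - k| * fderiv ℝ φ z (1, 0) +
            Real.sign (ρ z.1 z.2 - k) * (f (ρ z.1 z.2) - f k) * fderiv ℝ φ z (0, 1))) =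
          ∫ z in Ioi 0 ×ˢ univ, (|u z - k| * fderiv ℝ φ z (1, 0) +
            kflux (extFlux R f) (u z) k * fderiv ℝ φ z (0, 1)) := by
        rw [setIntegral_eq_of_subset_of_forall_sdiff_eq_zero (s := timeInterval T ×ˢ univ)
          (t := Ioi 0 ×ˢ univ) (measurableSet_Ioi.prod MeasurableSet.univ)
          (fun z hz => ⟨hz.1.1, hz.2⟩)]
        · refine integral_congr_ae ?_
          filter_upwards [eu] with z hz
          rw [hz]
          simp only [kflux, extFlux_eq hk, extFlux_eq (bu z)]
        · intro z hz
          have hz1 := hout z.1 hz.1.1 fun h' => hz.2 ⟨h', mem_univ _⟩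
          have hz2 : z ∉ tsupport φ := fun h' => not_lt.2 hz1 (ht z h')
          rw [fderiv_of_notMem_tsupport (𝕜 := ℝ) hz2]; simp
      have e2 : (∫ t in timeInterval T, (1 - q t / f ρbar) * f k * φ (t, 0)) =
          ∫ t in Ioi 0, (1 - q' t / f ρbar) * extFlux R f k * φ (t, 0) := by
        rw [setIntegral_eq_of_subset_of_forall_sdiff_eq_zero (s := timeInterval T)
          (t := Ioi 0) measurableSet_Ioi (fun z hz => hz.1)]
        · refine integral_congr_ae ?_
          filter_upwards [eq'] with t ht
          rw [ht, extFlux_eq hk]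
        · intro t h'
          have hz1 := hout t h'.1 h'.2
          have hz2 : (t, (0 : ℝ)) ∉ tsupport φ := fun h' => not_lt.2 hz1 (ht _ h')
          rw [image_eq_zero_of_notMem_tsupport hz2, mul_zero]
      rw [e1, e2] at this
      exact this
    · intro s hs
      exact tendsto_trace_of_test (J := fun ε => Ioo (-ε) 0) (fun _ => measurableSet_Ioo)
        (fun ε h0 h1 x hx => ⟨by linarith [hx.1], by linarith [hx.2]⟩) mu bu mγ bγ eu eγ hT hs
        hγ.tendsto
    · intro s hs
      have := tendsto_trace_of_test (J := fun ε => Ioo 0 ε) (fun _ => measurableSet_Ioo)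
        (fun ε h0 h1 x hx => ⟨by linarith [hx.1], by linarith [hx.2]⟩) mu bu mδ bδ eu eδ hT hs
        hδ.tendsto
      refine this.congr fun ε => ?_
      have e := setIntegral_reflect (fun z => |u z - δ' z.1|) (Ioo 0 s) (Ioo (-ε) 0)
      simp only [neg_Ioo, neg_zero, neg_neg] at e
      rw [← e]; rfl
  have hres : ∀ {P : ℝ → Prop}, (∀ᵐ t ∂(volume.restrict (timeInterval T)), P t) →
      ∀ᵐ t, t ∈ Ioo 0 T₀ → P t := fun h' => by
    filter_upwards [(ae_restrict_iff' hI).1 h'] with t ht h0 using ht (hsub h0)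
  have hslice : ∀ᵐ t, t ∈ Ioo 0 T₀ → ∀ᵐ x, ρ t x = u (t, x) := by
    refine hres ?_
    have e : (volume : Measure (ℝ × ℝ)).restrict (timeInterval T ×ˢ (univ : Set ℝ)) =
        (volume.restrict (timeInterval T)).prod volume := by
      rw [Measure.volume_eq_prod, ← Measure.prod_restrict, Measure.restrict_univ]
    rw [e] at eu
    exact Measure.ae_ae_of_ae_prod eu
  refine ⟨u, γ', δ', q', hline, hslice, hline.germ hf ?_, ?_⟩
  · filter_upwards [hres hle, hres eq', hres eγ] with t h1 h2 h3 ht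
    rw [← h2 ht, ← h3 ht]; exact (h1 ht).1
  · filter_upwards [hres hval, hres eq', hslice] with t h1 h2 h3 ht
    rw [← h2 ht]
    have : ∫ x in Iio (0 : ℝ), w x * u (t, x) = ∫ x in Iio (0 : ℝ), w x * ρ t x := by
      refine integral_congr_ae (ae_restrict_of_ae ?_)
      filter_upwards [h3 ht] with x hx
      rw [hx]
    rw [this]; exact h1 ht

end

section

variable {R ρbar : ℝ} {f w : ℝ → ℝ} {p : Constraint R (f ρbar)} {a b : ℝ}

/-- The small-time analysis uses an interval `]-K t,0[` of positive length, hence a strictly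
positive constant. -/
theorem FluxCondition.exists_pos_lip (hf : FluxCondition R ρbar f) :
    ∃ K, 0 < K ∧ Lip K (extFlux R f) := by
  obtain ⟨K, h0, hK⟩ := hf.exists_lip
  exact ⟨K + 1, by linarith, by linarith, fun x y => (hK x y).trans
    (mul_le_mul_of_nonneg_right (by linarith) (abs_nonneg _))⟩

/-! ### Uniqueness -/

theorem ae_eq_of_setIntegral_abs_nonpos {g h : ℝ → ℝ} {s : Set ℝ} (hs : MeasurableSet s)
    (hi : IntegrableOn (fun x => g x - h x) s) (h0 : ∫ x in s, |g x - h x| ≤ 0) :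
    ∀ᵐ x, x ∈ s → g x = h x := by
  have h1 := le_antisymm h0 (integral_nonneg fun x => abs_nonneg _)
  rw [integral_eq_zero_iff_of_nonneg (fun x => abs_nonneg _) hi.abs] at h1
  filter_upwards [(ae_restrict_iff' hs).1 h1] with x hx hxs
  exact sub_eq_zero.1 (abs_eq_zero.1 (hx hxs))

/-- A solution agrees with a pair of half-line solutions whose traces are admissible for the same
constraint. -/
theorem LineSol.ae_eq (hf : FluxCondition R ρbar f) {T c d : ℝ} (hT : 0 < T)
    {u v : ℝ × ℝ → ℝ} {γ δ q : ℝ → ℝ}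
    (h : LineSol (extFlux R f) (f ρbar) R T a b u γ δ q)
    (hg : ∀ᵐ t, t ∈ Ioo 0 T → Germ R f (q t) (γ t) (δ t))
    (hl : HalfSol (extFlux R f) R T a v fun _ => c)
    (hr : HalfSol (fun s => -extFlux R f s) R T b (fun z => v (reflect z)) fun _ => d)
    (hcd : ∀ᵐ t, t ∈ Ioo 0 T → Germ R f (q t) c d) :
    ∀ᵐ t, t ∈ Ioo 0 T → ∀ᵐ x, u (t, x) = v (t, x) := by
  obtain ⟨K, hK⟩ := hf.exists_lip
  have mu := h.measurable
  have mv := hl.measurable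
  have mr := measurable_reflect
  have mγ := h.left_measurable
  have mδ := h.right_measurable
  have hk := hK.continuous_kflux.measurable
  filter_upwards [ae_all_iff.2 fun M : ℕ => h.left.contraction hT hK hl M,
    ae_all_iff.2 fun M : ℕ => h.right.contraction hT hK.neg hr M] with t h1 h2 ht
  have mk : ∀ {γ : ℝ → ℝ} (c : ℝ), Measurable γ →
      Measurable fun r => kflux (extFlux R f) (γ r) c :=
    fun c hγ => hk.comp (hγ.prodMk measurable_const)
  have ii : ∀ {γ : ℝ → ℝ} {c : ℝ}, Measurable γ → (∀ r, γ r ∈ Icc 0 R) → c ∈ Icc 0 R →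
      IntervalIntegrable (fun r => kflux (extFlux R f) (γ r) c) volume 0 t := by
    intro γ c hγ hm hc
    rw [intervalIntegrable_iff]
    exact integrableOn_of_bounded' (C := K * R) (mk c hγ)
      (fun r => hK.abs_kflux_le (hm r) hc) (by simp)
  have hc := hl.trace_mem 0
  have hd := hr.trace_mem 0
  -- The L¹ distances on the two half-lines are bounded by quantities whose sum is the negative of
  -- this one; both distances are nonnegative, so both vanish.
  have key : 0 ≤ (∫ r in (0:ℝ)..t, kflux (extFlux R f) (γ r) c) -
      ∫ r in (0:ℝ)..t, kflux (extFlux R f) (δ r) d := by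
    rw [← intervalIntegral.integral_sub (ii mγ h.left_mem hc) (ii mδ h.right_mem hd)]
    refine intervalIntegral.integral_nonneg_of_ae_restrict ht.1.le ?_
    refine (ae_restrict_iff' measurableSet_Icc).2 ?_
    have hne : ∀ᵐ r : ℝ, r ≠ 0 := by simp [ae_iff, measure_singleton]
    filter_upwards [hg, hcd, hne] with r h3 h4 h5 hr'
    have hrT : r ∈ Ioo 0 T := ⟨lt_of_le_of_ne hr'.1 (Ne.symm h5), hr'.2.trans_lt ht.2⟩
    have := (h3 hrT).dissipation hf (h4 hrT)
    simp only [Pi.zero_apply, kflux, extFlux_eq hc, extFlux_eq hd, extFlux_eq (h.left_mem r),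
      extFlux_eq (h.right_mem r)] at this ⊢
    exact this
  have e2 : ∫ r in (0:ℝ)..t, kflux (fun s => -extFlux R f s) (δ r) d =
      -∫ r in (0:ℝ)..t, kflux (extFlux R f) (δ r) d := by
    simp only [kflux_neg, intervalIntegral.integral_neg]
  have n1 : ∀ M : ℕ, ∫ x in Ioo (-(M : ℝ)) 0, |u (t, x) - v (t, x)| ≤ 0 := by
    intro M
    have a1 := h1 M ht
    have a2 := h2 M ht
    rw [e2] at a2
    have a3 : 0 ≤ ∫ x in Ioo (-(M : ℝ)) 0, |u (reflect (t, x)) - v (reflect (t, x))| :=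
      integral_nonneg fun x => abs_nonneg _
    linarith
  have n2 : ∀ M : ℕ, ∫ x in Ioo (-(M : ℝ)) 0, |u (reflect (t, x)) - v (reflect (t, x))| ≤ 0 := by
    intro M
    have a1 := h1 M ht
    have a2 := h2 M ht
    rw [e2] at a2
    have a3 : 0 ≤ ∫ x in Ioo (-(M : ℝ)) 0, |u (t, x) - v (t, x)| :=
      integral_nonneg fun x => abs_nonneg _
    linarith
  have z1 : ∀ᵐ x, ∀ M : ℕ, x ∈ Ioo (-(M : ℝ)) 0 → u (t, x) = v (t, x) :=
    ae_all_iff.2 fun M => ae_eq_of_setIntegral_abs_nonpos measurableSet_Ioo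
      (integrableOn_of_bounded' (C := R) (by fun_prop)
        (fun x => abs_sub_le_of_mem (h.mem _) (hl.mem _)) (by simp)) (n1 M)
  have z2 : ∀ᵐ x, ∀ M : ℕ, x ∈ Ioo (-(M : ℝ)) 0 → u (reflect (t, x)) = v (reflect (t, x)) :=
    ae_all_iff.2 fun M => ae_eq_of_setIntegral_abs_nonpos measurableSet_Ioo
      (integrableOn_of_bounded' (C := R) (by fun_prop)
        (fun x => abs_sub_le_of_mem (h.mem _) (hl.mem _)) (by simp)) (n2 M)
  have z2' : ∀ᵐ x : ℝ, ∀ M : ℕ, -x ∈ Ioo (-(M : ℝ)) 0 →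
      u (reflect (t, -x)) = v (reflect (t, -x)) :=
    (Measure.measurePreserving_neg (volume : Measure ℝ)).quasiMeasurePreserving.ae z2
  have hne : ∀ᵐ x : ℝ, x ≠ 0 := by simp [ae_iff, measure_singleton]
  filter_upwards [z1, z2', hne] with x h3 h4 h5
  rcases lt_or_gt_of_ne h5 with hx | hx
  · obtain ⟨M, hM⟩ := exists_nat_gt (-x)
    exact h3 M ⟨by linarith, hx⟩
  · obtain ⟨M, hM⟩ := exists_nat_gt x
    simpa [reflect] using h4 M ⟨by linarith, by linarith⟩

/-- Two solutions that agree at almost all times agree at all times. -/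
theorem IsEntropyWeakSolution.eq_of_ae_eq {ρ0 : ℝ → ℝ} {T T' : EReal} {ρ σ : ℝ → ℝ → ℝ}
    (h : IsEntropyWeakSolution R ρbar f w p ρ0 T ρ)
    (h' : IsEntropyWeakSolution R ρbar f w p ρ0 T' σ) {S : ℝ} (hS : (S : EReal) ≤ T)
    (hS' : (S : EReal) ≤ T') (hae : ∀ᵐ t, t ∈ Ioo 0 S → ∀ᵐ x, ρ t x = σ t x) {t₀ : ℝ}
    (h0 : 0 ≤ t₀) (ht : t₀ < S) : ρ t₀ =ᵐ[volume] σ t₀ := by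
  have lt1 : ∀ t : ℝ, t < S → (t : EReal) < T := fun t ht =>
    lt_of_lt_of_le (EReal.coe_lt_coe_iff.2 ht) hS
  have lt2 : ∀ t : ℝ, t < S → (t : EReal) < T' := fun t ht =>
    lt_of_lt_of_le (EReal.coe_lt_coe_iff.2 ht) hS'
  have int : ∀ {T : EReal} {ρ ρ' : ℝ → ℝ → ℝ} {T' : EReal},
      IsEntropyWeakSolution R ρbar f w p ρ0 T ρ → IsEntropyWeakSolution R ρbar f w p ρ0 T' ρ' →
      ∀ (M t t' : ℝ), 0 ≤ t → (t : EReal) < T → 0 ≤ t' → (t' : EReal) < T' →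
      IntegrableOn (fun x => ρ t x - ρ' t' x) (Icc (-M) M) := by
    intro T ρ ρ' T' h h' M t t' h1 h2 h3 h4
    refine Measure.integrableOn_of_bounded (M := R) (by simp)
      ((h.slice_measurable t h1 h2).sub (h'.slice_measurable t' h3 h4)) (ae_restrict_of_ae ?_)
    filter_upwards [h.slice_mem t h1 h2, h'.slice_mem t' h3 h4] with x hx hx'
    exact abs_sub_le_of_mem hx hx'
  have hM : ∀ M : ℕ, ∀ᵐ x, x ∈ Icc (-(M : ℝ)) M → ρ t₀ x = σ t₀ x := by
    intro M
    refine ae_eq_of_setIntegral_abs_nonpos measurableSet_Icc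
      (int h h' M t₀ t₀ h0 (lt1 _ ht) h0 (lt2 _ ht)) ?_
    by_contra! hpos
    have c1 := h.continuous t₀ h0 (lt1 _ ht) M
    have c2 := h'.continuous t₀ h0 (lt2 _ ht) M
    have hle : ∀ {T : EReal}, (∀ t : ℝ, t < S → (t : EReal) < T) →
        𝓝[Ioo t₀ S] t₀ ≤ 𝓝[{t : ℝ | 0 ≤ t ∧ (t : EReal) < T}] t₀ := fun hT =>
      nhdsWithin_mono _ fun t h => ⟨h0.trans h.1.le, hT t h.2⟩
    -- The time `t₀` is approached from the right through times of agreement, which are dense; this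
    -- covers `t₀ = 0` as well.
    have c := (c1.mono_left (hle lt1)).add (c2.mono_left (hle lt2))
    rw [add_zero, nhdsWithin_Ioo_eq_nhdsGT ht] at c
    have ev := c.eventually (gt_mem_nhds hpos)
    rw [eventually_iff, mem_nhdsGT_iff_exists_Ioo_subset] at ev
    obtain ⟨r, hr, hsub⟩ := ev
    obtain ⟨t, htm, hgood⟩ := (Measure.dense_of_ae hae).exists_mem_open
      (isOpen_Ioo (a := t₀) (b := min r S)) (nonempty_Ioo.2 (lt_min hr ht))
    have ht1 : t₀ < t := hgood.1
    have htS : t < S := hgood.2.trans_le (min_le_right _ _)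
    have htr : t < r := hgood.2.trans_le (min_le_left _ _)
    have hlt := hsub ⟨ht1, htr⟩
    have heq := htm ⟨h0.trans_lt ht1, htS⟩
    have i1 := int h h M t t₀ (h0.trans ht1.le) (lt1 _ htS) h0 (lt1 _ ht)
    have i2 := int h' h' M t t₀ (h0.trans ht1.le) (lt2 _ htS) h0 (lt2 _ ht)
    have i3 := int h h' M t₀ t₀ h0 (lt1 _ ht) h0 (lt2 _ ht)
    have : ∫ x in Icc (-(M : ℝ)) M, |ρ t₀ x - σ t₀ x| ≤
        (∫ x in Icc (-(M : ℝ)) M, |ρ t x - ρ t₀ x|) + ∫ x in Icc (-(M : ℝ)) M, |σ t x - σ t₀ x| := by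
      rw [← integral_add i1.abs i2.abs]
      refine integral_mono_ae i3.abs (i1.abs.add i2.abs) (ae_restrict_of_ae ?_)
      filter_upwards [heq] with x hx
      rw [hx]
      calc |ρ t₀ x - σ t₀ x| = |-(σ t x - ρ t₀ x) + (σ t x - σ t₀ x)| := by ring_nf
        _ ≤ _ := by rw [← abs_neg (σ t x - ρ t₀ x)]; exact abs_add_le _ _
    simp only [mem_ofPred_eq] at hlt
    linarith
  filter_upwards [ae_all_iff.2 hM] with x hx
  obtain ⟨M, hM⟩ := exists_nat_gt |x|
  exact hx M (abs_le.1 hM.le)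

/-! ### The constraint near a point -/

/-- There are finitely many jump points, so none lies immediately to the right of `a`. -/
theorem Constraint.eventually_right {m : ℝ} (p : Constraint R m) (a : ℝ) :
    ∀ᶠ s in 𝓝[>] a, p.rightValue s = p.rightValue a ∧ p.leftValue s = p.rightValue a := by
  have key : ∀ᶠ s in 𝓝[>] a, ∀ i, (p.ξ i ≤ s ↔ p.ξ i ≤ a) ∧ (p.ξ i < s ↔ p.ξ i ≤ a) := by
    refine eventually_all.2 fun i => ?_
    rcases le_or_gt (p.ξ i) a with h | h
    · filter_upwards [self_mem_nhdsWithin] with s hs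
      have hs : a < s := hs
      exact ⟨⟨fun _ => h, fun _ => h.trans hs.le⟩, ⟨fun _ => h, fun _ => h.trans_lt hs⟩⟩
    · filter_upwards [Ioo_mem_nhdsGT h] with s hs
      exact ⟨⟨fun h' => absurd h' (not_le.2 hs.2), fun h' => absurd h' (not_le.2 h)⟩,
        ⟨fun h' => absurd h' (not_lt.2 hs.2.le), fun h' => absurd h' (not_le.2 h)⟩⟩
  filter_upwards [key] with s hs
  unfold Constraint.rightValue Constraint.leftValue
  simp only [fun i => (hs i).1, fun i => (hs i).2, and_self]

theorem Constraint.eventually_left {m : ℝ} (p : Constraint R m) (a : ℝ) :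
    ∀ᶠ s in 𝓝[<] a, p.rightValue s = p.leftValue a ∧ p.leftValue s = p.leftValue a := by
  have key : ∀ᶠ s in 𝓝[<] a, ∀ i, (p.ξ i ≤ s ↔ p.ξ i < a) ∧ (p.ξ i < s ↔ p.ξ i < a) := by
    refine eventually_all.2 fun i => ?_
    rcases lt_or_ge (p.ξ i) a with h | h
    · filter_upwards [Ioo_mem_nhdsLT h] with s hs
      exact ⟨⟨fun _ => h, fun _ => hs.1.le⟩, ⟨fun _ => h, fun _ => hs.1⟩⟩
    · filter_upwards [self_mem_nhdsWithin] with s hs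
      have hs : s < a := hs
      exact ⟨⟨fun h' => absurd (h'.trans_lt hs) (not_lt.2 h), fun h' => absurd h' (not_lt.2 h)⟩,
        ⟨fun h' => absurd (h'.trans hs) (not_lt.2 h), fun h' => absurd h' (not_lt.2 h)⟩⟩
  filter_upwards [key] with s hs
  unfold Constraint.rightValue Constraint.leftValue
  simp only [fun i => (hs i).1, fun i => (hs i).2, and_self]

theorem Constraint.right_le_left {m : ℝ} (p : Constraint R m) (a : ℝ) :
    p.rightValue a ≤ p.leftValue a := by
  unfold Constraint.rightValue Constraint.leftValue
  refine p.level_strictAnti.antitone ?_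
  simp only [Fin.mk_le_mk]
  exact Finset.card_le_card (Finset.monotone_filter_right _ fun i _ h => le_of_lt h)

theorem Constraint.rightValue_mem {m : ℝ} (p : Constraint R m) (a : ℝ) :
    p.rightValue a ∈ Ioc 0 m := p.level_mem _

theorem Constraint.leftValue_mem {m : ℝ} (p : Constraint R m) (a : ℝ) :
    p.leftValue a ∈ Ioc 0 m := p.level_mem _

theorem Constraint.values_near {m : ℝ} (p : Constraint R m) (a : ℝ) : ∃ r > 0, ∀ s, |s - a| < r →
    p.values s ⊆ Icc (p.rightValue a) (p.leftValue a) ∧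
    (a < s → p.values s = {p.rightValue a}) ∧ (s < a → p.values s = {p.leftValue a}) := by
  have h1 := p.eventually_right a
  have h2 := p.eventually_left a
  rw [eventually_iff, mem_nhdsGT_iff_exists_Ioo_subset] at h1
  rw [eventually_iff, mem_nhdsLT_iff_exists_Ioo_subset] at h2
  obtain ⟨c, hc, hc'⟩ := h1
  obtain ⟨d, hd, hd'⟩ := h2
  have hc : a < c := hc
  have hd : d < a := hd
  refine ⟨min (c - a) (a - d), lt_min (by linarith) (by linarith), fun s hs => ?_⟩
  have hs1 := abs_lt.1 (hs.trans_le (min_le_left _ _))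
  have hs2 := abs_lt.1 (hs.trans_le (min_le_right _ _))
  have A : a < s → p.values s = {p.rightValue a} := fun h => by
    obtain ⟨e1, e2⟩ := hc' ⟨h, by linarith⟩
    rw [Constraint.values, e1, e2, Icc_self]
  have B : s < a → p.values s = {p.leftValue a} := fun h => by
    obtain ⟨e1, e2⟩ := hd' ⟨by linarith, h⟩
    rw [Constraint.values, e1, e2, Icc_self]
  refine ⟨?_, A, B⟩
  rcases lt_trichotomy s a with h | h | h
  · rw [B h, singleton_subset_iff]; exact ⟨p.right_le_left a, le_rfl⟩
  · rw [h]; exact le_rfl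
  · rw [A h, singleton_subset_iff]; exact ⟨le_rfl, p.right_le_left a⟩

/-! ### The weighted mean -/

/-- The integral of a non-integrable function is zero by convention, so unit mass implies
integrability. -/
theorem WeightCondition.integrableOn (hw : WeightCondition w) : IntegrableOn w (Iio 0) := by
  by_contra h
  have := integral_undef h
  rw [hw.integral_eq_one] at this
  exact one_ne_zero this

/-- By monotonicity the left limit at the origin is the supremum; were it not positive, the weight
would vanish. Its positivity is what lets the sign of the mass be read off from the mean. -/
theorem WeightCondition.exists_limit (hw : WeightCondition w) :
    ∃ w₀ > 0, (∀ x < 0, w x ≤ w₀) ∧ Tendsto w (𝓝[<] 0) (𝓝 w₀) := by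
  obtain ⟨M, hM⟩ := hw.bounded
  have hb : BddAbove (w '' Iio 0) := ⟨M, by rintro _ ⟨x, hx, rfl⟩; exact hM x hx⟩
  have hle : ∀ x < 0, w x ≤ sSup (w '' Iio 0) := fun x hx => le_csSup hb ⟨x, hx, rfl⟩
  refine ⟨sSup (w '' Iio 0), ?_, hle, hw.monotone.tendsto_nhdsLT hb⟩
  by_contra hc
  have hz : ∀ x ∈ Iio (0:ℝ), w x = 0 := fun x hx =>
    le_antisymm ((hle x hx).trans (not_lt.1 hc)) (hw.nonneg x hx)
  have := hw.integral_eq_one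
  rw [setIntegral_eq_zero_of_forall_eq_zero hz] at this
  exact zero_ne_one this

/-- For a profile that differs from `a` only near the origin the weighted mean is governed by the
mass. -/
theorem WeightCondition.mean_sub_le (hw : WeightCondition w) {w₀ l : ℝ} (hw₀ : ∀ x < 0, w x ≤ w₀)
    (hl : 0 < l) {g : ℝ → ℝ} (mg : Measurable g) (bg : ∀ x, g x ∈ Icc 0 R) (ha : a ∈ Icc 0 R)
    (hg : ∀ᵐ x, x < -l → g x = a) :
    |(∫ x in Iio 0, w x * g x) - a - w₀ * ∫ x in Ioo (-l) 0, (g x - a)| ≤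
      (w₀ - w (-l)) * R * l := by
  have hR : 0 ≤ R := ha.1.trans ha.2
  have hwi := hw.integrableOn
  have bga : ∀ x, |g x - a| ≤ R := fun x => abs_sub_le_of_mem (bg x) ha
  have i1 : IntegrableOn (fun x => w x * g x) (Iio 0) :=
    hwi.mul_bdd (c := R) mg.aestronglyMeasurable
      (Eventually.of_forall fun x => abs_le_of_mem (bg x))
  have i2 : IntegrableOn (fun x => w x * a) (Iio 0) := hwi.mul_const a
  have i3 : IntegrableOn (fun x => w x * (g x - a)) (Iio 0) := by
    have : IntegrableOn (fun x => w x * g x - w x * a) (Iio 0) := i1.sub i2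
    simpa only [mul_sub] using this
  have e1 : (∫ x in Iio 0, w x * g x) - a = ∫ x in Iio 0, w x * (g x - a) := by
    have : ∫ x in Iio (0 : ℝ), w x * a = a := by
      rw [integral_mul_const, hw.integral_eq_one, one_mul]
    simp only [mul_sub]
    rw [integral_sub i1 i2, this]
  have hsub : Ioo (-l) 0 ⊆ Iio (0 : ℝ) := fun x hx => hx.2
  have e2 : ∫ x in Iio 0, w x * (g x - a) = ∫ x in Ioo (-l) 0, w x * (g x - a) := by
    rw [← integral_indicator measurableSet_Iio, ← integral_indicator measurableSet_Ioo]
    refine integral_congr_ae ?_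
    have hne : ∀ᵐ x : ℝ, x ≠ -l := by simp [ae_iff, measure_singleton]
    filter_upwards [hg, hne] with x hx hxne
    rcases lt_or_ge x 0 with hx0 | hx0
    · rw [indicator_of_mem (show x ∈ Iio (0 : ℝ) from hx0)]
      rcases lt_or_ge x (-l) with hxt | hxt
      · rw [hx hxt, indicator_of_notMem (fun h' => absurd h'.1 (not_lt.2 hxt.le))]; ring
      · rw [indicator_of_mem (show x ∈ Ioo (-l) 0 from ⟨lt_of_le_of_ne hxt hxne.symm, hx0⟩)]
    · rw [indicator_of_notMem (notMem_Iio.2 hx0),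
        indicator_of_notMem (fun h' => absurd h'.2 (not_lt.2 hx0))]
  have i4 : IntegrableOn (fun x => g x - a) (Ioo (-l) 0) :=
    integrableOn_of_bounded' (C := R) (by fun_prop) bga (by simp)
  rw [e1, e2, ← integral_const_mul, ← integral_sub (i3.mono_set hsub) (i4.const_mul w₀)]
  -- On `]-l,0[` monotonicity keeps the weight between `w (-l)` and `w₀`.
  have := norm_setIntegral_le_of_norm_le_const (μ := volume) (s := Ioo (-l) 0)
    (f := fun x => w x * (g x - a) - w₀ * (g x - a)) (C := (w₀ - w (-l)) * R) (by simp)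
    (fun x hx => by
      rw [← sub_mul, norm_mul, Real.norm_eq_abs, Real.norm_eq_abs, abs_sub_comm,
        abs_of_nonneg (sub_nonneg.2 (hw₀ x hx.2))]
      have h1 : w (-l) ≤ w x := hw.monotone (show -l < 0 by linarith) hx.2 hx.1.le
      exact mul_le_mul (by linarith) (bga x) (abs_nonneg _)
        (by linarith [hw₀ (-l) (by linarith)]))
  rw [Real.volume_real_Ioo_of_le (by linarith)] at this
  refine this.trans (le_of_eq ?_)
  ring

/-- At small times the constraint is determined by the sign of the mass. -/
theorem exists_small_time (hw : WeightCondition w) {m K : ℝ} (p : Constraint R m) (hK : 0 < K)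
    (ha : a ∈ Icc 0 R) {c : ℝ} (hc : 0 < c) :
    ∃ τ > 0, ∀ t, 0 < t → t < τ → ∀ g : ℝ → ℝ, Measurable g → (∀ x, g x ∈ Icc 0 R) →
      (∀ᵐ x, x < -(K * t) → g x = a) →
      p.values (∫ x in Iio 0, w x * g x) ⊆ Icc (p.rightValue a) (p.leftValue a) ∧
      (c * t ≤ ∫ x in Ioo (-(K * t)) 0, (g x - a) →
        p.values (∫ x in Iio 0, w x * g x) = {p.rightValue a}) ∧
      (∫ x in Ioo (-(K * t)) 0, (g x - a) ≤ -(c * t) →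
        p.values (∫ x in Iio 0, w x * g x) = {p.leftValue a}) := by
  have hR : 0 ≤ R := ha.1.trans ha.2
  obtain ⟨w₀, hw0, hle, hlim⟩ := hw.exists_limit
  obtain ⟨r, hr, hv⟩ := p.values_near a
  -- The error in replacing the mean by `w₀` times the mass is this quantity times `t`, hence
  -- `o(t)`, whereas a mass of size `c t` contributes at least `w₀ c t`.
  have hlim' : Tendsto (fun t : ℝ => (w₀ - w (-(K * t))) * R * K) (𝓝[>] 0) (𝓝 0) := by
    have h1 : Tendsto (fun t : ℝ => -(K * t)) (𝓝[>] 0) (𝓝[<] 0) := by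
      have := tendsto_mul_nhdsGT hK
      have h2 : Tendsto (fun x : ℝ => -x) (𝓝[>] 0) (𝓝[<] (-0)) := tendsto_neg_nhdsGT
      rw [neg_zero] at h2
      exact h2.comp this
    have := (((hlim.comp h1).const_sub w₀).mul_const R).mul_const K
    simpa using this
  have ev := hlim'.eventually (gt_mem_nhds (mul_pos hw0 hc))
  rw [eventually_iff, mem_nhdsGT_iff_exists_Ioo_subset] at ev
  obtain ⟨τ₁, hτ₁, hsub⟩ := ev
  have hτ₁ : 0 < τ₁ := hτ₁
  -- The mean is within `2 w₀ R K t < D t` of `a`; for `t < r / D` it stays in the neighbourhood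
  -- where `p` is described by its one-sided limits at `a`. The added `1` makes `D` positive.
  set D := 2 * (w₀ * R * K) + 1 with hD
  have hWRK : 0 ≤ w₀ * R * K := mul_nonneg (mul_nonneg hw0.le hR) hK.le
  have hDpos : 0 < D := by linarith
  refine ⟨min τ₁ (r / D), lt_min hτ₁ (div_pos hr hDpos), fun t ht htτ g mg bg hg => ?_⟩
  have hKt : 0 < K * t := mul_pos hK ht
  have main := hw.mean_sub_le hle hKt mg bg ha hg
  set ξ := ∫ x in Iio 0, w x * g x with hξ
  set μ := ∫ x in Ioo (-(K * t)) 0, (g x - a) with hμ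
  have hsmall : (w₀ - w (-(K * t))) * R * K < w₀ * c := hsub ⟨ht, htτ.trans_le (min_le_left _ _)⟩
  have hsmall' : (w₀ - w (-(K * t))) * R * (K * t) < w₀ * (c * t) := by
    have := mul_lt_mul_of_pos_right hsmall ht
    linarith
  have hμb : |μ| ≤ R * (K * t) := by
    have := norm_setIntegral_le_of_norm_le_const (μ := volume) (s := Ioo (-(K * t)) 0)
      (f := fun x => g x - a) (C := R) (by simp) (fun x _ => abs_sub_le_of_mem (bg x) ha)
    rw [Real.volume_real_Ioo_of_le (by linarith)] at this
    simpa using this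
  have hfirst : (w₀ - w (-(K * t))) * R * (K * t) ≤ w₀ * R * K * t := by
    have h0 : 0 ≤ w (-(K * t)) := hw.nonneg _ (by linarith)
    have h1 : 0 ≤ w (-(K * t)) * (R * (K * t)) := mul_nonneg h0 (mul_nonneg hR hKt.le)
    nlinarith
  have hnear : |ξ - a| < r := by
    have h1 : |ξ - a| ≤ |ξ - a - w₀ * μ| + |w₀ * μ| := by
      calc |ξ - a| = |(ξ - a - w₀ * μ) + w₀ * μ| := by ring_nf
        _ ≤ _ := abs_add_le _ _
    rw [abs_mul, abs_of_pos hw0] at h1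
    have h2 := mul_le_mul_of_nonneg_left hμb hw0.le
    have h3 : D * t < r := by
      have := (lt_div_iff₀ hDpos).1 (htτ.trans_le (min_le_right _ _))
      linarith
    have h4 : D * t = 2 * (w₀ * R * K * t) + t := by rw [hD]; ring
    have h5 : w₀ * (R * (K * t)) = w₀ * R * K * t := by ring
    linarith
  obtain ⟨v1, v2, v3⟩ := hv ξ hnear
  have hab := abs_le.1 main
  refine ⟨v1, fun h => v2 ?_, fun h => v3 ?_⟩
  · have := mul_le_mul_of_nonneg_left h hw0.le
    linarith [hab.1]
  · have := mul_le_mul_of_nonneg_left h hw0.le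
    linarith [hab.2]

end

section

/-! ### Self-similar profiles -/

/-- `P v` minimizes (`e = 1`) or maximizes (`e = -1`) `F s - v s` over `[lo,hi]`. -/
structure IsProfile (F : ℝ → ℝ) (e lo hi : ℝ) (P : ℝ → ℝ) : Prop where
  sign : e = 1 ∨ e = -1
  mem : ∀ v, P v ∈ Icc lo hi
  opt : ∀ v, ∀ s ∈ Icc lo hi, e * (F (P v) - v * P v) ≤ e * (F s - v * s)

/-- The signed difference of the envelope and of the line `v ↦ F k - v k`. -/
def envelopeGap (F : ℝ → ℝ) (e : ℝ) (P : ℝ → ℝ) (k v : ℝ) : ℝ :=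
  e * (F (P v) - v * P v) - e * (F k - v * k)

namespace IsProfile

variable {F P ψ ψ' : ℝ → ℝ} {e lo hi k δ K R a : ℝ}

theorem sq (h : IsProfile F e lo hi P) : e * e = 1 := by
  rcases h.sign with rfl | rfl <;> norm_num

/-- Each optimality condition, tested with the other optimiser and added, gives `(v₂ - v₁) e (P v₂ -
P v₁) ≥ 0`. -/
theorem monotone (h : IsProfile F e lo hi P) : Monotone fun v => e * P v := by
  intro v₁ v₂ hv
  rcases hv.eq_or_lt with rfl | hv
  · exact le_rfl
  have h1 := h.opt v₁ _ (h.mem v₂)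
  have h2 := h.opt v₂ _ (h.mem v₁)
  have h3 : (v₂ - v₁) * (e * P v₁) ≤ (v₂ - v₁) * (e * P v₂) := by nlinarith
  exact le_of_mul_le_mul_left h3 (by linarith)

theorem measurable (h : IsProfile F e lo hi P) : Measurable P := by
  have : P = fun v => e * (e * P v) := by funext v; rw [← mul_assoc, h.sq, one_mul]
  rw [this]
  exact h.monotone.measurable.const_mul e

/-- `P v` is a competitor at speed `y`. Thus the gap, an infimum of affine functions of the speed,
is concave with supergradient `-e (P v - k)`. -/
theorem gap_sub_le (h : IsProfile F e lo hi P) (k v y : ℝ) :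
    envelopeGap F e P k y - envelopeGap F e P k v ≤ (y - v) * -(e * (P v - k)) := by
  have := h.opt y _ (h.mem v)
  unfold envelopeGap
  nlinarith

theorem abs_gap_sub_le (h : IsProfile F e lo hi P) (k v y : ℝ) :
    |envelopeGap F e P k y - envelopeGap F e P k v - (y - v) * -(e * (P v - k))| ≤
      |e * P y - e * P v| * |y - v| := by
  have h1 := h.gap_sub_le k v y
  have h2 := h.gap_sub_le k y v
  have h3 : (e * P y - e * P v) * (y - v) ≤ |e * P y - e * P v| * |y - v| := by
    rw [← abs_mul]; exact le_abs_self _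
  rw [abs_of_nonpos (by linarith)]
  nlinarith

/-- Envelope theorem: the supergradients at `v` and at `y` enclose the difference quotient, and they
merge where the profile is continuous. -/
theorem hasDerivAt_gap (h : IsProfile F e lo hi P) (k : ℝ) {v : ℝ}
    (hc : ContinuousAt (fun v => e * P v) v) :
    HasDerivAt (envelopeGap F e P k) (-(e * (P v - k))) v := by
  rw [hasDerivAt_iff_isLittleO, Asymptotics.isLittleO_iff]
  intro c hc0
  filter_upwards [Metric.continuousAt_iff'.1 hc c hc0] with y hy
  rw [Real.dist_eq] at hy
  rw [smul_eq_mul, Real.norm_eq_abs, Real.norm_eq_abs]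
  exact (h.abs_gap_sub_le k v y).trans (mul_le_mul_of_nonneg_right hy.le (abs_nonneg _))

theorem continuous_gap (h : IsProfile F e lo hi P) (k : ℝ) : Continuous (envelopeGap F e P k) := by
  have hb : ∀ v, |e * (P v - k)| ≤ |lo - k| + |hi - k| := by
    intro v
    have he : |e| = 1 := by rcases h.sign with rfl | rfl <;> simp
    rw [abs_mul, he, one_mul]
    obtain ⟨h1, h2⟩ := h.mem v
    rw [abs_le]
    constructor
    · linarith [neg_abs_le (lo - k), abs_nonneg (hi - k)]
    · linarith [le_abs_self (hi - k), abs_nonneg (lo - k)]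
  have key : ∀ v y, envelopeGap F e P k y - envelopeGap F e P k v ≤
      (|lo - k| + |hi - k|) * |y - v| := by
    intro v y
    refine (h.gap_sub_le k v y).trans ((le_abs_self _).trans ?_)
    rw [abs_mul, abs_neg, mul_comm]
    exact mul_le_mul_of_nonneg_right (hb v) (abs_nonneg _)
  have : LipschitzWith ⟨|lo - k| + |hi - k|, by positivity⟩ (envelopeGap F e P k) := by
    refine LipschitzWith.of_dist_le_mul fun y v => ?_
    rw [Real.dist_eq, Real.dist_eq]
    refine abs_sub_le_iff.2 ⟨key v y, ?_⟩
    have := key y v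
    rw [abs_sub_comm v y] at this
    exact this
  exact this.continuous

theorem gap_nonpos (h : IsProfile F e lo hi P) (hk : k ∈ Icc lo hi) (v : ℝ) :
    envelopeGap F e P k v ≤ 0 := by
  have := h.opt v k hk
  unfold envelopeGap
  linarith

theorem intervalIntegrable_mul (h : IsProfile F e lo hi P) (k : ℝ) (hψ : Continuous ψ) (a b : ℝ) :
    IntervalIntegrable (fun v => e * (P v - k) * ψ v) volume a b := by
  have h1 : IntervalIntegrable (fun v => e * P v) volume a b := h.monotone.intervalIntegrable
  have h2 : IntervalIntegrable (fun v => e * P v - e * k) volume a b :=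
    h1.sub intervalIntegrable_const
  have h3 := h2.mul_continuousOn hψ.continuousOn
  refine h3.congr fun v _ => ?_
  show (e * P v - e * k) * ψ v = e * (P v - k) * ψ v
  ring

/-- Product rule for `gap · ψ`. By monotonicity the profile jumps at countably many speeds only, and
a continuous primitive may fail to be differentiable on a countable set. -/
theorem integral_gap (h : IsProfile F e lo hi P) (k : ℝ) (hψ : ∀ v, HasDerivAt ψ (ψ' v) v)
    (hψ' : Continuous ψ') (a b : ℝ) :
    ∫ v in a..b, (envelopeGap F e P k v * ψ' v - e * (P v - k) * ψ v) =
      envelopeGap F e P k b * ψ b - envelopeGap F e P k a * ψ a := by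
  have hL := h.continuous_gap k
  have hψc : Continuous ψ := continuous_iff_continuousAt.2 fun v => (hψ v).continuousAt
  refine integral_eq_of_hasDerivAt_off_countable (fun v => envelopeGap F e P k v * ψ v) _
    h.monotone.countable_not_continuousAt (by fun_prop) ?_ ?_
  · rintro v ⟨-, hv⟩
    have hv : ContinuousAt (fun v => e * P v) v := not_not.1 hv
    have := (h.hasDerivAt_gap k hv).fun_mul (hψ v)
    convert! this using 1
    ring
  · exact ((hL.mul hψ').intervalIntegrable _ _).sub (h.intervalIntegrable_mul k hψc _ _)

/-- On the side of the crossing given by `s`, the entropy and its flux are affine. -/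
theorem integrand_eq (h : IsProfile F e lo hi P) {s v : ℝ} (hs : s = 1 ∨ s = -1)
    (hv : 0 ≤ s * (e * (P v - k))) :
    |P v - k| = s * (e * (P v - k)) ∧
      kflux F (P v) k - v * |P v - k| = s * envelopeGap F e P k v := by
  have hse : s * e = 1 ∨ s * e = -1 := by
    rcases hs with rfl | rfl <;> rcases h.sign with rfl | rfl <;> norm_num
  unfold envelopeGap
  rw [← mul_assoc] at hv ⊢
  rcases hse with e1 | e1
  · rw [e1, one_mul] at hv
    rw [e1, one_mul, abs_of_nonneg hv, kflux_of_ge _ (by linarith)]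
    refine ⟨rfl, ?_⟩
    linear_combination (-(F (P v) - v * P v - F k + v * k)) * e1
  · rw [e1] at hv
    rw [e1, abs_of_nonpos (by linarith), kflux_of_le _ (by linarith)]
    refine ⟨by ring, ?_⟩
    linear_combination (-(F (P v) - v * P v - F k + v * k)) * e1

/-- While `P - k` keeps its sign there is no entropy dissipation: the integrand is the derivative of
`s · gap · ψ`. -/
theorem integral_side (h : IsProfile F e lo hi P) {s : ℝ} (hs : s = 1 ∨ s = -1)
    (hψ : ∀ v, HasDerivAt ψ (ψ' v) v) (hψ' : Continuous ψ') {a b : ℝ} (hab : a ≤ b)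
    (hv : ∀ v ∈ Ioo a b, 0 ≤ s * (e * (P v - k))) :
    ∫ v in a..b, ((kflux F (P v) k - v * |P v - k|) * ψ' v - |P v - k| * ψ v) =
      s * (envelopeGap F e P k b * ψ b - envelopeGap F e P k a * ψ a) := by
  rw [← h.integral_gap k hψ hψ', ← intervalIntegral.integral_const_mul]
  refine intervalIntegral.integral_congr_ae ?_
  have hne : ∀ᵐ x : ℝ, x ≠ b := by simp [ae_iff, measure_singleton]
  filter_upwards [hne] with v hvb hmem
  rw [uIoc_of_le hab] at hmem
  obtain ⟨e1, e2⟩ := h.integrand_eq hs (hv v ⟨hmem.1, lt_of_le_of_ne hmem.2 hvb⟩)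
  rw [e2, e1]
  ring

/-- In the identity for the flux in the moving frame, the term `v |P v - k|` disappears as `v` tends
to `0-`. -/
theorem trace_flux (h : IsProfile F e lo hi P) (hF : Lip K F) {s c : ℝ} (hs : s = 1 ∨ s = -1)
    (hδ : Tendsto P (𝓝[<] 0) (𝓝 δ)) (hc : c < 0)
    (hv : ∀ v ∈ Ioo c 0, 0 ≤ s * (e * (P v - k))) :
    kflux F δ k = s * envelopeGap F e P k 0 := by
  have hid : Tendsto (fun v : ℝ => v) (𝓝[<] 0) (𝓝 0) := tendsto_id.mono_left nhdsWithin_le_nhds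
  have l1 : Tendsto (fun v => kflux F (P v) k - v * |P v - k|) (𝓝[<] 0)
      (𝓝 (kflux F δ k - 0 * |δ - k|)) := by
    have h1 : Tendsto (fun v => kflux F (P v) k) (𝓝[<] 0) (𝓝 (kflux F δ k)) :=
      (hF.continuous_kflux.tendsto (δ, k)).comp (hδ.prodMk_nhds tendsto_const_nhds)
    exact h1.sub (hid.mul (hδ.sub_const k).abs)
  have l2 : Tendsto (fun v => s * envelopeGap F e P k v) (𝓝[<] 0)
      (𝓝 (s * envelopeGap F e P k 0)) :=
    (((h.continuous_gap k).tendsto 0).mono_left nhdsWithin_le_nhds).const_mul s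
  have l3 := l2.congr' (f₂ := fun v => kflux F (P v) k - v * |P v - k|) (by
    filter_upwards [Ioo_mem_nhdsLT hc] with v hv'
    exact (h.integrand_eq hs (hv v hv')).2.symm)
  have := tendsto_nhds_unique l1 l3
  rw [← this]; ring

/-- The entropy inequality for a self-similar profile, in the self-similar variable. -/
theorem entropy (h : IsProfile F e lo hi P) (hF : Lip K F) (hδ : Tendsto P (𝓝[<] 0) (𝓝 δ))
    (hψ : ∀ v, HasDerivAt ψ (ψ' v) v) (hψ' : Continuous ψ') (hψ0 : ∀ v, 0 ≤ ψ v) {B : ℝ}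
    (hB : 0 < B) (hψB : ψ (-B) = 0) (k : ℝ) :
    kflux F δ k * ψ 0 ≤
      ∫ v in (-B)..0, ((kflux F (P v) k - v * |P v - k|) * ψ' v - |P v - k| * ψ v) := by
  have hB' : -B < 0 := by linarith
  have one_sided : ∀ s : ℝ, s = 1 ∨ s = -1 → (∀ v ∈ Ioo (-B) 0, 0 ≤ s * (e * (P v - k))) →
      kflux F δ k * ψ 0 ≤
      ∫ v in (-B)..0, ((kflux F (P v) k - v * |P v - k|) * ψ' v - |P v - k| * ψ v) := by
    intro s hs hv
    rw [h.integral_side hs hψ hψ' hB'.le hv, hψB, h.trace_flux hF hs hδ hB' hv]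
    linarith
  by_cases h1 : ∀ v ∈ Ioo (-B) 0, 0 ≤ 1 * (e * (P v - k))
  · exact one_sided 1 (Or.inl rfl) h1
  by_cases h2 : ∀ v ∈ Ioo (-B) 0, 0 ≤ (-1) * (e * (P v - k))
  · exact one_sided (-1) (Or.inr rfl) h2
  push Not at h1 h2
  obtain ⟨v₁, hv₁, hn⟩ := h1
  obtain ⟨v₂, hv₂, hp⟩ := h2
  have hmono := h.monotone
  have hk : k ∈ Icc lo hi := by
    obtain ⟨a1, a2⟩ := h.mem v₁
    obtain ⟨b1, b2⟩ := h.mem v₂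
    rcases h.sign with rfl | rfl
    · constructor <;> linarith
    · constructor <;> linarith
  -- The supremum `c` of this set is the speed at which the monotone profile crosses `k`. The signs
  -- on its two sides are opposite, so the boundary terms at `c` add up to `-2 · gap · ψ` instead of
  -- cancelling; this is nonnegative since `k`, straddled by values of the profile, is itself a
  -- competitor.
  set A := {v | v ∈ Ioo (-B) 0 ∧ e * (P v - k) < 0} with hA
  have hAne : A.Nonempty := ⟨v₁, hv₁, by linarith⟩
  have hAb : ∀ v ∈ A, v ≤ v₂ := by
    rintro v ⟨-, hv⟩
    by_contra hc
    have := hmono (not_le.1 hc).le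
    simp only at this
    linarith
  have hbdd : BddAbove A := ⟨v₂, hAb⟩
  set c := sSup A with hc
  have hcle : c ≤ v₂ := csSup_le hAne hAb
  have hcge : v₁ ≤ c := le_csSup hbdd ⟨hv₁, by linarith⟩
  have before : ∀ v ∈ Ioo (-B) c, 0 ≤ (-1) * (e * (P v - k)) := by
    intro v hv
    obtain ⟨y, hy, hvy⟩ := exists_lt_of_lt_csSup hAne hv.2
    have := hmono hvy.le
    simp only at this
    linarith [hy.2]
  have after : ∀ v ∈ Ioo c 0, 0 ≤ 1 * (e * (P v - k)) := by
    intro v hv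
    by_contra hc'
    have : v ∈ A := ⟨⟨by linarith [hv.1, hv₁.1], hv.2⟩, by linarith⟩
    exact absurd (le_csSup hbdd this) (not_le.2 hv.1)
  have hcB : -B ≤ c := by linarith [hv₁.1]
  have hc0 : c < 0 := by linarith [hv₂.2]
  have hψc : Continuous ψ := continuous_iff_continuousAt.2 fun v => (hψ v).continuousAt
  have mP := h.measurable
  have mk : Measurable fun v => kflux F (P v) k :=
    hF.continuous_kflux.measurable.comp (mP.prodMk measurable_const)
  have ii : ∀ a b : ℝ, IntervalIntegrable
      (fun v => (kflux F (P v) k - v * |P v - k|) * ψ' v - |P v - k| * ψ v) volume a b := by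
    intro a b
    have j1 : ∀ {g : ℝ → ℝ} {C : ℝ}, Measurable g → (∀ v, |g v| ≤ C) →
        IntervalIntegrable g volume a b := fun mg bg => by
      rw [intervalIntegrable_iff]; exact integrableOn_of_bounded' mg bg (by simp)
    have b1 : ∀ v, |P v - k| ≤ hi - lo := fun v => by
      obtain ⟨a1, a2⟩ := h.mem v
      rw [abs_le]; constructor <;> linarith [hk.1, hk.2]
    have j2 : IntervalIntegrable (fun v => |P v - k|) volume a b :=
      j1 (by fun_prop) (fun v => by rw [abs_abs]; exact b1 v)
    have j3 : IntervalIntegrable (fun v => kflux F (P v) k) volume a b :=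
      j1 mk (fun v => (hF.kflux_le _ _).trans (mul_le_mul_of_nonneg_left (b1 v) hF.1))
    exact ((j3.sub (j2.continuousOn_mul continuous_id.continuousOn)).mul_continuousOn
      hψ'.continuousOn).sub (j2.mul_continuousOn hψc.continuousOn)
  rw [← intervalIntegral.integral_add_adjacent_intervals (ii (-B) c) (ii c 0),
    h.integral_side (Or.inr rfl) hψ hψ' hcB before, h.integral_side (Or.inl rfl) hψ hψ' hc0.le after,
    hψB, h.trace_flux hF (Or.inl rfl) hδ hc0 after]
  have := mul_nonneg (neg_nonneg.2 (h.gap_nonpos hk c)) (hψ0 c)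
  linarith

theorem limit_mem (h : IsProfile F e lo hi P) (hδ : Tendsto P (𝓝[<] 0) (𝓝 δ)) : δ ∈ Icc lo hi :=
  isClosed_Icc.mem_of_tendsto hδ (Eventually.of_forall h.mem)

theorem limit_opt (h : IsProfile F e lo hi P) (hF : Continuous F) (hδ : Tendsto P (𝓝[<] 0) (𝓝 δ))
    {s : ℝ} (hs : s ∈ Icc lo hi) : e * F δ ≤ e * F s := by
  have hid : Tendsto (fun v : ℝ => v) (𝓝[<] 0) (𝓝 0) := tendsto_id.mono_left nhdsWithin_le_nhds
  have l1 : Tendsto (fun v => e * (F (P v) - v * P v)) (𝓝[<] 0) (𝓝 (e * (F δ - 0 * δ))) :=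
    (((hF.tendsto δ).comp hδ).sub (hid.mul hδ)).const_mul e
  have l2 : Tendsto (fun v => e * (F s - v * s)) (𝓝[<] 0) (𝓝 (e * (F s - 0 * s))) :=
    (tendsto_const_nhds.sub (hid.mul_const s)).const_mul e
  have := le_of_tendsto_of_tendsto' l1 l2 fun v => h.opt v s hs
  simpa using this

end IsProfile

end

/-! ### Entropy inequality of self-similar maps on the half-line. -/

section

theorem setIntegral_Iio_eq_scaled {g : ℝ → ℝ} {t B : ℝ} (ht : 0 < t) (hB : 0 < B)
    (hg : ∀ x ≤ -(t * B), g x = 0) :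
    ∫ x in Iio 0, g x = t * ∫ v in (-B)..0, g (t * v) := by
  have htB := mul_pos ht hB
  rw [intervalIntegral.mul_integral_comp_mul_left, mul_zero, mul_neg,
    intervalIntegral.integral_of_le (by linarith), integral_Ioc_eq_integral_Ioo]
  refine setIntegral_eq_of_subset_of_forall_sdiff_eq_zero measurableSet_Iio
    (fun x hx => hx.2) fun x hx => hg x ?_
  by_contra hc
  exact hx.2 ⟨not_le.1 hc, hx.1⟩

theorem exists_support_bound {φ : ℝ × ℝ → ℝ} (hc : HasCompactSupport φ) :
    ∃ N > 0, ∀ z : ℝ × ℝ, N ≤ |z.1| ∨ N ≤ |z.2| → z ∉ tsupport φ := by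
  obtain ⟨N, hN⟩ := hc.isCompact.isBounded.exists_norm_le
  refine ⟨max N 0 + 1, by positivity, fun z hz hzs => ?_⟩
  have h1 := hN z hzs
  have h2 := norm_fst_le z
  have h3 := norm_snd_le z
  rw [Real.norm_eq_abs] at h2 h3
  rcases hz with h | h <;> linarith [le_max_left N 0]

namespace IsProfile

variable {F P : ℝ → ℝ} {e lo hi k δ K R a : ℝ} {φ : ℝ × ℝ → ℝ}

/-- In the variable `v = x / t` the integral is `t` times that of `|P v - k| φ(t, t v)` in `v`, so
the time derivative falls on the smooth factor only and shocks cause no difficulty. The space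
derivatives that appear are controlled by the entropy inequality in the self-similar variable with
weight `v ↦ φ(t₀, t₀ v)`. -/
theorem hasDerivAt_mean_le (h : IsProfile F e lo hi P) (hF : Lip K F) (h0 : 0 ≤ lo) (hR : hi ≤ R)
    (hδ : Tendsto P (𝓝[<] 0) (𝓝 δ)) (hk : k ∈ Icc 0 R)
    (hs : ContDiff ℝ ∞ φ) (hc : HasCompactSupport φ) (hn : ∀ z, 0 ≤ φ z) {t₀ : ℝ} (ht₀ : 0 < t₀) :
    ∃ Y', HasDerivAt (fun t => ∫ x in Iio 0, |P (x / t) - k| * φ (t, x)) Y' t₀ ∧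
      Y' ≤ (∫ x in Iio 0, (|P (x / t₀) - k| * fderiv ℝ φ (t₀, x) (1, 0) +
        kflux F (P (x / t₀)) k * fderiv ℝ φ (t₀, x) (0, 1))) - kflux F δ k * φ (t₀, 0) := by
  have hmem : ∀ v, P v ∈ Icc 0 R := fun v => ⟨h0.trans (h.mem v).1, (h.mem v).2.trans hR⟩
  have hR0 : 0 ≤ R := hk.1.trans hk.2
  obtain ⟨N, hN, hsup⟩ := exists_support_bound hc
  have hd : Differentiable ℝ φ := hs.differentiable (by simp)
  have q1 := fderiv_apply_props hs hc (1, 0)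
  have q2 := fderiv_apply_props hs hc (0, 1)
  obtain ⟨C1, hC1, b1⟩ := Continuous.exists_abs_le_of_compact q1.1 q1.2
  obtain ⟨C2, hC2, b2⟩ := Continuous.exists_abs_le_of_compact q2.1 q2.2
  have mP := h.measurable
  have mk : Measurable fun v => kflux F (P v) k :=
    hF.continuous_kflux.measurable.comp (mP.prodMk measurable_const)
  have bη : ∀ v, |(|P v - k|)| ≤ R := fun v => by
    rw [abs_abs]; exact abs_sub_le_of_mem (hmem v) hk
  have bΘ : ∀ v, |kflux F (P v) k| ≤ K * R := fun v => hF.abs_kflux_le (hmem v) hk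
  -- With this cut-off speed the support of `φ(t,·)` lies in `x > -t B` for all `t ≥ t₀ / 2`, so one
  -- speed interval serves for all times near `t₀`.
  set B := 2 * N / t₀ with hBdef
  have hB : 0 < B := by positivity
  have hout : ∀ t, t₀ / 2 ≤ t → ∀ x, x ≤ -(t * B) → (t, x) ∉ tsupport φ := by
    intro t ht x hx
    refine hsup _ (Or.inr ?_)
    have h1 : N ≤ t * B := by
      have : N = t₀ / 2 * B := by rw [hBdef]; field_simp
      rw [this]; exact mul_le_mul_of_nonneg_right ht hB.le
    show N ≤ |x|
    rw [abs_of_nonpos (by linarith)]; linarith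
  have ii : ∀ {g c : ℝ → ℝ} {C : ℝ}, Measurable g → (∀ v, |g v| ≤ C) → Continuous c →
      IntervalIntegrable (fun v => g v * c v) volume (-B) 0 := by
    intro g c C mg bg hc
    have : IntervalIntegrable g volume (-B) 0 := by
      rw [intervalIntegrable_iff]; exact integrableOn_of_bounded' mg bg (by simp)
    exact this.mul_continuousOn hc.continuousOn
  have mη : Measurable fun v => |P v - k| := by fun_prop
  have hchain : ∀ t v : ℝ, HasDerivAt (fun t => φ (t, t * v))
      (fderiv ℝ φ (t, t * v) (1, 0) + v * fderiv ℝ φ (t, t * v) (0, 1)) t := by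
    intro t v
    have e1 : HasDerivAt (fun t : ℝ => (t, t * v)) ((1 : ℝ), v) t := by
      have := (hasDerivAt_id t).prodMk ((hasDerivAt_id t).mul_const v)
      simpa using this
    have e2 := (hd (t, t * v)).hasFDerivAt.comp_hasDerivAt t e1
    convert! e2 using 1
    have : ((1 : ℝ), v) = (1, 0) + v • ((0 : ℝ), (1 : ℝ)) := by simp
    rw [this, map_add, map_smul, smul_eq_mul]
  have hφc := hs.continuous
  have q1c := q1.1
  have q2c := q2.1
  have cc : ∀ t : ℝ, Continuous fun v : ℝ => (t, t * v) := fun t => by fun_prop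
  have c0 : ∀ t : ℝ, Continuous fun v => φ (t, t * v) := fun t => hφc.comp (cc t)
  have c1 : ∀ t : ℝ, Continuous fun v => fderiv ℝ φ (t, t * v) (1, 0) := fun t => q1c.comp (cc t)
  have c2 : ∀ t : ℝ, Continuous fun v => fderiv ℝ φ (t, t * v) (0, 1) := fun t => q2c.comp (cc t)
  have cD : ∀ t : ℝ, Continuous fun v =>
      fderiv ℝ φ (t, t * v) (1, 0) + v * fderiv ℝ φ (t, t * v) (0, 1) := fun t =>
    (c1 t).add (continuous_id.mul (c2 t))
  have hI := (intervalIntegral.hasDerivAt_integral_of_dominated_loc_of_deriv_le (μ := volume)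
    (a := -B) (b := 0) (x₀ := t₀) (s := univ)
    (F := fun t v => |P v - k| * φ (t, t * v))
    (F' := fun t v => |P v - k| * (fderiv ℝ φ (t, t * v) (1, 0) + v * fderiv ℝ φ (t, t * v) (0, 1)))
    (bound := fun _ => R * (C1 + B * C2)) univ_mem
    (Eventually.of_forall fun t => (mη.mul (c0 t).measurable).aestronglyMeasurable)
    (ii mη bη (c0 t₀)) (mη.mul (cD t₀).measurable).aestronglyMeasurable
    (Eventually.of_forall fun v hv t _ => by
      rw [uIoc_of_le (by linarith)] at hv
      rw [norm_mul]
      refine mul_le_mul (bη v) ((norm_add_le _ _).trans (add_le_add (b1 _) ?_)) (norm_nonneg _) hR0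
      rw [norm_mul]
      refine mul_le_mul ?_ (b2 _) (norm_nonneg _) hB.le
      rw [Real.norm_eq_abs, abs_of_nonpos hv.2]; linarith [hv.1])
    intervalIntegrable_const
    (Eventually.of_forall fun v hv t _ => (hchain t v).const_mul _)).2
  have hY := (hasDerivAt_id t₀).mul hI
  refine ⟨_, hY.congr_of_eventuallyEq ?_, ?_⟩
  · filter_upwards [lt_mem_nhds (show t₀ / 2 < t₀ by linarith)] with t ht
    have htp : 0 < t := by linarith
    rw [setIntegral_Iio_eq_scaled htp hB fun x hx => by
      rw [image_eq_zero_of_notMem_tsupport (hout t ht.le x hx), mul_zero]]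
    simp only [Pi.mul_apply, id_eq, mul_div_cancel_left₀ _ htp.ne']
  · rw [setIntegral_Iio_eq_scaled ht₀ hB fun x hx => by
      rw [fderiv_of_notMem_tsupport (𝕜 := ℝ) (hout t₀ (by linarith) x hx)]; simp]
    simp only [id_eq, mul_div_cancel_left₀ _ ht₀.ne', one_mul]
    have hψ : ∀ v, HasDerivAt (fun v => φ (t₀, t₀ * v)) (t₀ * fderiv ℝ φ (t₀, t₀ * v) (0, 1)) v := by
      intro v
      have e1 : HasDerivAt (fun v : ℝ => t₀ * v) t₀ v := by
        simpa using (hasDerivAt_id v).const_mul t₀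
      have e2 := (fderiv_snd_eq_deriv hd (t₀, t₀ * v)).comp v e1
      convert! e2 using 1
      ring
    have hE := h.entropy hF hδ hψ ((c2 t₀).const_mul t₀ : _) (fun v => hn _) hB
      (image_eq_zero_of_notMem_tsupport (hout t₀ (by linarith) _ (by rw [mul_neg]))) k
    rw [mul_zero] at hE
    have i1 := ii mη bη (c0 t₀)
    have i2 := ii mη bη (cD t₀)
    have i3 : IntervalIntegrable (fun v => |P v - k| * fderiv ℝ φ (t₀, t₀ * v) (1, 0) +
        kflux F (P v) k * fderiv ℝ φ (t₀, t₀ * v) (0, 1)) volume (-B) 0 :=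
      (ii mη bη (c1 t₀)).add (ii mk bΘ (c2 t₀))
    have : ∫ v in (-B)..0, ((kflux F (P v) k - v * |P v - k|) *
        (t₀ * fderiv ℝ φ (t₀, t₀ * v) (0, 1)) - |P v - k| * φ (t₀, t₀ * v)) =
        t₀ * (∫ v in (-B)..0, (|P v - k| * fderiv ℝ φ (t₀, t₀ * v) (1, 0) +
          kflux F (P v) k * fderiv ℝ φ (t₀, t₀ * v) (0, 1))) -
        (∫ v in (-B)..0, |P v - k| * φ (t₀, t₀ * v)) -
        t₀ * ∫ v in (-B)..0, |P v - k| *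
          (fderiv ℝ φ (t₀, t₀ * v) (1, 0) + v * fderiv ℝ φ (t₀, t₀ * v) (0, 1)) := by
      rw [← intervalIntegral.integral_const_mul, ← intervalIntegral.integral_const_mul,
        ← intervalIntegral.integral_sub (i3.const_mul t₀) i1,
        ← intervalIntegral.integral_sub ((i3.const_mul t₀).sub i1) (i2.const_mul t₀)]
      congr 1; funext v; ring
    rw [this] at hE
    linarith

/-- The entropy inequality with boundary term for the self-similar map `P (x / t)` on the
half-line. -/
theorem entropy_halfLine (h : IsProfile F e lo hi P) (hF : Lip K F) (h0 : 0 ≤ lo) (hR : hi ≤ R)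
    (hδ : Tendsto P (𝓝[<] 0) (𝓝 δ)) {A : ℝ} (hA : ∀ v < -A, P v = a) (hk : k ∈ Icc 0 R)
    (hs : ContDiff ℝ ∞ φ) (hc : HasCompactSupport φ) (hn : ∀ z, 0 ≤ φ z) :
    0 ≤ (∫ z in Ioi 0 ×ˢ Iio 0, (|P (z.2 / z.1) - k| * fderiv ℝ φ z (1, 0) +
        kflux F (P (z.2 / z.1)) k * fderiv ℝ φ z (0, 1))) +
      (∫ x in Iio 0, |a - k| * φ (0, x)) - ∫ t in Ioi 0, kflux F δ k * φ (t, 0) := by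
  have hmem : ∀ v, P v ∈ Icc 0 R := fun v => ⟨h0.trans (h.mem v).1, (h.mem v).2.trans hR⟩
  have hR0 : 0 ≤ R := hk.1.trans hk.2
  obtain ⟨N, hN, hsup⟩ := exists_support_bound hc
  have q1 := fderiv_apply_props hs hc (1, 0)
  have q2 := fderiv_apply_props hs hc (0, 1)
  obtain ⟨C0, hC0, b0⟩ := Continuous.exists_abs_le_of_compact hs.continuous hc
  have mP := h.measurable
  have mk : Measurable fun v => kflux F (P v) k :=
    hF.continuous_kflux.measurable.comp (mP.prodMk measurable_const)
  have bη : ∀ v, |(|P v - k|)| ≤ R := fun v => by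
    rw [abs_abs]; exact abs_sub_le_of_mem (hmem v) hk
  have bΘ : ∀ v, |kflux F (P v) k| ≤ K * R := fun v => hF.abs_kflux_le (hmem v) hk
  set G : ℝ × ℝ → ℝ := fun z => |P (z.2 / z.1) - k| * fderiv ℝ φ z (1, 0) +
    kflux F (P (z.2 / z.1)) k * fderiv ℝ φ z (0, 1) with hG
  have iG : Integrable G :=
    ((q1.1.integrable_of_hasCompactSupport q1.2).bdd_mul (f := fun z => |P (z.2 / z.1) - k|)
      (c := R) (Measurable.aestronglyMeasurable (by fun_prop))
      (Eventually.of_forall fun z => bη _)).add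
    ((q2.1.integrable_of_hasCompactSupport q2.2).bdd_mul
      (f := fun z => kflux F (P (z.2 / z.1)) k)
      (c := K * R) (mk.comp (measurable_snd.div measurable_fst)).aestronglyMeasurable
      (Eventually.of_forall fun z => bΘ _))
  have iG' : IntegrableOn G (Ioi 0 ×ˢ Iio 0) (volume.prod volume) := iG.integrableOn
  set m : ℝ → ℝ := fun t => (∫ x in Iio 0, G (t, x)) - kflux F δ k * φ (t, 0) with hm
  set Y : ℝ → ℝ := fun t => ∫ x in Iio 0, |P (x / t) - k| * φ (t, x) with hY
  set Y₀ := ∫ x in Iio 0, |a - k| * φ (0, x) with hY₀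
  -- The mean, completed at time zero by its limit, is continuous on `[0,N]`, vanishes at `N`, and
  -- has derivative at most `m`. The mean value inequality gives `-Y₀ ≤ ∫ m`, which is the claim.
  set Z : ℝ → ℝ := fun t => if 0 < t then Y t else Y₀ with hZ
  have hder : ∀ t, 0 < t → ∃ Y', HasDerivAt Z Y' t ∧ Y' ≤ m t := by
    intro t ht
    obtain ⟨Y', h1, h2⟩ := h.hasDerivAt_mean_le hF h0 hR hδ hk hs hc hn ht
    refine ⟨Y', h1.congr_of_eventuallyEq ?_, h2⟩
    filter_upwards [lt_mem_nhds ht] with r hr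
    simp only [hZ, hr, if_true, hY]
  choose! Y' hY1 hY2 using hder
  have lim : Tendsto Y (𝓝[>] 0) (𝓝 Y₀) := by
    refine tendsto_integral_filter_of_dominated_convergence
      (fun x => R * (Icc (-N) N).indicator (fun _ => C0) x) ?_ ?_ ?_ ?_
    · refine Eventually.of_forall fun t => Measurable.aestronglyMeasurable ?_
      have : Measurable fun x => φ (t, x) := (hs.continuous.comp (by fun_prop)).measurable
      exact (continuous_abs.measurable.comp
        ((mP.comp (measurable_id.div_const t)).sub_const k)).mul this
    · refine Eventually.of_forall fun t => Eventually.of_forall fun x => ?_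
      rw [norm_mul]
      refine mul_le_mul (bη _) ?_ (norm_nonneg _) hR0
      by_cases hx : x ∈ Icc (-N) N
      · rw [indicator_of_mem hx]; exact b0 _
      · rw [indicator_of_notMem hx, image_eq_zero_of_notMem_tsupport (f := φ) (x := (t, x)),
          norm_zero]
        refine hsup _ (Or.inr ?_)
        by_contra hc'
        exact hx (abs_le.1 (not_le.1 hc').le)
    · have : Integrable ((Icc (-N) N).indicator fun _ => C0) :=
        (integrable_indicator_iff measurableSet_Icc).2
          ((integrable_const C0 (μ := volume.restrict (Icc (-N) N))))
      exact this.restrict.const_mul R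
    · refine (ae_restrict_iff' measurableSet_Iio).2 (Eventually.of_forall fun x hx => ?_)
      have hx : x < 0 := hx
      have l1 : Tendsto (fun t : ℝ => φ (t, x)) (𝓝[>] 0) (𝓝 (φ (0, x))) :=
        ((hs.continuous.comp (f := fun t : ℝ => (t, x)) (by fun_prop)).tendsto 0).mono_left
          nhdsWithin_le_nhds
      refine (l1.const_mul |a - k|).congr' ?_
      have hpos : 0 < -x / (|A| + 1) := div_pos (by linarith) (by positivity)
      filter_upwards [Ioo_mem_nhdsGT hpos] with t ht
      -- For fixed `x < 0` the speed `x / t` tends to `-∞` as `t` tends to `0+`, so the far state is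
      -- reached.
      have h1 : x / t < -A := by
        rw [div_lt_iff₀ ht.1]
        have h2 := (lt_div_iff₀ (by positivity)).1 ht.2
        nlinarith [le_abs_self A, ht.1]
      simp only [hA _ h1]
  have hcont : ContinuousOn Z (Icc 0 N) := by
    intro t ht
    rcases ht.1.eq_or_lt with h1 | h1
    · rw [← h1]
      refine ContinuousWithinAt.mono (t := insert 0 (Ioi 0)) ?_ fun s hs => ?_
      · rw [continuousWithinAt_insert_self]
        have e : Z 0 = Y₀ := by simp [hZ]
        rw [ContinuousWithinAt, e]
        refine lim.congr' ?_
        filter_upwards [self_mem_nhdsWithin] with s hs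
        have hs : 0 < s := hs
        simp [hZ, hs]
      · rcases hs.1.eq_or_lt with h2 | h2
        · exact Or.inl h2.symm
        · exact Or.inr h2
    · exact (hY1 t h1).continuousAt.continuousWithinAt
  have im1 : IntegrableOn (fun t => ∫ x in Iio 0, G (t, x)) (Ioi 0) := by
    rw [IntegrableOn, ← Measure.prod_restrict] at iG'
    exact iG'.integral_prod_left
  have cφ0 : Continuous fun t : ℝ => φ (t, 0) := hs.continuous.comp (by fun_prop)
  have cs0 : HasCompactSupport fun t : ℝ => φ (t, 0) := by
    refine HasCompactSupport.intro (isCompact_Icc (a := -N) (b := N)) fun t ht => ?_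
    refine image_eq_zero_of_notMem_tsupport (hsup _ (Or.inl ?_))
    by_contra hc'
    exact ht (abs_le.1 (not_le.1 hc').le)
  have im2 : IntegrableOn (fun t => kflux F δ k * φ (t, 0)) (Ioi 0) :=
    ((cφ0.integrable_of_hasCompactSupport cs0).const_mul _).integrableOn
  have im : IntegrableOn m (Ioi 0) := im1.sub im2
  have im' : IntegrableOn m (Icc 0 N) := by
    rw [integrableOn_Icc_iff_integrableOn_Ioc]
    exact im.mono_set fun t ht => ht.1
  have hmain := intervalIntegral.sub_le_integral_of_hasDeriv_right_of_le hN.le hcont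
    (fun t ht => (hY1 t ht.1).hasDerivWithinAt) im' (fun t ht => hY2 t ht.1)
  have hZN : Z N = 0 := by
    simp only [hZ, hN, if_true, hY]
    refine integral_eq_zero_of_ae (Eventually.of_forall fun x => ?_)
    have : (N, x) ∉ tsupport φ := hsup _ (Or.inl (le_abs_self N))
    simp [image_eq_zero_of_notMem_tsupport this]
  have hZ0 : Z 0 = Y₀ := by simp [hZ]
  have hineq : ∫ t in (0:ℝ)..N, m t = (∫ z in Ioi 0 ×ˢ Iio 0, G z) -
      ∫ t in Ioi 0, kflux F δ k * φ (t, 0) := by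
    have e1 : ∫ z in Ioi 0 ×ˢ Iio 0, G z = ∫ t in Ioi 0, ∫ x in Iio 0, G (t, x) := by
      rw [Measure.volume_eq_prod]; exact setIntegral_prod G iG'
    rw [e1, ← integral_sub im1 im2, intervalIntegral.integral_of_le hN.le]
    symm
    refine setIntegral_eq_of_subset_of_forall_sdiff_eq_zero measurableSet_Ioi
      (fun x hx => hx.1) fun t ht => ?_
    have htN : N ≤ t := by
      by_contra hc'; exact ht.2 ⟨ht.1, (not_le.1 hc').le⟩
    have hz : ∀ x, (t, x) ∉ tsupport φ := fun x => hsup _ (Or.inl (htN.trans (le_abs_self t)))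
    have hGz : ∀ x, G (t, x) = 0 := fun x => by
      simp only [hG]; rw [fderiv_of_notMem_tsupport (𝕜 := ℝ) (hz x)]; simp
    simp only [hGz, integral_zero, image_eq_zero_of_notMem_tsupport (hz 0), mul_zero, sub_zero]
  rw [hZN, hZ0, hineq] at hmain
  linarith

end IsProfile

end

/-! ### Profiles on half-lines and their gluing. -/

section

/-- A profile on the half-line, with values in `[0,R]`, far state `a` and limit `δ` at `0-`. -/
structure HalfProfile (F : ℝ → ℝ) (R a δ : ℝ) (P : ℝ → ℝ) : Prop where
  exists_profile : ∃ e lo hi, IsProfile F e lo hi P ∧ 0 ≤ lo ∧ hi ≤ R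
  tendsto : Tendsto P (𝓝[<] 0) (𝓝 δ)
  far : ∃ A, ∀ v < -A, P v = a

namespace HalfProfile

variable {F P : ℝ → ℝ} {k δ K R a T : ℝ} {u : ℝ × ℝ → ℝ}

theorem measurable (h : HalfProfile F R a δ P) : Measurable P := by
  obtain ⟨e, lo, hi, hP, -, -⟩ := h.exists_profile
  exact hP.measurable

theorem mem (h : HalfProfile F R a δ P) (v : ℝ) : P v ∈ Icc 0 R := by
  obtain ⟨e, lo, hi, hP, h0, hR⟩ := h.exists_profile
  exact ⟨h0.trans (hP.mem v).1, (hP.mem v).2.trans hR⟩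

theorem limit_mem (h : HalfProfile F R a δ P) : δ ∈ Icc 0 R :=
  isClosed_Icc.mem_of_tendsto h.tendsto (Eventually.of_forall h.mem)

theorem datum_mem (h : HalfProfile F R a δ P) : a ∈ Icc 0 R := by
  obtain ⟨A, hA⟩ := h.far
  rw [← hA (-A - 1) (by linarith)]
  exact h.mem _

theorem countable_not_continuousAt (h : HalfProfile F R a δ P) :
    {v | ¬ContinuousAt P v}.Countable := by
  obtain ⟨e, lo, hi, hP, -, -⟩ := h.exists_profile
  refine hP.monotone.countable_not_continuousAt.mono fun v (hv : ¬ContinuousAt P v) => ?_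
  intro (hc : ContinuousAt (fun v => e * P v) v)
  refine hv ?_
  have : P = fun v => e * (e * P v) := by funext v; rw [← mul_assoc, hP.sq, one_mul]
  rw [this]
  exact hc.const_mul e

/-- The mean over `]-ε,0[` of the distance to the limit tends to zero. -/
theorem tendsto_mean (h : HalfProfile F R a δ P) {t : ℝ} (ht : 0 < t) :
    Tendsto (fun ε : ℝ => ε⁻¹ * ∫ x in Ioo (-ε) 0, |P (x / t) - δ|) (𝓝[>] 0) (𝓝 0) := by
  rw [Metric.tendsto_nhds]
  intro η hη
  have h1 := (Metric.tendsto_nhds.1 h.tendsto) (η / 2) (by linarith)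
  rw [eventually_iff, mem_nhdsLT_iff_exists_Ioo_subset] at h1
  obtain ⟨c, hc, hsub⟩ := h1
  have hc : c < 0 := hc
  filter_upwards [Ioo_mem_nhdsGT (show 0 < -c * t from mul_pos (by linarith) ht)] with ε hε
  have h2 := norm_setIntegral_le_of_norm_le_const (μ := volume) (s := Ioo (-ε) 0)
    (f := fun x => |P (x / t) - δ|) (C := η / 2) (by simp) (fun x hx => by
      rw [Real.norm_eq_abs, abs_abs]
      have : x / t ∈ Ioo c 0 :=
        ⟨by rw [lt_div_iff₀ ht]; linarith [hx.1, hε.2], div_neg_of_neg_of_pos hx.2 ht⟩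
      exact (hsub this).le)
  rw [Real.volume_real_Ioo_of_le (by linarith [hε.1])] at h2
  rw [Real.dist_eq, sub_zero, abs_mul, abs_of_pos (inv_pos.2 hε.1)]
  calc ε⁻¹ * |(∫ x in Ioo (-ε) 0, |P (x / t) - δ|)| ≤ ε⁻¹ * (η / 2 * (0 - -ε)) :=
        mul_le_mul_of_nonneg_left h2 (inv_pos.2 hε.1).le
    _ = η / 2 := by have := hε.1.ne'; field_simp; ring
    _ < η := by linarith

/-- At each positive time the layer mean converges because the profile has a limit at `0-`; Fubini
and dominated convergence in time do the rest. -/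
theorem hasTrace (h : HalfProfile F R a δ P) (mu : Measurable u) (bu : ∀ z, u z ∈ Icc 0 R)
    (hu : ∀ t x, 0 < t → x < 0 → u (t, x) = P (x / t)) : HasTrace T u fun _ => δ := by
  intro s _
  have hR : 0 ≤ R := h.datum_mem.1.trans h.datum_mem.2
  have hb : ∀ z, |(|u z - δ|)| ≤ R := fun z => by
    rw [abs_abs]; exact abs_sub_le_of_mem (bu z) h.limit_mem
  have e : ∀ ε : ℝ, ε⁻¹ * ∫ z in Ioo 0 s ×ˢ Ioo (-ε) 0, |u z - δ| =
      ∫ t in Ioo 0 s, ε⁻¹ * ∫ x in Ioo (-ε) 0, |u (t, x) - δ| := by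
    intro ε
    rw [integral_const_mul, Measure.volume_eq_prod, setIntegral_prod]
    exact integrableOn_of_bounded' (by fun_prop) hb (volume_Ioo_prod_Ioo_ne_top _ _ _ _)
  simp only [e]
  have : Tendsto (fun ε : ℝ => ∫ t in Ioo 0 s, ε⁻¹ * ∫ x in Ioo (-ε) 0, |u (t, x) - δ|)
      (𝓝[>] 0) (𝓝 (∫ t in Ioo 0 s, (0 : ℝ))) := by
    refine tendsto_integral_filter_of_dominated_convergence (fun _ => R) ?_ ?_
      (integrable_const R) ?_
    · refine Eventually.of_forall fun ε => ?_
      have m1 : Measurable fun z : ℝ × ℝ => |u z - δ| := by fun_prop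
      exact (m1.stronglyMeasurable.integral_prod_right' (ν := volume.restrict (Ioo (-ε) 0))
        |>.measurable.const_mul ε⁻¹).aestronglyMeasurable
    · filter_upwards [self_mem_nhdsWithin] with ε hε
      have hε : 0 < ε := hε
      refine Eventually.of_forall fun t => ?_
      have h2 := norm_setIntegral_le_of_norm_le_const (μ := volume) (s := Ioo (-ε) 0)
        (f := fun x => |u (t, x) - δ|) (C := R) (by simp) (fun x _ => hb _)
      rw [Real.volume_real_Ioo_of_le (by linarith)] at h2
      rw [norm_mul, Real.norm_eq_abs, abs_of_pos (inv_pos.2 hε)]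
      refine (mul_le_mul_of_nonneg_left h2 (inv_pos.2 hε).le).trans (le_of_eq ?_)
      field_simp; ring
    · refine (ae_restrict_iff' measurableSet_Ioo).2 (Eventually.of_forall fun t ht => ?_)
      refine (h.tendsto_mean ht.1).congr fun ε => ?_
      congr 1
      refine setIntegral_congr_fun measurableSet_Ioo fun x hx => ?_
      simp only [hu t x ht.1 hx.2]
  simpa using this

/-- The self-similar map is a solution on the half-line. -/
theorem halfSol (h : HalfProfile F R a δ P) (hF : Lip K F) (mu : Measurable u)
    (bu : ∀ z, u z ∈ Icc 0 R) (hu : ∀ t x, 0 < t → x < 0 → u (t, x) = P (x / t)) :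
    HalfSol F R T a u fun _ => δ where
  measurable := mu
  mem := bu
  trace_measurable := measurable_const
  trace_mem _ := h.limit_mem
  datum_mem := h.datum_mem
  trace := h.hasTrace mu bu hu
  entropy k hk φ hs hc _ hn h0 := by
    obtain ⟨e, lo, hi, hP, hlo, hhi⟩ := h.exists_profile
    obtain ⟨A, hA⟩ := h.far
    have hE := hP.entropy_halfLine hF hlo hhi h.tendsto hA hk hs hc hn
    have e1 : ∀ t : ℝ, φ (t, 0) = 0 := fun t => h0 _ le_rfl
    simp only [e1, mul_zero, integral_zero, sub_zero] at hE
    have e2 : ∫ x in Iio 0, |a - k| * φ (0, x) = ∫ x, |a - k| * φ (0, x) :=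
      setIntegral_eq_integral_of_forall_compl_eq_zero fun x hx => by
        rw [h0 (0, x) (not_lt.1 hx), mul_zero]
    have e3 : ∫ z in Ioi 0 ×ˢ univ, (|u z - k| * fderiv ℝ φ z (1, 0) +
        kflux F (u z) k * fderiv ℝ φ z (0, 1)) =
        ∫ z in Ioi 0 ×ˢ Iio 0, (|P (z.2 / z.1) - k| * fderiv ℝ φ z (1, 0) +
          kflux F (P (z.2 / z.1)) k * fderiv ℝ φ z (0, 1)) := by
      rw [setIntegral_eq_of_subset_of_forall_sdiff_eq_zero (s := Ioi 0 ×ˢ Iio 0)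
        (measurableSet_Ioi.prod MeasurableSet.univ) (fun z hz => ⟨hz.1, mem_univ _⟩)]
      · refine setIntegral_congr_fun (measurableSet_Ioi.prod measurableSet_Iio) fun z hz => ?_
        simp only [hu z.1 z.2 hz.1 hz.2]
      · intro z hz
        have hz2 : 0 ≤ z.2 := by
          by_contra hc'; exact hz.2 ⟨hz.1.1, not_le.1 hc'⟩
        have : fderiv ℝ φ z = 0 := IsLocalMin.fderiv_eq_zero
          (Eventually.of_forall fun y => by rw [h0 z hz2]; exact hn y)
        rw [this]; simp
    rw [e3, ← e2]
    exact hE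

end HalfProfile

/-! ### Self-similar maps on the line -/

/-- The map equal to `P (x / t)` for `x < 0` and to `Q (x / t)` for `x ≥ 0`. -/
def selfSimilarMap (P Q : ℝ → ℝ) (a b t x : ℝ) : ℝ :=
  if 0 < t then if x < 0 then P (x / t) else Q (x / t) else riemannDatum a b x

/-- A pair of profiles for the two half-lines. -/
structure ProfilePair (F : ℝ → ℝ) (R a b δl δr : ℝ) (P Q : ℝ → ℝ) : Prop where
  left : HalfProfile F R a δl P
  right : HalfProfile (fun s => -F s) R b δr fun v => Q (-v)

namespace ProfilePair

variable {F P Q : ℝ → ℝ} {K R T a b δl δr : ℝ}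

theorem measurable_right (h : ProfilePair F R a b δl δr P Q) : Measurable Q := by
  have := h.right.measurable.comp measurable_neg
  simpa [Function.comp_def] using this

theorem mem_right (h : ProfilePair F R a b δl δr P Q) (v : ℝ) : Q v ∈ Icc 0 R := by
  simpa using h.right.mem (-v)

theorem measurable (h : ProfilePair F R a b δl δr P Q) :
    Measurable fun z : ℝ × ℝ => selfSimilarMap P Q a b z.1 z.2 := by
  have h1 := h.left.measurable
  have h2 := h.measurable_right
  have hx : MeasurableSet {z : ℝ × ℝ | z.2 < 0} := measurableSet_lt measurable_snd measurable_const
  have ht : MeasurableSet {z : ℝ × ℝ | 0 < z.1} := measurableSet_lt measurable_const measurable_fst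
  unfold selfSimilarMap riemannDatum
  exact Measurable.ite ht (Measurable.ite hx (by fun_prop) (by fun_prop))
    (Measurable.ite hx measurable_const measurable_const)

theorem mem (h : ProfilePair F R a b δl δr P Q) (t x : ℝ) :
    selfSimilarMap P Q a b t x ∈ Icc 0 R := by
  unfold selfSimilarMap riemannDatum
  split_ifs
  exacts [h.left.mem _, h.mem_right _, h.left.datum_mem, h.right.datum_mem]

theorem left_halfSol (h : ProfilePair F R a b δl δr P Q) (hF : Lip K F) :
    HalfSol F R T a (fun z => selfSimilarMap P Q a b z.1 z.2) fun _ => δl :=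
  h.left.halfSol hF h.measurable (fun z => h.mem _ _) fun t x ht hx => by
    simp [selfSimilarMap, ht, hx]

theorem right_halfSol (h : ProfilePair F R a b δl δr P Q) (hF : Lip K F) :
    HalfSol (fun s => -F s) R T b
      (fun z => selfSimilarMap P Q a b (reflect z).1 (reflect z).2) fun _ => δr :=
  h.right.halfSol hF.neg (h.measurable.comp measurable_reflect) (fun z => h.mem _ _)
    fun t x ht hx => by
      have : ¬ -x < 0 := by linarith
      simp only [selfSimilarMap, reflect, ht, this, if_true, if_false]
      rw [neg_div]

/-- The map is continuous in time with values in `L¹_loc`. -/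
theorem continuous (h : ProfilePair F R a b δl δr P Q) {t₀ : ℝ} (ht₀ : 0 ≤ t₀) (M : ℝ) :
    Tendsto (fun t => ∫ x in Icc (-M) M,
      |selfSimilarMap P Q a b t x - selfSimilarMap P Q a b t₀ x|) (𝓝[Ici 0] t₀) (𝓝 0) := by
  have ms := h.measurable
  have ms' : ∀ t, Measurable fun x => selfSimilarMap P Q a b t x := fun t =>
    ms.comp (measurable_const.prodMk measurable_id)
  have hne : ∀ᵐ x : ℝ, x ≠ 0 := by simp [ae_iff, measure_singleton]
  -- At `t₀ = 0` every `x ≠ 0` eventually sees a far state; at `t₀ > 0` it is enough that `x / t₀`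
  -- avoids the countably many discontinuities of the profiles.
  have hpt : ∀ᵐ x : ℝ, Tendsto (fun t => selfSimilarMap P Q a b t x) (𝓝[Ici 0] t₀)
      (𝓝 (selfSimilarMap P Q a b t₀ x)) := by
    rcases ht₀.eq_or_lt with h0 | h0
    · rw [← h0]
      obtain ⟨A, hA⟩ := h.left.far
      obtain ⟨B, hB⟩ := h.right.far
      set D := max |A| |B| + 1 with hD
      have hDp : 0 < D := by positivity
      have hDA : A < D := (le_abs_self A).trans_lt (by linarith [le_max_left |A| |B|])
      have hDB : B < D := (le_abs_self B).trans_lt (by linarith [le_max_right |A| |B|])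
      filter_upwards [hne] with x hx
      refine tendsto_const_nhds.congr' ?_
      have hpos : 0 < |x| / D := div_pos (abs_pos.2 hx) hDp
      filter_upwards [mem_nhdsWithin_of_mem_nhds (gt_mem_nhds hpos)] with t ht
      unfold selfSimilarMap riemannDatum
      simp only [lt_irrefl, if_false]
      by_cases htp : 0 < t
      · simp only [htp, if_true]
        have h1 : t * D < |x| := (lt_div_iff₀ hDp).1 ht
        rcases lt_or_gt_of_ne hx with hx' | hx'
        · simp only [hx', if_true]
          rw [abs_of_neg hx'] at h1
          rw [hA]
          rw [div_lt_iff₀ htp]; nlinarith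
        · simp only [not_lt.2 hx'.le, if_false]
          rw [abs_of_pos hx'] at h1
          have := hB (-(x / t)) (by
            rw [neg_lt_neg_iff, lt_div_iff₀ htp]; nlinarith)
          rw [neg_neg] at this
          exact this.symm
      · simp only [htp, if_false]
    · have hinj : Function.Injective fun x : ℝ => x / t₀ := fun x y hxy =>
        (div_left_inj' h0.ne').1 hxy
      have c1 := (h.left.countable_not_continuousAt.preimage hinj).ae_notMem volume
      have hinj' : Function.Injective fun x : ℝ => -(x / t₀) := neg_injective.comp hinj
      have c2 := (h.right.countable_not_continuousAt.preimage hinj').ae_notMem volume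
      filter_upwards [c1, c2, hne] with x h1 h2 hx
      have h1 : ContinuousAt P (x / t₀) := not_not.1 h1
      have h2 : ContinuousAt (fun v => Q (-v)) (-(x / t₀)) := not_not.1 h2
      have hdiv : Tendsto (fun t : ℝ => x / t) (𝓝[Ici 0] t₀) (𝓝 (x / t₀)) :=
        (tendsto_const_nhds.div tendsto_id h0.ne').mono_left nhdsWithin_le_nhds
      have ev : ∀ᶠ t in 𝓝[Ici 0] t₀, 0 < t := mem_nhdsWithin_of_mem_nhds (lt_mem_nhds h0)
      unfold selfSimilarMap
      simp only [h0, if_true]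
      rcases lt_or_gt_of_ne hx with hx' | hx'
      · simp only [hx', if_true]
        refine (h1.tendsto.comp hdiv).congr' ?_
        filter_upwards [ev] with t ht
        simp [ht]
      · simp only [not_lt.2 hx'.le, if_false]
        have := h2.tendsto.comp hdiv.neg
        simp only [Function.comp_def, neg_neg] at this
        refine this.congr' ?_
        filter_upwards [ev] with t ht
        simp [ht]
  have hR : 0 ≤ R := h.left.datum_mem.1.trans h.left.datum_mem.2
  have : Tendsto (fun t => ∫ x in Icc (-M) M,
      |selfSimilarMap P Q a b t x - selfSimilarMap P Q a b t₀ x|) (𝓝[Ici 0] t₀)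
      (𝓝 (∫ x in Icc (-M) M, (0 : ℝ))) := by
    refine tendsto_integral_filter_of_dominated_convergence (fun _ => R) ?_ ?_
      (integrable_const R) ?_
    · refine Eventually.of_forall fun t => Measurable.aestronglyMeasurable ?_
      exact continuous_abs.measurable.comp ((ms' t).sub (ms' t₀))
    · refine Eventually.of_forall fun t => Eventually.of_forall fun x => ?_
      rw [Real.norm_eq_abs, abs_abs]
      exact abs_sub_le_of_mem (h.mem _ _) (h.mem _ _)
    · refine ae_restrict_of_ae ?_
      filter_upwards [hpt] with x hx
      have := (hx.sub_const (selfSimilarMap P Q a b t₀ x)).abs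
      simpa using this
  simpa using this

/-- The entropy inequality on the line, up to the contribution of the interface. -/
theorem entropy (h : ProfilePair F R a b δl δr P Q) (hF : Lip K F) {k : ℝ} (hk : k ∈ Icc 0 R)
    {φ : ℝ × ℝ → ℝ} (hs : ContDiff ℝ ∞ φ) (hc : HasCompactSupport φ) (hn : ∀ z, 0 ≤ φ z) :
    (∫ t in Ioi 0, (kflux F δl k - kflux F δr k) * φ (t, 0)) ≤
      (∫ z in Ioi 0 ×ˢ univ, (|selfSimilarMap P Q a b z.1 z.2 - k| * fderiv ℝ φ z (1, 0) +
        kflux F (selfSimilarMap P Q a b z.1 z.2) k * fderiv ℝ φ z (0, 1))) +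
      ∫ x, |riemannDatum a b x - k| * φ (0, x) := by
  obtain ⟨e, lo, hi, hP, hlo, hhi⟩ := h.left.exists_profile
  obtain ⟨e', lo', hi', hQ, hlo', hhi'⟩ := h.right.exists_profile
  obtain ⟨A, hA⟩ := h.left.far
  obtain ⟨B, hB⟩ := h.right.far
  have hE := hP.entropy_halfLine hF hlo hhi h.left.tendsto hA hk hs hc hn
  have hE' := hQ.entropy_halfLine (φ := fun z => φ (reflect z)) hF.neg hlo' hhi' h.right.tendsto hB hk
    (hs.comp reflect_smooth) (hasCompactSupport_reflect hc) (fun z => hn _)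
  have ms := h.measurable
  set σ : ℝ × ℝ → ℝ := fun z => selfSimilarMap P Q a b z.1 z.2 with hσ
  have q1 := fderiv_apply_props hs hc (1, 0)
  have q2 := fderiv_apply_props hs hc (0, 1)
  have mk : Measurable fun z => kflux F (σ z) k :=
    hF.continuous_kflux.measurable.comp (ms.prodMk measurable_const)
  set G : ℝ × ℝ → ℝ := fun z => |σ z - k| * fderiv ℝ φ z (1, 0) +
    kflux F (σ z) k * fderiv ℝ φ z (0, 1) with hG
  have iG : Integrable G :=
    ((q1.1.integrable_of_hasCompactSupport q1.2).bdd_mul (f := fun z => |σ z - k|)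
      (c := R) (Measurable.aestronglyMeasurable (by fun_prop))
      (Eventually.of_forall fun z => by
        rw [Real.norm_eq_abs, abs_abs]; exact abs_sub_le_of_mem (h.mem _ _) hk)).add
    ((q2.1.integrable_of_hasCompactSupport q2.2).bdd_mul
      (f := fun z => kflux F (σ z) k) (c := K * R) mk.aestronglyMeasurable
      (Eventually.of_forall fun z => hF.abs_kflux_le (h.mem _ _) hk))
  have s1 : ∫ z in Ioi 0 ×ˢ univ, G z =
      (∫ z in Ioi 0 ×ˢ Iio 0, G z) + ∫ z in Ioi 0 ×ˢ Ici 0, G z := by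
    rw [← setIntegral_union ?_ (measurableSet_Ioi.prod measurableSet_Ici) iG.integrableOn
      iG.integrableOn, ← prod_union, Iio_union_Ici]
    rw [disjoint_left]
    rintro z hz hz'
    exact not_lt.2 (show (0 : ℝ) ≤ z.2 from hz'.2) hz.2
  have s2 : ∫ z in Ioi 0 ×ˢ Iio 0, G z =
      ∫ z in Ioi 0 ×ˢ Iio 0, (|P (z.2 / z.1) - k| * fderiv ℝ φ z (1, 0) +
        kflux F (P (z.2 / z.1)) k * fderiv ℝ φ z (0, 1)) := by
    refine setIntegral_congr_fun (measurableSet_Ioi.prod measurableSet_Iio) fun z hz => ?_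
    have h1 : 0 < z.1 := hz.1
    have h2 : z.2 < 0 := hz.2
    simp only [hG, hσ, selfSimilarMap, h1, h2, if_true]
  have s3 : ∫ z in Ioi 0 ×ˢ Ici 0, G z = ∫ z in Ioi 0 ×ˢ Iio 0, G (reflect z) := by
    rw [setIntegral_reflect G (Ioi 0) (Iio 0)]
    have e1 : -Iio (0 : ℝ) = Ioi 0 := by simp
    rw [e1]
    refine setIntegral_congr_set ?_
    have : (Ioi (0 : ℝ) ×ˢ Ici (0 : ℝ) : Set (ℝ × ℝ)) =ᵐ[volume.prod volume] Ioi 0 ×ˢ Ioi 0 :=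
      Measure.set_prod_ae_eq (ae_eq_refl _) Ioi_ae_eq_Ici.symm
    exact this
  have s4 : ∫ z in Ioi 0 ×ˢ Iio 0, G (reflect z) = ∫ z in Ioi 0 ×ˢ Iio 0,
      (|Q (-(z.2 / z.1)) - k| * fderiv ℝ (fun z => φ (reflect z)) z (1, 0) +
        kflux (fun s => -F s) (Q (-(z.2 / z.1))) k *
          fderiv ℝ (fun z => φ (reflect z)) z (0, 1)) := by
    refine setIntegral_congr_fun (measurableSet_Ioi.prod measurableSet_Iio) fun z hz => ?_
    have h1 : 0 < z.1 := hz.1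
    have h2 : ¬ -z.2 < 0 := not_lt.2 (neg_nonneg.2 (le_of_lt hz.2))
    have h3 : σ (reflect z) = Q (-(z.2 / z.1)) := by
      simp only [hσ, selfSimilarMap, reflect, h1, h2, if_true, if_false, neg_div]
    simp only [hG, fderiv_reflect_fst hs, fderiv_reflect_snd hs, kflux_neg, h3]
    ring
  have cφ0 : Continuous fun x : ℝ => φ (0, x) := hs.continuous.comp (by fun_prop)
  obtain ⟨N, hN, hsup⟩ := exists_support_bound hc
  have csx : HasCompactSupport fun x : ℝ => φ (0, x) := by
    refine HasCompactSupport.intro (isCompact_Icc (a := -N) (b := N)) fun t ht => ?_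
    refine image_eq_zero_of_notMem_tsupport (hsup _ (Or.inr ?_))
    by_contra hc'
    exact ht (abs_le.1 (not_le.1 hc').le)
  have iφ := cφ0.integrable_of_hasCompactSupport csx (μ := volume)
  have d1 : ∫ x, |riemannDatum a b x - k| * φ (0, x) =
      (∫ x in Iio 0, |a - k| * φ (0, x)) + ∫ x in Iio 0, |b - k| * φ (0, -x) := by
    have r1 : ∫ x in Iio 0, |b - k| * φ (0, -x) = ∫ x in Ioi 0, |b - k| * φ (0, x) := by
      have := integral_comp_neg_Iic (0 : ℝ) fun x => |b - k| * φ (0, x)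
      rw [neg_zero] at this
      rw [← this, integral_Iic_eq_integral_Iio]
    have r2 : ∫ x in Iio 0, |a - k| * φ (0, x) =
        ∫ x in Iio 0, |riemannDatum a b x - k| * φ (0, x) :=
      setIntegral_congr_fun measurableSet_Iio fun x hx => by
        have hx : x < 0 := hx
        simp [riemannDatum, hx]
    have r3 : ∫ x in Ioi 0, |b - k| * φ (0, x) =
        ∫ x in Ici 0, |riemannDatum a b x - k| * φ (0, x) := by
      rw [integral_Ici_eq_integral_Ioi]
      refine setIntegral_congr_fun measurableSet_Ioi fun x hx => ?_
      have hx : ¬ x < 0 := not_lt.2 (le_of_lt hx)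
      simp [riemannDatum, hx]
    have mdat : Measurable fun x => |riemannDatum a b x - k| := by
      have : Measurable (riemannDatum a b) :=
        Measurable.ite measurableSet_Iio measurable_const measurable_const
      fun_prop
    have id : Integrable fun x => |riemannDatum a b x - k| * φ (0, x) :=
      iφ.bdd_mul (c := R) mdat.aestronglyMeasurable (Eventually.of_forall fun x => by
        rw [Real.norm_eq_abs, abs_abs]
        refine abs_sub_le_of_mem ?_ hk
        unfold riemannDatum
        split_ifs
        exacts [h.left.datum_mem, h.right.datum_mem])
    rw [r1, r2, r3, ← setIntegral_union (by
      rw [disjoint_left]; intro x hx hx'; exact not_lt.2 (show (0 : ℝ) ≤ x from hx') hx) measurableSet_Ici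
      id.integrableOn id.integrableOn, Iio_union_Ici, setIntegral_univ]
  have d2 : ∫ t in Ioi 0, (kflux F δl k - kflux F δr k) * φ (t, 0) =
      (∫ t in Ioi 0, kflux F δl k * φ (t, 0)) +
        ∫ t in Ioi 0, kflux (fun s => -F s) δr k * φ (t, 0) := by
    rw [integral_const_mul, integral_const_mul, integral_const_mul, kflux_neg]
    ring
  have e0 : ∀ t : ℝ, reflect (t, 0) = (t, 0) := fun t => by simp [reflect]
  have e1 : ∀ x : ℝ, reflect (0, x) = (0, -x) := fun x => rfl
  simp only [e0, e1] at hE'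
  rw [d1, d2, s1, s2, s3, s4]
  linarith

end ProfilePair

end

/-! ### Self-similar maps as entropy weak solutions, and the level at small times. -/

section

variable {R ρbar : ℝ} {f w P Q : ℝ → ℝ} {p : Constraint R (f ρbar)} {a b δl δr : ℝ}

theorem timeInterval_coe (τ : ℝ) : timeInterval (τ : EReal) = Ioo 0 τ := by
  ext t; simp [timeInterval]

/-- The trace condition with test functions follows from the one on bounded time intervals. -/
theorem tendsto_test_of_trace {τ δ : ℝ} {u : ℝ × ℝ → ℝ} {J : ℝ → Set ℝ}
    (hJ : ∀ ε, volume (J ε) < ⊤) (mu : Measurable u) (bu : ∀ z, u z ∈ Icc 0 R) (hδ : δ ∈ Icc 0 R)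
    (h : ∀ s, Tendsto (fun ε : ℝ => ε⁻¹ * ∫ z in Ioo 0 s ×ˢ J ε, |u z - δ|) (𝓝[>] 0) (𝓝 0))
    {φ : ℝ × ℝ → ℝ} (hφ : IsTestFunction τ φ) :
    Tendsto (fun ε : ℝ => ε⁻¹ * ∫ z in timeInterval τ ×ˢ J ε, |u z - δ| * φ z)
      (𝓝[>] 0) (𝓝 0) := by
  obtain ⟨C, hC0, hC⟩ := Continuous.exists_abs_le_of_compact hφ.smooth.continuous hφ.compact
  have lim := (h τ).const_mul C
  rw [mul_zero] at lim
  refine squeeze_zero_norm' ?_ lim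
  filter_upwards [self_mem_nhdsWithin] with ε hε
  have hε : 0 < ε := hε
  rw [timeInterval_coe, norm_mul, Real.norm_eq_abs, abs_of_pos (inv_pos.2 hε), mul_left_comm]
  refine mul_le_mul_of_nonneg_left ?_ (inv_pos.2 hε).le
  rw [← integral_const_mul]
  have hi : IntegrableOn (fun z => C * |u z - δ|) (Ioo 0 τ ×ˢ J ε) := by
    refine Integrable.const_mul ?_ C
    exact integrableOn_of_bounded' (C := R) (by fun_prop) (fun z => by
      rw [abs_abs]; exact abs_sub_le_of_mem (bu z) hδ)
      (volume_prod_lt_top measure_Ioo_lt_top (hJ ε)).ne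
  refine norm_integral_le_of_norm_le hi (Eventually.of_forall fun z => ?_)
  rw [norm_mul, mul_comm, Real.norm_eq_abs, Real.norm_eq_abs, abs_abs]
  exact mul_le_mul_of_nonneg_right (hC z) (abs_nonneg _)

/-- A self-similar map with admissible traces is an entropy weak solution. -/
theorem ProfilePair.isEntropyWeakSolution (hf : FluxCondition R ρbar f)
    (h : ProfilePair (extFlux R f) R a b δl δr P Q) {q τ : ℝ} (hg : Germ R f q δl δr)
    (hq : q ≤ f ρbar) (hval : ∀ᵐ t, t ∈ Ioo 0 τ →
      q ∈ p.values (∫ x in Iio (0 : ℝ), w x * selfSimilarMap P Q a b t x)) :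
    IsEntropyWeakSolution R ρbar f w p (riemannDatum a b) τ (selfSimilarMap P Q a b) := by
  obtain ⟨K, hK⟩ := hf.exists_lip
  have ms := h.measurable
  have hq0 : 0 ≤ q := (hf.nonneg _ hg.left_mem).trans hg.le
  refine ⟨ms.aestronglyMeasurable, fun t _ _ =>
    (ms.comp (measurable_const.prodMk measurable_id)).aestronglyMeasurable,
    fun t _ _ => Eventually.of_forall fun x => h.mem t x, fun t₀ h0 _ M =>
    (h.continuous h0 M).mono_left (nhdsWithin_mono _ fun t ht => ht.1),
    fun _ => q, fun _ => δl, fun _ => δr, aestronglyMeasurable_const,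
    Eventually.of_forall fun _ => ⟨hq0, hq⟩, ?_, ?_, ?_,
    Eventually.of_forall fun _ => ⟨hg.le, hg.eq ▸ hg.le⟩, ?_⟩
  · intro φ hφ hn k hk
    have hE := h.entropy hK hk hφ.smooth hφ.compact hn
    unfold EntropyInequality
    have ht : ∀ z ∈ tsupport φ, z.1 < τ := fun z hz => EReal.coe_lt_coe_iff.1 (hφ.support z hz)
    have hout : ∀ t : ℝ, 0 < t → t ∉ timeInterval (τ : EReal) → ∀ x, (t, x) ∉ tsupport φ := by
      intro t h0 h1 x hx
      rw [timeInterval_coe] at h1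
      exact h1 ⟨h0, ht _ hx⟩
    have e1 : (∫ z in timeInterval (τ : EReal) ×ˢ (univ : Set ℝ),
        (|selfSimilarMap P Q a b z.1 z.2 - k| * fderiv ℝ φ z (1, 0) +
          Real.sign (selfSimilarMap P Q a b z.1 z.2 - k) *
            (f (selfSimilarMap P Q a b z.1 z.2) - f k) * fderiv ℝ φ z (0, 1))) =
        ∫ z in Ioi 0 ×ˢ univ, (|selfSimilarMap P Q a b z.1 z.2 - k| * fderiv ℝ φ z (1, 0) +
          kflux (extFlux R f) (selfSimilarMap P Q a b z.1 z.2) k * fderiv ℝ φ z (0, 1)) := by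
      rw [setIntegral_eq_of_subset_of_forall_sdiff_eq_zero (s := timeInterval (τ : EReal) ×ˢ univ)
        (t := Ioi 0 ×ˢ univ) (measurableSet_Ioi.prod MeasurableSet.univ)
        (fun z hz => ⟨hz.1.1, hz.2⟩)]
      · simp only [kflux, extFlux_eq hk, extFlux_eq (h.mem _ _)]
      · intro z hz
        have hz2 : z ∉ tsupport φ := hout z.1 hz.1.1 (fun h' => hz.2 ⟨h', mem_univ _⟩) z.2
        rw [fderiv_of_notMem_tsupport (𝕜 := ℝ) hz2]; simp
    have e2 : (∫ t in timeInterval (τ : EReal), (1 - q / f ρbar) * f k * φ (t, 0)) =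
        ∫ t in Ioi 0, (1 - q / f ρbar) * f k * φ (t, 0) := by
      rw [setIntegral_eq_of_subset_of_forall_sdiff_eq_zero (s := timeInterval (τ : EReal))
        (t := Ioi 0) measurableSet_Ioi (fun z hz => hz.1)]
      intro t h'
      rw [image_eq_zero_of_notMem_tsupport (hout t h'.1 h'.2 0), mul_zero]
    rw [e1, e2, integral_const_mul]
    rw [integral_const_mul] at hE
    have hi := hg.interface hf hq hk
    have hcong : kflux (extFlux R f) δl k - kflux (extFlux R f) δr k =
        kflux f δl k - kflux f δr k := by
      simp only [kflux, extFlux_eq hk, extFlux_eq hg.left_mem, extFlux_eq hg.right_mem]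
    rw [hcong] at hE
    have hnn : 0 ≤ ∫ t in Ioi 0, φ (t, 0) := integral_nonneg fun t => hn _
    have := mul_nonneg hi hnn
    linarith
  · refine ⟨aestronglyMeasurable_const, Eventually.of_forall fun _ => hg.left_mem, fun φ hφ => ?_⟩
    exact tendsto_test_of_trace (J := fun ε => Ioo (-ε) 0)
      (fun _ => measure_Ioo_lt_top) ms (fun z => h.mem _ _) hg.left_mem
      (fun s => (h.left_halfSol hK (T := s + 1)).trace s (by linarith)) hφ
  · refine ⟨aestronglyMeasurable_const, Eventually.of_forall fun _ => hg.right_mem, fun φ hφ => ?_⟩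
    refine tendsto_test_of_trace (J := fun ε => Ioo 0 ε)
      (fun _ => measure_Ioo_lt_top) ms (fun z => h.mem _ _) hg.right_mem (fun s => ?_) hφ
    refine ((h.right_halfSol hK (T := s + 1)).trace s (by linarith)).congr fun ε => ?_
    have e := setIntegral_reflect (fun z => |selfSimilarMap P Q a b z.1 z.2 - δr|)
      (Ioo 0 s) (Ioo (-ε) 0)
    simp only [neg_Ioo, neg_zero, neg_neg] at e
    rw [← e]
  · rw [timeInterval_coe]
    exact (ae_restrict_iff' measurableSet_Ioo).2 hval

/-- The constraint level `q` is compatible with the flux `g` at the interface and the left state. -/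
def LevelCompatible (f : ℝ → ℝ) (p : Constraint R (f ρbar)) (P : ℝ → ℝ) (a g q : ℝ) : Prop :=
  (g < f a ∧ q = p.rightValue a) ∨ (f a < g ∧ q = p.leftValue a) ∨
    ((∀ v < 0, P v = a) ∧ q ∈ Icc (p.rightValue a) (p.leftValue a))

/-- The mass gained by the left half is exactly `t (f a - f δl)`. Its sign places the weighted mean
on one side of `a` at small times and so selects the one-sided limit of `p`; if the left half is
constant the mean is `a` itself and every value at the jump is allowed. The bound is uniform in `τ'
≤ τ` so that two solutions can be put on a common time interval. -/
theorem ProfilePair.exists_solution (hf : FluxCondition R ρbar f) (hw : WeightCondition w)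
    (h : ProfilePair (extFlux R f) R a b δl δr P Q) {q : ℝ} (hg : Germ R f q δl δr)
    (hq : LevelCompatible f p P a (f δl) q) :
    ∃ τ > 0, ∀ τ' ≤ τ, IsEntropyWeakSolution R ρbar f w p (riemannDatum a b) (τ' : ℝ)
      (selfSimilarMap P Q a b) := by
  obtain ⟨K, hK0, hK⟩ := hf.exists_pos_lip
  have ha := h.left.datum_mem
  have ms : ∀ t, Measurable fun x => selfSimilarMap P Q a b t x := fun t =>
    h.measurable.comp (measurable_const.prodMk measurable_id)
  have hqm : q ≤ f ρbar := by
    rcases hq with ⟨-, rfl⟩ | ⟨-, rfl⟩ | ⟨-, h2⟩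
    · exact (p.rightValue_mem a).2
    · exact (p.leftValue_mem a).2
    · exact h2.2.trans (p.leftValue_mem a).2
  have mass : ∀ τ > 0, ∀ᵐ t, t ∈ Ioo 0 τ →
      (∀ᵐ x, x < -(K * t) → selfSimilarMap P Q a b t x = a) ∧
      ∫ x in Ioo (-(K * t)) 0, (selfSimilarMap P Q a b t x - a) = t * (f a - f δl) := by
    intro τ hτ
    filter_upwards [(h.left_halfSol hK (T := τ)).mass hτ hK] with t ht htτ
    obtain ⟨h1, h2⟩ := ht htτ
    refine ⟨h1, h2.trans ?_⟩
    rw [intervalIntegral.integral_const, extFlux_eq ha, extFlux_eq h.left.limit_mem, smul_eq_mul,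
      sub_zero]
  rcases hq with ⟨h1, rfl⟩ | ⟨h1, rfl⟩ | ⟨h1, h2⟩
  · obtain ⟨τ, hτ, hsmall⟩ := exists_small_time hw p hK0 ha (sub_pos.2 h1)
    refine ⟨τ, hτ, fun τ' hτ' => h.isEntropyWeakSolution hf hg hqm ?_⟩
    filter_upwards [mass τ hτ] with t ht htτ
    have htτ' : t ∈ Ioo 0 τ := ⟨htτ.1, htτ.2.trans_le hτ'⟩
    obtain ⟨m1, m2⟩ := ht htτ'
    obtain ⟨-, v2, -⟩ := hsmall t htτ'.1 htτ'.2 _ (ms t) (h.mem t) m1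
    rw [v2 (by rw [m2]; linarith)]
    rfl
  · obtain ⟨τ, hτ, hsmall⟩ := exists_small_time hw p hK0 ha (sub_pos.2 h1)
    refine ⟨τ, hτ, fun τ' hτ' => h.isEntropyWeakSolution hf hg hqm ?_⟩
    filter_upwards [mass τ hτ] with t ht htτ
    have htτ' : t ∈ Ioo 0 τ := ⟨htτ.1, htτ.2.trans_le hτ'⟩
    obtain ⟨m1, m2⟩ := ht htτ'
    obtain ⟨-, -, v3⟩ := hsmall t htτ'.1 htτ'.2 _ (ms t) (h.mem t) m1
    rw [v3 (by rw [m2]; linarith)]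
    rfl
  · refine ⟨1, one_pos, fun τ' _ => h.isEntropyWeakSolution hf hg hqm ?_⟩
    refine Eventually.of_forall fun t ht => ?_
    have : ∫ x in Iio (0 : ℝ), w x * selfSimilarMap P Q a b t x = a := by
      have e : ∫ x in Iio (0 : ℝ), w x * selfSimilarMap P Q a b t x = ∫ x in Iio (0 : ℝ), w x * a := by
        refine setIntegral_congr_fun measurableSet_Iio fun x hx => ?_
        have hx : x < 0 := hx
        have ht0 : 0 < t := ht.1
        simp only [selfSimilarMap, ht0, hx, if_true, h1 _ (div_neg_of_neg_of_pos hx ht0)]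
      rw [e, integral_mul_const, hw.integral_eq_one, one_mul]
    rw [this]
    exact h2

/-- Uniqueness for small times of an explicit solution whose traces are admissible for the
constraint of every other solution. -/
theorem ProfilePair.isUnique (hf : FluxCondition R ρbar f) (hw : WeightCondition w)
    (h : ProfilePair (extFlux R f) R a b δl δr P Q) {q : ℝ} (hg : Germ R f q δl δr)
    (hq : LevelCompatible f p P a (f δl) q)
    (hforce : ∃ τ > 0, ∀ T, 0 < T → T ≤ τ → ∀ u γ δ q,
      LineSol (extFlux R f) (f ρbar) R T a b u γ δ q →
      (∀ᵐ t, t ∈ Ioo 0 T → Germ R f (q t) (γ t) (δ t)) →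
      (∀ᵐ t, t ∈ Ioo 0 T → q t ∈ p.values (∫ x in Iio (0 : ℝ), w x * u (t, x))) →
      ∀ᵐ t, t ∈ Ioo 0 T → Germ R f (q t) δl δr) :
    IsUniqueForSmallTimes R ρbar f w p a b (selfSimilarMap P Q a b) := by
  obtain ⟨K, hK⟩ := hf.exists_lip
  obtain ⟨τ₁, hτ₁, hsol⟩ := h.exists_solution hf hw hg hq
  obtain ⟨τ₂, hτ₂, hfo⟩ := hforce
  have hτ : 0 < min τ₁ τ₂ := lt_min hτ₁ hτ₂
  refine ⟨min τ₁ τ₂, hτ, hsol _ (min_le_left _ _), fun T ρ hT hρ t ht0 htτ htT => ?_⟩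
  -- A finite horizon beyond `t` and below both lifetimes; `T` may be infinite.
  obtain ⟨S, hS1, hS2⟩ := EReal.lt_iff_exists_real_btwn.1
    (lt_min (EReal.coe_lt_coe_iff.2 htτ) htT : (t : EReal) < min ((min τ₁ τ₂ : ℝ) : EReal) T)
  have htS : t < S := EReal.coe_lt_coe_iff.1 hS1
  have hSτ : (S : EReal) < ((min τ₁ τ₂ : ℝ) : EReal) := hS2.trans_le (min_le_left _ _)
  have hST : (S : EReal) ≤ T := (hS2.trans_le (min_le_right _ _)).le
  have hS0 : 0 < S := ht0.trans_lt htS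
  obtain ⟨u, γ, δ, q', hline, hae, hgerm, hval⟩ :=
    hρ.exists_lineSol hf h.left.datum_mem h.right.datum_mem hST
  have hσ := hfo S hS0 ((EReal.coe_lt_coe_iff.1 hSτ).le.trans (min_le_right _ _)) u γ δ q' hline
    hgerm hval
  -- The comparison uses the level of the given solution, not the one that was used to construct the
  -- explicit map.
  have key := hline.ae_eq hf hS0 hgerm (h.left_halfSol hK) (h.right_halfSol hK) hσ
  refine hρ.eq_of_ae_eq (hsol _ (min_le_left _ _)) hST hSτ.le ?_ ht0 htS
  filter_upwards [hae, key] with r h1 h2 hr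
  filter_upwards [h1 hr, h2 hr] with x h3 h4
  rw [h3, h4]

/-- At small times the constraint of a solution is determined by the mean flux through the
interface. -/
theorem exists_level_time (hf : FluxCondition R ρbar f) (hw : WeightCondition w)
    (p : Constraint R (f ρbar)) (ha : a ∈ Icc 0 R) {c : ℝ} (hc : 0 < c) :
    ∃ τ > 0, ∀ T, 0 < T → T ≤ τ → ∀ u γ δ q,
      LineSol (extFlux R f) (f ρbar) R T a b u γ δ q →
      (∀ᵐ t, t ∈ Ioo 0 T → q t ∈ p.values (∫ x in Iio (0 : ℝ), w x * u (t, x))) →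
      ∀ᵐ t, t ∈ Ioo 0 T → q t ∈ Icc (p.rightValue a) (p.leftValue a) ∧
        (c * t ≤ ∫ r in (0:ℝ)..t, (f a - f (γ r)) → q t = p.rightValue a) ∧
        (∫ r in (0:ℝ)..t, (f a - f (γ r)) ≤ -(c * t) → q t = p.leftValue a) := by
  obtain ⟨K, hK0, hK⟩ := hf.exists_pos_lip
  obtain ⟨τ, hτ, hsmall⟩ := exists_small_time hw p hK0 ha hc
  refine ⟨τ, hτ, fun T hT hTτ u γ δ q h hval => ?_⟩
  filter_upwards [h.left.mass hT hK, hval] with t ht hv htT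
  obtain ⟨h1, h2⟩ := ht htT
  have e : ∫ r in (0:ℝ)..t, (extFlux R f a - extFlux R f (γ r)) =
      ∫ r in (0:ℝ)..t, (f a - f (γ r)) := by
    simp only [extFlux_eq ha, extFlux_eq (h.left_mem _)]
  rw [e] at h2
  obtain ⟨v1, v2, v3⟩ := hsmall t htT.1 (htT.2.trans_le hTτ) (fun x => u (t, x))
    (h.measurable.comp (measurable_const.prodMk measurable_id)) (fun x => h.mem _) h1
  have hv := hv htT
  refine ⟨v1 hv, fun h' => ?_, fun h' => ?_⟩
  · rw [← h2] at h'
    have := v2 h'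
    rw [this] at hv
    exact hv
  · rw [← h2] at h'
    have := v3 h'
    rw [this] at hv
    exact hv

end

/-! ### Limits of Riemann profiles at the interface. -/

section

variable {R ρbar : ℝ} {f F P Q : ℝ → ℝ} {a b e lo hi K δ : ℝ}

namespace IsProfile

/-- Under the reflection of `x` the flux and the speed change sign, and minimisation becomes
maximisation. -/
theorem reverse (h : IsProfile F e lo hi P) :
    IsProfile (fun s => -F s) (-e) lo hi fun v => P (-v) where
  sign := by rcases h.sign with rfl | rfl <;> simp
  mem v := h.mem _
  opt v s hs := by
    have := h.opt (-v) s hs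
    linarith

theorem exists_limit (h : IsProfile F e lo hi P) : ∃ δ, Tendsto P (𝓝[<] 0) (𝓝 δ) := by
  have hb : BddAbove ((fun v => e * P v) '' Iio 0) := by
    refine ⟨e * P 0, ?_⟩
    rintro _ ⟨v, hv, rfl⟩
    exact h.monotone (le_of_lt hv)
  have := ((h.monotone.monotoneOn (Iio 0)).tendsto_nhdsLT hb).const_mul e
  refine ⟨_, this.congr fun v => ?_⟩
  rw [← mul_assoc, h.sq, one_mul]

/-- For `v < -K` the linear term outweighs the variation of the Lipschitz flux, so the optimum is at
the end of the interval. -/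
theorem far_eq (h : IsProfile F e lo hi P) (hF : Lip K F) (ha : a ∈ Icc lo hi)
    (hfar : ∀ s ∈ Icc lo hi, 0 ≤ e * (s - a)) {v : ℝ} (hv : v < -K) : P v = a := by
  have h1 := h.opt v a ha
  have h2 := hfar _ (h.mem v)
  have he : |e| = 1 := by rcases h.sign with rfl | rfl <;> simp
  have h3 : e * (F a - F (P v)) ≤ K * (e * (P v - a)) := by
    have h4 : e * (F a - F (P v)) ≤ |F a - F (P v)| := by
      rw [← one_mul |F a - F (P v)|, ← he, ← abs_mul]; exact le_abs_self _
    have h5 : |a - P v| = e * (P v - a) := by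
      rw [abs_sub_comm, ← abs_of_nonneg h2, abs_mul, he, one_mul]
    rw [← h5]
    exact h4.trans (hF.2 _ _)
  have h4 : (-v - K) * (e * (P v - a)) ≤ 0 := by nlinarith
  have h5 : e * (P v - a) = 0 := by
    rcases h2.eq_or_lt with h6 | h6
    · exact h6.symm
    · nlinarith
  have h6 : e ≠ 0 := by rcases h.sign with rfl | rfl <;> norm_num
  linarith [(mul_eq_zero.1 h5).resolve_left h6]

/-- If the far state is optimal for `F`, the profile is constant on the half-line. -/
theorem eq_far_of_opt (h : IsProfile F e lo hi P) (ha : a ∈ Icc lo hi)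
    (hfar : ∀ s ∈ Icc lo hi, 0 ≤ e * (s - a)) (hopt : ∀ s ∈ Icc lo hi, e * F a ≤ e * F s) {v : ℝ}
    (hv : v < 0) : P v = a := by
  have h1 := h.opt v a ha
  have h2 := hfar _ (h.mem v)
  have h3 := hopt _ (h.mem v)
  have h5 : e * (P v - a) = 0 := by
    rcases h2.eq_or_lt with h6 | h6
    · exact h6.symm
    · nlinarith
  have h6 : e ≠ 0 := by rcases h.sign with rfl | rfl <;> norm_num
  linarith [(mul_eq_zero.1 h5).resolve_left h6]

theorem halfProfile (h : IsProfile F e lo hi P) (hF : Lip K F) (h0 : 0 ≤ lo) (hR : hi ≤ R)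
    (ha : a ∈ Icc lo hi) (hfar : ∀ s ∈ Icc lo hi, 0 ≤ e * (s - a)) :
    ∃ δ ∈ Icc lo hi, HalfProfile F R a δ P ∧ ∀ s ∈ Icc lo hi, e * F δ ≤ e * F s := by
  obtain ⟨δ, hδ⟩ := h.exists_limit
  exact ⟨δ, h.limit_mem hδ, ⟨⟨e, lo, hi, h, h0, hR⟩, hδ, K, fun v hv => h.far_eq hF ha hfar hv⟩,
    fun s hs => h.limit_opt hF.continuous hδ hs⟩

end IsProfile

/-! ### The classical Riemann solver -/

/-- The minimisers form a nonempty compact set, so their supremum is one of them; the selection made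
at shock speeds plays no other role. -/
theorem riemannSolver_isProfile_of_le (hf : FluxCondition R ρbar f) (ha : 0 ≤ a) (hb : b ≤ R)
    (hab : a ≤ b) : IsProfile (extFlux R f) 1 a b (riemannSolver f a b) := by
  have hsub : Icc a b ⊆ Icc 0 R := Icc_subset_Icc ha hb
  have key : ∀ v, riemannSolver f a b v ∈
      {s | s ∈ Icc a b ∧ ∀ r ∈ Icc a b, f s - v * s ≤ f r - v * r} := by
    intro v
    unfold riemannSolver
    rw [if_pos hab]
    have hc : ContinuousOn (fun s => f s - v * s) (Icc a b) :=
      (hf.continuousOn.mono hsub).sub (by fun_prop)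
    obtain ⟨s₀, hs₀, hmin⟩ := isCompact_Icc.exists_isMinOn (nonempty_Icc.2 hab) hc
    have hset : {s | s ∈ Icc a b ∧ ∀ r ∈ Icc a b, f s - v * s ≤ f r - v * r} =
        {s | s ∈ Icc a b ∧ (fun s => f s - v * s) s ∈ Iic (f s₀ - v * s₀)} := by
      ext s
      refine ⟨fun h => ⟨h.1, h.2 s₀ hs₀⟩, fun h => ⟨h.1, fun r hr => ?_⟩⟩
      have h2 : f s - v * s ≤ f s₀ - v * s₀ := h.2
      exact h2.trans (hmin hr)
    have hclosed : IsClosed {s | s ∈ Icc a b ∧ ∀ r ∈ Icc a b, f s - v * s ≤ f r - v * r} := by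
      rw [hset]; exact hc.preimage_isClosed_of_isClosed isClosed_Icc isClosed_Iic
    exact hclosed.csSup_mem ⟨s₀, hs₀, fun r hr => hmin hr⟩ ⟨b, fun s hs => hs.1.2⟩
  refine ⟨Or.inl rfl, fun v => (key v).1, fun v s hs => ?_⟩
  rw [one_mul, one_mul, extFlux_eq (hsub (key v).1), extFlux_eq (hsub hs)]
  exact (key v).2 s hs

theorem riemannSolver_isProfile_of_lt (hf : FluxCondition R ρbar f) (hb : 0 ≤ b) (ha : a ≤ R)
    (hab : b < a) : IsProfile (extFlux R f) (-1) b a (riemannSolver f a b) := by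
  have hsub : Icc b a ⊆ Icc 0 R := Icc_subset_Icc hb ha
  have key : ∀ v, riemannSolver f a b v ∈
      {s | s ∈ Icc b a ∧ ∀ r ∈ Icc b a, f r - v * r ≤ f s - v * s} := by
    intro v
    unfold riemannSolver
    rw [if_neg (not_le.2 hab)]
    have hc : ContinuousOn (fun s => f s - v * s) (Icc b a) :=
      (hf.continuousOn.mono hsub).sub (by fun_prop)
    obtain ⟨s₀, hs₀, hmax⟩ := isCompact_Icc.exists_isMaxOn (nonempty_Icc.2 hab.le) hc
    have hset : {s | s ∈ Icc b a ∧ ∀ r ∈ Icc b a, f r - v * r ≤ f s - v * s} =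
        {s | s ∈ Icc b a ∧ (fun s => f s - v * s) s ∈ Ici (f s₀ - v * s₀)} := by
      ext s
      refine ⟨fun h => ⟨h.1, h.2 s₀ hs₀⟩, fun h => ⟨h.1, fun r hr => ?_⟩⟩
      have h2 : f s₀ - v * s₀ ≤ f s - v * s := h.2
      exact (hmax hr).trans h2
    have hclosed : IsClosed {s | s ∈ Icc b a ∧ ∀ r ∈ Icc b a, f r - v * r ≤ f s - v * s} := by
      rw [hset]; exact hc.preimage_isClosed_of_isClosed isClosed_Icc isClosed_Ici
    exact hclosed.csInf_mem ⟨s₀, hs₀, fun r hr => hmax hr⟩ ⟨b, fun s hs => hs.1.1⟩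
  refine ⟨Or.inr rfl, fun v => (key v).1, fun v s hs => ?_⟩
  rw [extFlux_eq (hsub (key v).1), extFlux_eq (hsub hs)]
  linarith [(key v).2 s hs]

/-- `δ` is optimal for the flux between the states `a` and `b`: it minimizes `f` over `[a,b]` if
`a ≤ b` and maximizes `f` over `[b,a]` if `b ≤ a`. -/
structure IsOptimalState (f : ℝ → ℝ) (a b δ : ℝ) : Prop where
  of_le : a ≤ b → δ ∈ Icc a b ∧ ∀ s ∈ Icc a b, f δ ≤ f s
  of_ge : b ≤ a → δ ∈ Icc b a ∧ ∀ s ∈ Icc b a, f s ≤ f δ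

theorem riemannSolver_left (hf : FluxCondition R ρbar f) (ha : a ∈ Icc 0 R) (hb : b ∈ Icc 0 R) :
    ∃ δ, IsOptimalState f a b δ ∧ HalfProfile (extFlux R f) R a δ (riemannSolver f a b) := by
  obtain ⟨K, hK⟩ := hf.exists_lip
  rcases le_or_gt a b with hab | hab
  · have hsub : Icc a b ⊆ Icc 0 R := Icc_subset_Icc ha.1 hb.2
    obtain ⟨δ, hδ, h1, h2⟩ := (riemannSolver_isProfile_of_le hf ha.1 hb.2 hab).halfProfile hK ha.1
      hb.2 ⟨le_rfl, hab⟩ (fun s hs => by linarith [hs.1])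
    have h3 : ∀ s ∈ Icc a b, f δ ≤ f s := fun s hs => by
      have := h2 s hs
      rwa [one_mul, one_mul, extFlux_eq (hsub hδ), extFlux_eq (hsub hs)] at this
    refine ⟨δ, ⟨fun _ => ⟨hδ, h3⟩, fun hba => ?_⟩, h1⟩
    obtain rfl := le_antisymm hab hba
    exact ⟨hδ, fun s hs => by
      rw [Icc_self, mem_singleton_iff] at hs hδ; rw [hs, hδ]⟩
  · have hsub : Icc b a ⊆ Icc 0 R := Icc_subset_Icc hb.1 ha.2
    obtain ⟨δ, hδ, h1, h2⟩ := (riemannSolver_isProfile_of_lt hf hb.1 ha.2 hab).halfProfile hK hb.1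
      ha.2 ⟨hab.le, le_rfl⟩ (fun s hs => by linarith [hs.2])
    refine ⟨δ, ⟨fun h => absurd h (not_le.2 hab), fun _ => ⟨hδ, fun s hs => ?_⟩⟩, h1⟩
    have := h2 s hs
    rw [extFlux_eq (hsub hδ), extFlux_eq (hsub hs)] at this
    linarith

theorem riemannSolver_right (hf : FluxCondition R ρbar f) (ha : a ∈ Icc 0 R) (hb : b ∈ Icc 0 R) :
    ∃ δ, IsOptimalState f a b δ ∧
      HalfProfile (fun s => -extFlux R f s) R b δ fun v => riemannSolver f a b (-v) := by
  obtain ⟨K, hK⟩ := hf.exists_lip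
  rcases le_or_gt a b with hab | hab
  · have hsub : Icc a b ⊆ Icc 0 R := Icc_subset_Icc ha.1 hb.2
    obtain ⟨δ, hδ, h1, h2⟩ := (riemannSolver_isProfile_of_le hf ha.1 hb.2 hab).reverse.halfProfile
      hK.neg ha.1 hb.2 ⟨hab, le_rfl⟩ (fun s hs => by linarith [hs.2])
    have h3 : ∀ s ∈ Icc a b, f δ ≤ f s := fun s hs => by
      have := h2 s hs
      rw [extFlux_eq (hsub hδ), extFlux_eq (hsub hs)] at this
      linarith
    refine ⟨δ, ⟨fun _ => ⟨hδ, h3⟩, fun hba => ?_⟩, h1⟩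
    obtain rfl := le_antisymm hab hba
    exact ⟨hδ, fun s hs => by
      rw [Icc_self, mem_singleton_iff] at hs hδ; rw [hs, hδ]⟩
  · have hsub : Icc b a ⊆ Icc 0 R := Icc_subset_Icc hb.1 ha.2
    obtain ⟨δ, hδ, h1, h2⟩ := (riemannSolver_isProfile_of_lt hf hb.1 ha.2 hab).reverse.halfProfile
      hK.neg hb.1 ha.2 ⟨le_rfl, hab.le⟩ (fun s hs => by linarith [hs.1])
    refine ⟨δ, ⟨fun h => absurd h (not_le.2 hab), fun _ => ⟨hδ, fun s hs => ?_⟩⟩, h1⟩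
    have := h2 s hs
    rw [extFlux_eq (hsub hδ), extFlux_eq (hsub hs)] at this
    linarith

/-- The profile is constant on the left if the left state is optimal. -/
theorem riemannSolver_eq_left (hf : FluxCondition R ρbar f) (ha : a ∈ Icc 0 R) (hb : b ∈ Icc 0 R)
    (h : IsOptimalState f a b a) {v : ℝ} (hv : v < 0) : riemannSolver f a b v = a := by
  rcases le_or_gt a b with hab | hab
  · have hsub : Icc a b ⊆ Icc 0 R := Icc_subset_Icc ha.1 hb.2
    refine (riemannSolver_isProfile_of_le hf ha.1 hb.2 hab).eq_far_of_opt ⟨le_rfl, hab⟩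
      (fun s hs => by linarith [hs.1]) (fun s hs => ?_) hv
    rw [extFlux_eq ha, extFlux_eq (hsub hs)]
    linarith [(h.of_le hab).2 s hs]
  · have hsub : Icc b a ⊆ Icc 0 R := Icc_subset_Icc hb.1 ha.2
    refine (riemannSolver_isProfile_of_lt hf hb.1 ha.2 hab).eq_far_of_opt ⟨hab.le, le_rfl⟩
      (fun s hs => by linarith [hs.2]) (fun s hs => ?_) hv
    rw [extFlux_eq ha, extFlux_eq (hsub hs)]
    linarith [(h.of_ge hab.le).2 s hs]

/-- Two limits of one and the same profile at the origin. -/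
theorem riemannSolver_limits_le (hf : FluxCondition R ρbar f) (ha : a ∈ Icc 0 R)
    (hb : b ∈ Icc 0 R) {δ δ' : ℝ} (h : IsOptimalState f a b δ) (h' : IsOptimalState f a b δ')
    (hδ : HalfProfile (extFlux R f) R a δ (riemannSolver f a b))
    (hδ' : HalfProfile (fun s => -extFlux R f s) R b δ' fun v => riemannSolver f a b (-v)) :
    δ ≤ δ' := by
  rcases le_or_gt a b with hab | hab
  · refine le_of_tendsto_of_tendsto hδ.tendsto hδ'.tendsto ?_
    filter_upwards [self_mem_nhdsWithin] with v hv
    have hv : v < 0 := hv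
    have := (riemannSolver_isProfile_of_le hf ha.1 hb.2 hab).monotone (show v ≤ -v by linarith)
    simpa using this
  · obtain ⟨m1, o1⟩ := h.of_ge hab.le
    obtain ⟨m2, o2⟩ := h'.of_ge hab.le
    -- For `b < a` the profile decreases, so the limits could be in the wrong order. But both
    -- maximise `f` over `[b,a]`, and `f`, strictly increasing and then strictly decreasing, has a
    -- single maximiser there.
    by_contra! hlt
    have e : f δ = f δ' := le_antisymm (o2 _ m1) (o1 _ m2)
    have hδR : δ ≤ R := m1.2.trans ha.2
    have hδ'0 : 0 ≤ δ' := hb.1.trans m2.1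
    rcases le_or_gt δ ρbar with h1 | h1
    · exact (hf.strictMonoOn ⟨hδ'0, hlt.le.trans h1⟩ ⟨hδ'0.trans hlt.le, h1⟩ hlt).ne e.symm
    rcases le_or_gt ρbar δ' with h2 | h2
    · exact (hf.strictAntiOn ⟨h2, hlt.le.trans hδR⟩ ⟨h2.trans hlt.le, hδR⟩ hlt).ne e
    · have := o1 ρbar ⟨m2.1.trans h2.le, h1.le.trans m1.2⟩
      exact absurd this (not_le.2 (hf.lt_max ⟨hδ'0.trans hlt.le, hδR⟩ h1.ne'))

/-- Two self-similar maps that agree at a positive time have the same limit at `0-`. -/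
theorem limit_eq_of_ae_eq {P' Q' : ℝ → ℝ} {δ δ' t b' : ℝ} (ht : 0 < t)
    (hδ : Tendsto P (𝓝[<] 0) (𝓝 δ)) (hδ' : Tendsto P' (𝓝[<] 0) (𝓝 δ'))
    (h : selfSimilarMap P Q a b t =ᵐ[volume] selfSimilarMap P' Q' a b' t) : δ = δ' := by
  have hdiv : Tendsto (fun x : ℝ => x / t) (𝓝[<] 0) (𝓝[<] 0) := by
    refine tendsto_nhdsWithin_iff.2 ⟨?_, ?_⟩
    · have : Tendsto (fun x : ℝ => x / t) (𝓝 0) (𝓝 (0 / t)) := tendsto_id.div_const t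
      rw [zero_div] at this
      exact this.mono_left nhdsWithin_le_nhds
    · filter_upwards [self_mem_nhdsWithin] with x hx using div_neg_of_neg_of_pos hx ht
  refine tendsto_nhds_unique_of_frequently_eq (hδ.comp hdiv) (hδ'.comp hdiv) fun hev => ?_
  rw [eventually_iff, mem_nhdsLT_iff_exists_Ioo_subset] at hev
  obtain ⟨c, hc, hsub⟩ := hev
  obtain ⟨x, hx, hxI⟩ := (Measure.dense_of_ae h).exists_mem_open
    (isOpen_Ioo (a := c) (b := (0 : ℝ))) (nonempty_Ioo.2 hc)
  refine hsub hxI ?_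
  have hx : selfSimilarMap P Q a b t x = selfSimilarMap P' Q' a b' t x := hx
  simpa [selfSimilarMap, ht, hxI.2] using hx

end

section

variable {R ρbar : ℝ} {f w : ℝ → ℝ} {p : Constraint R (f ρbar)} {a b : ℝ}

/-! ### Explicit solutions -/

theorem classicalMap_eq (f : ℝ → ℝ) (a b : ℝ) :
    classicalMap f a b = selfSimilarMap (riemannSolver f a b) (riemannSolver f a b) a b := by
  funext t x; simp [classicalMap, selfSimilarMap]

theorem nonclassicalMap_eq (R ρbar : ℝ) (f : ℝ → ℝ) (a b q : ℝ) :
    nonclassicalMap R ρbar f a b q = selfSimilarMap (riemannSolver f a (hatρ R ρbar f q))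
      (riemannSolver f (checkρ ρbar f q) b) a b := rfl

theorem IsOptimalState.flux_eq {δ δ' : ℝ} (h : IsOptimalState f a b δ)
    (h' : IsOptimalState f a b δ') : f δ = f δ' := by
  rcases le_total a b with hab | hab
  · exact le_antisymm ((h.of_le hab).2 _ (h'.of_le hab).1) ((h'.of_le hab).2 _ (h.of_le hab).1)
  · exact le_antisymm ((h'.of_ge hab).2 _ (h.of_ge hab).1) ((h.of_ge hab).2 _ (h'.of_ge hab).1)

/-- The two limits of a single profile carry the same flux and satisfy `δl ≤ δr`, so they are
admissible for every level not below that flux. -/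
theorem exists_classical_pair (hf : FluxCondition R ρbar f) (ha : a ∈ Icc 0 R) (hb : b ∈ Icc 0 R) :
    ∃ δl δr, ProfilePair (extFlux R f) R a b δl δr (riemannSolver f a b) (riemannSolver f a b) ∧
      IsOptimalState f a b δl ∧ ∀ q, f δl ≤ q → Germ R f q δl δr := by
  obtain ⟨δl, ol, hl⟩ := riemannSolver_left hf ha hb
  obtain ⟨δr, or', hr⟩ := riemannSolver_right hf ha hb
  exact ⟨δl, δr, ⟨hl, hr⟩, ol, fun q hq => ⟨hl.limit_mem, hr.limit_mem, ol.flux_eq or', hq,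
    Or.inl (riemannSolver_limits_le hf ha hb ol or' hl hr)⟩⟩

theorem exists_nonclassical_pair (hf : FluxCondition R ρbar f) (ha : a ∈ Icc 0 R)
    (hb : b ∈ Icc 0 R) {q : ℝ} (hq : q ∈ Icc 0 (f ρbar)) :
    ∃ δl δr, ProfilePair (extFlux R f) R a b δl δr (riemannSolver f a (hatρ R ρbar f q))
        (riemannSolver f (checkρ ρbar f q) b) ∧
      IsOptimalState f a (hatρ R ρbar f q) δl ∧ IsOptimalState f (checkρ ρbar f q) b δr := by
  obtain ⟨h0, h1⟩ := hf.ρbar_mem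
  have hh : hatρ R ρbar f q ∈ Icc 0 R :=
    ⟨h0.le.trans (hf.hat_spec hq).1.1, (hf.hat_spec hq).1.2⟩
  have hc : checkρ ρbar f q ∈ Icc 0 R :=
    ⟨(hf.check_spec hq).1.1, (hf.check_spec hq).1.2.trans h1.le⟩
  obtain ⟨δl, ol, hl⟩ := riemannSolver_left hf ha hh
  obtain ⟨δr, or', hr⟩ := riemannSolver_right hf hc hb
  exact ⟨δl, δr, ⟨hl, hr⟩, ol, or'⟩

/-- Here `a ≤ ρ̂(q)`, and by quasiconcavity the minimum of `f` over `[a, ρ̂(q)]` is attained at an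
end, namely the one with the smaller flux `q`. -/
theorem left_flux_of_lt (hf : FluxCondition R ρbar f) (ha : a ∈ Icc 0 R) {q δ : ℝ}
    (hq : q ∈ Icc 0 (f ρbar)) (h : IsOptimalState f a (hatρ R ρbar f q) δ) (hlt : q < f a) :
    f δ = q := by
  obtain ⟨hm, he⟩ := hf.hat_spec hq
  have hle : a ≤ hatρ R ρbar f q := by
    by_contra! hc
    have := hf.strictAntiOn hm ⟨hm.1.trans hc.le, ha.2⟩ hc
    linarith
  obtain ⟨h1, h2⟩ := h.of_le hle
  have h3 := h2 _ ⟨hle, le_rfl⟩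
  have h4 := hf.min_le ha.1 hm.2 h1
  rw [he] at h3 h4
  rw [min_eq_right hlt.le] at h4
  exact le_antisymm h3 h4

/-- Both states are congested, so `f` decreases on `[ρ̂(q), a]` and its maximum is at `ρ̂(q)`. A
free state `a` of smaller flux could not supply the flux `q`. -/
theorem left_flux_of_gt (hf : FluxCondition R ρbar f) (ha : a ∈ Icc 0 R) {q δ : ℝ}
    (hq : q ∈ Icc 0 (f ρbar)) (h : IsOptimalState f a (hatρ R ρbar f q) δ) (hlt : f a < q)
    (har : ρbar < a) : f δ = q := by
  obtain ⟨hm, he⟩ := hf.hat_spec hq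
  have hle : hatρ R ρbar f q ≤ a := by
    by_contra! hc
    have := hf.strictAntiOn ⟨har.le, ha.2⟩ hm hc
    linarith
  obtain ⟨h1, h2⟩ := h.of_ge hle
  have h3 := h2 _ ⟨le_rfl, hle⟩
  have h4 := hf.strictAntiOn.antitoneOn hm ⟨hm.1.trans h1.1, h1.2.trans ha.2⟩ h1.1
  rw [he] at h3 h4
  exact le_antisymm h4 h3

/-- The condition `hc` excludes a congested right state that carries less than `q`, for which the
interface flux of the right profile would drop to `f b`. -/
theorem right_flux (hf : FluxCondition R ρbar f) (hb : b ∈ Icc 0 R) {q δ : ℝ}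
    (hq : q ∈ Icc 0 (f ρbar)) (h : IsOptimalState f (checkρ ρbar f q) b δ)
    (hc : ρbar < b → q ≤ f b) : f δ = q := by
  obtain ⟨hm, he⟩ := hf.check_spec hq
  rcases le_total (checkρ ρbar f q) b with hle | hle
  · have hqb : q ≤ f b := by
      rcases le_or_gt b ρbar with h1 | h1
      · rw [← he]; exact hf.strictMonoOn.monotoneOn hm ⟨hb.1, h1⟩ hle
      · exact hc h1
    obtain ⟨h1, h2⟩ := h.of_le hle
    have h3 := h2 _ ⟨le_rfl, hle⟩
    have h4 := hf.min_le hm.1 hb.2 h1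
    rw [he] at h3 h4
    rw [min_eq_left hqb] at h4
    exact le_antisymm h3 h4
  · obtain ⟨h1, h2⟩ := h.of_ge hle
    have h3 := h2 _ ⟨hle, le_rfl⟩
    have h4 := hf.strictMonoOn.monotoneOn ⟨hb.1.trans h1.1, h1.2.trans hm.2⟩ hm h1.2
    rw [he] at h3 h4
    exact le_antisymm h4 h3

theorem ProfilePair.germ_of_flux {P Q : ℝ → ℝ} {δl δr q : ℝ}
    (h : ProfilePair (extFlux R f) R a b δl δr P Q) (hl : f δl = q) (hr : f δr = q) :
    Germ R f q δl δr :=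
  ⟨h.left.limit_mem, h.right.limit_mem, hl.trans hr.symm, hl.le, Or.inr hl⟩

/-! ### A priori determination of the constraint -/

theorem const_mul_le_integral {g : ℝ → ℝ} {c t T : ℝ} (ht : 0 < t) (htT : t < T)
    (hi : IntervalIntegrable g volume 0 t) (h : ∀ᵐ r, r ∈ Ioo 0 T → c ≤ g r) :
    c * t ≤ ∫ r in (0:ℝ)..t, g r := by
  have hne : ∀ᵐ r : ℝ, r ≠ 0 := by simp [ae_iff, measure_singleton]
  have := intervalIntegral.integral_mono_ae_restrict ht.le
    (intervalIntegrable_const (c := c) (μ := volume)) hi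
    ((ae_restrict_iff' measurableSet_Icc).2 (by
      filter_upwards [h, hne] with r h1 h2 hr
      exact h1 ⟨lt_of_le_of_ne hr.1 (Ne.symm h2), hr.2.trans_lt htT⟩))
  rw [intervalIntegral.integral_const, smul_eq_mul, sub_zero] at this
  linarith

/-- The hypothesis holds at almost every time only, but such times accumulate at the end of the
interval, and the integral up to any of them controls everything before. -/
theorem ae_eq_zero_of_integral_nonpos {g : ℝ → ℝ} {C T : ℝ} (hT : 0 < T) (mg : Measurable g)
    (bg : ∀ r, |g r| ≤ C) (hg : ∀ r, 0 ≤ g r)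
    (h : ∀ᵐ t, t ∈ Ioo 0 T → ∫ r in (0:ℝ)..t, g r ≤ 0) : ∀ᵐ r, r ∈ Ioo 0 T → g r = 0 := by
  have key : ∀ n : ℕ, ∀ᵐ r, r ∈ Ioo 0 (T - T / (n + 2)) → g r = 0 := by
    intro n
    have hpos : 0 < T / ((n : ℝ) + 2) := by positivity
    have hlt : T / ((n : ℝ) + 2) < T := by
      rw [div_lt_iff₀ (by positivity)]
      nlinarith [(Nat.cast_nonneg n : (0 : ℝ) ≤ n)]
    obtain ⟨t, ht, htI⟩ := (Measure.dense_of_ae h).exists_mem_open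
      (isOpen_Ioo (a := T - T / ((n : ℝ) + 2)) (b := T)) (nonempty_Ioo.2 (by linarith))
    have ht0 : 0 < t := by linarith [htI.1]
    have h0 : ∫ r in (0:ℝ)..t, g r ≤ 0 := ht ⟨ht0, htI.2⟩
    rw [intervalIntegral.integral_of_le ht0.le] at h0
    have h1 := le_antisymm h0 (integral_nonneg hg)
    rw [integral_eq_zero_iff_of_nonneg hg
      (integrableOn_of_bounded' (μ := volume) mg bg (by simp))] at h1
    filter_upwards [(ae_restrict_iff' measurableSet_Ioc).1 h1] with r hr hrI
    exact hr ⟨hrI.1, by linarith [hrI.2, htI.1]⟩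
  filter_upwards [ae_all_iff.2 key] with r hr hrT
  obtain ⟨n, hn⟩ := exists_nat_gt (T / (T - r))
  refine hr n ⟨hrT.1, ?_⟩
  have h1 : 0 < T - r := by linarith [hrT.2]
  have h2 : T < n * (T - r) := (div_lt_iff₀ h1).1 hn
  have h3 : T / ((n : ℝ) + 2) < T - r := by
    rw [div_lt_iff₀ (by positivity)]
    nlinarith
  linarith

variable {T : ℝ} {u : ℝ × ℝ → ℝ} {γ δ q : ℝ → ℝ}

theorem LineSol.intervalIntegrable_flux (hf : FluxCondition R ρbar f)
    (h : LineSol (extFlux R f) (f ρbar) R T a b u γ δ q) (c t : ℝ) :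
    IntervalIntegrable (fun r => c - f (γ r)) volume 0 t := by
  obtain ⟨K, hK⟩ := hf.exists_lip
  have mγ := h.left_measurable
  have mF := hK.continuous.measurable
  have e : (fun r => c - f (γ r)) = fun r => c - extFlux R f (γ r) := by
    funext r; rw [extFlux_eq (h.left_mem r)]
  rw [e, intervalIntegrable_iff]
  refine integrableOn_of_bounded' (C := |c| + f ρbar) (by fun_prop) (fun r => ?_) (by simp)
  refine (abs_sub _ _).trans (add_le_add le_rfl ?_)
  rw [extFlux_eq (h.left_mem r), abs_of_nonneg (hf.nonneg _ (h.left_mem r))]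
  exact hf.le_max (h.left_mem r)

/-- If the left state is on the congested side, so is the left trace. -/
theorem LineSol.left_trace_ge (hf : FluxCondition R ρbar f) (hT : 0 < T)
    (h : LineSol (extFlux R f) (f ρbar) R T a b u γ δ q) (ha : ρbar ≤ a) :
    ∀ᵐ t, t ∈ Ioo 0 T → ρbar ≤ γ t := by
  obtain ⟨K, hK⟩ := hf.exists_lip
  have hρ : ρbar ∈ Icc 0 R := Ioo_subset_Icc_self hf.ρbar_mem
  have mγ := h.left_measurable
  have mF := hK.continuous.measurable
  have mk : Measurable fun r => kflux (extFlux R f) (γ r) ρbar :=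
    hK.continuous_kflux.measurable.comp (mγ.prodMk measurable_const)
  have h1 := h.left.boundary_flux_oneSided hT hK (e := -1) (Or.inr rfl) hρ
    (by rw [abs_of_nonneg (by linarith)]; ring)
  -- The boundary flux of the entropy built on `(ρbar - u)⁺`, zero initially, is `2 (f ρbar - f γ)`
  -- where `γ < ρbar` and zero elsewhere. Being nonnegative with nonpositive integral, it vanishes.
  have hval : ∀ t, 0 ≤ kflux (extFlux R f) (γ t) ρbar +
      -1 * (extFlux R f (γ t) - extFlux R f ρbar) ∧
      (γ t < ρbar → kflux (extFlux R f) (γ t) ρbar +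
      -1 * (extFlux R f (γ t) - extFlux R f ρbar) ≠ 0) := by
    intro t
    have hm := h.left_mem t
    rcases le_or_gt ρbar (γ t) with hc | hc
    · rw [kflux_of_ge _ hc]
      exact ⟨by linarith, fun h' => absurd h' (not_lt.2 hc)⟩
    · rw [kflux_of_le _ hc.le, extFlux_eq hm, extFlux_eq hρ]
      have := hf.lt_max hm hc.ne
      exact ⟨by linarith, fun _ => by linarith⟩
  have h2 := ae_eq_zero_of_integral_nonpos hT (C := K * R + K * R) (by fun_prop) (fun r => by
    refine (abs_add_le _ _).trans (add_le_add (hK.abs_kflux_le (h.left_mem r) hρ) ?_)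
    rw [abs_mul, abs_neg, abs_one, one_mul]
    exact hK.abs_sub_le (h.left_mem r) hρ) (fun r => (hval r).1) h1
  filter_upwards [h2] with t ht htT
  by_contra! hc
  exact (hval t).2 hc (ht htT)

/-- A bound on the right trace by the right state. -/
theorem LineSol.right_trace_le (hf : FluxCondition R ρbar f) (hT : 0 < T)
    (h : LineSol (extFlux R f) (f ρbar) R T a b u γ δ q) {k : ℝ} (hk : k ∈ Icc ρbar R)
    (hbk : b ≤ k) : ∀ᵐ t, t ∈ Ioo 0 T → δ t ≤ k := by
  obtain ⟨K, hK⟩ := hf.exists_lip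
  have hk' : k ∈ Icc 0 R := ⟨hf.ρbar_mem.1.le.trans hk.1, hk.2⟩
  have mδ := h.right_measurable
  have mF := hK.continuous.measurable
  have mk : Measurable fun r => kflux (fun s => -extFlux R f s) (δ r) k :=
    hK.neg.continuous_kflux.measurable.comp (mδ.prodMk measurable_const)
  have h1 := h.right.boundary_flux_oneSided hT hK.neg (e := 1) (Or.inl rfl) hk'
    (by rw [abs_of_nonpos (by linarith)]; ring)
  -- The same argument for `(u - k)⁺` in the reflected problem: the boundary flux is `2 (f k - f δ)`
  -- where `δ > k`, positive because `f` decreases beyond `ρbar ≤ k`.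
  have hval : ∀ t, 0 ≤ kflux (fun s => -extFlux R f s) (δ t) k +
      1 * (-extFlux R f (δ t) - -extFlux R f k) ∧
      (k < δ t → kflux (fun s => -extFlux R f s) (δ t) k +
      1 * (-extFlux R f (δ t) - -extFlux R f k) ≠ 0) := by
    intro t
    have hm := h.right_mem t
    rcases le_or_gt (δ t) k with hc | hc
    · rw [kflux_of_le _ hc]
      exact ⟨by linarith, fun h' => absurd h' (not_lt.2 hc)⟩
    · rw [kflux_of_ge _ hc.le, extFlux_eq hm, extFlux_eq hk']
      have := hf.strictAntiOn hk ⟨hk.1.trans hc.le, hm.2⟩ hc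
      exact ⟨by linarith, fun _ => by linarith⟩
  have h2 := ae_eq_zero_of_integral_nonpos hT (C := K * R + K * R) (by fun_prop) (fun r => by
    refine (abs_add_le _ _).trans (add_le_add (hK.neg.abs_kflux_le (h.right_mem r) hk') ?_)
    rw [one_mul]
    exact hK.neg.abs_sub_le (h.right_mem r) hk') (fun r => (hval r).1) h1
  filter_upwards [h2] with t ht htT
  by_contra! hc
  exact (hval t).2 hc (ht htT)

/-- At small times the constraint of every solution lies in `S`. -/
def ForcesLevel (R ρbar : ℝ) (f w : ℝ → ℝ) (p : Constraint R (f ρbar)) (a b : ℝ) (S : Set ℝ) :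
    Prop :=
  ∃ τ > 0, ∀ T, 0 < T → T ≤ τ → ∀ u γ δ q,
    LineSol (extFlux R f) (f ρbar) R T a b u γ δ q →
    (∀ᵐ t, t ∈ Ioo 0 T → Germ R f (q t) (γ t) (δ t)) →
    (∀ᵐ t, t ∈ Ioo 0 T → q t ∈ p.values (∫ x in Iio (0 : ℝ), w x * u (t, x))) →
    ∀ᵐ t, t ∈ Ioo 0 T → q t ∈ S

theorem forcesLevel_Icc (hf : FluxCondition R ρbar f) (hw : WeightCondition w)
    (p : Constraint R (f ρbar)) (ha : a ∈ Icc 0 R) :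
    ForcesLevel R ρbar f w p a b (Icc (p.rightValue a) (p.leftValue a)) := by
  -- The value of `c` is immaterial, as only the localisation near `a` is used.
  obtain ⟨τ, hτ, h⟩ := exists_level_time (b := b) hf hw p ha one_pos
  refine ⟨τ, hτ, fun T hT hTτ u γ δ q hl _ hv => ?_⟩
  filter_upwards [h T hT hTτ u γ δ q hl hv] with t ht htT using (ht htT).1

/-- The constraint alone suffices: `f γ ≤ q ≤ p(a-) < f a`, so mass accumulates on the left at a
positive rate. -/
theorem forcesLevel_right_of_lt (hf : FluxCondition R ρbar f) (hw : WeightCondition w)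
    (ha : a ∈ Icc 0 R) (hlt : p.leftValue a < f a) :
    ForcesLevel R ρbar f w p a b {p.rightValue a} := by
  obtain ⟨τ, hτ, h⟩ := exists_level_time (b := b) hf hw p ha (sub_pos.2 hlt)
  refine ⟨τ, hτ, fun T hT hTτ u γ δ q hl hg hv => ?_⟩
  have h1 := h T hT hTτ u γ δ q hl hv
  filter_upwards [h1] with t ht htT
  refine (ht htT).2.1 (const_mul_le_integral htT.1 htT.2 (hl.intervalIntegrable_flux hf _ _) ?_)
  filter_upwards [h1, hg] with r h2 h3 hr
  linarith [(h2 hr).1.2, (h3 hr).le]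

/-- The interface flux is bounded by `f b` only in the mean. The boundary entropy inequality on the
right half-line, relative to the constant `b`, shows that the time integral of `f δ - f b` is
nonpositive, because beyond the congested state `b` the flux is below `f b`. -/
theorem forcesLevel_right_of_right_flux (hf : FluxCondition R ρbar f) (hw : WeightCondition w)
    (ha : a ∈ Icc 0 R) (hb : b ∈ Icc 0 R) (hab : a < b) (hlt : f b < f a) :
    ForcesLevel R ρbar f w p a b {p.rightValue a} := by
  obtain ⟨K, hK⟩ := hf.exists_lip
  have hbr : ρbar < b := by
    by_contra! hc
    have := hf.strictMonoOn ⟨ha.1, hab.le.trans hc⟩ ⟨hb.1, hc⟩ hab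
    linarith
  obtain ⟨τ, hτ, h⟩ := exists_level_time (b := b) hf hw p ha (sub_pos.2 hlt)
  refine ⟨τ, hτ, fun T hT hTτ u γ δ q hl hg hv => ?_⟩
  filter_upwards [h T hT hTτ u γ δ q hl hv, hl.right.boundary_flux hT hK.neg] with t ht hbf htT
  refine (ht htT).2.1 ?_
  have hbf := hbf htT
  have mδ := hl.right_measurable
  have mk : Measurable fun r => kflux (fun s => -extFlux R f s) (δ r) b :=
    hK.neg.continuous_kflux.measurable.comp (mδ.prodMk measurable_const)
  have ik : IntervalIntegrable (fun r => kflux (fun s => -extFlux R f s) (δ r) b) volume 0 t := by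
    rw [intervalIntegrable_iff]
    exact integrableOn_of_bounded' mk (fun r => hK.neg.abs_kflux_le (hl.right_mem r) hb) (by simp)
  -- Adding the boundary entropy flux makes the bound pointwise: the sum equals `f a - f b` if `δ ≤
  -- b` and exceeds it by `2 (f b - f δ)` otherwise.
  have key := const_mul_le_integral (c := f a - f b) htT.1 htT.2
    ((hl.intervalIntegrable_flux hf (f a) t).add ik) (by
      filter_upwards [hg] with r hr hrT
      have hm := hl.right_mem r
      rw [(hr hrT).eq]
      rcases le_or_gt (δ r) b with hc | hc
      · rw [kflux_of_le _ hc, extFlux_eq hm, extFlux_eq hb]; linarith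
      · rw [kflux_of_ge _ hc.le, extFlux_eq hm, extFlux_eq hb]
        have := hf.strictAntiOn ⟨hbr.le, hb.2⟩ ⟨hbr.le.trans hc.le, hm.2⟩ hc
        linarith)
  rw [intervalIntegral.integral_add (hl.intervalIntegrable_flux hf (f a) t) ik] at key
  linarith

/-- The left trace stays congested and the right trace stays below `k = max ρbar b`. An admissible
pair either has `γ ≤ δ ≤ k`, so that `f γ ≥ f k > f a`, or saturates the constraint, whose level is
at least `p(a+) > f a`. Either way the left half loses mass at a positive rate. -/
theorem forcesLevel_left (hf : FluxCondition R ρbar f) (hw : WeightCondition w)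
    (ha : a ∈ Icc 0 R) (hb : b ∈ Icc 0 R) (har : ρbar < a) (hba : b < a)
    (hlt : f a < p.rightValue a) : ForcesLevel R ρbar f w p a b {p.leftValue a} := by
  set k := max ρbar b with hk
  have hkm : k ∈ Icc ρbar R := ⟨le_max_left _ _, max_le hf.ρbar_mem.2.le hb.2⟩
  have hka : k < a := max_lt har hba
  have hfk : f a < f k := hf.strictAntiOn hkm ⟨har.le, ha.2⟩ hka
  have hc : 0 < min (p.rightValue a) (f k) - f a := sub_pos.2 (lt_min hlt hfk)
  obtain ⟨τ, hτ, h⟩ := exists_level_time (b := b) hf hw p ha hc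
  refine ⟨τ, hτ, fun T hT hTτ u γ δ q hl hg hv => ?_⟩
  have h1 := h T hT hTτ u γ δ q hl hv
  filter_upwards [h1] with t ht htT
  refine (ht htT).2.2 ?_
  have key := const_mul_le_integral (c := min (p.rightValue a) (f k) - f a) htT.1 htT.2
    (hl.intervalIntegrable_flux hf (f a) t).neg (by
      filter_upwards [h1, hg, hl.left_trace_ge hf hT har.le,
        hl.right_trace_le hf hT hkm (le_max_right _ _)] with r h2 h3 h4 h5 hr
      have hflux : min (p.rightValue a) (f k) ≤ f (γ r) := by
        rcases (h3 hr).entropy with e | e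
        · refine (min_le_right _ _).trans ?_
          have hle : γ r ≤ k := e.trans (h5 hr)
          exact hf.strictAntiOn.antitoneOn ⟨h4 hr, (hl.left_mem r).2⟩ hkm hle
        · rw [e]; exact (min_le_left _ _).trans (h2 hr).1.1
      simp only [Pi.neg_apply]
      linarith)
  have e : ∫ r in (0:ℝ)..t, (-fun r => f a - f (γ r)) r = -∫ r in (0:ℝ)..t, (f a - f (γ r)) := by
    rw [← intervalIntegral.integral_neg]; rfl
  rw [e] at key
  linarith

theorem ProfilePair.isUnique_of_forcesLevel {P Q : ℝ → ℝ} {δl δr q₀ : ℝ} {S : Set ℝ}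
    (hf : FluxCondition R ρbar f) (hw : WeightCondition w)
    (h : ProfilePair (extFlux R f) R a b δl δr P Q) (hS : ForcesLevel R ρbar f w p a b S)
    (hg : ∀ q ∈ S, Germ R f q δl δr) (hq₀ : Germ R f q₀ δl δr)
    (hc : LevelCompatible f p P a (f δl) q₀) :
    IsUniqueForSmallTimes R ρbar f w p a b (selfSimilarMap P Q a b) := by
  obtain ⟨τ, hτ, hfo⟩ := hS
  refine h.isUnique hf hw hq₀ hc ⟨τ, hτ, fun T hT hTτ u γ δ q hl hge hv => ?_⟩
  filter_upwards [hfo T hT hTτ u γ δ q hl hge hv] with t ht htT using hg _ (ht htT)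

end

section

variable {R ρbar : ℝ} {f w : ℝ → ℝ} {p : Constraint R (f ρbar)} {a b : ℝ}

/-! ### The classical region -/

theorem isOptimalState_left_of_lt (hf : FluxCondition R ρbar f) (ha : a ∈ Icc 0 R)
    (hb : b ∈ Icc 0 R) (hab : a < b) (hfab : f a ≤ f b) : IsOptimalState f a b a := by
  refine ⟨fun h => ⟨⟨le_rfl, h⟩, fun s hs => ?_⟩, fun h => absurd hab (not_lt.2 h)⟩
  have := hf.min_le ha.1 hb.2 hs
  rwa [min_eq_left hfab] at this

theorem isOptimalState_self (f : ℝ → ℝ) (a : ℝ) : IsOptimalState f a a a := by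
  refine ⟨fun h => ⟨⟨h, h⟩, fun s hs => ?_⟩, fun h => ⟨⟨h, h⟩, fun s hs => ?_⟩⟩ <;>
    rw [le_antisymm hs.2 hs.1]

theorem isOptimalState_left_of_ge (hf : FluxCondition R ρbar f) (hb : b ∈ Icc 0 R)
    (hba : b ≤ a) (har : a ≤ ρbar) : IsOptimalState f a b a := by
  rcases hba.eq_or_lt with rfl | hlt
  · exact isOptimalState_self f b
  refine ⟨fun h => absurd hlt (not_lt.2 h), fun h => ⟨⟨h, le_rfl⟩, fun s hs => ?_⟩⟩
  exact hf.strictMonoOn.monotoneOn ⟨hb.1.trans hs.1, hs.2.trans har⟩ ⟨hb.1.trans hba, har⟩ hs.2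

theorem IsOptimalState.flux_eq_of_congested {δ : ℝ} (hf : FluxCondition R ρbar f)
    (ha : a ∈ Icc 0 R) (h : IsOptimalState f a b δ) (hb : ρbar < b) (hba : b ≤ a) :
    f δ = f b := by
  obtain ⟨h1, h2⟩ := h.of_ge hba
  exact le_antisymm (hf.strictAntiOn.antitoneOn ⟨hb.le, hba.trans ha.2⟩
    ⟨hb.le.trans h1.1, h1.2.trans ha.2⟩ h1.1) (h2 b ⟨le_rfl, hba⟩)

/-- No wave enters the left half, so the mean remains at `a`. The flux `f a` respects every level at
the jump, so the level of a competing solution need not be known. -/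
theorem isUnique_classicalMap_of_left_const (hf : FluxCondition R ρbar f) (hw : WeightCondition w)
    (ha : a ∈ Icc 0 R) (hb : b ∈ Icc 0 R) (ho : IsOptimalState f a b a)
    (hle : f a ≤ p.rightValue a) :
    IsUniqueForSmallTimes R ρbar f w p a b (classicalMap f a b) := by
  obtain ⟨δl, δr, hP, hl, hg⟩ := exists_classical_pair hf ha hb
  rw [classicalMap_eq]
  have e := hl.flux_eq ho
  exact hP.isUnique_of_forcesLevel hf hw (forcesLevel_Icc hf hw p ha)
    (fun q hq => hg q (by linarith [hq.1])) (hg (p.rightValue a) (by linarith))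
    (Or.inr (Or.inr ⟨fun v hv => riemannSolver_eq_left hf ha hb ho hv,
      le_rfl, p.right_le_left a⟩))

theorem isUnique_classicalMap (hf : FluxCondition R ρbar f) (hw : WeightCondition w)
    (ha : a ∈ Icc 0 R) (hb : b ∈ Icc 0 R) (h : (a, b) ∈ classicalRegion R ρbar f p) :
    IsUniqueForSmallTimes R ρbar f w p a b (classicalMap f a b) := by
  obtain ⟨a', b', e, -, -, h⟩ := h
  obtain ⟨rfl, rfl⟩ := Prod.mk.inj e
  have hpl := p.right_le_left a
  rcases h with ⟨hab, hlt, hle⟩ | ⟨hab, hlt, hle⟩ | ⟨hba, har, hle⟩ | ⟨hbr, har, heq⟩ |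
    ⟨hbr, hba, hle, hlt⟩
  · obtain ⟨δl, δr, hP, hl, hg⟩ := exists_classical_pair hf ha hb
    rw [classicalMap_eq]
    have e : f δl ≤ f b := (hl.of_le hab.le).2 b ⟨hab.le, le_rfl⟩
    exact hP.isUnique_of_forcesLevel hf hw (forcesLevel_Icc hf hw p ha)
      (fun q hq => hg q (by linarith [hq.1])) (hg (p.rightValue a) (by linarith))
      (Or.inl ⟨by linarith, rfl⟩)
  · exact isUnique_classicalMap_of_left_const hf hw ha hb
      (isOptimalState_left_of_lt hf ha hb hab hlt) hle
  · exact isUnique_classicalMap_of_left_const hf hw ha hb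
      (isOptimalState_left_of_ge hf hb hba har) hle
  · obtain ⟨δl, δr, hP, hl, hg⟩ := exists_classical_pair hf ha hb
    rw [classicalMap_eq]
    -- The interval from `b` to `a` contains `ρbar`, so the interface carries the maximal flux,
    -- which is allowed because `p(a+)` is maximal.
    have e : f ρbar ≤ f δl := (hl.of_ge (hbr.trans har.le)).2 ρbar ⟨hbr, har.le⟩
    have e' := hf.le_max hP.left.limit_mem
    have := hf.lt_max ha har.ne'
    exact hP.isUnique_of_forcesLevel hf hw (forcesLevel_Icc hf hw p ha)
      (fun q hq => hg q (by linarith [hq.1])) (hg (p.leftValue a) (by linarith))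
      (Or.inr (Or.inl ⟨by linarith, rfl⟩))
  -- For `b = a` the flux equals `f a` and the mass has no sign; the constant solution is handled on
  -- its own.
  · rcases hba.eq_or_lt with rfl | hba
    · exact isUnique_classicalMap_of_left_const hf hw ha hb (isOptimalState_self f b) hlt.le
    obtain ⟨δl, δr, hP, hl, hg⟩ := exists_classical_pair hf ha hb
    rw [classicalMap_eq]
    have e := hl.flux_eq_of_congested hf ha hbr hba.le
    have := hf.strictAntiOn ⟨hbr.le, hb.2⟩ ⟨hbr.le.trans hba.le, ha.2⟩ hba
    exact hP.isUnique_of_forcesLevel hf hw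
      (forcesLevel_left hf hw ha hb (hbr.trans hba) hba hlt)
      (fun q hq => hg q (by rw [mem_singleton_iff.1 hq]; linarith))
      (hg (p.leftValue a) (by linarith)) (Or.inr (Or.inl ⟨by linarith, rfl⟩))

/-! ### The nonclassical region -/

theorem Constraint.mem_of_mem_values (p : Constraint R (f ρbar)) {q : ℝ}
    (hq : q ∈ Icc (p.rightValue a) (p.leftValue a)) : q ∈ Icc 0 (f ρbar) :=
  ⟨(p.rightValue_mem a).1.le.trans hq.1, hq.2.trans (p.leftValue_mem a).2⟩

/-- For the uniqueness of the level: a map built with a level `q ≥ f a` has interface flux at least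
`f a` and cannot coincide with one whose flux is smaller. -/
theorem left_flux_ge (hf : FluxCondition R ρbar f) (ha : a ∈ Icc 0 R) {q δ : ℝ}
    (hq : q ∈ Icc 0 (f ρbar)) (h : IsOptimalState f a (hatρ R ρbar f q) δ) (hle : f a ≤ q) :
    f a ≤ f δ := by
  obtain ⟨hm, he⟩ := hf.hat_spec hq
  rcases le_total a (hatρ R ρbar f q) with hc | hc
  · have := hf.min_le ha.1 hm.2 (h.of_le hc).1
    rwa [he, min_eq_left hle] at this
  · exact (h.of_ge hc).2 a ⟨hc, le_rfl⟩

theorem isUnique_nonclassicalMap (hf : FluxCondition R ρbar f) (hw : WeightCondition w)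
    (ha : a ∈ Icc 0 R) (hb : b ∈ Icc 0 R) {q : ℝ} (hq : q ∈ Icc 0 (f ρbar))
    (hl : (q < f a ∧ q = p.rightValue a) ∨ (f a < q ∧ ρbar < a ∧ q = p.leftValue a))
    (hc : ρbar < b → q ≤ f b) (hS : ForcesLevel R ρbar f w p a b {q}) :
    IsUniqueForSmallTimes R ρbar f w p a b (nonclassicalMap R ρbar f a b q) := by
  obtain ⟨δl, δr, hP, ol, or'⟩ := exists_nonclassical_pair hf ha hb hq
  rw [nonclassicalMap_eq]
  have e : f δl = q := by
    rcases hl with ⟨h, -⟩ | ⟨h, h', -⟩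
    · exact left_flux_of_lt hf ha hq ol h
    · exact left_flux_of_gt hf ha hq ol h h'
  have hg := hP.germ_of_flux e (right_flux hf hb hq or' hc)
  refine hP.isUnique_of_forcesLevel hf hw hS (fun q' hq' => by rwa [mem_singleton_iff.1 hq']) hg ?_
  rw [e]
  rcases hl with h | ⟨h, -, h'⟩
  · exact Or.inl h
  · exact Or.inr (Or.inl ⟨h, h'⟩)

/-- The map for `q` is a solution, hence equals the uniquely determined map for `q'` at a small
positive time; so the limits at `0-` agree, and with them the interface fluxes. -/
theorem IsUniqueForSmallTimes.flux_eq (hf : FluxCondition R ρbar f)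
    (ha : a ∈ Icc 0 R) (hb : b ∈ Icc 0 R) {q q' δ δ' : ℝ} (hq : q ∈ Icc 0 (f ρbar))
    (hq' : q' ∈ Icc 0 (f ρbar))
    (h : IsUniqueForSmallTimes R ρbar f w p a b (nonclassicalMap R ρbar f a b q))
    (h' : IsUniqueForSmallTimes R ρbar f w p a b (nonclassicalMap R ρbar f a b q'))
    (hδ : IsOptimalState f a (hatρ R ρbar f q) δ)
    (hδ' : IsOptimalState f a (hatρ R ρbar f q') δ') : f δ = f δ' := by
  obtain ⟨δl, δr, hP, ol, -⟩ := exists_nonclassical_pair hf ha hb hq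
  obtain ⟨δl', δr', hP', ol', -⟩ := exists_nonclassical_pair hf ha hb hq'
  obtain ⟨τ, hτ, hs, -⟩ := h
  obtain ⟨τ', hτ', -, hu⟩ := h'
  have hm : 0 < min τ τ' := lt_min hτ hτ'
  have ht := hu τ _ (by exact_mod_cast hτ) hs (min τ τ' / 2) (by linarith)
    (by linarith [min_le_right τ τ']) (by exact_mod_cast (by linarith [min_le_left τ τ']))
  rw [nonclassicalMap_eq, nonclassicalMap_eq] at ht
  have := limit_eq_of_ae_eq (by linarith) hP.left.tendsto hP'.left.tendsto ht
  rw [hδ.flux_eq ol, hδ'.flux_eq ol', this]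

/-- A level is not obviously determined by the map it defines. The interface flux decides: it is
`q'` if `q' < f a` and at least `f a` otherwise, so only `p(a+)` reproduces the flux `p(a+) < f a`.
-/
theorem existsUnique_level_right (hf : FluxCondition R ρbar f) (hw : WeightCondition w)
    (ha : a ∈ Icc 0 R) (hb : b ∈ Icc 0 R) (hlt : p.rightValue a < f a)
    (hc : ρbar < b → p.rightValue a ≤ f b)
    (hS : ForcesLevel R ρbar f w p a b {p.rightValue a}) :
    ∃! q, q ∈ Icc (p.rightValue a) (p.leftValue a) ∧
      IsUniqueForSmallTimes R ρbar f w p a b (nonclassicalMap R ρbar f a b q) := by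
  have hm : p.rightValue a ∈ Icc (p.rightValue a) (p.leftValue a) := ⟨le_rfl, p.right_le_left a⟩
  have hq := p.mem_of_mem_values hm
  have hu := isUnique_nonclassicalMap hf hw ha hb hq (Or.inl ⟨hlt, rfl⟩) hc hS
  refine ⟨p.rightValue a, ⟨hm, hu⟩, fun q' ⟨hm', hu'⟩ => ?_⟩
  have hq' := p.mem_of_mem_values hm'
  obtain ⟨δl, δr, -, ol, -⟩ := exists_nonclassical_pair hf ha hb hq
  obtain ⟨δl', δr', -, ol', -⟩ := exists_nonclassical_pair hf ha hb hq'
  have e := hu.flux_eq hf ha hb hq hq' hu' ol ol'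
  have e1 := left_flux_of_lt hf ha hq ol hlt
  rcases lt_or_ge q' (f a) with h | h
  · have := left_flux_of_lt hf ha hq' ol' h
    linarith
  · have := left_flux_ge hf ha hq' ol' h
    linarith

/-- All levels in the interval exceed `f a` and `a` is congested, so the interface flux equals the
level and determines it. -/
theorem existsUnique_level_left (hf : FluxCondition R ρbar f) (hw : WeightCondition w)
    (ha : a ∈ Icc 0 R) (hb : b ∈ Icc 0 R) (har : ρbar < a) (hba : b < a)
    (hlt : f a < p.rightValue a) (hc : ρbar < b → p.leftValue a ≤ f b) :
    ∃! q, q ∈ Icc (p.rightValue a) (p.leftValue a) ∧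
      IsUniqueForSmallTimes R ρbar f w p a b (nonclassicalMap R ρbar f a b q) := by
  have hm : p.leftValue a ∈ Icc (p.rightValue a) (p.leftValue a) := ⟨p.right_le_left a, le_rfl⟩
  have hq := p.mem_of_mem_values hm
  have hu := isUnique_nonclassicalMap hf hw ha hb hq (Or.inr ⟨hlt.trans_le hm.1, har, rfl⟩) hc
    (forcesLevel_left hf hw ha hb har hba hlt)
  refine ⟨p.leftValue a, ⟨hm, hu⟩, fun q' ⟨hm', hu'⟩ => ?_⟩
  have hq' := p.mem_of_mem_values hm'
  obtain ⟨δl, δr, -, ol, -⟩ := exists_nonclassical_pair hf ha hb hq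
  obtain ⟨δl', δr', -, ol', -⟩ := exists_nonclassical_pair hf ha hb hq'
  rw [← left_flux_of_gt hf ha hq ol (hlt.trans_le hm.1) har,
    ← left_flux_of_gt hf ha hq' ol' (hlt.trans_le hm'.1) har]
  exact (hu.flux_eq hf ha hb hq hq' hu' ol ol').symm

theorem existsUnique_level (hf : FluxCondition R ρbar f) (hw : WeightCondition w)
    (ha : a ∈ Icc 0 R) (hb : b ∈ Icc 0 R) (h : (a, b) ∈ nonclassicalRegion R ρbar f p) :
    ∃! q, q ∈ Icc (p.rightValue a) (p.leftValue a) ∧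
      IsUniqueForSmallTimes R ρbar f w p a b (nonclassicalMap R ρbar f a b q) := by
  obtain ⟨a', b', e, -, -, h⟩ := h
  obtain ⟨rfl, rfl⟩ := Prod.mk.inj e
  have hpl := p.right_le_left a
  rcases h with ⟨hab, h1, h2⟩ | ⟨hab, h1, h2⟩ | ⟨hba, har, h2⟩ | ⟨hbr, har, -, h2⟩ |
    ⟨hbr, har, -, h2⟩ | ⟨hbr, hba, h1, h2⟩ | ⟨hbr, hba, h2⟩
  · exact existsUnique_level_right hf hw ha hb (by linarith) (fun _ => h2.le)
      (forcesLevel_right_of_right_flux hf hw ha hb hab h1)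
  · exact existsUnique_level_right hf hw ha hb (by linarith) (fun _ => by linarith)
      (forcesLevel_right_of_lt hf hw ha h2)
  · exact existsUnique_level_right hf hw ha hb (by linarith) (fun _ => by linarith)
      (forcesLevel_right_of_lt hf hw ha h2)
  · exact existsUnique_level_left hf hw ha hb har (by linarith) h2 (fun _ => by linarith)
  · exact existsUnique_level_right hf hw ha hb (by linarith) (fun _ => by linarith)
      (forcesLevel_right_of_lt hf hw ha h2)
  -- Equality would give `f a > p(a-) ≥ p(a+) > f a`.
  · have hne : b ≠ a := by rintro rfl; linarith
    exact existsUnique_level_left hf hw ha hb (by linarith) (lt_of_le_of_ne hba hne) h2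
      (fun _ => h1.le)
  · have := hf.strictAntiOn.antitoneOn ⟨hbr.le, hb.2⟩ ⟨hbr.le.trans hba, ha.2⟩ hba
    exact existsUnique_level_right hf hw ha hb (by linarith) (fun _ => by linarith)
      (forcesLevel_right_of_lt hf hw ha h2)

/-! ### Loss of uniqueness -/

/-- A self-similar solution for small times whose flux at the constraint is `g`. -/
def HasSelfSimilarSolution (R ρbar : ℝ) (f w : ℝ → ℝ) (p : Constraint R (f ρbar)) (a b g : ℝ) :
    Prop :=
  ∃ P Q : ℝ → ℝ, ∃ δ, f δ = g ∧ Tendsto P (𝓝[<] 0) (𝓝 δ) ∧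
    ∃ τ > 0, ∀ τ' ≤ τ, IsEntropyWeakSolution R ρbar f w p (riemannDatum a b) (τ' : ℝ)
      (selfSimilarMap P Q a b)

/-- Different fluxes mean different limits at `0-`, and for self-similar maps these limits are the
same at all positive times. -/
theorem exists_two_solutions {g g' : ℝ} (h : HasSelfSimilarSolution R ρbar f w p a b g)
    (h' : HasSelfSimilarSolution R ρbar f w p a b g') (hne : g ≠ g') :
    ∃ τ : ℝ, 0 < τ ∧ ∃ ρ₁ ρ₂ : ℝ → ℝ → ℝ,
      IsEntropyWeakSolution R ρbar f w p (riemannDatum a b) τ ρ₁ ∧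
      IsEntropyWeakSolution R ρbar f w p (riemannDatum a b) τ ρ₂ ∧
      ∀ t : ℝ, 0 < t → t < τ → ¬ ρ₁ t =ᵐ[volume] ρ₂ t := by
  obtain ⟨P, Q, δ, hδ, hP, τ, hτ, hs⟩ := h
  obtain ⟨P', Q', δ', hδ', hP', τ', hτ', hs'⟩ := h'
  refine ⟨min τ τ', lt_min hτ hτ', _, _, hs _ (min_le_left _ _), hs' _ (min_le_right _ _),
    fun t ht _ he => hne ?_⟩
  rw [← hδ, ← hδ', limit_eq_of_ae_eq ht hP hP' he]

/-- The left half is constant, so the mean sits at the jump and the largest level `p(a-)` may be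
chosen. -/
theorem hasSelfSimilarSolution_classical (hf : FluxCondition R ρbar f) (hw : WeightCondition w)
    (ha : a ∈ Icc 0 R) (hb : b ∈ Icc 0 R) (ho : IsOptimalState f a b a)
    (hle : f a ≤ p.leftValue a) : HasSelfSimilarSolution R ρbar f w p a b (f a) := by
  obtain ⟨δl, δr, hP, hl, hg⟩ := exists_classical_pair hf ha hb
  have e := hl.flux_eq ho
  exact ⟨_, _, δl, e, hP.left.tendsto, hP.exists_solution hf hw (hg (p.leftValue a) (by linarith))
    (Or.inr (Or.inr ⟨fun v hv => riemannSolver_eq_left hf ha hb ho hv, p.right_le_left a, le_rfl⟩))⟩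

theorem hasSelfSimilarSolution_right (hf : FluxCondition R ρbar f) (hw : WeightCondition w)
    (ha : a ∈ Icc 0 R) (hb : b ∈ Icc 0 R) (hlt : p.rightValue a < f a)
    (hc : ρbar < b → p.rightValue a ≤ f b) :
    HasSelfSimilarSolution R ρbar f w p a b (p.rightValue a) := by
  have hq := p.mem_of_mem_values (a := a) ⟨le_rfl, p.right_le_left a⟩
  obtain ⟨δl, δr, hP, ol, or'⟩ := exists_nonclassical_pair hf ha hb hq
  have e := left_flux_of_lt hf ha hq ol hlt
  exact ⟨_, _, δl, e, hP.left.tendsto, hP.exists_solution hf hw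
    (hP.germ_of_flux e (right_flux hf hb hq or' hc)) (Or.inl ⟨by linarith, rfl⟩)⟩

theorem hasSelfSimilarSolution_left (hf : FluxCondition R ρbar f) (hw : WeightCondition w)
    (ha : a ∈ Icc 0 R) (hb : b ∈ Icc 0 R) (har : ρbar < a) (hlt : f a < p.leftValue a)
    (hc : ρbar < b → p.leftValue a ≤ f b) :
    HasSelfSimilarSolution R ρbar f w p a b (p.leftValue a) := by
  have hq := p.mem_of_mem_values (a := a) ⟨p.right_le_left a, le_rfl⟩
  obtain ⟨δl, δr, hP, ol, or'⟩ := exists_nonclassical_pair hf ha hb hq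
  have e := left_flux_of_gt hf ha hq ol hlt har
  exact ⟨_, _, δl, e, hP.left.tendsto, hP.exists_solution hf hw
    (hP.germ_of_flux e (right_flux hf hb hq or' hc)) (Or.inr (Or.inl ⟨by linarith, rfl⟩))⟩

/-- The level `f a` itself is used. Since `ρ̂(f a) = a`, the left half stays constant and the mean
stays at the jump, while the right half starts from `ρ̌(f a)`. -/
theorem hasSelfSimilarSolution_congested (hf : FluxCondition R ρbar f) (hw : WeightCondition w)
    (ha : a ∈ Icc 0 R) (hb : b ∈ Icc 0 R) (har : ρbar < a) (hba : b ≤ a)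
    (hmem : f a ∈ Icc (p.rightValue a) (p.leftValue a)) :
    HasSelfSimilarSolution R ρbar f w p a b (f a) := by
  have hq := p.mem_of_mem_values hmem
  obtain ⟨δl, δr, hP, ol, or'⟩ := exists_nonclassical_pair hf ha hb hq
  have ha' : hatρ R ρbar f (f a) = a :=
    hf.strictAntiOn.injOn (hf.hat_spec hq).1 ⟨har.le, ha.2⟩ (hf.hat_spec hq).2
  rw [ha'] at hP ol
  have e := ol.flux_eq (isOptimalState_self f a)
  have er := right_flux hf hb hq or' fun h =>
    hf.strictAntiOn.antitoneOn ⟨h.le, hb.2⟩ ⟨har.le, ha.2⟩ hba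
  exact ⟨_, _, δl, e, hP.left.tendsto, hP.exists_solution hf hw (hP.germ_of_flux e er)
    (Or.inr (Or.inr ⟨fun v hv => riemannSolver_eq_left hf ha ha (isOptimalState_self f a) hv,
      hmem⟩))⟩

/-- The classical solution has interface flux `f b > f a`, so the mean falls below `a` and the level
becomes `p(a-)`, which does not restrict this flux. -/
theorem hasSelfSimilarSolution_rarefaction (hf : FluxCondition R ρbar f) (hw : WeightCondition w)
    (ha : a ∈ Icc 0 R) (hb : b ∈ Icc 0 R) (hbr : ρbar < b) (hba : b < a)
    (hle : f b ≤ p.leftValue a) : HasSelfSimilarSolution R ρbar f w p a b (f b) := by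
  obtain ⟨δl, δr, hP, hl, hg⟩ := exists_classical_pair hf ha hb
  have e := hl.flux_eq_of_congested hf ha hbr hba.le
  have := hf.strictAntiOn ⟨hbr.le, hb.2⟩ ⟨hbr.le.trans hba.le, ha.2⟩ hba
  exact ⟨_, _, δl, e, hP.left.tendsto, hP.exists_solution hf hw (hg (p.leftValue a) (by linarith))
    (Or.inr (Or.inl ⟨by linarith, rfl⟩))⟩

theorem exists_two_solutions_of_jump (hf : FluxCondition R ρbar f) (hw : WeightCondition w)
    (ha : a ∈ Icc 0 R) (hb : b ∈ Icc 0 R)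
    (h : (a, b) ∉ classicalRegion R ρbar f p ∪ nonclassicalRegion R ρbar f p)
    (hjump : p.rightValue a ≠ p.leftValue a) (hle : p.rightValue a ≤ f a)
    (hge : f a ≤ p.leftValue a) (hex : ¬ (b = a ∧ ρbar < a ∧ f a = p.rightValue a)) :
    ∃ τ : ℝ, 0 < τ ∧ ∃ ρ₁ ρ₂ : ℝ → ℝ → ℝ,
      IsEntropyWeakSolution R ρbar f w p (riemannDatum a b) τ ρ₁ ∧
      IsEntropyWeakSolution R ρbar f w p (riemannDatum a b) τ ρ₂ ∧
      ∀ t : ℝ, 0 < t → t < τ → ¬ ρ₁ t =ᵐ[volume] ρ₂ t := by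
  have hlr : p.rightValue a < p.leftValue a := lt_of_le_of_ne (p.right_le_left a) hjump
  have hC : (a, b) ∉ classicalRegion R ρbar f p := fun h' => h (Or.inl h')
  have hN : (a, b) ∉ nonclassicalRegion R ρbar f p := fun h' => h (Or.inr h')
  rcases lt_or_ge a b with hab | hba
  · have hfab : f a ≤ f b := by
      by_contra! hc
      rcases le_or_gt (f b) (p.rightValue a) with h1 | h1
      · exact hC ⟨a, b, rfl, ha, hb, Or.inl ⟨hab, hc, h1⟩⟩
      · exact hN ⟨a, b, rfl, ha, hb, Or.inl ⟨hab, hc, h1⟩⟩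
    have hlt : p.rightValue a < f a := by
      by_contra! hc
      exact hC ⟨a, b, rfl, ha, hb, Or.inr (Or.inl ⟨hab, hfab, hc⟩)⟩
    exact exists_two_solutions (hasSelfSimilarSolution_classical hf hw ha hb
      (isOptimalState_left_of_lt hf ha hb hab hfab) hge)
      (hasSelfSimilarSolution_right hf hw ha hb hlt fun _ => by linarith) hlt.ne'
  rcases le_or_gt a ρbar with har | har
  · have hlt : p.rightValue a < f a := by
      by_contra! hc
      exact hC ⟨a, b, rfl, ha, hb, Or.inr (Or.inr (Or.inl ⟨hba, har, hc⟩))⟩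
    exact exists_two_solutions (hasSelfSimilarSolution_classical hf hw ha hb
      (isOptimalState_left_of_ge hf hb hba har) hge)
      (hasSelfSimilarSolution_right hf hw ha hb hlt fun _ => by linarith) hlt.ne'
  -- From here `b ≤ a` and `a` is congested: one solution keeps its left half constant with flux `f
  -- a`, and a second one is sought with flux `p(a+)` below `f a`, or, if `p(a+) = f a`, with a flux
  -- above `f a`.
  have h₁ := hasSelfSimilarSolution_congested hf hw ha hb har hba ⟨hle, hge⟩
  rcases hle.lt_or_eq with hlt | heq
  · refine exists_two_solutions h₁ (hasSelfSimilarSolution_right hf hw ha hb hlt fun hbr => ?_)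
      hlt.ne'
    have := hf.strictAntiOn.antitoneOn ⟨hbr.le, hb.2⟩ ⟨har.le, ha.2⟩ hba
    linarith
  -- With `b = a` no larger flux would be available; this is the excluded case.
  have hba' : b < a := lt_of_le_of_ne hba fun e => hex ⟨e, har, heq.symm⟩
  -- The second flux is `p(a-)` if the right half can carry it, and otherwise the flux `f b` of the
  -- classical solution.
  by_cases hc : ρbar < b → p.leftValue a ≤ f b
  · exact exists_two_solutions h₁
      (hasSelfSimilarSolution_left hf hw ha hb har (by linarith) hc) (by linarith)
  · push Not at hc
    exact exists_two_solutions h₁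
      (hasSelfSimilarSolution_rarefaction hf hw ha hb hc.1 hba' hc.2.le)
      (hf.strictAntiOn ⟨hc.1.le, hb.2⟩ ⟨har.le, ha.2⟩ hba').ne

end

end PointConstraint

end

open PointConstraint in
theorem proposition2p1 {R ρbar : ℝ} {f w : ℝ → ℝ}
    (hf : FluxCondition R ρbar f) (hw : WeightCondition w) (p : Constraint R (f ρbar))
    {ρL ρR : ℝ} (hL : ρL ∈ Set.Icc 0 R) (hR : ρR ∈ Set.Icc 0 R) :
    ((ρL, ρR) ∈ classicalRegion R ρbar f p →
      IsUniqueForSmallTimes R ρbar f w p ρL ρR (classicalMap f ρL ρR)) ∧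
    ((ρL, ρR) ∈ nonclassicalRegion R ρbar f p →
      ∃! pbar : ℝ, pbar ∈ Set.Icc (p.rightValue ρL) (p.leftValue ρL) ∧
        IsUniqueForSmallTimes R ρbar f w p ρL ρR (nonclassicalMap R ρbar f ρL ρR pbar)) ∧
    ((ρL, ρR) ∉ classicalRegion R ρbar f p ∪ nonclassicalRegion R ρbar f p →
      p.rightValue ρL ≠ p.leftValue ρL →
      p.rightValue ρL ≤ f ρL → f ρL ≤ p.leftValue ρL →
      ¬ (ρR = ρL ∧ ρbar < ρL ∧ f ρL = p.rightValue ρL) →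
      ∃ τ : ℝ, 0 < τ ∧ ∃ ρ₁ ρ₂ : ℝ → ℝ → ℝ,
        IsEntropyWeakSolution R ρbar f w p (riemannDatum ρL ρR) τ ρ₁ ∧
        IsEntropyWeakSolution R ρbar f w p (riemannDatum ρL ρR) τ ρ₂ ∧
        ∀ t : ℝ, 0 < t → t < τ → ¬ ρ₁ t =ᵐ[MeasureTheory.volume] ρ₂ t) := by
  exact ⟨isUnique_classicalMap hf hw hL hR, existsUnique_level hf hw hL hR,
    exists_two_solutions_of_jump hf hw hL hR⟩
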